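/- **Setting.** For $W\in\mathbb{R}^{d\times k}$ and $b\in\mathbb{R}^d$ let $\mathcal{D}(W,b)$ be the law of $\mathrm{ReLU}(Wz+b)$ with $z\sim\mathcal{N}(0,I_k)$. **Algorithm.** Parameters: $r>1$, $\lambda>0$ and $B\in\mathbb{N}$. Input: samples $x_1,\dots,x_n\in\mathbb{R}^d$. (1) For each $i\in[d]$ let $y_1,\dots,y_N$ be the positive ones among $x_1(i),\dots,x_n(i)$, in their order, with mean $\hat\mu_0$ and empirical variance $\hat\sigma_0^2=\frac1N\sum_m(y_m-\hat\mu_0)^2$. If $N=0$, put $\hat b(i)=\hat\Sigma(i,i)=0$. If $N>0$ and $\hat\sigma_0=0$, put $\hat b(i)=\hat\mu_0$, $\hat\Sigma(i,i)=0$. If $0<N<B$ and $\hat\sigma_0>0$, put $\hat b(i)=\hat\Sigma(i,i)=0$ (this is not a case of interest). Otherwise replace each $y_m$ by $(y_m-\hat\mu_0)/\hat\sigma_0$ and form $B$ disjoint consecutive batches of $T=\lfloor N/B\rfloor$ of these values. On each batch run projected SGD for the negative log-likelihood of a Gaussian truncated to $S=(-\hat\mu_0/\hat\sigma_0,\infty)$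 in the parameters $v=(1/\sigma^2,\mu/\sigma^2)$: start at $v^{(0)}=(1,0)$; for $t=1,\dots,T$ let $y$ be the $t$-th value of the batch, draw $z$ from $\mathcal{N}(v^{(t-1)}_2/v^{(t-1)}_1,\,1/v^{(t-1)}_1)$ conditioned on $S$, by drawing from the Gaussian until the value falls into $S$, and let $v^{(t)}$ be the projection of $v^{(t-1)}-\frac{1}{\lambda t}\bigl(\frac{y^2-z^2}{2},\,z-y\bigr)$ to $\{v: 1/r\le v_1\le r,\ |v_2|\le r\}$; return $\frac1T\sum_{t=1}^T v^{(t)}$. Among the $B$ returned vectors let $\hat v$ be one that minimizes the sum of the Euclidean distances to all of them, and put $\hat b(i)=\max(0,\ \hat\mu_0+\hat\sigma_0\hat v_2/\hat v_1)$, $\hat\Sigma(i,i)=\hat\sigma_0^2/\hat v_1$. (2) For $i<j$ put $\hat\theta_{ij}=\pi-\frac{2\pi}{n}\,\#\{m: x_m(i)>\hat b(i),\ x_m(j)>\hat b(j)\}$ and $\hat\Sigma(i,j)=\hat\Sigma(j,i)=\sqrt{\hat\Sigma(i,i)\hat\Sigma(j,j)}\cos\hat\theta_{ij}$. The algorithm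 runs on a randomized real RAM: unit-cost arithmetic, comparisons, memory access and draws from $\mathcal{N}(0,1)$. Its space is the number of memory cells used, including the input; its time is the number of steps. **Theorem.** There are absolute constants $r>1$, $\lambda>0$, $c>0$, $C>0$ and $a\in\mathbb{N}$ such that the following holds for all $d\ge1$ and $\epsilon,\delta\in(0,1)$. Put $L=\ln(2d/\delta)$ and run the algorithm with $B=\lceil cL\rceil$. There is a sample size $n\ge1$, depending only on $d,\epsilon,\delta$, with $$n\le C\,\frac{1}{\epsilon^2}\,L\,\ln^a\!\Bigl(\frac2\epsilon\Bigr),$$ such that for every $k$, every $W^*\in\mathbb{R}^{d\times k}$ and every $b^*\in\mathbb{R}^d$ with non-negative entries, on $n$ i.i.d. samples from $\mathcal{D}(W^*,b^*)$ the algorithm halts with probability at least $1-\delta$ with outputs satisfying $$\|\hat\Sigma-W^*W^{*T}\|_F\le\epsilon\|W^*\|_F^2,\qquad \|\hat b-b^*\|_2\le\epsilon\|W^*\|_F$$ after at most $$C\Bigl(\frac{d^2}{\epsilon^2}\,L\,\ln^a\!\Bigl(\frac2\epsilon\Bigr)+d\,L^2\Bigr)=\widetilde{O}\Bigl(\frac{d^2}{\epsilon^2}\ln\frac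 d\delta\Bigr)$$ steps, where $\widetilde O$ hides factors polylogarithmic in $d$, $1/\epsilon$ and $1/\delta$. The expected number of steps has the same bound. In every run that halts, the space is at most $$C\Bigl(\frac{d}{\epsilon^2}\,L\,\ln^a\!\Bigl(\frac2\epsilon\Bigr)+d^2\Bigr).$$ -/

import Mathlib

open MeasureTheory ProbabilityTheory

/- The norm of a matrix is its Frobenius norm. -/
attribute [local instance] Matrix.frobeniusNormedAddCommGroup

noncomputable section

namespace ReluLearning

/-! ## The rectified Gaussian distribution -/

/-- The law `D(W, b)` of `ReLU (W z + b)`, where `z` is a standard Gaussian vector in `ℝ^k`. -/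
def rectifiedGaussian {d k : ℕ} (W : Matrix (Fin d) (Fin k) ℝ) (b : Fin d → ℝ) :
    Measure (Fin d → ℝ) :=
  (Measure.pi fun _ : Fin k => gaussianReal 0 1).map
    fun z i => max ((W.mulVec z) i + b i) 0

/-! ## A randomized real RAM with a step count and a space count

A program works on exact real numbers. `A` is the type of addresses of its memory cells, each of
which holds one real number. `K` is a set of labels of the random draws: the draw labelled `κ` is
the number `ω κ`, where `ω : K → ℝ` is a family of independent standard Gaussian variables.
Besides the memory, a program has a fixed finite number of registers, its local variables. -/

/-- The state of the machine: the memory, the number of steps made so far, and the set of the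
cells accessed so far. -/
structure State (A : Type) where
  mem : A → ℝ
  steps : ℕ
  used : Set A

/-- A program with result in `α`: it maps the random draws and the initial state to the result
and the final state; the value `none` means that the program does not halt. -/
def RAM (A K α : Type) : Type := (K → ℝ) → State A → Option (α × State A)

namespace RAM

variable {A K α : Type}

instance : Monad (RAM A K) where
  pure a := fun _ σ => some (a, σ)
  bind p q := fun ω σ => (p ω σ).bind fun y => q y.1 ω y.2

/-- Let `c` steps pass. -/
def tick (c : ℕ) : RAM A K Unit := fun _ σ => some ((), { σ with steps := σ.steps + c })

/-- Read a memory cell; one step. -/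
def load (a : A) : RAM A K ℝ := fun _ σ =>
  some (σ.mem a, { σ with steps := σ.steps + 1, used := insert a σ.used })

open Classical in
/-- Write to a memory cell; one step. -/
def store (a : A) (x : ℝ) : RAM A K Unit := fun _ σ =>
  some ((), { mem := Function.update σ.mem a x, steps := σ.steps + 1, used := insert a σ.used })

/-- Draw a standard Gaussian; one step. -/
def gauss (κ : K) : RAM A K ℝ := do
  tick 1
  fun ω σ => some (ω κ, σ)

/-- Compare two reals; one step. -/
def lt (x y : ℝ) : RAM A K Bool := do
  tick 1
  pure (decide (x < y))

end RAM

/-- Straight-line arithmetic on real numbers. Division by zero returns zero. -/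
inductive Expr : Type
  | lit (x : ℝ)
  | add (e f : Expr)
  | sub (e f : Expr)
  | mul (e f : Expr)
  | div (e f : Expr)
  | sqrt (e : Expr)
  | cos (e : Expr)

namespace Expr

instance : Coe ℝ Expr := ⟨lit⟩
instance : Add Expr := ⟨add⟩
instance : Sub Expr := ⟨sub⟩
instance : Mul Expr := ⟨mul⟩
instance : Div Expr := ⟨div⟩

/-- The value of an expression. -/
def eval : Expr → ℝ
  | lit x => x
  | add e f => e.eval + f.eval
  | sub e f => e.eval - f.eval
  | mul e f => e.eval * f.eval
  | div e f => e.eval / f.eval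
  | sqrt e => Real.sqrt e.eval
  | cos e => Real.cos e.eval

/-- The number of steps needed to evaluate an expression: one for every operand and for every
arithmetic operation. -/
def cost : Expr → ℕ
  | lit _ => 1
  | add e f => e.cost + f.cost + 1
  | sub e f => e.cost + f.cost + 1
  | mul e f => e.cost + f.cost + 1
  | div e f => e.cost + f.cost + 1
  | sqrt e => e.cost + 1
  | cos e => e.cost + 1

end Expr

namespace RAM

variable {A K α : Type}

/-- Evaluate an arithmetic expression. -/
def arith (e : Expr) : RAM A K ℝ := do
  tick e.cost
  pure e.eval

/-- Increment a counter; one step. -/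
def incr (c : ℕ) : RAM A K ℕ := do
  tick 1
  pure (c + 1)

/-- Divide two counters, rounding down; one step. -/
def natDiv (a b : ℕ) : RAM A K ℕ := do
  tick 1
  pure (a / b)

/-- The loop `for m = 0, …, N - 1 do a ← body m a`; one step for every iteration, in addition to
those of the body. -/
def loop (N : ℕ) (body : ℕ → α → RAM A K α) (a : α) : RAM A K α :=
  match N with
  | 0 => pure a
  | N + 1 => do
    let a' ← loop N body a
    tick 1
    body N a'

/-- The first `N` rounds of a loop that runs `body 0`, `body 1`, … until one of them returns a
value; one step for every round, in addition to those of the body. -/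
def attempts (body : ℕ → RAM A K (Option α)) : ℕ → RAM A K (Option α)
  | 0 => pure none
  | N + 1 => do
    match ← attempts body N with
    | some a => pure (some a)
    | none => do
      tick 1
      body N

open Classical in
/-- Run `body 0`, `body 1`, … until one of them returns a value, and return this value; the program
does not halt if none of them does. (Rounds after the first value are idle in `attempts`, so the
result and the final state do not depend on the choice of `N`.) -/
def search (body : ℕ → RAM A K (Option α)) : RAM A K α := fun ω σ =>
  if h : ∃ y : α × State A, ∃ N, attempts body N ω σ = some (some y.1, y.2) then some h.choose
  else none

end RAM

/-! ## The learning algorithm -/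

/-- The memory of the learning algorithm. -/
inductive Cell : Type
  /-- the `i`-th coordinate of the `m`-th input sample -/
  | x (m i : ℕ)
  /-- the `m`-th positive sample of the coordinate that is being processed -/
  | s (m : ℕ)
  /-- first entry of the result of the `β`-th run of projected SGD -/
  | run₁ (β : ℕ)
  /-- second entry of the result of the `β`-th run of projected SGD -/
  | run₂ (β : ℕ)
  /-- output: estimate of the `i`-th entry of the bias -/
  | bhat (i : ℕ)
  /-- output: estimate of the `(i, j)` entry of `W Wᵀ` -/
  | sig (i j : ℕ)

/-- Labels of the random draws. The label `(i, β, t, s)` is for the `s`-th attempt to draw the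
truncated Gaussian in the `t`-th step of the `β`-th run for coordinate `i`, so that no label is used
twice. -/
abbrev Draw : Type := ℕ × ℕ × ℕ × ℕ

/-- Programs of the learning algorithm. -/
abbrev Prog (α : Type) : Type := RAM Cell Draw α

open RAM Cell

/-- Store the positive values of coordinate `i` of the `n` samples in the cells `s 0`, `s 1`, …
and return their number. -/
def collect (n i : ℕ) : Prog ℕ :=
  loop n (fun m c => do
    let y ← load (x m i)
    if ← lt 0 y then
      store (s c) y
      incr c
    else pure c) 0

/-- The mean of the `N` stored values. -/
def mean (N : ℕ) : Prog ℝ := do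
  let t ← loop N (fun m a => do
    let y ← load (s m)
    arith (a + y)) (0 : ℝ)
  arith (t / (N : ℝ))

/-- The empirical standard deviation of the `N` stored values, where `μ` is their mean. -/
def stdDev (N : ℕ) (μ : ℝ) : Prog ℝ := do
  let t ← loop N (fun m a => do
    let y ← load (s m)
    arith (a + (y - μ) * (y - μ))) (0 : ℝ)
  arith (Expr.sqrt (t / (N : ℝ)))

/-- Shift and rescale the `N` stored values. -/
def standardize (N : ℕ) (μ σ : ℝ) : Prog Unit :=
  loop N (fun m _ => do
    let y ← load (s m)
    let y' ← arith ((y - μ) / σ)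
    store (s m) y') ()

/-- Projection of a real number to the interval `[lo, hi]`. -/
def clamp (lo hi y : ℝ) : Prog ℝ := do
  if ← lt y lo then pure lo
  else if ← lt hi y then pure hi
  else pure y

/-- Sample from the Gaussian with mean `v₂ / v₁` and variance `1 / v₁`, truncated to `(τ, ∞)`:
draw from the Gaussian until the value falls into the truncation set. -/
def truncatedGaussian (v₁ v₂ τ : ℝ) (i β t : ℕ) : Prog ℝ :=
  search fun l => do
    let ξ ← gauss (i, β, t, l)
    let z ← arith (v₂ / v₁ + ξ / Expr.sqrt v₁)
    if ← lt τ z then pure (some z) else pure none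

/-- Projected stochastic gradient descent for the negative log-likelihood of the Gaussian
truncated to `(τ, ∞)`, in the parameters `v = (1/σ², μ/σ²)`, with step size `1 / (lam * t)` at step
`t` and projection to `{v | 1/r ≤ v₁ ≤ r, |v₂| ≤ r}`. It starts at `(1, 0)`, uses every sample of the
`β`-th batch of `T` stored samples once, and returns the average of the iterates.
A local variable `(v, w)` holds the current iterate and the sum of the iterates. -/
def projSGD (r lam τ : ℝ) (T i β : ℕ) : Prog (ℝ × ℝ) := do
  let rinv ← arith ((1 : ℝ) / r)
  let rneg ← arith ((0 : ℝ) - r)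
  let (_, w₁, w₂) ← loop T (fun t (v, w) => do
    let y ← load (s (β * T + t))
    let z ← truncatedGaussian v.1 v.2 τ i β t
    let g₁ ← arith ((y * y - z * z) / (2 : ℝ))
    let g₂ ← arith (z - y)
    let u₁ ← arith (v.1 - g₁ / (lam * ((t + 1 : ℕ) : ℝ)))
    let u₂ ← arith (v.2 - g₂ / (lam * ((t + 1 : ℕ) : ℝ)))
    let v₁ ← clamp rinv r u₁
    let v₂ ← clamp rneg r u₂
    let w₁ ← arith (w.1 + v₁)
    let w₂ ← arith (w.2 + v₂)
    pure ((v₁, v₂), (w₁, w₂))) (((1 : ℝ), (0 : ℝ)), ((0 : ℝ), (0 : ℝ)))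
  let a₁ ← arith (w₁ / (T : ℝ))
  let a₂ ← arith (w₂ / (T : ℝ))
  pure (a₁, a₂)

/-- The sum of the Euclidean distances between the result of run `β` and those of all runs. -/
def score (B β : ℕ) : Prog ℝ := do
  let p₁ ← load (run₁ β)
  let p₂ ← load (run₂ β)
  loop B (fun j a => do
    let q₁ ← load (run₁ j)
    let q₂ ← load (run₂ j)
    arith (a + Expr.sqrt ((p₁ - q₁) * (p₁ - q₁) + (p₂ - q₂) * (p₂ - q₂)))) (0 : ℝ)

/-- The result of a run with the least score. -/
def selectRun (B : ℕ) : Prog (ℝ × ℝ) := do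
  let s₀ ← score B 0
  let (β, _) ← loop B (fun β best => do
    let sβ ← score B β
    if ← lt sβ best.2 then pure (β, sβ) else pure best) (0, s₀)
  let p₁ ← load (run₁ β)
  let p₂ ← load (run₂ β)
  pure (p₁, p₂)

/-- Estimates `(μ, σ²)` from `N` stored samples of a Gaussian truncated to `(0, ∞)`. Zero variance
is detected first: if there is no sample then the estimate is `(0, 0)`, and if all samples have the
same value then it is that value, with variance zero. -/
def normBiasEst (r lam : ℝ) (B N i : ℕ) : Prog (ℝ × ℝ) := do
  tick 1
  if N = 0 then pure (0, 0)
  else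
    let μ₀ ← mean N
    let σ₀ ← stdDev N μ₀
    if ← lt 0 σ₀ then
      standardize N μ₀ σ₀
      let T ← natDiv N B
      let τ ← arith ((0 : ℝ) - μ₀ / σ₀)
      loop B (fun β _ => do
        let v ← projSGD r lam τ T i β
        store (run₁ β) v.1
        store (run₂ β) v.2) ()
      let v ← selectRun B
      let v₁ ← arith (v.1 / (σ₀ * σ₀))
      let v₂ ← arith (v.2 / σ₀ + μ₀ * v.1 / (σ₀ * σ₀))
      let μ ← arith (v₂ / v₁)
      let σsq ← arith ((1 : ℝ) / v₁)
      pure (μ, σsq)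
    else pure (μ₀, 0)

/-- Estimate the bias and the row norm of coordinate `i`. -/
def estimateRow (r lam : ℝ) (B n i : ℕ) : Prog Unit := do
  let N ← collect n i
  let p ← normBiasEst r lam B N i
  store (sig i i) p.2
  if ← lt p.1 0 then store (bhat i) 0 else store (bhat i) p.1

/-- Estimate the angle between the rows `i` and `j`, and the corresponding entries of `W Wᵀ`. -/
def estimatePair (n i j : ℕ) : Prog Unit := do
  let c ← loop n (fun m c => do
    let y ← load (x m i)
    let y' ← load (x m j)
    let t ← load (bhat i)
    let t' ← load (bhat j)
    if ← lt t y then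
      if ← lt t' y' then arith (c + (1 : ℝ)) else pure c
    else pure c) (0 : ℝ)
  let θ ← arith (Real.pi - (2 : ℝ) * Real.pi / (n : ℝ) * c)
  let p ← load (sig i i)
  let q ← load (sig j j)
  let e ← arith (Expr.sqrt (p * q) * Expr.cos θ)
  store (sig i j) e
  store (sig j i) e

/-- The learning algorithm for `n` samples in `ℝ^d`: first the bias and the row norms, then the
pairwise angles. -/
def learn (r lam : ℝ) (B d n : ℕ) : Prog Unit := do
  loop d (fun i _ => estimateRow r lam B n i) ()
  loop d (fun j _ => loop j (fun i _ => estimatePair n i j) ()) ()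

/-- The initial state, with the samples `X` in memory. -/
def initial {d n : ℕ} (X : Fin n → Fin d → ℝ) : State Cell where
  mem
    | x m i => if h : m < n ∧ i < d then X ⟨m, h.1⟩ ⟨i, h.2⟩ else 0
    | _ => 0
  steps := 0
  used := {c | ∃ (m : Fin n) (i : Fin d), c = x m i}

/-- The final state of the learning algorithm on the samples `X` and random draws `ω`. -/
def final (r lam : ℝ) (B : ℕ) {d n : ℕ} (X : Fin n → Fin d → ℝ) (ω : Draw → ℝ) :
    Option (State Cell) :=
  (learn r lam B d n ω (initial X)).map Prod.snd

/-- The number of steps of the learning algorithm, `⊤` if it does not halt. -/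
def runTime (r lam : ℝ) (B : ℕ) {d n : ℕ} (X : Fin n → Fin d → ℝ) (ω : Draw → ℝ) : ENNReal :=
  match final r lam B X ω with
  | some σ => (σ.steps : ENNReal)
  | none => ⊤

/-- The estimate of `W Wᵀ` in a final state. -/
def State.sigmaHat (σ : State Cell) (d : ℕ) : Matrix (Fin d) (Fin d) ℝ :=
  Matrix.of fun i j => σ.mem (sig i j)

/-- The estimate of the bias in a final state. -/
def State.biasHat (σ : State Cell) (d : ℕ) : EuclideanSpace ℝ (Fin d) :=
  WithLp.toLp 2 fun i => σ.mem (bhat i)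

/-- The joint law of `n` independent samples from `D(W, b)` and of the random draws of the
algorithm, which are independent standard Gaussians, independent of the samples. -/
def experiment {d k : ℕ} (W : Matrix (Fin d) (Fin k) ℝ) (b : Fin d → ℝ) (n : ℕ) :
    Measure ((Fin n → Fin d → ℝ) × (Draw → ℝ)) :=
  (Measure.pi fun _ : Fin n => rectifiedGaussian W b).prod
    (Measure.infinitePi fun _ : Draw => gaussianReal 0 1)

/-- The number of runs of projected SGD for each coordinate, of order `ln (d / δ)`. -/
def numRuns (c : ℝ) (d : ℕ) (δ : ℝ) : ℕ := ⌈c * Real.log (2 * d / δ)⌉₊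

/-- The sample size `ε⁻² ln (d / δ)`, up to a constant and a power of `ln (1 / ε)`. -/
def sampleBound (C : ℝ) (a d : ℕ) (ε δ : ℝ) : ℝ :=
  C * (1 / ε ^ 2) * Real.log (2 * d / δ) * Real.log (2 / ε) ^ a

/-- The running time `d² ε⁻² ln (d / δ)`, up to a constant and a power of `ln (1 / ε)`. The last
term is for the distances between the results of the runs of projected SGD. -/
def timeBound (C : ℝ) (a d : ℕ) (ε δ : ℝ) : ℝ :=
  C * ((d : ℝ) ^ 2 / ε ^ 2 * Real.log (2 * d / δ) * Real.log (2 / ε) ^ a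
    + d * Real.log (2 * d / δ) ^ 2)

/-- The space `d ε⁻² ln (d / δ) + d²`, up to a constant and a power of `ln (1 / ε)`. -/
def spaceBound (C : ℝ) (a d : ℕ) (ε δ : ℝ) : ℝ :=
  C * (d / ε ^ 2 * Real.log (2 * d / δ) * Real.log (2 / ε) ^ a + (d : ℝ) ^ 2)

end ReluLearning

end

open MeasureTheory ProbabilityTheory

noncomputable section

namespace ReluLearning

/-! ## Weakest preconditions for programs -/

namespace RAM

variable {A K α β : Type}

/-! One coordinate, with row norm `s` and bias `b`. If `s > 0`, write `b = s * a` with `a ≥ 0`.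
Given which samples are positive, the positive ones are independent copies of `s * y + s * a`, where
`y` is standard normal conditioned on `(-a, ∞)` (`measure_badColumn_le`); since `a ≥ 0`, a constant
fraction is positive with high probability. If `s = 0`, the column is constant and the branch for
zero variance is exact. So every error can be measured relative to `s`.

In natural parameters, Gaussians truncated to a half-line form an exponential family, and the
expected gradient of the negative log-likelihood is a difference of moment vectors. After
standardization the truncation point is at most `0`, so `(0, 1)` always lies in the support, and
there the densities are bounded below over the whole parameter box. This makes the moment map
strongly monotone with an absolute modulus (`truncLaw_strongMono`), and the step size `1 / (lam *
t)` gives a mean squared error of order `1 / T` up to logarithms. With overwhelming probability the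
true parameters lie in the box after standardization (`exists_regular`).

The difficulty is dependence: the empirical mean and deviation are computed from all values, so the
standardized values are dependent and so are the batches. The way out is exchangeability. Mean and
deviation are symmetric in the data, and the iterate before step `t` of a batch does not use the
value of step `t` otherwise. That value may therefore be exchanged with any value outside the
batches under consideration, and in expectation it may be replaced by an average over this reservoir
(`IsWeight.integral_deviation`), which concentrates. The argument tolerates a weight that is
invariant under these exchanges, in particular the indicator that other batches are bad. Adding one
batch at a time bounds the probability that all of `B / 4` given batches are bad by a product
(`exists_many_bad_le`), and a union over subsets remains exponentially small in `B`. Values are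
clipped at a level of order `√(log T)`, so that bounded-difference concentration applies; a batch
without large values is not affected by clipping. If three quarters of the runs are accurate, the
run of least total distance is accurate as well (`dist_le_of_minimizes`).

Pairs of coordinates. By rotation invariance, both samples exceed their biases with probability `(π
- θ) / (2π)`, where `θ` is the angle between the rows (`stdGaussian_orthant`). The algorithm counts
with estimated biases, which depend on the same samples; replacing the true biases affects only
positive samples close to them, and these are rare whatever the estimates are
(`abs_jointFreq_sub_le`). Each entry then has an error proportional to the product of two row norms,
and these errors add up to a multiple of `‖W‖ ^ 2` in Frobenius norm.

Running time. A draw above `r * √r` is accepted for every iterate in the box and every truncation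
point at most `0` (`lt_candidate`). The number of attempts is thus dominated by independent
geometric variables that depend on the draws alone (`exists_totalAttempts_le`). The program logic
carries an exceptional event, later taken to be `Stuck`: outside it the program halts within the
stated number of steps, and it has probability zero (`ae_not_stuck`). -/

/-- If `p` halts then its result and final state satisfy `Q`; if it does not, then `E` holds. -/
def wp (E : Prop) (p : RAM A K α) (ω : K → ℝ) (σ : State A) (Q : α → State A → Prop) : Prop :=
  match p ω σ with
  | none => E
  | some y => Q y.1 y.2

variable {E : Prop} {ω : K → ℝ} {σ : State A}

lemma wp_mono {p : RAM A K α} {Q Q' : α → State A → Prop} (h : wp E p ω σ Q)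
    (hQ : ∀ a σ', Q a σ' → Q' a σ') : wp E p ω σ Q' := by
  unfold wp at *
  split at h <;> simp_all

@[simp] lemma wp_bind {p : RAM A K α} {q : α → RAM A K β} {Q : β → State A → Prop} :
    wp E (p >>= q) ω σ Q ↔ wp E p ω σ fun a σ' => wp E (q a) ω σ' Q := by
  have : (p >>= q) ω σ = (p ω σ).bind fun y => q y.1 ω y.2 := rfl
  unfold wp
  rw [this]
  cases p ω σ <;> simp

@[simp] lemma wp_pure {a : α} {Q : α → State A → Prop} :
    wp E (pure a : RAM A K α) ω σ Q ↔ Q a σ := Iff.rfl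

@[simp] lemma wp_tick {c : ℕ} {Q : Unit → State A → Prop} :
    wp E (tick c : RAM A K Unit) ω σ Q ↔ Q () { σ with steps := σ.steps + c } := Iff.rfl

@[simp] lemma wp_load {a : A} {Q : ℝ → State A → Prop} :
    wp E (load a : RAM A K ℝ) ω σ Q ↔
      Q (σ.mem a) { σ with steps := σ.steps + 1, used := insert a σ.used } := Iff.rfl

open Classical in
@[simp] lemma wp_store {a : A} {x : ℝ} {Q : Unit → State A → Prop} :
    wp E (store a x : RAM A K Unit) ω σ Q ↔
      Q () { mem := Function.update σ.mem a x, steps := σ.steps + 1, used := insert a σ.used } :=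
  Iff.rfl

@[simp] lemma wp_lt {x y : ℝ} {Q : Bool → State A → Prop} :
    wp E (lt x y : RAM A K Bool) ω σ Q ↔ Q (decide (x < y)) { σ with steps := σ.steps + 1 } :=
  Iff.rfl

@[simp] lemma wp_arith {e : Expr} {Q : ℝ → State A → Prop} :
    wp E (arith e : RAM A K ℝ) ω σ Q ↔ Q e.eval { σ with steps := σ.steps + e.cost } := Iff.rfl

@[simp] lemma wp_incr {c : ℕ} {Q : ℕ → State A → Prop} :
    wp E (incr c : RAM A K ℕ) ω σ Q ↔ Q (c + 1) { σ with steps := σ.steps + 1 } := Iff.rfl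

@[simp] lemma wp_natDiv {a b : ℕ} {Q : ℕ → State A → Prop} :
    wp E (natDiv a b : RAM A K ℕ) ω σ Q ↔ Q (a / b) { σ with steps := σ.steps + 1 } := Iff.rfl

lemma wp_ite {c : Prop} [Decidable c] {p q : RAM A K α} {Q : α → State A → Prop}
    (h₁ : c → wp E p ω σ Q) (h₂ : ¬c → wp E q ω σ Q) :
    wp E (if c then p else q) ω σ Q := by
  split_ifs with h
  exacts [h₁ h, h₂ h]

lemma wp_loop {N : ℕ} {body : ℕ → α → RAM A K α} {a : α} (I : ℕ → α → State A → Prop)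
    (h0 : I 0 a σ)
    (hs : ∀ m < N, ∀ a σ, I m a σ →
      wp E (body m a) ω { σ with steps := σ.steps + 1 } (I (m + 1))) :
    wp E (loop N body a) ω σ (I N) := by
  induction N with
  | zero => exact h0
  | succ N ih =>
    rw [loop, wp_bind]
    refine wp_mono (ih fun m hm => hs m (by omega)) fun a' σ' h => ?_
    rw [wp_bind, wp_tick]
    exact hs N (by omega) a' σ' h

lemma attempts_succ (body : ℕ → RAM A K (Option α)) (ω : K → ℝ) (σ : State A) (N : ℕ) :
    attempts body (N + 1) ω σ =
      (attempts body N ω σ).bind fun y => match y.1 with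
        | some a => some (some a, y.2)
        | none => body N ω { y.2 with steps := y.2.steps + 1 } := by
  change (attempts body N ω σ).bind _ = _
  congr 1
  funext y
  rcases y with ⟨_ | a, σ'⟩ <;> rfl

/-- A search that never finds a value does not halt. -/
lemma search_eq_none {body : ℕ → RAM A K (Option α)} (c : ℕ)
    (hb : ∀ l σ, body l ω σ = some (none, { σ with steps := σ.steps + c })) :
    search body ω σ = none := by
  have h1 : ∀ N, ∃ σ', attempts body N ω σ = some (none, σ') := by
    intro N
    induction N with
    | zero => exact ⟨σ, rfl⟩
    | succ N ih =>
      obtain ⟨σ', h⟩ := ih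
      rw [attempts_succ, h]
      exact ⟨_, hb ..⟩
  rw [search, dif_neg]
  rintro ⟨y, N, hN⟩
  obtain ⟨σ', h⟩ := h1 N
  rw [h] at hN
  simp at hN

/-- A search whose body leaves the memory alone and makes `c` steps per round returns the first
value found. -/
lemma search_eq {body : ℕ → RAM A K (Option α)} (f : ℕ → Option α) (c : ℕ)
    (hb : ∀ l σ, body l ω σ = some (f l, { σ with steps := σ.steps + c })) {l₀ : ℕ} {z : α}
    (h₀ : f l₀ = some z) (hlt : ∀ l < l₀, f l = none) :
    search body ω σ = some (z, { σ with steps := σ.steps + (l₀ + 1) * (c + 1) }) := by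
  have hbind := attempts_succ body ω σ
  have h1 : ∀ N ≤ l₀, attempts body N ω σ =
      some (none, { σ with steps := σ.steps + N * (c + 1) }) := by
    intro N
    induction N with
    | zero => intro _; simp [attempts]; rfl
    | succ N ih =>
      intro hN
      rw [hbind, ih (by omega)]
      simp only [Option.bind_some, hb, hlt N (by omega)]
      congr 3
      ring
  have h2 : ∀ N > l₀, attempts body N ω σ =
      some (some z, { σ with steps := σ.steps + (l₀ + 1) * (c + 1) }) := by
    intro N hN
    induction N, hN using Nat.le_induction with
    | base =>
      rw [hbind, h1 l₀ le_rfl]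
      simp only [Option.bind_some, hb, h₀]
      congr 3
      ring
    | succ N hN ih => rw [hbind, ih]; rfl
  have hex : ∃ y : α × State A, ∃ N, attempts body N ω σ = some (some y.1, y.2) :=
    ⟨(z, _), l₀ + 1, h2 _ (by omega)⟩
  rw [search, dif_pos hex]
  obtain ⟨N, hN⟩ := hex.choose_spec
  -- The chosen `N` is unknown. Up to `l₀` rounds nothing has been found, and after that the outcome
  -- no longer changes.
  rcases le_or_gt N l₀ with h | h
  · rw [h1 N h] at hN
    simp at hN
  · rw [h2 N h] at hN
    simp only [Option.some.injEq, Prod.mk.injEq] at hN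
    rw [Option.some.injEq]
    exact Prod.ext hN.1.symm hN.2.symm

end RAM

/-! ## What the programs compute -/

open RAM Cell

/-- The candidate of a Gaussian draw `x` in the rejection sampler. -/
def candidate (v : ℝ × ℝ) (x : ℝ) : ℝ := v.2 / v.1 + x / √v.1

open Classical in
/-- The first candidate that exceeds `τ`. -/
def firstAccepted (v : ℝ × ℝ) (τ : ℝ) (ξ : ℕ → ℝ) : ℝ :=
  if h : ∃ l, τ < candidate v (ξ l) then candidate v (ξ (Nat.find h)) else 0

/-- Projection to the interval `[lo, hi]`. -/
def clip (lo hi y : ℝ) : ℝ := if y < lo then lo else if hi < y then hi else y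

/-- One step of projected SGD with the data value `y` and the random draw `z`. -/
def sgdStep (r lam : ℝ) (t : ℕ) (y z : ℝ) (v : ℝ × ℝ) : ℝ × ℝ :=
  (clip (1 / r) r (v.1 - (y * y - z * z) / 2 / (lam * ((t + 1 : ℕ) : ℝ))),
    clip (0 - r) r (v.2 - (z - y) / (lam * ((t + 1 : ℕ) : ℝ))))

/-- The iterates of projected SGD. -/
def sgd (r lam τ : ℝ) (y : ℕ → ℝ) (ξ : ℕ → ℕ → ℝ) : ℕ → ℝ × ℝ
  | 0 => (1, 0)
  | t + 1 => sgdStep r lam t (y t) (firstAccepted (sgd r lam τ y ξ t) τ (ξ t))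
      (sgd r lam τ y ξ t)

/-- The average of the first `T` iterates of projected SGD. -/
def sgdAvg (r lam τ : ℝ) (T : ℕ) (y : ℕ → ℝ) (ξ : ℕ → ℕ → ℝ) : ℝ × ℝ :=
  ((∑ t ∈ Finset.range T, (sgd r lam τ y ξ (t + 1)).1) / T,
    (∑ t ∈ Finset.range T, (sgd r lam τ y ξ (t + 1)).2) / T)

/-- The sum of the distances between `run β` and all runs. -/
def totalDist (B : ℕ) (run : ℕ → ℝ × ℝ) (β : ℕ) : ℝ :=
  ∑ j ∈ Finset.range B, √(((run β).1 - (run j).1) * ((run β).1 - (run j).1)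
    + ((run β).2 - (run j).2) * ((run β).2 - (run j).2))

/-- The mean of the first `N` values. -/
def empMean (N : ℕ) (y : ℕ → ℝ) : ℝ := (∑ j ∈ Finset.range N, y j) / N

/-- The standard deviation of the first `N` values. -/
def empSd (N : ℕ) (y : ℕ → ℝ) : ℝ :=
  √((∑ j ∈ Finset.range N, (y j - empMean N y) * (y j - empMean N y)) / N)

/-- The result of projected SGD on the `β`-th batch of standardized values. -/
def batchRun (r lam : ℝ) (B N : ℕ) (y : ℕ → ℝ) (ξ : ℕ → ℕ → ℕ → ℝ) (β : ℕ) : ℝ × ℝ :=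
  sgdAvg r lam (0 - empMean N y / empSd N y) (N / B)
    (fun t => (y (β * (N / B) + t) - empMean N y) / empSd N y) (ξ β)

/-- The mean and variance of an uncensored Gaussian, given the natural parameters `v` of the
standardized one. -/
def unstandardize (μ₀ σ₀ : ℝ) (v : ℝ × ℝ) : ℝ × ℝ :=
  ((v.2 / σ₀ + μ₀ * v.1 / (σ₀ * σ₀)) / (v.1 / (σ₀ * σ₀)), 1 / (v.1 / (σ₀ * σ₀)))

/-- `p` is a possible result of `normBiasEst` on the values `y 0, …, y (N - 1)`. -/
def IsEstimate (r lam : ℝ) (B N : ℕ) (y : ℕ → ℝ) (ξ : ℕ → ℕ → ℕ → ℝ) (p : ℝ × ℝ) : Prop :=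
  (N = 0 → p = (0, 0)) ∧ (N ≠ 0 → ¬0 < empSd N y → p = (empMean N y, 0)) ∧
  (N ≠ 0 → 0 < empSd N y → ∃ β < B,
    (∀ β' < B, totalDist B (batchRun r lam B N y ξ) β ≤ totalDist B (batchRun r lam B N y ξ) β') ∧
    p = unstandardize (empMean N y) (empSd N y) (batchRun r lam B N y ξ β))

/-- The number of positive entries of a column. -/
def posCount (n : ℕ) (x : ℕ → ℝ) : ℕ :=
  open Classical in Nat.count (fun m => 0 < x m) n

/-- The positive entries of a column. -/
def posValue (x : ℕ → ℝ) (j : ℕ) : ℝ := x (Nat.nth (fun m => 0 < x m) j)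

/-- No draw with the label `(i, β, t, ·)` exceeds `κ`. -/
def Stuck (κ : ℝ) (ω : Draw → ℝ) : Prop := ∃ i β t, ∀ l, ω (i, β, t, l) ≤ κ

open Classical in
/-- The number of draws labelled `(i, β, t, ·)` up to the first one that exceeds `κ`. -/
def attemptsNeeded (κ : ℝ) (ω : Draw → ℝ) (i β t : ℕ) : ℕ :=
  if h : ∃ l, κ < ω (i, β, t, l) then Nat.find h + 1 else 0

/-- The cells that the algorithm may use. -/
def Allowed (d n B : ℕ) : Cell → Prop
  | x m i => m < n ∧ i < d
  | s m => m < n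
  | run₁ β => β < B
  | run₂ β => β < B
  | bhat i => i < d
  | sig i j => i < d ∧ j < d

/-! ### Uniform acceptance threshold and the accounting of steps and cells. -/

lemma clip_mem {lo hi : ℝ} (h : lo ≤ hi) (y : ℝ) : lo ≤ clip lo hi y ∧ clip lo hi y ≤ hi := by
  unfold clip
  split_ifs <;> constructor <;> linarith

lemma sgd_mem {r : ℝ} (hr : 1 < r) (lam τ : ℝ) (y : ℕ → ℝ) (ξ : ℕ → ℕ → ℝ) (t : ℕ) :
    (1 / r ≤ (sgd r lam τ y ξ t).1 ∧ (sgd r lam τ y ξ t).1 ≤ r) ∧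
      (0 - r ≤ (sgd r lam τ y ξ t).2 ∧ (sgd r lam τ y ξ t).2 ≤ r) := by
  have h1 : 1 / r ≤ 1 := by rw [div_le_one (by linarith)]; exact hr.le
  cases t with
  | zero => simp only [sgd]; exact ⟨⟨h1, hr.le⟩, by linarith, by linarith⟩
  | succ t => exact ⟨clip_mem (by linarith) _, clip_mem (by linarith) _⟩

/-- The acceptance threshold for Gaussian draws that works for all iterates. -/
lemma lt_candidate {r : ℝ} (hr : 1 < r) {v : ℝ × ℝ} (h1 : 1 / r ≤ v.1) (_h2 : v.1 ≤ r)
    (h3 : 0 - r ≤ v.2) {τ x : ℝ} (hτ : τ ≤ 0) (hx : r * √r < x) : τ < candidate v x := by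
  have hr0 : 0 < r := by linarith
  have hv : 0 < v.1 := lt_of_lt_of_le (by positivity) h1
  have hs : 0 < √v.1 := Real.sqrt_pos.2 hv
  have hprod : 1 ≤ √v.1 * √r := by
    rw [← Real.sqrt_mul hv.le, Real.one_le_sqrt]
    rwa [div_le_iff₀ hr0] at h1
  -- Since `v.1 ≥ 1 / r`, the product `√v.1 * √r` is at least `1`, so `x > r * √r` gives `x * √v.1 >
  -- r ≥ -v.2`.
  have key : 0 < v.2 + x * √v.1 := by
    have : r * √r * √v.1 < x * √v.1 := by gcongr
    nlinarith
  have : candidate v x = (v.2 + x * √v.1) / v.1 := by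
    unfold candidate
    rw [add_div, mul_div_assoc, Real.sqrt_div_self', mul_one_div]
  rw [this]
  exact hτ.trans_lt (by positivity)

variable {E : Prop} {ω : Draw → ℝ} {σ : State Cell} {d n B : ℕ}

/-- The state `σ'` arises from `σ` using only allowed cells, and in at most `c` steps unless the
exceptional event `E` occurs. -/
structure Bounded (d n B : ℕ) (E : Prop) (σ : State Cell) (c : ℕ) (σ' : State Cell) : Prop where
  steps : ¬E → σ'.steps ≤ σ.steps + c
  used : (∀ a ∈ σ.used, Allowed d n B a) → ∀ a ∈ σ'.used, Allowed d n B a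

lemma Bounded.refl (σ : State Cell) : Bounded d n B E σ 0 σ := ⟨fun _ => le_rfl, id⟩

lemma Bounded.trans {σ σ' σ'' : State Cell} {c c' : ℕ} (h : Bounded d n B E σ c σ')
    (h' : Bounded d n B E σ' c' σ'') : Bounded d n B E σ (c + c') σ'' :=
  ⟨fun hE => by have := h.steps hE; have := h'.steps hE; omega, fun hu => h'.used (h.used hu)⟩

lemma Bounded.mono {σ σ' : State Cell} {c c' : ℕ} (h : Bounded d n B E σ c σ')
    (hc : c ≤ c') : Bounded d n B E σ c' σ' :=
  ⟨fun hE => (h.steps hE).trans (by omega), h.used⟩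

lemma Bounded.tick {σ σ' : State Cell} {c : ℕ} (h : Bounded d n B E σ c σ') (k : ℕ) :
    Bounded d n B E σ (c + k) { σ' with steps := σ'.steps + k } :=
  ⟨fun hE => by have := h.steps hE; simp only; omega, h.used⟩

lemma Bounded.insert {σ σ' : State Cell} {c : ℕ} (h : Bounded d n B E σ c σ') {a : Cell}
    (ha : Allowed d n B a) (mem : Cell → ℝ) (k : ℕ) :
    Bounded d n B E σ (c + k) ⟨mem, σ'.steps + k, insert a σ'.used⟩ :=
  ⟨fun hE => by have := h.steps hE; simp only; omega, fun hu b hb => by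
    rcases hb with rfl | hb
    exacts [ha, h.used hu b hb]⟩

lemma wp_collect {i : ℕ} (hi : i < d) :
    wp E (collect n i) ω σ fun N σ' =>
      N = posCount n (fun m => σ.mem (x m i)) ∧ N ≤ n ∧
      (∀ j < N, σ'.mem (s j) = posValue (fun m => σ.mem (x m i)) j) ∧
      (∀ c, (∀ j, c ≠ s j) → σ'.mem c = σ.mem c) ∧ Bounded d n B E σ (5 * n) σ' := by
  classical
  unfold collect
  set X : ℕ → ℝ := fun m => σ.mem (x m i) with hX
  have key := wp_loop (E := E) (ω := ω) (σ := σ) (N := n) (body := fun m c => do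
    let y ← load (x m i)
    if ← lt 0 y then
      store (s c) y
      incr c
    else pure c) (a := 0) (fun m c σ' => c = Nat.count (fun m => 0 < X m) m ∧ c ≤ m ∧
      (∀ j < c, σ'.mem (s j) = posValue X j) ∧
      (∀ c, (∀ j, c ≠ s j) → σ'.mem c = σ.mem c) ∧ Bounded d n B E σ (5 * m) σ')
      (by simpa using Bounded.refl σ) ?_
  · refine wp_mono key fun N σ' h => ⟨?_, h.2⟩
    rw [h.1, posCount]
  · intro m hm c σ' ⟨hc, hcm, hs, hf, hb⟩
    have hxm : σ'.mem (x m i) = X m := hf _ (by simp)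
    have hb1 := ((hb.tick 1).insert (a := x m i) ⟨hm, hi⟩ σ'.mem 1).tick 1
    simp only [wp_bind, wp_load, wp_lt]
    refine wp_ite (fun h => ?_) (fun h => ?_)
    · simp only [decide_eq_true_eq, hxm] at h
      simp only [wp_bind, wp_store, wp_incr]
      refine ⟨?_, by omega, ?_, ?_, ?_⟩
      · rw [Nat.count_succ, if_pos h, hc]
      · intro j hj
        by_cases hjc : j = c
        · subst hjc
          have : posValue X (Nat.count (fun m => 0 < X m) m) = X m := by
            unfold posValue
            rw [Nat.nth_count h]
          simp [hxm, ← this, hc]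
        · simp only [Function.update_apply, s.injEq, hjc, if_false]
          exact hs j (by omega)
      · intro a ha
        rw [Function.update_of_ne (ha c)]
        exact hf a ha
      · exact ((hb1.insert (a := s c) (show c < n by omega) _ 1).tick 1).mono (by omega)
    · simp only [decide_eq_true_eq, hxm, not_lt] at h
      simp only [wp_pure]
      refine ⟨?_, by omega, hs, hf, hb1.mono (by omega)⟩
      rw [Nat.count_succ, if_neg (by linarith), hc, add_zero]

lemma wp_mean {N : ℕ} (hN : N ≤ n) {y : ℕ → ℝ} (hy : ∀ j < N, σ.mem (s j) = y j) :
    wp E (mean N) ω σ fun μ σ' =>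
      μ = empMean N y ∧ σ'.mem = σ.mem ∧ Bounded d n B E σ (5 * n + 3) σ' := by
  unfold mean
  rw [wp_bind]
  refine wp_mono (wp_loop (fun m t σ' => t = ∑ j ∈ Finset.range m, y j ∧ σ'.mem = σ.mem ∧
    Bounded d n B E σ (5 * m) σ') ⟨by simp, rfl, Bounded.refl σ⟩ ?_) ?_
  · intro m hm t σ' ⟨ht, hmem, hb⟩
    have hb1 := (((hb.tick 1).insert (a := s m) (show m < n by omega) σ'.mem 1).tick 3)
    simp only [wp_bind, wp_load, wp_arith]
    refine ⟨?_, hmem, hb1.mono (by omega)⟩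
    rw [Finset.sum_range_succ, ← ht, hmem, hy m hm]
    rfl
  · intro t σ' ⟨ht, hmem, hb⟩
    rw [wp_arith]
    refine ⟨?_, hmem, (hb.tick 3).mono (by omega)⟩
    rw [empMean, ← ht]
    rfl

lemma wp_stdDev {N : ℕ} (hN : N ≤ n) {y : ℕ → ℝ} (hy : ∀ j < N, σ.mem (s j) = y j) :
    wp E (stdDev N (empMean N y)) ω σ fun μ σ' =>
      μ = empSd N y ∧ σ'.mem = σ.mem ∧ Bounded d n B E σ (11 * n + 4) σ' := by
  unfold stdDev
  rw [wp_bind]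
  refine wp_mono (wp_loop (fun m t σ' => t = ∑ j ∈ Finset.range m,
    (y j - empMean N y) * (y j - empMean N y) ∧ σ'.mem = σ.mem ∧
    Bounded d n B E σ (11 * m) σ') ⟨by simp, rfl, Bounded.refl σ⟩ ?_) ?_
  · intro m hm t σ' ⟨ht, hmem, hb⟩
    have hb1 := (((hb.tick 1).insert (a := s m) (show m < n by omega) σ'.mem 1).tick 9)
    simp only [wp_bind, wp_load, wp_arith]
    refine ⟨?_, hmem, hb1.mono (by omega)⟩
    rw [Finset.sum_range_succ, ← ht, hmem, hy m hm]
    rfl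
  · intro t σ' ⟨ht, hmem, hb⟩
    rw [wp_arith]
    refine ⟨?_, hmem, (hb.tick 4).mono (by omega)⟩
    rw [empSd, ← ht]
    rfl

lemma wp_standardize {N : ℕ} (hN : N ≤ n) {y : ℕ → ℝ} (hy : ∀ j < N, σ.mem (s j) = y j)
    (μ sd : ℝ) :
    wp E (standardize N μ sd) ω σ fun _ σ' =>
      (∀ j < N, σ'.mem (s j) = (y j - μ) / sd) ∧
      (∀ c, (∀ j, c ≠ s j) → σ'.mem c = σ.mem c) ∧ Bounded d n B E σ (8 * n) σ' := by
  classical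
  unfold standardize
  -- The values are overwritten in place. The invariant therefore also records that the cells from
  -- `s m` on still hold the original values.
  refine wp_mono (wp_loop (fun m _ σ' => (∀ j < m, σ'.mem (s j) = (y j - μ) / sd) ∧
    (∀ c, (∀ j < m, c ≠ s j) → σ'.mem c = σ.mem c) ∧ Bounded d n B E σ (8 * m) σ')
    ⟨by simp, fun _ _ => rfl, Bounded.refl σ⟩ ?_) ?_
  · intro m hm _ σ' ⟨hs, hf, hb⟩
    have hm' : Allowed d n B (s m) := show m < n by omega
    have hb1 := ((((hb.tick 1).insert hm' σ'.mem 1).tick 5).insert hm'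
      (Function.update σ'.mem (s m) ((y m - μ) / sd)) 1)
    have hsm : σ'.mem (s m) = y m := by
      rw [hf _ (by intro j hj; simp; omega), hy m hm]
    simp only [wp_bind, wp_load, wp_arith, wp_store, hsm]
    refine ⟨?_, ?_, ?_⟩
    · intro j hj
      by_cases hjm : j = m
      · subst hjm
        exact Function.update_self ..
      · rw [Function.update_of_ne (by simpa using hjm), hs j (by omega)]
    · intro c hc
      rw [Function.update_of_ne (hc m (by omega))]
      exact hf c fun j hj => hc j (by omega)
    · exact hb1.mono (by omega)
  · intro _ σ' ⟨hs, hf, hb⟩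
    exact ⟨hs, fun c hc => hf c fun j _ => hc j, hb.mono (by omega)⟩

lemma wp_clamp (lo hi y : ℝ) :
    wp E (clamp lo hi y) ω σ fun a σ' =>
      a = clip lo hi y ∧ σ'.mem = σ.mem ∧ Bounded d n B E σ 2 σ' := by
  unfold clamp clip
  simp only [wp_bind, wp_lt]
  refine wp_ite (fun h => ?_) (fun h => ?_)
  · simp only [decide_eq_true_eq] at h
    exact ⟨by simp [h], rfl, ((Bounded.refl σ).tick 1).mono (by omega)⟩
  · simp only [decide_eq_true_eq] at h
    simp only [wp_bind, wp_lt]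
    refine wp_ite (fun h' => ?_) (fun h' => ?_)
    · simp only [decide_eq_true_eq] at h'
      exact ⟨by simp [h, h'], rfl, (((Bounded.refl σ).tick 1).tick 1).mono (by omega)⟩
    · simp only [decide_eq_true_eq] at h'
      exact ⟨by simp [h, h'], rfl, (((Bounded.refl σ).tick 1).tick 1).mono (by omega)⟩

/-- The first accepted candidate comes no later than the first draw above `κ`. This replaces the
true number of rounds, which depends on the iterate, by one that depends on the draws only. A round
costs `10` steps for its body and one for the search. -/
lemma wp_truncatedGaussian {κ : ℝ} {v : ℝ × ℝ} {τ : ℝ}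
    (hacc : ∀ x, κ < x → τ < candidate v x) (i β t : ℕ) :
    wp (Stuck κ ω) (truncatedGaussian v.1 v.2 τ i β t) ω σ fun z σ' =>
      z = firstAccepted v τ (fun l => ω (i, β, t, l)) ∧ σ'.mem = σ.mem ∧
      Bounded d n B (Stuck κ ω) σ (11 * attemptsNeeded κ ω i β t) σ' := by
  classical
  have hbody : ∀ l σ', (do
      let ξ ← gauss (i, β, t, l)
      let z ← arith (v.2 / v.1 + ξ / Expr.sqrt v.1)
      if ← lt τ z then pure (some z) else pure none : Prog (Option ℝ)) ω σ' =
      some (if τ < candidate v (ω (i, β, t, l)) then some (candidate v (ω (i, β, t, l))) else none,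
        { σ' with steps := σ'.steps + 10 }) := by
    intro l σ'
    have : ∀ (b : Bool) (z : ℝ) (σ'' : State Cell),
        (if b = true then (pure (some z) : Prog (Option ℝ)) else pure none) ω σ'' =
          some (if b = true then some z else none, σ'') := by
      intro b z σ''
      cases b <;> rfl
    refine (this _ _ _).trans ?_
    simp only [decide_eq_true_eq]
    rfl
  by_cases hex : ∃ l, τ < candidate v (ω (i, β, t, l))
  · have hse : truncatedGaussian v.1 v.2 τ i β t ω σ = some (firstAccepted v τ
        (fun l => ω (i, β, t, l)), { σ with steps := σ.steps + (Nat.find hex + 1) * (10 + 1) }) := by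
      refine search_eq _ 10 hbody ?_ ?_
      · rw [if_pos (Nat.find_spec hex), firstAccepted, dif_pos hex]
      · intro l hl
        rw [if_neg (Nat.find_min hex hl)]
    unfold wp
    rw [hse]
    refine ⟨rfl, rfl, fun hst => ?_, id⟩
    have hst : ∃ l, κ < ω (i, β, t, l) := by
      by_contra! h
      exact hst ⟨i, β, t, h⟩
    have hle : Nat.find hex ≤ Nat.find hst := Nat.find_mono fun l hl => hacc _ hl
    rw [attemptsNeeded, dif_pos hst]
    simp only
    omega
  · have hse : truncatedGaussian v.1 v.2 τ i β t ω σ = none := by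
      refine search_eq_none 10 fun l σ' => ?_
      rw [hbody, if_neg fun h => hex ⟨l, h⟩]
    unfold wp
    rw [hse]
    exact ⟨i, β, t, fun l => not_lt.1 fun h => hex ⟨l, hacc _ h⟩⟩

/-! ### Correctness and cost of the runs, the selection and the whole program. -/

open RAM Cell

variable {E : Prop} {ω : Draw → ℝ} {σ : State Cell} {d n B : ℕ}

/-- All iterates stay in the box, so the single threshold `r * √r` serves every step of the run,
whatever the data are. -/
lemma wp_projSGD {r : ℝ} (hr : 1 < r) (lam : ℝ) {τ : ℝ} (hτ : τ ≤ 0) {T i β : ℕ}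
    (hT : β * T + T ≤ n) {y : ℕ → ℝ} (hy : ∀ t < T, σ.mem (s (β * T + t)) = y t) :
    wp (Stuck (r * √r) ω) (projSGD r lam τ T i β) ω σ fun v σ' =>
      v = sgdAvg r lam τ T y (fun t l => ω (i, β, t, l)) ∧ σ'.mem = σ.mem ∧
      Bounded d n B (Stuck (r * √r) ω) σ
        (60 * T + 20 + 11 * ∑ t ∈ Finset.range T, attemptsNeeded (r * √r) ω i β t) σ' := by
  set ξ : ℕ → ℕ → ℝ := fun t l => ω (i, β, t, l) with hξ
  set v := sgd r lam τ y ξ with hv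
  unfold projSGD
  simp only [wp_bind, wp_arith]
  refine wp_mono (wp_loop (fun m p σ' => p = (v m, (∑ t ∈ Finset.range m, (v (t + 1)).1,
    ∑ t ∈ Finset.range m, (v (t + 1)).2)) ∧ σ'.mem = σ.mem ∧
    Bounded d n B (Stuck (r * √r) ω) σ
      (6 + (60 * m + 11 * ∑ t ∈ Finset.range m, attemptsNeeded (r * √r) ω i β t)) σ')
    ⟨by simp [hv, sgd], rfl, (((Bounded.refl σ).tick 3).tick 3).mono (by omega)⟩ ?_) ?_
  · rintro m hm _ σ' ⟨rfl, hmem, hb⟩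
    have hb1 := (hb.tick 1).insert (a := s (β * T + m)) (show β * T + m < n by omega) σ'.mem 1
    simp only [wp_bind, wp_load]
    have hm' := sgd_mem hr lam τ y ξ m
    refine wp_mono (wp_truncatedGaussian (κ := r * √r) (d := d) (n := n) (B := B) (v := v m)
      (fun x hx => lt_candidate hr hm'.1.1 hm'.1.2 hm'.2.1 hτ hx) i β m) ?_
    rintro z σ₁ ⟨hz, hmem₁, hb₁⟩
    have hb2 := ((((hb1.trans hb₁).tick 9).tick 3).tick 7).tick 7
    simp only [wp_arith]
    refine wp_mono (wp_clamp (d := d) (n := n) (B := B) _ _ _) ?_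
    rintro v₁ σ₂ ⟨hv₁, hmem₂, hb₂⟩
    refine wp_mono (wp_clamp (d := d) (n := n) (B := B) _ _ _) ?_
    rintro v₂ σ₃ ⟨hv₂, hmem₃, hb₃⟩
    have hb3 := (((hb2.trans hb₂).trans hb₃).tick 3).tick 3
    simp only [wp_pure]
    rw [hmem, hy m hm] at hv₁ hv₂
    have e : (v₁, v₂) = v (m + 1) := by
      rw [hv₁, hv₂, hv, sgd, ← hz]
      rfl
    have e1 : (v (m + 1)).1 = v₁ := by rw [← e]
    have e2 : (v (m + 1)).2 = v₂ := by rw [← e]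
    refine ⟨?_, ?_, ?_⟩
    · rw [Finset.sum_range_succ, Finset.sum_range_succ, e1, e2, e]
      rfl
    · rw [hmem₃, hmem₂, hmem₁, hmem]
    · rw [Finset.sum_range_succ]
      exact hb3.mono (by omega)
  · rintro _ σ' ⟨rfl, hmem, hb⟩
    exact ⟨rfl, hmem, ((hb.tick 3).tick 3).mono (by omega)⟩

lemma wp_score {run : ℕ → ℝ × ℝ} (h₁ : ∀ β < B, σ.mem (run₁ β) = (run β).1)
    (h₂ : ∀ β < B, σ.mem (run₂ β) = (run β).2) {β : ℕ} (hβ : β < B) :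
    wp E (score B β) ω σ fun a σ' => a = totalDist B run β ∧ σ'.mem = σ.mem ∧
      Bounded d n B E σ (2 + 30 * B) σ' := by
  unfold score
  simp only [wp_bind, wp_load]
  refine wp_mono (wp_loop (fun m a σ' => a = totalDist m run β ∧ σ'.mem = σ.mem ∧ 
    Bounded d n B E σ (2 + 30 * m) σ') ⟨rfl, rfl, ?_⟩ ?_) fun _ _ h => h
  · exact ((Bounded.refl σ).insert (a := run₁ β) hβ σ.mem 1).insert (a := run₂ β) hβ σ.mem 1
  · rintro m hm _ σ' ⟨rfl, hmem, hb⟩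
    have hb1 := (((hb.tick 1).insert (a := run₁ m) hm σ'.mem 1).insert
      (a := run₂ m) hm σ'.mem 1).tick 18
    simp only [wp_bind, wp_load, wp_arith]
    refine ⟨?_, hmem, hb1.mono (by omega)⟩
    rw [hmem, h₁ m hm, h₂ m hm, h₁ β hβ, h₂ β hβ, totalDist, totalDist, Finset.sum_range_succ]
    rfl

lemma wp_selectRun {run : ℕ → ℝ × ℝ} (h₁ : ∀ β < B, σ.mem (run₁ β) = (run β).1)
    (h₂ : ∀ β < B, σ.mem (run₂ β) = (run β).2) (hB : 0 < B) :
    wp E (selectRun B) ω σ fun v σ' =>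
      (∃ β < B, (∀ β' < B, totalDist B run β ≤ totalDist B run β') ∧ v = run β) ∧
      σ'.mem = σ.mem ∧ Bounded d n B E σ (80 * B ^ 2) σ' := by
  unfold selectRun
  rw [wp_bind]
  refine wp_mono (wp_score (d := d) (n := n) h₁ h₂ hB) ?_
  rintro s₀ σ₀ ⟨hs₀, hmem₀, hb₀⟩
  rw [wp_bind]
  refine wp_mono (wp_loop (fun m p σ' => (p.1 < B ∧ p.2 = totalDist B run p.1 ∧
    ∀ β' < m, p.2 ≤ totalDist B run β') ∧ σ'.mem = σ.mem ∧
    Bounded d n B E σ ((2 + 30 * B) + (4 + 30 * B) * m) σ') ⟨⟨hB, hs₀, by simp⟩, hmem₀, hb₀⟩ ?_) ?_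
  · rintro m hm ⟨β, sβ⟩ σ' ⟨⟨hβ, hsβ, hmin⟩, hmem, hb⟩
    simp only [wp_bind]
    refine wp_mono (wp_score (d := d) (n := n) (run := run) (by simpa [hmem] using h₁)
      (by simpa [hmem] using h₂) hm) ?_
    rintro s₁ σ₁ ⟨hs₁, hmem₁, hb₁⟩
    have hb2 := (((hb.tick 1).trans hb₁).tick 1).mono
      (show _ ≤ (2 + 30 * B) + (4 + 30 * B) * (m + 1) by ring_nf; omega)
    simp only [wp_lt]
    have hlast : ∀ {a : ℝ}, (∀ β' < m, a ≤ totalDist B run β') → a ≤ totalDist B run m →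
        ∀ β' < m + 1, a ≤ totalDist B run β' := by
      intro a h h' β' hβ'
      rcases Nat.lt_succ_iff_lt_or_eq.1 hβ' with h'' | rfl
      exacts [h β' h'', h']
    refine wp_ite (fun h => ?_) (fun h => ?_)
    · simp only [decide_eq_true_eq] at h
      exact ⟨⟨hm, hs₁, hlast (fun β' hβ' => h.le.trans (hmin β' hβ')) hs₁.le⟩,
        hmem₁.trans hmem, hb2⟩
    · simp only [decide_eq_true_eq, not_lt] at h
      exact ⟨⟨hβ, hsβ, hlast hmin (h.trans hs₁.le)⟩, hmem₁.trans hmem, hb2⟩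
  · rintro ⟨β, sβ⟩ σ' ⟨⟨hβ, hsβ, hmin⟩, hmem, hb⟩
    simp only at hβ hsβ hmin
    simp only [wp_bind, wp_load, wp_pure]
    refine ⟨⟨β, hβ, fun β' h' => hsβ ▸ hmin β' h', ?_⟩, hmem, ?_⟩
    · rw [hmem, h₁ β hβ, h₂ β hβ]
    · have h1 : 1 ≤ B := hB
      have h2 : B ≤ B ^ 2 := by nlinarith
      refine ((hb.insert (a := run₁ β) hβ σ'.mem 1).insert (a := run₂ β) hβ σ'.mem 1).mono ?_
      nlinarith

/-- An upper bound for the draws that the batches of coordinate `i` need. -/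
def rowAttempts (κ : ℝ) (ω : Draw → ℝ) (n B i : ℕ) : ℕ :=
  ∑ β ∈ Finset.range B, ∑ t ∈ Finset.range (n / B), attemptsNeeded κ ω i β t

lemma wp_normBiasEst {r : ℝ} (hr : 1 < r) (lam : ℝ) {N i : ℕ} (hB : 0 < B) (hN : N ≤ n)
    {y : ℕ → ℝ} (hpos : ∀ j < N, 0 < y j) (hy : ∀ j < N, σ.mem (s j) = y j) :
    wp (Stuck (r * √r) ω) (normBiasEst r lam B N i) ω σ fun p σ' =>
      IsEstimate r lam B N y (fun β t l => ω (i, β, t, l)) p ∧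
      (∀ c, (∀ j, c ≠ s j) → (∀ β, c ≠ run₁ β) → (∀ β, c ≠ run₂ β) → σ'.mem c = σ.mem c) ∧
      Bounded d n B (Stuck (r * √r) ω) σ
        (100 * n + 200 * B ^ 2 + 100 + 11 * rowAttempts (r * √r) ω n B i) σ' := by
  classical
  unfold normBiasEst
  rw [wp_bind, wp_tick]
  have hb0 : Bounded d n B (Stuck (r * √r) ω) σ (0 + 1) { σ with steps := σ.steps + 1 } :=
    (Bounded.refl σ).tick 1
  refine wp_ite (fun h0 => ?_) (fun h0 => ?_)
  · exact ⟨⟨fun _ => rfl, fun h => (h h0).elim, fun h => (h h0).elim⟩, fun _ _ _ _ => rfl,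
      hb0.mono (by omega)⟩
  rw [wp_bind]
  refine wp_mono (wp_mean (d := d) (n := n) (B := B) hN hy) ?_
  rintro _ σ₁ ⟨rfl, hmem₁, hb₁⟩
  rw [wp_bind]
  refine wp_mono (wp_stdDev (d := d) (n := n) (B := B) hN (by simpa [hmem₁] using hy)) ?_
  rintro _ σ₂ ⟨rfl, hmem₂, hb₂⟩
  have hb2 := ((hb0.trans hb₁).trans hb₂).tick 1
  simp only [wp_bind, wp_lt]
  refine wp_ite (fun h => ?_) (fun h => ?_)
  swap
  · simp only [decide_eq_true_eq] at h
    exact ⟨⟨fun h => (h0 h).elim, fun _ _ => rfl, fun _ h' => (h h').elim⟩,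
      fun _ _ _ _ => by simp [hmem₂, hmem₁], hb2.mono (by omega)⟩
  simp only [decide_eq_true_eq] at h
  rw [wp_bind]
  refine wp_mono (wp_standardize (d := d) (n := n) (B := B) hN (y := y)
    (by simpa [hmem₂, hmem₁] using hy) _ _) ?_
  rintro _ σ₃ ⟨hs₃, hf₃, hb₃⟩
  simp only [wp_bind, wp_natDiv, wp_arith]
  have hb3 := ((hb2.trans hb₃).tick 1).tick 5
  -- The stored values are positive, hence so is the truncation point's distance below the mean: the
  -- standardized point is at most `0`, as the acceptance threshold requires.
  have hμ : 0 ≤ empMean N y := div_nonneg (Finset.sum_nonneg fun j hj =>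
    (hpos j (Finset.mem_range.1 hj)).le) (Nat.cast_nonneg _)
  have hτ : 0 - empMean N y / empSd N y ≤ 0 := by
    have := div_nonneg hμ h.le
    linarith
  set run := batchRun r lam B N y (fun β t l => ω (i, β, t, l)) with hrun
  refine wp_mono (wp_loop (fun m _ σ' => (∀ β < m, σ'.mem (run₁ β) = (run β).1) ∧
    (∀ β < m, σ'.mem (run₂ β) = (run β).2) ∧
    (∀ c, (∀ β, c ≠ run₁ β) → (∀ β, c ≠ run₂ β) → σ'.mem c = σ₃.mem c) ∧
    Bounded d n B (Stuck (r * √r) ω) σ (24 * n + 20 + ((60 * (N / B) + 25) * m +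
      11 * ∑ β ∈ Finset.range m, ∑ t ∈ Finset.range (N / B), attemptsNeeded (r * √r) ω i β t)) σ')
    ⟨by simp, by simp, fun _ _ _ => rfl, hb3.mono (by simp; omega)⟩ ?_) ?_
  · rintro m hm _ σ' ⟨hr₁, hr₂, hf, hb⟩
    have hle : m * (N / B) + N / B ≤ N := by
      have h1 : (m + 1) * (N / B) ≤ B * (N / B) := Nat.mul_le_mul_right _ hm
      have h2 := Nat.mul_div_le N B
      linarith
    rw [wp_bind]
    refine wp_mono (wp_projSGD (d := d) (n := n) (B := B) hr lam hτ (T := N / B) (i := i) (β := m)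
      (hle.trans hN) (y := fun t => (y (m * (N / B) + t) - empMean N y) / empSd N y) ?_) ?_
    · intro t ht
      simp only
      rw [hf _ (by simp) (by simp), hs₃ _ (by omega)]
    rintro v σ'' ⟨hv, hmem, hb'⟩
    have hvr : v = run m := hv
    simp only [wp_bind, wp_store]
    have hb4 := (((hb.tick 1).trans hb').insert (a := run₁ m) hm
      (Function.update σ''.mem (run₁ m) v.1) 1).insert (a := run₂ m) hm
      (Function.update (Function.update σ''.mem (run₁ m) v.1) (run₂ m) v.2) 1
    refine ⟨?_, ?_, ?_, ?_⟩
    · intro β hβ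
      by_cases hβm : β = m
      · subst hβm
        simp [hvr]
      · simp [hβm, hmem, hr₁ β (by omega)]
    · intro β hβ
      by_cases hβm : β = m
      · subst hβm
        simp [hvr]
      · simp [hβm, hmem, hr₂ β (by omega)]
    · intro c hc₁ hc₂
      rw [Function.update_of_ne (hc₂ m), Function.update_of_ne (hc₁ m), hmem]
      exact hf c hc₁ hc₂
    · rw [Finset.sum_range_succ]
      refine hb4.mono ?_
      ring_nf
      omega
  · rintro _ σ₄ ⟨hr₁, hr₂, hf, hb⟩
    refine wp_mono (wp_selectRun (d := d) (n := n) hr₁ hr₂ hB) ?_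
    rintro v σ₅ ⟨⟨β, hβ, hmin, rfl⟩, hmem₅, hb₅⟩
    refine ⟨⟨fun h => (h0 h).elim, fun _ h' => (h' h).elim, fun _ _ => ⟨β, hβ, hmin, rfl⟩⟩, ?_, ?_⟩
    · intro c hc₁ hc₂ hc₃
      rw [hmem₅, hf c hc₂ hc₃, hf₃ c hc₁, hmem₂, hmem₁]
    · have hb6 := ((((hb.trans hb₅).tick 5).tick 11).tick 3).tick 3
      refine hb6.mono ?_
      have h1 : N / B * B ≤ n := (Nat.div_mul_le_self N B).trans hN
      have h2 : B ≤ B ^ 2 := by nlinarith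
      -- The batch length `N / B` depends on the samples. Enlarging it to `n / B` gives a cost bound
      -- in terms of the draws alone.
      have h3 : ∑ β ∈ Finset.range B, ∑ t ∈ Finset.range (N / B),
          attemptsNeeded (r * √r) ω i β t ≤ rowAttempts (r * √r) ω n B i := by
        refine Finset.sum_le_sum fun β _ => Finset.sum_le_sum_of_subset fun t ht => ?_
        simp only [Finset.mem_range] at *
        exact ht.trans_le (Nat.div_le_div_right hN)
      nlinarith

/-- The estimate of the bias and the variance of coordinate `i` from the samples in memory `mem`
is `(b, q)`. -/
def RowEstimate (r lam : ℝ) (B n i : ℕ) (mem : Cell → ℝ) (ω : Draw → ℝ) (b q : ℝ) : Prop :=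
  ∃ p : ℝ × ℝ, IsEstimate r lam B (posCount n fun m => mem (x m i))
    (posValue fun m => mem (x m i)) (fun β t l => ω (i, β, t, l)) p ∧ q = p.2 ∧ b = max p.1 0

lemma posValue_pos {n : ℕ} {x : ℕ → ℝ} {j : ℕ} (hj : j < posCount n x) : 0 < posValue x j := by
  classical
  unfold posValue
  unfold posCount at hj
  have := Nat.nth_lt_of_lt_count hj
  refine Nat.nth_mem (p := fun m => 0 < x m) j fun hfin => ?_
  refine hj.trans_le ?_
  rw [Nat.count_eq_card_filter_range]
  refine Finset.card_le_card fun m hm => ?_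
  simp only [Finset.mem_filter] at hm
  simpa using hm.2

lemma wp_estimateRow {r : ℝ} (hr : 1 < r) (lam : ℝ) {i : ℕ} (hi : i < d) (hB : 0 < B) :
    wp (Stuck (r * √r) ω) (estimateRow r lam B n i) ω σ fun _ σ' =>
      RowEstimate r lam B n i σ.mem ω (σ'.mem (bhat i)) (σ'.mem (sig i i)) ∧
      (∀ c, (∀ j, c ≠ s j) → (∀ β, c ≠ run₁ β) → (∀ β, c ≠ run₂ β) → c ≠ bhat i → c ≠ sig i i →
        σ'.mem c = σ.mem c) ∧
      Bounded d n B (Stuck (r * √r) ω) σ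
        (105 * n + 200 * B ^ 2 + 103 + 11 * rowAttempts (r * √r) ω n B i) σ' := by
  classical
  unfold estimateRow
  rw [wp_bind]
  refine wp_mono (wp_collect (n := n) (B := B) hi) ?_
  rintro N σ₁ ⟨hN, hNn, hs, hf, hb⟩
  rw [wp_bind]
  refine wp_mono (wp_normBiasEst (d := d) (B := B) hr lam hB hNn
    (fun j hj => posValue_pos (hN ▸ hj)) hs) ?_
  rintro p σ₂ ⟨hp, hf₂, hb₂⟩
  subst hN
  have hss : Allowed d n B (sig i i) := ⟨hi, hi⟩
  have hbb : Allowed d n B (bhat i) := hi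
  simp only [wp_bind, wp_store, wp_lt]
  refine wp_ite (fun h => ?_) (fun h => ?_)
  · simp only [decide_eq_true_eq] at h
    have hb3 := ((((hb.trans hb₂).insert hss (Function.update σ₂.mem (sig i i) p.2) 1).tick 1).insert
      hbb (Function.update (Function.update σ₂.mem (sig i i) p.2) (bhat i) 0) 1)
    rw [wp_store]
    refine ⟨⟨p, hp, by simp, by simp [max_eq_right h.le]⟩, ?_,
      hb3.mono (by omega)⟩
    intro c h1 h2 h3 h4 h5
    simp only [ne_eq, h4, not_false_eq_true, Function.update_of_ne, h5]
    rw [hf₂ c h1 h2 h3, hf c h1]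
  · simp only [decide_eq_true_eq, not_lt] at h
    have hb3 := ((((hb.trans hb₂).insert hss (Function.update σ₂.mem (sig i i) p.2) 1).tick 1).insert
      hbb (Function.update (Function.update σ₂.mem (sig i i) p.2) (bhat i) p.1) 1)
    rw [wp_store]
    refine ⟨⟨p, hp, by simp, by simp [max_eq_left h]⟩, ?_,
      hb3.mono (by omega)⟩
    intro c h1 h2 h3 h4 h5
    simp only [ne_eq, h4, not_false_eq_true, Function.update_of_ne, h5]
    rw [hf₂ c h1 h2 h3, hf c h1]

/-- The estimate of an off-diagonal entry, given the estimates `b` and `q` of the bias and the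
variances and the number of samples `c` that exceed the bias in both coordinates. -/
def pairEstimate (n : ℕ) (p q c : ℝ) : ℝ :=
  √(p * q) * Real.cos (Real.pi - 2 * Real.pi / n * c)

open Classical in
/-- The number of samples in memory that exceed the estimated bias in both coordinates. -/
def jointCount (n i j : ℕ) (mem : Cell → ℝ) : ℕ :=
  ((Finset.range n).filter fun m => mem (bhat i) < mem (x m i) ∧ mem (bhat j) < mem (x m j)).card

lemma wp_estimatePair {i j : ℕ} (hi : i < d) (hj : j < d) :
    wp E (estimatePair n i j) ω σ fun _ σ' =>
      (∀ c, c ≠ sig i j → c ≠ sig j i → σ'.mem c = σ.mem c) ∧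
      σ'.mem (sig i j) = pairEstimate n (σ.mem (sig i i)) (σ.mem (sig j j))
        (jointCount n i j σ.mem) ∧
      σ'.mem (sig j i) = pairEstimate n (σ.mem (sig i i)) (σ.mem (sig j j))
        (jointCount n i j σ.mem) ∧
      Bounded d n B E σ (10 * n + 22) σ' := by
  classical
  unfold estimatePair
  rw [wp_bind]
  refine wp_mono (wp_loop (a := (0 : ℝ)) (fun m c σ' => c = jointCount m i j σ.mem ∧ σ'.mem = σ.mem ∧
    Bounded d n B E σ (10 * m) σ') ⟨by simp [jointCount], rfl, Bounded.refl σ⟩ ?_) ?_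
  · rintro m hm _ σ' ⟨rfl, hmem, hb⟩
    have hb1 := (((((hb.tick 1).insert (a := x m i) ⟨hm, hi⟩ σ'.mem 1).insert
      (a := x m j) ⟨hm, hj⟩ σ'.mem 1).insert (a := bhat i) hi σ'.mem 1).insert
      (a := bhat j) hj σ'.mem 1).tick 1
    simp only [wp_bind, wp_load, wp_lt]
    have hcount : ((jointCount (m + 1) i j σ.mem : ℕ) : ℝ) = jointCount m i j σ.mem +
        if σ.mem (bhat i) < σ.mem (x m i) ∧ σ.mem (bhat j) < σ.mem (x m j) then 1 else 0 := by
      simp only [jointCount, Finset.range_add_one, Finset.filter_insert]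
      split_ifs
      · rw [Finset.card_insert_of_notMem (by simp)]
        push_cast
        ring
      · simp
    refine wp_ite (fun h => ?_) (fun h => ?_)
    · simp only [decide_eq_true_eq, hmem] at h
      simp only [wp_bind, wp_lt]
      refine wp_ite (fun h' => ?_) (fun h' => ?_)
      · simp only [decide_eq_true_eq, hmem] at h'
        rw [wp_arith]
        refine ⟨?_, hmem, ((hb1.tick 1).tick 3).mono (by omega)⟩
        rw [hcount, if_pos ⟨h, h'⟩]
        rfl
      · simp only [decide_eq_true_eq, hmem] at h'
        refine ⟨?_, hmem, (hb1.tick 1).mono (by omega)⟩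
        rw [hcount, if_neg fun h => h' h.2, add_zero]
    · simp only [decide_eq_true_eq, hmem] at h
      refine ⟨?_, hmem, hb1.mono (by omega)⟩
      rw [hcount, if_neg fun h' => h h'.1, add_zero]
  · rintro _ σ' ⟨rfl, hmem, hb⟩
    simp only [wp_bind, wp_arith, wp_load, wp_store]
    have h1 : Allowed d n B (sig i i) := ⟨hi, hi⟩
    have h2 : Allowed d n B (sig j j) := ⟨hj, hj⟩
    have h3 : Allowed d n B (sig i j) := ⟨hi, hj⟩
    have h4 : Allowed d n B (sig j i) := ⟨hj, hi⟩
    have hb1 := ((((hb.tick 9).insert h1 σ'.mem 1).insert h2 σ'.mem 1).tick 7)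
    set e : ℝ := pairEstimate n (σ.mem (sig i i)) (σ.mem (sig j j)) (jointCount n i j σ.mem) with he
    have hb2 := (hb1.insert h3 (Function.update σ'.mem (sig i j) e) 1).insert h4
      (Function.update (Function.update σ'.mem (sig i j) e) (sig j i) e) 1
    have hee : ((Expr.lit (σ'.mem (sig i i)) * Expr.lit (σ'.mem (sig j j))).sqrt *
      (Expr.lit (Expr.lit Real.pi - Expr.lit 2 * Expr.lit Real.pi / Expr.lit (n : ℝ) *
        Expr.lit ((jointCount n i j σ.mem : ℕ) : ℝ)).eval).cos).eval = e := by
      rw [hmem]; rfl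
    rw [hee]
    refine ⟨?_, ?_, ?_, ?_⟩
    · intro c hc hc'
      simp [hc, hc', hmem]
    · simp [Function.update_apply]
    · simp
    · exact hb2.mono (by omega)

/-- What a halting run of the learning algorithm computes from the memory `mem`. -/
structure LearnResult (r lam : ℝ) (B d n : ℕ) (ω : Draw → ℝ) (mem mem' : Cell → ℝ) : Prop where
  samples : ∀ m i, mem' (x m i) = mem (x m i)
  row : ∀ i < d, RowEstimate r lam B n i mem ω (mem' (bhat i)) (mem' (sig i i))
  pair : ∀ i j, i < j → j < d →
    mem' (sig i j) = pairEstimate n (mem' (sig i i)) (mem' (sig j j)) (jointCount n i j mem') ∧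
    mem' (sig j i) = pairEstimate n (mem' (sig i i)) (mem' (sig j j)) (jointCount n i j mem')

lemma RowEstimate.congr {r lam : ℝ} {i : ℕ} {mem mem' : Cell → ℝ} {b q : ℝ}
    (h : RowEstimate r lam B n i mem ω b q) (hm : ∀ m, mem' (x m i) = mem (x m i)) :
    RowEstimate r lam B n i mem' ω b q := by
  unfold RowEstimate at *
  simpa only [hm] using h

lemma wp_learn {r : ℝ} (hr : 1 < r) (lam : ℝ) (hB : 0 < B) :
    wp (Stuck (r * √r) ω) (learn r lam B d n) ω σ fun _ σ' =>
      LearnResult r lam B d n ω σ.mem σ'.mem ∧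
      Bounded d n B (Stuck (r * √r) ω) σ (d * (105 * n + 200 * B ^ 2 + 104) +
        11 * ∑ i ∈ Finset.range d, rowAttempts (r * √r) ω n B i +
        d * (1 + d * (10 * n + 23))) σ' := by
  unfold learn
  rw [wp_bind]
  refine wp_mono (wp_loop (fun m _ σ' =>
    (∀ i < m, RowEstimate r lam B n i σ.mem ω (σ'.mem (bhat i)) (σ'.mem (sig i i))) ∧
    (∀ k i, σ'.mem (x k i) = σ.mem (x k i)) ∧
    Bounded d n B (Stuck (r * √r) ω) σ (m * (105 * n + 200 * B ^ 2 + 104) +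
        11 * ∑ i ∈ Finset.range m, rowAttempts (r * √r) ω n B i) σ')
    ⟨by simp, fun _ _ => rfl, (Bounded.refl σ).mono (by omega)⟩ ?_) ?_
  · rintro m hm _ σ₁ ⟨hrow, hx, hb⟩
    refine wp_mono (wp_estimateRow hr lam hm hB) ?_
    rintro _ σ₂ ⟨hrow₂, hf, hb₂⟩
    refine ⟨?_, ?_, ?_⟩
    · intro i hi
      rcases Nat.lt_succ_iff_lt_or_eq.1 hi with h | rfl
      · rw [hf (bhat i) (by simp) (by simp) (by simp) (by simp; omega) (by simp),
          hf (sig i i) (by simp) (by simp) (by simp) (by simp) (by simp; omega)]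
        exact hrow i h
      · exact hrow₂.congr fun k => (hx k i).symm
    · intro k i
      rw [hf _ (by simp) (by simp) (by simp) (by simp) (by simp)]
      exact hx k i
    · rw [Finset.sum_range_succ]
      refine ((hb.tick 1).trans hb₂).mono ?_
      ring_nf
      omega
  rintro _ σ₁ ⟨hrow, hx, hb₁⟩
  -- The second loop writes only off-diagonal cells `sig i j` and reads only samples, biases and
  -- diagonal cells. All its results are therefore determined by the state after the first loop.
  set val : ℕ → ℕ → ℝ := fun i j => pairEstimate n (σ₁.mem (sig i i)) (σ₁.mem (sig j j))
    (jointCount n i j σ₁.mem) with hval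
  have hcongr : ∀ {mem' : Cell → ℝ}, (∀ k i, mem' (x k i) = σ₁.mem (x k i)) →
      (∀ i, mem' (bhat i) = σ₁.mem (bhat i)) → (∀ i, mem' (sig i i) = σ₁.mem (sig i i)) →
      ∀ i j, pairEstimate n (mem' (sig i i)) (mem' (sig j j)) (jointCount n i j mem') =
        val i j := by
    intro mem' h1 h2 h3 i j
    simp only [hval, h3, jointCount, h1, h2]
  refine wp_mono (wp_loop (fun m _ σ' =>
    (∀ i j, i < j → j < m → σ'.mem (sig i j) = val i j ∧ σ'.mem (sig j i) = val i j) ∧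
    ((∀ k i, σ'.mem (x k i) = σ₁.mem (x k i)) ∧ (∀ i, σ'.mem (bhat i) = σ₁.mem (bhat i)) ∧
      ∀ i, σ'.mem (sig i i) = σ₁.mem (sig i i)) ∧
    Bounded d n B (Stuck (r * √r) ω) σ₁ (m * (1 + d * (10 * n + 23))) σ')
    ⟨by simp, ⟨fun _ _ => rfl, fun _ => rfl, fun _ => rfl⟩, (Bounded.refl σ₁).mono (by omega)⟩
    ?_) ?_
  · rintro m hm _ σ₂ ⟨hp, ⟨hx₂, hb₂, hs₂⟩, hbd⟩
    refine wp_mono (wp_loop (fun l _ σ' =>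
      (∀ i j, i < j → (j < m ∨ j = m ∧ i < l) →
        σ'.mem (sig i j) = val i j ∧ σ'.mem (sig j i) = val i j) ∧
      ((∀ k i, σ'.mem (x k i) = σ₁.mem (x k i)) ∧ (∀ i, σ'.mem (bhat i) = σ₁.mem (bhat i)) ∧
        ∀ i, σ'.mem (sig i i) = σ₁.mem (sig i i)) ∧
      Bounded d n B (Stuck (r * √r) ω) σ₁ (m * (1 + d * (10 * n + 23)) + 1 + l * (10 * n + 23)) σ')
      ⟨fun i j hij h => hp i j hij (by omega), ⟨hx₂, hb₂, hs₂⟩, (hbd.tick 1).mono (by omega)⟩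
      ?_) ?_
    · rintro l hl _ σ₃ ⟨hp, ⟨hx₃, hb₃, hs₃⟩, hbd⟩
      refine wp_mono (wp_estimatePair (d := d) (n := n) (B := B) (i := l) (j := m)
        (by omega) hm) ?_
      rintro _ σ₄ ⟨hf, h1, h2, hbd₄⟩
      simp only at h1 h2 hf
      rw [hcongr hx₃ hb₃ hs₃] at h1 h2
      refine ⟨?_, ⟨?_, ?_, ?_⟩, ?_⟩
      · intro i j hij h
        by_cases hc : j = m ∧ i = l
        · obtain ⟨rfl, rfl⟩ := hc
          exact ⟨h1, h2⟩
        · rw [hf _ (by simp; omega) (by simp; omega), hf _ (by simp; omega) (by simp; omega)]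
          exact hp i j hij (by omega)
      · intro k i
        rw [hf _ (by simp) (by simp)]
        exact hx₃ k i
      · intro i
        rw [hf _ (by simp) (by simp)]
        exact hb₃ i
      · intro i
        rw [hf _ (by simp; omega) (by simp; omega)]
        exact hs₃ i
      · refine ((hbd.tick 1).trans hbd₄).mono ?_
        ring_nf
        omega
    · rintro _ σ' ⟨hp', h, hbd'⟩
      refine ⟨fun i j hij hj => hp' i j hij (by omega), h, hbd'.mono ?_⟩
      have : m * (10 * n + 23) ≤ d * (10 * n + 23) := Nat.mul_le_mul_right _ hm.le
      ring_nf at this ⊢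
      omega
  · rintro _ σ' ⟨hp, ⟨hx', hb', hs'⟩, hbd⟩
    refine ⟨⟨?_, ?_, ?_⟩, hb₁.trans hbd⟩
    · intro m i
      rw [hx', hx]
    · intro i hi
      rw [hb', hs']
      exact hrow i hi
    · intro i j hij hj
      rw [hcongr hx' hb' hs' i j]
      exact hp i j hij hj

/-! ## Halting runs -/

open RAM Cell

lemma finite_and_ncard_allowed_le (d n B : ℕ) :
    {c | Allowed d n B c}.Finite ∧
      {c | Allowed d n B c}.ncard ≤ n * d + n + 2 * B + d + d * d := by
  classical
  set F : Finset Cell := (((((Finset.range n ×ˢ Finset.range d).image fun p => x p.1 p.2) ∪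
    (Finset.range n).image s) ∪ ((Finset.range B).image run₁ ∪ (Finset.range B).image run₂)) ∪
    (Finset.range d).image bhat) ∪ (Finset.range d ×ˢ Finset.range d).image fun p => sig p.1 p.2
    with hF
  have hsub : {c | Allowed d n B c} ⊆ (F : Set Cell) := by
    intro c hc
    cases c <;> simp_all [Allowed]
  have hcard : F.card ≤ n * d + n + 2 * B + d + d * d := by
    refine (Finset.card_union_le _ _).trans (Nat.add_le_add ((Finset.card_union_le _ _).trans
      (Nat.add_le_add ((Finset.card_union_le _ _).trans (Nat.add_le_add
        ((Finset.card_union_le _ _).trans (Nat.add_le_add ?_ ?_)) ?_)) ?_)) ?_)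
    · exact Finset.card_image_le.trans (by simp)
    · exact Finset.card_image_le.trans (by simp)
    · refine (Finset.card_union_le _ _).trans ?_
      have h1 : ((Finset.range B).image run₁).card ≤ B := Finset.card_image_le.trans (by simp)
      have h2 : ((Finset.range B).image run₂).card ≤ B := Finset.card_image_le.trans (by simp)
      omega
    · exact Finset.card_image_le.trans (by simp)
    · exact Finset.card_image_le.trans (by simp)
  refine ⟨F.finite_toSet.subset hsub, ?_⟩
  rw [← Set.ncard_coe_finset] at hcard
  exact (Set.ncard_le_ncard hsub F.finite_toSet).trans hcard

/-- An upper bound for the number of steps of the learning algorithm. -/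
def stepBound (κ : ℝ) (d n B : ℕ) (ω : Draw → ℝ) : ℕ :=
  d * (105 * n + 200 * B ^ 2 + 104) + d * (1 + d * (10 * n + 23)) +
    11 * ∑ i ∈ Finset.range d, rowAttempts κ ω n B i

lemma final_spec {r : ℝ} (hr : 1 < r) (lam : ℝ) {B d n : ℕ} (hB : 0 < B)
    (X : Fin n → Fin d → ℝ) (ω : Draw → ℝ) :
    (final r lam B X ω = none → Stuck (r * √r) ω) ∧
    ∀ σ, final r lam B X ω = some σ →
      LearnResult r lam B d n ω (initial X).mem σ.mem ∧
      (¬Stuck (r * √r) ω → σ.steps ≤ stepBound (r * √r) d n B ω) ∧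
      ∀ c ∈ σ.used, Allowed d n B c := by
  have h := wp_learn (ω := ω) (σ := initial X) (d := d) (n := n) hr lam hB
  have hu : ∀ c ∈ (initial X).used, Allowed d n B c := by
    rintro c ⟨m, i, rfl⟩
    exact ⟨m.2, i.2⟩
  unfold final
  unfold wp at h
  cases hl : learn r lam B d n ω (initial X) with
  | none =>
    rw [hl] at h
    simpa using h
  | some y =>
    rw [hl] at h
    obtain ⟨h1, h2⟩ := h
    simp only [Option.map_some, reduceCtorEq, false_imp_iff, Option.some.injEq, true_and]
    rintro _ rfl
    refine ⟨h1, fun hs => (h2.steps hs).trans ?_, h2.used hu⟩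
    simp only [initial, stepBound]
    omega

/-! ## Infinite products of probability measures -/

section Product

variable {ι : Type*}

/-- Resampling one coordinate preserves a product measure. -/
lemma measurePreserving_update [DecidableEq ι] {X : ι → Type*} [∀ i, MeasurableSpace (X i)]
    (P : ∀ i, Measure (X i)) [∀ i, IsProbabilityMeasure (P i)] (i : ι) :
    MeasurePreserving (fun p : (∀ j, X j) × X i => Function.update p.1 i p.2)
      ((Measure.infinitePi P).prod (P i)) (Measure.infinitePi P) := by
  have hm : Measurable fun p : (∀ j, X j) × X i => Function.update p.1 i p.2 := measurable_update'
  refine ⟨hm, Measure.eq_infinitePi _ fun s t ht => ?_⟩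
  rw [Measure.map_apply hm (MeasurableSet.pi s.countable_toSet fun j _ => ht j)]
  have hpre : (fun p : (∀ j, X j) × X i => Function.update p.1 i p.2) ⁻¹' (Set.pi s t) =
      (Set.pi (s.erase i : Finset ι) t) ×ˢ (if i ∈ s then t i else Set.univ) := by
    ext ⟨f, a⟩
    simp only [Set.mem_preimage, Set.mem_pi, Finset.mem_coe, Set.mem_prod, Finset.mem_erase]
    constructor
    · intro h
      refine ⟨fun j hj => by simpa [hj.1] using h j hj.2, ?_⟩
      split_ifs with his
      · simpa using h i his
      · trivial
    · rintro ⟨h, h'⟩ j hj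
      by_cases hji : j = i
      · subst hji
        simpa [hj] using h'
      · simpa [hji] using h j ⟨hji, hj⟩
  rw [hpre, Measure.prod_prod, Measure.infinitePi_pi P fun j _ => ht j]
  split_ifs with his
  · rw [mul_comm, Finset.mul_prod_erase s (fun j => P j (t j)) his]
  · rw [measure_univ, mul_one, Finset.erase_eq_of_notMem his]

/-- A product of equal measures is invariant under permutations. -/
lemma measurePreserving_perm {X : Type*} [MeasurableSpace X] (μ : Measure X)
    [IsProbabilityMeasure μ] (e : Equiv.Perm ι) :
    MeasurePreserving (fun (f : ι → X) j => f (e j)) (Measure.infinitePi fun _ => μ)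
      (Measure.infinitePi fun _ => μ) :=
  ⟨by fun_prop, Measure.map_infinitePi_infinitePi_of_inj e.injective⟩

/-- Splitting the coordinates of a product into blocks. -/
lemma measurePreserving_blocks {κ α : Type*} {X : Type*} [MeasurableSpace X] (μ : Measure X)
    [IsProbabilityMeasure μ] {f : ι × κ → α} (hf : Function.Injective f) :
    MeasurePreserving (fun (g : α → X) (i : ι) (j : κ) => g (f (i, j)))
      (Measure.infinitePi fun _ => μ)
      (Measure.infinitePi fun _ => Measure.infinitePi fun _ => μ) := by
  refine ⟨by fun_prop, ?_⟩
  rw [← Measure.infinitePi_map_curry (fun (_ : ι) (_ : κ) => μ),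
    ← Measure.map_infinitePi_infinitePi_of_inj (P := fun _ : α => μ) hf,
    Measure.map_map (by fun_prop) (by fun_prop)]
  rfl

lemma lintegral_prod_infinitePi {X : Type*} [MeasurableSpace X] (μ : Measure X)
    [IsProbabilityMeasure μ] (s : Finset ι) {f : ι → X → ENNReal} (hf : ∀ i, Measurable (f i)) :
    ∫⁻ x, ∏ i ∈ s, f i (x i) ∂(Measure.infinitePi fun _ : ι => μ) =
      ∏ i ∈ s, ∫⁻ x, f i x ∂μ := by
  have hind : iIndepFun (fun i (x : ι → X) => f i (x i)) (Measure.infinitePi fun _ : ι => μ) :=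
    iIndepFun_infinitePi hf
  rw [lintegral_prod_eq_prod_lintegral_of_indepFun s _ hind fun i => by fun_prop]
  refine Finset.prod_congr rfl fun i _ => ?_
  exact (measurePreserving_eval_infinitePi (fun _ : ι => μ) i).lintegral_comp (hf i)

/-- The elementary geometric law behind both the output distribution of the rejection sampler (`S`
is part of the acceptance set) and the tail of the number of attempts (`S` is everything). -/
lemma infinitePi_apply_forall {X : Type*} [MeasurableSpace X] (μ : Measure X)
    [IsProbabilityMeasure μ] {A S : Set X} (hA : MeasurableSet A) (hS : MeasurableSet S) (l : ℕ) :
    (Measure.infinitePi fun _ : ℕ => μ) {ξ | (∀ j < l, ξ j ∈ A) ∧ ξ l ∈ S} = μ A ^ l * μ S := by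
  have : {ξ : ℕ → X | (∀ j < l, ξ j ∈ A) ∧ ξ l ∈ S} =
      Set.pi (Finset.range (l + 1)) fun j => if j < l then A else S := by
    ext ξ
    simp only [Set.mem_ofPred_eq, Set.mem_pi, Finset.coe_range, Set.mem_Iio]
    constructor
    · rintro ⟨h1, h2⟩ j hj
      split_ifs with h
      · exact h1 j h
      · rwa [show j = l by omega]
    · intro h
      exact ⟨fun j hj => by simpa [hj] using h j (by omega), by simpa using h l (by omega)⟩
  rw [this, Measure.infinitePi_pi _ fun j _ => by split_ifs <;> assumption,
    Finset.prod_range_succ]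
  simp only [lt_irrefl, if_false]
  congr 1
  rw [Finset.prod_congr rfl fun j hj => by rw [if_pos (Finset.mem_range.1 hj)]]
  simp

end Product

lemma measurableSet_forall_lt {X : Type*} [MeasurableSpace X] {A S : Set X}
    (hA : MeasurableSet A) (hS : MeasurableSet S) (l : ℕ) :
    MeasurableSet {ξ : ℕ → X | (∀ j < l, ξ j ∈ A) ∧ ξ l ∈ S} := by
  have : {ξ : ℕ → X | (∀ j < l, ξ j ∈ A) ∧ ξ l ∈ S} =
      (⋂ j, ⋂ (_ : j < l), (fun ξ => ξ j) ⁻¹' A) ∩ (fun ξ => ξ l) ⁻¹' S := by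
    ext; simp
  rw [this]
  exact (MeasurableSet.iInter fun j => MeasurableSet.iInter fun _ =>
    hA.preimage (measurable_pi_apply j)).inter (hS.preimage (measurable_pi_apply l))

/-! ## Rejection sampling -/

lemma measurable_candidate : Measurable fun p : (ℝ × ℝ) × ℝ => candidate p.1 p.2 := by
  unfold candidate
  fun_prop

@[fun_prop]
lemma Measurable.candidate' {α : Type*} [MeasurableSpace α] {f : α → ℝ × ℝ} {g : α → ℝ}
    (hf : Measurable f) (hg : Measurable g) : Measurable fun a => candidate (f a) (g a) :=
  measurable_candidate.comp (hf.prodMk hg)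

lemma measurable_firstAccepted :
    Measurable fun p : (ℝ × ℝ) × ℝ × (ℕ → ℝ) => firstAccepted p.1 p.2.1 p.2.2 := by
  classical
  set P : ℕ → (ℝ × ℝ) × ℝ × (ℕ → ℝ) → Prop := fun l p => p.2.1 < candidate p.1 (p.2.2 l) with hP
  have hPm : ∀ l, MeasurableSet {p | P l p} := fun l =>
    measurableSet_lt (by fun_prop) (by fun_prop)
  -- The second alternative makes an index exist for every `p`, as `Measurable.find` demands. It
  -- selects index `0` when nothing is ever accepted, where the function has its default value `0`.
  set Q : ℕ → (ℝ × ℝ) × ℝ × (ℕ → ℝ) → Prop := fun l p => P l p ∨ ∀ m, ¬P m p with hQ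
  have hQm : ∀ l, MeasurableSet {p | Q l p} := fun l => by
    have : {p | Q l p} = {p | P l p} ∪ ⋂ m, {p | P m p}ᶜ := by ext p; simp [hQ]
    rw [this]
    exact (hPm l).union (MeasurableSet.iInter fun m => (hPm m).compl)
  have hex : ∀ p, ∃ l, Q l p := fun p => by
    by_cases h : ∃ l, P l p
    · exact h.imp fun l hl => Or.inl hl
    · push Not at h
      exact ⟨0, Or.inr h⟩
  have := Measurable.find (f := fun l p => if P l p then candidate p.1 (p.2.2 l) else 0)
    (fun l => Measurable.ite (hPm l) (by fun_prop) measurable_const) hQm hex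
  convert! this using 2 with p
  unfold firstAccepted
  split_ifs with h1 h2 h2
  · congr 3
    obtain ⟨m, hm⟩ := id h1
    refine congrArg p.2.2 ?_
    exact le_antisymm (Nat.find_mono fun l h => h.resolve_right fun h' => h' m hm)
      (Nat.find_mono fun l h => Or.inl h)
  · exfalso
    rcases Nat.find_spec (hex p) with h | h
    · exact h2 h
    · obtain ⟨m, hm⟩ := h1
      exact h m hm
  · exact absurd ⟨_, h2⟩ h1
  · rfl

/-- Rejection sampling draws from the conditional law. -/
lemma map_firstAccepted (μ : Measure ℝ) [IsProbabilityMeasure μ] (v : ℝ × ℝ) (τ : ℝ)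
    (hq : μ {x | τ < candidate v x} ≠ 0) :
    (Measure.infinitePi fun _ : ℕ => μ).map (firstAccepted v τ) =
      (μ[|{x | τ < candidate v x}]).map (candidate v) := by
  classical
  set A := {x | τ < candidate v x} with hA
  have hAm : MeasurableSet A := measurableSet_lt (by fun_prop) (by fun_prop)
  have hm : Measurable (firstAccepted v τ) :=
    measurable_firstAccepted.comp (measurable_const.prodMk (measurable_const.prodMk measurable_id))
  have hcm : Measurable (candidate v) := by fun_prop
  set P := Measure.infinitePi fun _ : ℕ => μ with hP
  have key : ∀ S, MeasurableSet S → P {ξ | (∃ l, ξ l ∈ A) ∧ firstAccepted v τ ξ ∈ S} =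
      (μ A)⁻¹ * μ (A ∩ candidate v ⁻¹' S) := by
    intro S hS
    -- Disjoint decomposition by the index of the first accepted draw; the geometric series with
    -- ratio `1 - μ A` then produces the factor `(μ A)⁻¹` of the conditional law.
    have hset : {ξ | (∃ l, ξ l ∈ A) ∧ firstAccepted v τ ξ ∈ S} =
        ⋃ l, {ξ : ℕ → ℝ | (∀ j < l, ξ j ∈ Aᶜ) ∧ ξ l ∈ A ∩ candidate v ⁻¹' S} := by
      ext ξ
      simp only [Set.mem_ofPred_eq, Set.mem_iUnion]
      constructor
      · rintro ⟨(h : ∃ l, τ < candidate v (ξ l)), hS'⟩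
        unfold firstAccepted at hS'
        rw [dif_pos h] at hS'
        exact ⟨Nat.find h, fun j hj => Nat.find_min h hj, Nat.find_spec h, hS'⟩
      · rintro ⟨l, h1, h2, h3⟩
        have h : ∃ l, τ < candidate v (ξ l) := ⟨l, h2⟩
        have hfind : Nat.find h = l := (Nat.find_eq_iff h).2 ⟨h2, h1⟩
        refine ⟨⟨l, h2⟩, ?_⟩
        unfold firstAccepted
        rw [dif_pos h, hfind]
        exact h3
    rw [hset, measure_iUnion, tsum_congr fun l => infinitePi_apply_forall μ hAm.compl
      (hAm.inter (hcm hS)) l, ENNReal.tsum_mul_right, ENNReal.tsum_geometric]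
    · congr 2
      rw [prob_compl_eq_one_sub hAm, ENNReal.sub_sub_cancel (by simp) prob_le_one]
    · intro l l' hne
      refine Set.disjoint_left.2 ?_
      rintro ξ ⟨h1, h2⟩ ⟨h3, h4⟩
      rcases lt_or_gt_of_ne hne with h | h
      · exact h3 l h h2.1
      · exact h1 l' h h4.1
    · intro l
      exact measurableSet_forall_lt hAm.compl (hAm.inter (hcm hS)) l
  -- The case `S = univ` of `key` says that something is accepted with probability one.
  have hex : ∀ᵐ ξ ∂P, ∃ l, ξ l ∈ A := by
    have h1 := key Set.univ MeasurableSet.univ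
    simp only [Set.mem_univ, and_true, Set.preimage_univ, Set.inter_univ] at h1
    rw [ENNReal.inv_mul_cancel hq (measure_ne_top _ _)] at h1
    have hmeas : MeasurableSet {ξ : ℕ → ℝ | ∃ l, ξ l ∈ A} := by
      rw [Set.ofPred_exists]
      exact MeasurableSet.iUnion fun l => hAm.preimage (measurable_pi_apply l)
    rw [ae_iff]
    exact (prob_compl_eq_zero_iff hmeas).2 h1
  ext S hS
  rw [Measure.map_apply hm hS, Measure.map_apply hcm hS, cond_apply hAm, ← key S hS]
  refine measure_congr ?_
  filter_upwards [hex] with ξ hξ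
  exact propext ⟨fun h => ⟨hξ, h⟩, fun h => h.2⟩

/-! ## The number of attempts -/

section Attempts

open Classical in
/-- The number of entries of `ξ` up to the first one that exceeds `κ`. -/
def firstExceed (κ : ℝ) (ξ : ℕ → ℝ) : ℕ := if h : ∃ l, κ < ξ l then Nat.find h + 1 else 0

lemma attemptsNeeded_eq (κ : ℝ) (ω : Draw → ℝ) (i β t : ℕ) :
    attemptsNeeded κ ω i β t = firstExceed κ fun l => ω (i, β, t, l) := rfl

/-- The waiting time has a geometric tail of ratio `q = μ (Iic κ) < 1`, so it has a finite
exponential moment for some positive rate. The sum below uses the event that the first `l` draws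
fail, without asking that the next one succeed. -/
lemma exists_exp_moment_firstExceed (μ : Measure ℝ) [IsProbabilityMeasure μ] (κ : ℝ)
    (hq : μ (Set.Ioi κ) ≠ 0) : ∃ s K : ℝ, 0 < s ∧ 1 ≤ K ∧
      ∫⁻ ξ, ENNReal.ofReal (Real.exp (s * firstExceed κ ξ)) ∂(Measure.infinitePi fun _ : ℕ => μ)
        ≤ ENNReal.ofReal K := by
  classical
  set q := μ.real (Set.Iic κ) with hqdef
  have hq1 : q < 1 := by
    have h1 : μ.real (Set.Ioi κ) = 1 - q := by
      rw [← Set.compl_Iic, probReal_compl_eq_one_sub measurableSet_Iic]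
    have h2 : 0 < μ.real (Set.Ioi κ) := by
      rw [measureReal_def]
      exact ENNReal.toReal_pos hq (measure_ne_top _ _)
    linarith
  have hq0 : 0 ≤ q := measureReal_nonneg
  -- A base with `a > 1`, for a positive rate `log a`, and with `a * q < 1`, for a convergent
  -- series.
  set a : ℝ := 2 / (1 + q) with ha
  have ha1 : 1 < a := by rw [ha, lt_div_iff₀ (by linarith)]; linarith
  have haq : a * q < 1 := by rw [ha, div_mul_eq_mul_div, div_lt_one (by linarith)]; linarith
  have hexp : Real.exp (Real.log a) = a := Real.exp_log (by linarith)
  have hK0 : 1 ≤ a / (1 - a * q) := by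
    rw [le_div_iff₀ (by linarith)]
    nlinarith [mul_nonneg (by linarith : (0:ℝ) ≤ a) hq0]
  refine ⟨Real.log a, a / (1 - a * q), Real.log_pos ha1, hK0, ?_⟩
  have hpt : ∀ ξ : ℕ → ℝ, ENNReal.ofReal (Real.exp (Real.log a * firstExceed κ ξ)) ≤
      ∑' l, ENNReal.ofReal (a ^ (l + 1)) *
        Set.indicator {ξ : ℕ → ℝ | (∀ j < l, ξ j ∈ Set.Iic κ) ∧ ξ l ∈ Set.univ} 1 ξ := by
    intro ξ
    by_cases h : ∃ l, κ < ξ l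
    · refine le_trans ?_ (ENNReal.le_tsum (Nat.find h))
      rw [Set.indicator_of_mem, Pi.one_apply, mul_one, firstExceed, dif_pos h, mul_comm,
        Real.exp_nat_mul, hexp]
      exact ⟨fun j hj => not_lt.1 (Nat.find_min h hj), trivial⟩
    · refine le_trans ?_ (ENNReal.le_tsum 0)
      rw [firstExceed, dif_neg h, Set.indicator_of_mem (by simp)]
      simpa using ha1.le
  have hmeas : ∀ l, MeasurableSet {ξ : ℕ → ℝ | (∀ j < l, ξ j ∈ Set.Iic κ) ∧ ξ l ∈ Set.univ} :=
    fun l => measurableSet_forall_lt measurableSet_Iic MeasurableSet.univ l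
  refine (lintegral_mono hpt).trans ?_
  rw [lintegral_tsum fun l => ((measurable_one.indicator (hmeas l)).const_mul _).aemeasurable]
  have hterm : ∀ l, ∫⁻ ξ, ENNReal.ofReal (a ^ (l + 1)) *
        Set.indicator {ξ : ℕ → ℝ | (∀ j < l, ξ j ∈ Set.Iic κ) ∧ ξ l ∈ Set.univ} 1 ξ
        ∂(Measure.infinitePi fun _ : ℕ => μ) = ENNReal.ofReal (a * (a * q) ^ l) := by
    intro l
    rw [lintegral_const_mul _ (measurable_one.indicator (hmeas l)), lintegral_indicator_one (hmeas l),
      infinitePi_apply_forall μ measurableSet_Iic MeasurableSet.univ, measure_univ, mul_one,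
      ← ofReal_measureReal, ← ENNReal.ofReal_pow hq0, ← ENNReal.ofReal_mul (by positivity)]
    congr 1
    rw [mul_pow]
    ring
  have haq0 : 0 ≤ a * q := by positivity
  rw [tsum_congr hterm, ← ENNReal.ofReal_tsum_of_nonneg (fun l => by positivity)
    ((summable_geometric_of_lt_one haq0 haq).mul_left a), tsum_mul_left,
    tsum_geometric_of_lt_one haq0 haq, div_eq_mul_inv]

end Attempts

/-! ## Truncated Gaussians as an exponential family -/

/-- The parameters over which projected SGD runs. -/
def paramBox (r : ℝ) : Set (ℝ × ℝ) := {v | (1 / r ≤ v.1 ∧ v.1 ≤ r) ∧ (0 - r ≤ v.2 ∧ v.2 ≤ r)}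

/-- The law of the Gaussian with natural parameters `v`, conditioned on `(τ, ∞)`. -/
def truncLaw (v : ℝ × ℝ) (τ : ℝ) : Measure ℝ :=
  ((gaussianReal 0 1)[|{x | τ < candidate v x}]).map (candidate v)

lemma gaussianReal_pos {S : Set ℝ} (hS : volume S ≠ 0) : gaussianReal 0 1 S ≠ 0 := fun h =>
  hS (gaussianReal_absolutelyContinuous' 0 one_ne_zero h)

lemma gaussianReal_Ioi_ne_zero (κ : ℝ) : gaussianReal 0 1 (Set.Ioi κ) ≠ 0 :=
  gaussianReal_pos (by simp)

lemma measurableSet_accept (v : ℝ × ℝ) (τ : ℝ) : MeasurableSet {x | τ < candidate v x} :=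
  measurableSet_lt (by fun_prop) (by fun_prop)

lemma Ioi_subset_accept {r : ℝ} (hr : 1 < r) {v : ℝ × ℝ} (hv : v ∈ paramBox r) {τ : ℝ}
    (hτ : τ ≤ 0) : Set.Ioi (r * √r) ⊆ {x | τ < candidate v x} := fun _ hx =>
  lt_candidate hr hv.1.1 hv.1.2 hv.2.1 hτ hx

lemma accept_ne_zero {r : ℝ} (hr : 1 < r) {v : ℝ × ℝ} (hv : v ∈ paramBox r) {τ : ℝ}
    (hτ : τ ≤ 0) : gaussianReal 0 1 {x | τ < candidate v x} ≠ 0 := fun h =>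
  gaussianReal_Ioi_ne_zero (r * √r) (measure_mono_null (Ioi_subset_accept hr hv hτ) h)

lemma isProbabilityMeasure_truncLaw {r : ℝ} (hr : 1 < r) {v : ℝ × ℝ} (hv : v ∈ paramBox r) {τ : ℝ}
    (hτ : τ ≤ 0) : IsProbabilityMeasure (truncLaw v τ) := by
  have := cond_isProbabilityMeasure (accept_ne_zero hr hv hτ)
  exact Measure.isProbabilityMeasure_map (by fun_prop)

lemma map_candidate {v : ℝ × ℝ} (hv : 0 < v.1) :
    (gaussianReal 0 1).map (candidate v) = gaussianReal (v.2 / v.1) (1 / v.1).toNNReal := by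
  have h1 : candidate v = (fun x => v.2 / v.1 + x) ∘ fun x => (1 / √v.1) * x := by
    funext x
    simp only [candidate, Function.comp]
    ring
  rw [h1, ← Measure.map_map (by fun_prop) (by fun_prop), gaussianReal_map_const_mul,
    gaussianReal_map_const_add]
  congr 1
  · ring
  · ext
    simp only [mul_one, NNReal.coe_mk, Real.coe_toNNReal _ (one_div_pos.2 hv).le]
    rw [div_pow, one_pow, Real.sq_sqrt hv.le]

lemma truncLaw_eq {v : ℝ × ℝ} (hv : 0 < v.1) (τ : ℝ) :
    truncLaw v τ = (gaussianReal (v.2 / v.1) (1 / v.1).toNNReal)[|Set.Ioi τ] := by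
  have hm : Measurable (candidate v) := by fun_prop
  ext S hS
  rw [truncLaw, Measure.map_apply hm hS, cond_apply (measurableSet_accept v τ),
    cond_apply measurableSet_Ioi, ← map_candidate hv, Measure.map_apply hm measurableSet_Ioi,
    Measure.map_apply hm (measurableSet_Ioi.inter hS)]
  rfl

/-- A lower bound for the densities on `[0, 1]`. -/
def densityBound (r : ℝ) : ℝ := (√(2 * Real.pi * r))⁻¹ * Real.exp (-((1 + r ^ 2) ^ 2 * r / 2))

lemma densityBound_pos {r : ℝ} (hr : 1 < r) : 0 < densityBound r := by
  have : 0 < r := by linarith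
  unfold densityBound
  have := Real.pi_pos
  positivity

/-- Exponential family form: the log-density is a constant plus a linear function of `v`, with
sufficient statistics `-z² / 2` and `z`. Normalizing by a mass at most `1` only raises the density,
so the lower bound on `(0, 1)` needs only that mean and variance are bounded on the box, by `r ^ 2`
and `r`. -/
lemma exists_truncLaw_density {r : ℝ} (hr : 1 < r) {v : ℝ × ℝ} (hv : v ∈ paramBox r) (τ : ℝ) :
    ∃ ℓ : ℝ,
      truncLaw v τ = (volume.restrict (Set.Ioi τ)).withDensity
        (fun z => ENNReal.ofReal (Real.exp (ℓ + (-(v.1 * z ^ 2 / 2) + v.2 * z)))) ∧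
      ∀ z ∈ Set.Ioo (0 : ℝ) 1, densityBound r ≤ Real.exp (ℓ + (-(v.1 * z ^ 2 / 2) + v.2 * z)) := by
  have hr0 : 0 < r := by linarith
  obtain ⟨⟨h1, h2⟩, h3, h4⟩ := hv
  have hv0 : 0 < v.1 := lt_of_lt_of_le (by positivity) h1
  have hpi := Real.pi_pos
  set m := v.2 / v.1 with hm
  set s : NNReal := (1 / v.1).toNNReal with hs
  have hsv : (s : ℝ) = 1 / v.1 := Real.coe_toNNReal _ (one_div_pos.2 hv0).le
  have hs0 : s ≠ 0 := by
    intro h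
    have : (s : ℝ) = 0 := by rw [h]; rfl
    rw [hsv] at this
    have := one_div_pos.2 hv0
    linarith
  set G := (gaussianReal m s).real (Set.Ioi τ) with hG
  have hGe : gaussianReal m s (Set.Ioi τ) = ENNReal.ofReal G := by
    rw [hG, ofReal_measureReal]
  have hG0 : 0 < G := by
    refine lt_of_le_of_ne measureReal_nonneg fun h => ?_
    have h' : gaussianReal m s (Set.Ioi τ) = 0 := by rw [hGe, ← h]; simp
    have := gaussianReal_absolutelyContinuous' m hs0 h'
    simp at this
  have hG1 : G ≤ 1 := measureReal_le_one
  have hc0 : 0 < G⁻¹ * (√(2 * Real.pi * s))⁻¹ := by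
    rw [hsv]
    positivity
  have hpdf : ∀ z, G⁻¹ * gaussianPDFReal m s z = Real.exp (Real.log (G⁻¹ * (√(2 * Real.pi * s))⁻¹)
      - v.2 ^ 2 / (2 * v.1) + (-(v.1 * z ^ 2 / 2) + v.2 * z)) := by
    intro z
    rw [gaussianPDFReal, ← mul_assoc, sub_add_eq_add_sub, add_sub_assoc, Real.exp_add,
      Real.exp_log hc0, hsv, hm]
    congr 2
    field_simp
    ring
  refine ⟨Real.log (G⁻¹ * (√(2 * Real.pi * s))⁻¹) - v.2 ^ 2 / (2 * v.1), ?_, ?_⟩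
  · rw [truncLaw_eq hv0, ProbabilityTheory.cond, hGe, gaussianReal_of_var_ne_zero _ hs0,
      restrict_withDensity measurableSet_Ioi, ← withDensity_smul _ (by fun_prop)]
    congr 1
    funext z
    rw [← hpdf, ← ENNReal.ofReal_inv_of_pos hG0, Pi.smul_apply, smul_eq_mul, gaussianPDF,
      ← ENNReal.ofReal_mul (by positivity)]
  · intro z hz
    rw [← hpdf]
    have hle : gaussianPDFReal m s z ≤ G⁻¹ * gaussianPDFReal m s z := by
      have : 1 ≤ G⁻¹ := (one_le_inv₀ hG0).2 hG1
      nlinarith [gaussianPDFReal_nonneg m s z]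
    refine le_trans ?_ hle
    unfold densityBound
    rw [gaussianPDFReal, hsv]
    have hmr : |m| ≤ r ^ 2 := by
      rw [hm, abs_div, abs_of_pos hv0, div_le_iff₀ hv0]
      have : |v.2| ≤ r := abs_le.2 ⟨by linarith, h4⟩
      rw [div_le_iff₀ hr0] at h1
      nlinarith
    have hzm : (z - m) ^ 2 ≤ (1 + r ^ 2) ^ 2 := by
      have : |z - m| ≤ 1 + r ^ 2 := by
        refine (abs_sub _ _).trans (add_le_add ?_ hmr)
        rw [abs_of_pos hz.1]
        exact hz.2.le
      rw [← sq_abs]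
      gcongr
    have hiv : 1 / v.1 ≤ r := by
      rw [div_le_iff₀ hv0]
      rwa [div_le_iff₀ hr0, mul_comm] at h1
    refine mul_le_mul ?_ ?_ (Real.exp_pos _).le (by positivity)
    · gcongr
    · refine Real.exp_le_exp.2 ?_
      have : -(z - m) ^ 2 / (2 * (1 / v.1)) = -((z - m) ^ 2 * v.1 / 2) := by field_simp
      rw [this]
      have : (z - m) ^ 2 * v.1 ≤ (1 + r ^ 2) ^ 2 * r := by gcongr
      linarith

lemma integrable_pow_gaussianReal {k : ℕ} : Integrable (fun x : ℝ => x ^ k) (gaussianReal 0 1) := by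
  have := (memLp_id_gaussianReal (μ := 0) (v := 1) (k : NNReal)).integrable_norm_pow'
  refine this.mono' (by fun_prop) ?_
  filter_upwards with x
  simp

/-- A lower bound for the acceptance probability. -/
def acceptBound (r : ℝ) : ℝ := (gaussianReal 0 1).real (Set.Ioi (r * √r))

lemma acceptBound_pos (r : ℝ) : 0 < acceptBound r :=
  ENNReal.toReal_pos (gaussianReal_Ioi_ne_zero _) (measure_ne_top _ _)

lemma integrable_truncLaw {r : ℝ} (hr : 1 < r) {v : ℝ × ℝ} (hv : v ∈ paramBox r) {τ : ℝ}
    (hτ : τ ≤ 0) {f : ℝ → ℝ} (hf : Measurable f)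
    (hi : Integrable (fun x => f (candidate v x)) (gaussianReal 0 1)) :
    Integrable f (truncLaw v τ) := by
  rw [truncLaw, integrable_map_measure hf.aestronglyMeasurable (by fun_prop), ProbabilityTheory.cond]
  exact hi.restrict.smul_measure (ENNReal.inv_ne_top.2 (accept_ne_zero hr hv hτ))

/-- Conditioning costs at most the inverse acceptance probability, which is bounded uniformly over
the box and over `τ ≤ 0`. This transfers Gaussian moment bounds to the truncated laws. -/
lemma integral_truncLaw_le {r : ℝ} (hr : 1 < r) {v : ℝ × ℝ} (hv : v ∈ paramBox r) {τ : ℝ}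
    (hτ : τ ≤ 0) {f : ℝ → ℝ} (hf : Measurable f) (h0 : ∀ z, 0 ≤ f z)
    (hi : Integrable (fun x => f (candidate v x)) (gaussianReal 0 1)) :
    ∫ z, f z ∂(truncLaw v τ) ≤ (acceptBound r)⁻¹ * ∫ x, f (candidate v x) ∂(gaussianReal 0 1) := by
  rw [truncLaw, integral_map (by fun_prop) hf.aestronglyMeasurable, ProbabilityTheory.cond, integral_smul_measure,
    smul_eq_mul, ENNReal.toReal_inv]
  refine mul_le_mul ?_ ?_ (integral_nonneg fun x => h0 _) (inv_nonneg.2 (acceptBound_pos r).le)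
  · refine inv_anti₀ (acceptBound_pos r) ?_
    exact measureReal_mono (Ioi_subset_accept hr hv hτ)
  · exact setIntegral_le_integral hi (ae_of_all _ fun x => h0 _)

lemma integrable_candidate_pow (v : ℝ × ℝ) (k : ℕ) :
    Integrable (fun x => candidate v x ^ k) (gaussianReal 0 1) := by
  have h1 : Integrable (fun x => ∑ j ∈ Finset.range (k + 1), (v.2 / v.1) ^ j * (x / √v.1) ^ (k - j)
      * (k.choose j : ℝ)) (gaussianReal 0 1) := by
    refine integrable_finsetSum _ fun j _ => ?_
    simp only [div_pow]
    exact ((integrable_pow_gaussianReal.div_const _).const_mul _).mul_const _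
  refine h1.congr (ae_of_all _ fun x => ?_)
  simp only [candidate, add_pow]

lemma integrable_pow_truncLaw {r : ℝ} (hr : 1 < r) {v : ℝ × ℝ} (hv : v ∈ paramBox r) {τ : ℝ}
    (hτ : τ ≤ 0) (k : ℕ) : Integrable (fun z => z ^ k) (truncLaw v τ) :=
  integrable_truncLaw hr hv hτ (by fun_prop) (integrable_candidate_pow v k)

lemma exists_fourth_moment_bound {r : ℝ} (hr : 1 < r) : ∃ K : ℝ, 0 ≤ K ∧
    ∀ v ∈ paramBox r, ∀ τ ≤ (0 : ℝ), ∫ z, z ^ 4 ∂(truncLaw v τ) ≤ K := by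
  have hr0 : 0 < r := by linarith
  set M := ∫ x, x ^ 4 ∂(gaussianReal 0 1) with hM
  have hM0 : 0 ≤ M := integral_nonneg fun x => by positivity
  refine ⟨(acceptBound r)⁻¹ * (8 * r ^ 8 + 8 * r ^ 2 * M), ?_, ?_⟩
  · have := (acceptBound_pos r).le
    positivity
  intro v hv τ hτ
  refine (integral_truncLaw_le hr hv hτ (by fun_prop) (fun z => by positivity)
    (integrable_candidate_pow v 4)).trans ?_
  refine mul_le_mul_of_nonneg_left ?_ (inv_nonneg.2 (acceptBound_pos r).le)
  have hi : Integrable (fun x : ℝ => 8 * r ^ 8 + 8 * r ^ 2 * x ^ 4) (gaussianReal 0 1) :=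
    (integrable_const _).add (integrable_pow_gaussianReal.const_mul _)
  have hle : ∀ x, candidate v x ^ 4 ≤ 8 * r ^ 8 + 8 * r ^ 2 * x ^ 4 := by
    intro x
    obtain ⟨⟨h1, h2⟩, h3, h4⟩ := hv
    have hv0 : 0 < v.1 := lt_of_lt_of_le (by positivity) h1
    rw [div_le_iff₀ hr0] at h1
    have hiv : 1 / v.1 ≤ r := by
      rw [div_le_iff₀ hv0]
      linarith
    have hA : (v.2 / v.1) ^ 4 ≤ r ^ 8 := by
      have : |v.2 / v.1| ≤ r ^ 2 := by
        rw [abs_div, abs_of_pos hv0, div_le_iff₀ hv0]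
        have : |v.2| ≤ r := abs_le.2 ⟨by linarith, h4⟩
        nlinarith
      calc (v.2 / v.1) ^ 4 = |v.2 / v.1| ^ 4 := by rw [← abs_pow, abs_of_nonneg (by positivity)]
        _ ≤ (r ^ 2) ^ 4 := by gcongr
        _ = r ^ 8 := by ring
    have hB : (x / √v.1) ^ 4 ≤ r ^ 2 * x ^ 4 := by
      have h : (√v.1) ^ 4 = v.1 ^ 2 := by
        rw [show 4 = 2 * 2 by rfl, pow_mul, Real.sq_sqrt hv0.le]
      rw [div_pow, h, div_eq_mul_one_div, mul_comm, ← one_div_pow]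
      gcongr
    have hC : ∀ a b : ℝ, (a + b) ^ 4 ≤ 8 * (a ^ 4 + b ^ 4) := by
      intro a b
      nlinarith [sq_nonneg (a - b), sq_nonneg (a ^ 2 - b ^ 2), sq_nonneg (a + b),
        mul_nonneg (sq_nonneg (a - b)) (sq_nonneg (a + b)), sq_nonneg ((a-b)^2)]
    refine (hC _ _).trans ?_
    linarith
  refine (integral_mono (integrable_candidate_pow v 4) hi hle).trans (le_of_eq ?_)
  rw [integral_add (integrable_const _) (integrable_pow_gaussianReal.const_mul _), integral_const,
    integral_const_mul]
  simp [hM]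

/-- Quantifies that `1`, `z` and `z²` are linearly independent on `[0, 1]`. The minimum over `c` is
`α² / 45 - α β / 12 + β² / 12`, a positive definite form whose least eigenvalue is about `0.001`. -/
lemma quadratic_lower_bound (α β c : ℝ) :
    (α ^ 2 + β ^ 2) / 2000 ≤ ∫ z in (0 : ℝ)..1, (-(α * z ^ 2 / 2) + β * z - c) ^ 2 := by
  have h : ∫ z in (0 : ℝ)..1, (-(α * z ^ 2 / 2) + β * z - c) ^ 2 =
      α ^ 2 / 20 + β ^ 2 / 3 + c ^ 2 - α * β / 4 + α * c / 3 - β * c := by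
    have : ∀ z : ℝ, (-(α * z ^ 2 / 2) + β * z - c) ^ 2 =
        α ^ 2 / 4 * z ^ 4 - α * β * z ^ 3 + (β ^ 2 + α * c) * z ^ 2 - 2 * β * c * z ^ 1 + c ^ 2 := by
      intro z; ring
    simp only [this]
    rw [intervalIntegral.integral_add (by apply Continuous.intervalIntegrable; fun_prop) (by simp),
      intervalIntegral.integral_sub (by apply Continuous.intervalIntegrable; fun_prop)
        (by apply Continuous.intervalIntegrable; fun_prop),
      intervalIntegral.integral_add (by apply Continuous.intervalIntegrable; fun_prop)
        (by apply Continuous.intervalIntegrable; fun_prop),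
      intervalIntegral.integral_sub (by apply Continuous.intervalIntegrable; fun_prop)
        (by apply Continuous.intervalIntegrable; fun_prop)]
    simp only [intervalIntegral.integral_const_mul, integral_pow,
      intervalIntegral.integral_const]
    norm_num
    ring
  rw [h]
  nlinarith [sq_nonneg (c - β / 2 + α / 6), sq_nonneg (α - 1.9 * β), sq_nonneg (α - 1.94 * β),
    sq_nonneg α, sq_nonneg β]

/-- The negative log-likelihood of truncated Gaussians is uniformly strongly convex. -/
lemma truncLaw_strongMono {r : ℝ} (hr : 1 < r) {v u : ℝ × ℝ} (hv : v ∈ paramBox r)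
    (hu : u ∈ paramBox r) {τ : ℝ} (hτ : τ ≤ 0) :
    densityBound r / 2000 * ((v.1 - u.1) ^ 2 + (v.2 - u.2) ^ 2) ≤
      (v.1 - u.1) * (∫ z, -(z ^ 2 / 2) ∂(truncLaw v τ) - ∫ z, -(z ^ 2 / 2) ∂(truncLaw u τ)) +
      (v.2 - u.2) * (∫ z, z ∂(truncLaw v τ) - ∫ z, z ∂(truncLaw u τ)) := by
  have key : ∀ w ∈ paramBox r, ∃ ℓ : ℝ,
      (∀ z ∈ Set.Ioo (0 : ℝ) 1, densityBound r ≤ Real.exp (ℓ + (-(w.1 * z ^ 2 / 2) + w.2 * z))) ∧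
      (∀ a b : ℝ, Integrable (fun z => Real.exp (ℓ + (-(w.1 * z ^ 2 / 2) + w.2 * z)) *
        (-(a * z ^ 2 / 2) + b * z)) (volume.restrict (Set.Ioi τ)) ∧
        ∫ z in Set.Ioi τ, Real.exp (ℓ + (-(w.1 * z ^ 2 / 2) + w.2 * z)) *
          (-(a * z ^ 2 / 2) + b * z) = a * ∫ z, -(z ^ 2 / 2) ∂(truncLaw w τ) +
          b * ∫ z, z ∂(truncLaw w τ)) ∧
      Integrable (fun z => Real.exp (ℓ + (-(w.1 * z ^ 2 / 2) + w.2 * z)))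
        (volume.restrict (Set.Ioi τ)) ∧
      ∫ z in Set.Ioi τ, Real.exp (ℓ + (-(w.1 * z ^ 2 / 2) + w.2 * z)) = 1 := by
    intro w hw
    obtain ⟨ℓ, h1, h2⟩ := exists_truncLaw_density hr hw τ
    have hprob := isProbabilityMeasure_truncLaw hr hw hτ
    set p : ℝ → ℝ := fun z => Real.exp (ℓ + (-(w.1 * z ^ 2 / 2) + w.2 * z)) with hp
    have hpm : Measurable p := by fun_prop
    have hp0 : ∀ z, (ENNReal.ofReal (p z)).toReal = p z := fun z =>
      ENNReal.toReal_ofReal (Real.exp_pos _).le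
    have hint : ∀ f : ℝ → ℝ, ∫ z, f z ∂(truncLaw w τ) = ∫ z in Set.Ioi τ, p z * f z := by
      intro f
      rw [h1, integral_withDensity_eq_integral_toReal_smul (by fun_prop)
        (ae_of_all _ fun _ => ENNReal.ofReal_lt_top)]
      simp only [smul_eq_mul]
      exact integral_congr_ae (ae_of_all _ fun z => by simp only; rw [← hp0 z])
    have hintg : ∀ f : ℝ → ℝ, Integrable f (truncLaw w τ) →
        Integrable (fun z => p z * f z) (volume.restrict (Set.Ioi τ)) := by
      intro f hf
      rw [h1, integrable_withDensity_iff_integrable_smul' (by fun_prop)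
        (ae_of_all _ fun _ => ENNReal.ofReal_lt_top)] at hf
      refine hf.congr (ae_of_all _ fun z => ?_)
      simp only [smul_eq_mul]
      rw [← hp0 z]
    have i1 : Integrable (fun z : ℝ => z) (truncLaw w τ) := by
      simpa using integrable_pow_truncLaw hr hw hτ 1
    have i2 : Integrable (fun z : ℝ => -(z ^ 2 / 2)) (truncLaw w τ) :=
      ((integrable_pow_truncLaw hr hw hτ 2).div_const 2).neg
    refine ⟨ℓ, h2, fun a b => ?_, ?_, ?_⟩
    · have e : (fun z : ℝ => -(a * z ^ 2 / 2) + b * z) = fun z => a * -(z ^ 2 / 2) + b * z := by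
        funext z; ring
      have i3 : Integrable (fun z : ℝ => -(a * z ^ 2 / 2) + b * z) (truncLaw w τ) := by
        rw [e]; exact (i2.const_mul a).add (i1.const_mul b)
      refine ⟨hintg _ i3, ?_⟩
      rw [← hint, e, integral_add (i2.const_mul a) (i1.const_mul b), integral_const_mul,
        integral_const_mul]
    · simpa using hintg (fun _ => 1) (integrable_const _)
    · have := hint fun _ => 1
      simpa using this.symm
  obtain ⟨ℓv, hv1, hv2, hv3, hv4⟩ := key v hv
  obtain ⟨ℓu, hu1, hu2, hu3, hu4⟩ := key u hu
  set α := v.1 - u.1 with hα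
  set β := v.2 - u.2 with hβ
  set c := ℓu - ℓv with hc
  set q : ℝ → ℝ := fun z => -(α * z ^ 2 / 2) + β * z with hq
  set pv : ℝ → ℝ := fun z => Real.exp (ℓv + (-(v.1 * z ^ 2 / 2) + v.2 * z)) with hpv
  set pu : ℝ → ℝ := fun z => Real.exp (ℓu + (-(u.1 * z ^ 2 / 2) + u.2 * z)) with hpu
  -- Both densities integrate to `1`, so the constant `c` may be subtracted. With this choice `q -
  -- c` is exactly the difference of the log-densities.
  have hrhs : α * (∫ z, -(z ^ 2 / 2) ∂(truncLaw v τ) - ∫ z, -(z ^ 2 / 2) ∂(truncLaw u τ)) +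
      β * (∫ z, z ∂(truncLaw v τ) - ∫ z, z ∂(truncLaw u τ)) =
      ∫ z in Set.Ioi τ, (q z - c) * (pv z - pu z) := by
    have e : (fun z => (q z - c) * (pv z - pu z)) =
        fun z => (pv z * q z - pu z * q z) - (c * pv z - c * pu z) := by
      funext z; ring
    have iv : Integrable (fun z => pv z * q z) (volume.restrict (Set.Ioi τ)) := (hv2 α β).1
    have iu : Integrable (fun z => pu z * q z) (volume.restrict (Set.Ioi τ)) := (hu2 α β).1
    have ev : ∫ z in Set.Ioi τ, pv z * q z = _ := (hv2 α β).2
    have eu : ∫ z in Set.Ioi τ, pu z * q z = _ := (hu2 α β).2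
    have i1 : Integrable (fun z => pv z * q z - pu z * q z) (volume.restrict (Set.Ioi τ)) :=
      iv.sub iu
    have i2 : Integrable (fun z => c * pv z - c * pu z) (volume.restrict (Set.Ioi τ)) :=
      (hv3.const_mul c).sub (hu3.const_mul c)
    rw [e, integral_sub i1 i2, integral_sub iv iu,
      integral_sub (hv3.const_mul c) (hu3.const_mul c),
      integral_const_mul, integral_const_mul, hv4, hu4, ev, eu]
    ring
  -- Convexity of the exponential function: between two points its slope is at least the smaller of
  -- its two values. Taking `c₀ = 0` gives monotonicity, used outside `(0, 1)`.
  have hexp : ∀ a b : ℝ, ∀ c₀ ≥ 0, c₀ ≤ Real.exp a → c₀ ≤ Real.exp b →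
      c₀ * (a - b) ^ 2 ≤ (a - b) * (Real.exp a - Real.exp b) := by
    have aux : ∀ a b : ℝ, b ≤ a → ∀ c₀ ≥ 0, c₀ ≤ Real.exp b →
        c₀ * (a - b) ^ 2 ≤ (a - b) * (Real.exp a - Real.exp b) := by
      intro a b hab c₀ hc₀ h
      have h1 : Real.exp a = Real.exp b * Real.exp (a - b) := by rw [← Real.exp_add]; ring_nf
      have h2 := Real.add_one_le_exp (a - b)
      have h3 : c₀ * (a - b) ≤ Real.exp a - Real.exp b := by
        rw [h1]
        nlinarith [Real.exp_pos b]
      nlinarith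
    intro a b c₀ hc₀ ha hb
    rcases le_total b a with h | h
    · exact aux a b h c₀ hc₀ hb
    · have := aux b a h c₀ hc₀ ha
      nlinarith
  have hdiff : ∀ z, q z - c = (ℓv + (-(v.1 * z ^ 2 / 2) + v.2 * z)) -
      (ℓu + (-(u.1 * z ^ 2 / 2) + u.2 * z)) := by
    intro z
    simp only [hq, hα, hβ, hc]
    ring
  have hnn : ∀ z, 0 ≤ (q z - c) * (pv z - pu z) := by
    intro z
    rw [hdiff]
    have := hexp (ℓv + (-(v.1 * z ^ 2 / 2) + v.2 * z)) (ℓu + (-(u.1 * z ^ 2 / 2) + u.2 * z)) 0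
      le_rfl (Real.exp_pos _).le (Real.exp_pos _).le
    simpa using this
  -- This is where `τ ≤ 0` matters: one fixed interval lies in the support for every truncation
  -- point, so the modulus does not depend on `τ`.
  have hsub : Set.Ioo (0 : ℝ) 1 ⊆ Set.Ioi τ := fun z hz => hτ.trans_lt hz.1
  have hintg : IntegrableOn (fun z => (q z - c) * (pv z - pu z)) (Set.Ioi τ) := by
    have e : (fun z => (q z - c) * (pv z - pu z)) =
        fun z => (pv z * q z - pu z * q z) - (c * pv z - c * pu z) := by
      funext z; ring
    rw [e]
    exact ((hv2 α β).1.sub (hu2 α β).1).sub ((hv3.const_mul c).sub (hu3.const_mul c))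
  have hq2 : IntegrableOn (fun z => densityBound r * (q z - c) ^ 2) (Set.Ioo 0 1) := by
    have : Continuous fun z => densityBound r * (q z - c) ^ 2 := by fun_prop
    exact (this.integrableOn_Icc (a := 0) (b := 1)).mono_set Set.Ioo_subset_Icc_self
  rw [hrhs]
  calc densityBound r / 2000 * (α ^ 2 + β ^ 2)
      = densityBound r * ((α ^ 2 + β ^ 2) / 2000) := by ring
    _ ≤ densityBound r * ∫ z in (0 : ℝ)..1, (q z - c) ^ 2 :=
        mul_le_mul_of_nonneg_left (quadratic_lower_bound α β c) (densityBound_pos hr).le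
    _ = ∫ z in Set.Ioo (0 : ℝ) 1, densityBound r * (q z - c) ^ 2 := by
        rw [integral_const_mul, intervalIntegral.integral_of_le zero_le_one,
          integral_Ioc_eq_integral_Ioo]
    _ ≤ ∫ z in Set.Ioo (0 : ℝ) 1, (q z - c) * (pv z - pu z) := by
        refine setIntegral_mono_on hq2 (hintg.mono_set hsub) measurableSet_Ioo fun z hz => ?_
        rw [hdiff]
        exact hexp _ _ _ (densityBound_pos hr).le (hv1 z hz) (hu1 z hz)
    _ ≤ ∫ z in Set.Ioi τ, (q z - c) * (pv z - pu z) :=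
        setIntegral_mono_set hintg (ae_of_all _ hnn) (ae_of_all _ hsub)

/-! ## One step of projected SGD -/

/-- The squared Euclidean distance. -/
def sqDist (v u : ℝ × ℝ) : ℝ := (v.1 - u.1) ^ 2 + (v.2 - u.2) ^ 2

lemma sqDist_nonneg (v u : ℝ × ℝ) : 0 ≤ sqDist v u := by unfold sqDist; positivity

/-- The modulus of strong convexity, which determines the step size. -/
def stepParam (r : ℝ) : ℝ := densityBound r / 2000

lemma stepParam_pos {r : ℝ} (hr : 1 < r) : 0 < stepParam r := by
  have := densityBound_pos hr
  unfold stepParam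
  positivity

lemma measurable_clip (lo hi : ℝ) : Measurable (clip lo hi) := by
  unfold clip
  exact Measurable.ite measurableSet_Iio measurable_const
    (Measurable.ite measurableSet_Ioi measurable_const measurable_id)

@[fun_prop]
lemma Measurable.clip' {α : Type*} [MeasurableSpace α] {f : α → ℝ} (lo hi : ℝ)
    (hf : Measurable f) : Measurable fun a => clip lo hi (f a) :=
  (measurable_clip lo hi).comp hf

lemma sq_clip_sub_le {lo hi u : ℝ} (h1 : lo ≤ u) (h2 : u ≤ hi) (y : ℝ) :
    (clip lo hi y - u) ^ 2 ≤ (y - u) ^ 2 := by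
  unfold clip
  split_ifs with h h' <;> nlinarith

/-- Projection to the box does not increase the distance to a point of the box. The rest is the
expansion of the square, with the squared gradient bounded by fourth powers. -/
lemma sgdStep_sqDist_le {r lam : ℝ} {u : ℝ × ℝ} (hu : u ∈ paramBox r) (t : ℕ) (y z : ℝ)
    (v : ℝ × ℝ) {h : ℝ} (hh : h = 1 / (lam * ((t + 1 : ℕ) : ℝ))) :
    sqDist (sgdStep r lam t y z v) u ≤ sqDist v u + 2 * h * ((v.1 - u.1) * (-(y ^ 2 / 2)) +
      (v.2 - u.2) * y) - 2 * h * ((v.1 - u.1) * (-(z ^ 2 / 2)) + (v.2 - u.2) * z) +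
      h ^ 2 * (2 * y ^ 4 + 2 + 2 * z ^ 4) := by
  unfold sqDist sgdStep
  have h1 := sq_clip_sub_le hu.1.1 hu.1.2 (v.1 - (y * y - z * z) / 2 / (lam * ((t + 1 : ℕ) : ℝ)))
  have h2 := sq_clip_sub_le hu.2.1 hu.2.2 (v.2 - (z - y) / (lam * ((t + 1 : ℕ) : ℝ)))
  rw [div_eq_mul_one_div _ (lam * _), ← hh] at h1 h2
  have h3 : ((y * y - z * z) / 2) ^ 2 + (z - y) ^ 2 ≤ 2 * y ^ 4 + 2 + 2 * z ^ 4 := by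
    nlinarith [sq_nonneg (y * y + z * z), sq_nonneg (z + y), sq_nonneg (y ^ 2 - 1),
      sq_nonneg (z ^ 2 - 1), sq_nonneg (y ^ 2), sq_nonneg (z ^ 2), sq_nonneg (y * z)]
  have h4 := mul_le_mul_of_nonneg_left h3 (sq_nonneg h)
  dsimp only
  rw [div_eq_mul_one_div _ (lam * _), ← hh, div_eq_mul_one_div (z - y) (lam * _), ← hh]
  nlinarith

/-- Averaging over the sampled `z` turns the negative part of the gradient into the moments at `v`.
Adding and subtracting the moments at `u` leaves a contraction, by strong monotonicity, and a term
linear in the deviation of the data value `y` from its model at `u`. The step parameter equals the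
modulus, whence the factor `1 - 2 / (t + 1)`. -/
lemma integral_sgdStep_le {r : ℝ} (hr : 1 < r) : ∃ K : ℝ, 0 ≤ K ∧
    ∀ v ∈ paramBox r, ∀ u ∈ paramBox r, ∀ τ ≤ (0 : ℝ), ∀ (y : ℝ) (t : ℕ),
      ∫ z, sqDist (sgdStep r (stepParam r) t y z v) u ∂(truncLaw v τ) ≤
        (1 - 2 / ((t + 1 : ℕ) : ℝ)) * sqDist v u + 2 / (stepParam r * ((t + 1 : ℕ) : ℝ)) *
          ((v.1 - u.1) * (-(y ^ 2 / 2) - ∫ z, -(z ^ 2 / 2) ∂(truncLaw u τ)) +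
            (v.2 - u.2) * (y - ∫ z, z ∂(truncLaw u τ))) +
        (1 / (stepParam r * ((t + 1 : ℕ) : ℝ))) ^ 2 * (2 * y ^ 4 + K) := by
  obtain ⟨K, hK0, hK⟩ := exists_fourth_moment_bound hr
  refine ⟨2 + 2 * K, by positivity, fun v hv u hu τ hτ y t => ?_⟩
  set lam := stepParam r with hlam
  have hlam0 : 0 < lam := stepParam_pos hr
  have ht : (0 : ℝ) < ((t + 1 : ℕ) : ℝ) := by positivity
  set h := 1 / (lam * ((t + 1 : ℕ) : ℝ)) with hh
  have hprob := isProbabilityMeasure_truncLaw hr hv hτ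
  have i1 : Integrable (fun z : ℝ => z) (truncLaw v τ) := by
    simpa using integrable_pow_truncLaw hr hv hτ 1
  have i2 : Integrable (fun z : ℝ => -(z ^ 2 / 2)) (truncLaw v τ) :=
    ((integrable_pow_truncLaw hr hv hτ 2).div_const 2).neg
  have i4 := integrable_pow_truncLaw hr hv hτ 4
  have hle : ∫ z, sqDist (sgdStep r lam t y z v) u ∂(truncLaw v τ) ≤
      ∫ z, (sqDist v u + 2 * h * ((v.1 - u.1) * (-(y ^ 2 / 2)) + (v.2 - u.2) * y) +
        h ^ 2 * (2 * y ^ 4 + 2)) + ((-(2 * h * (v.1 - u.1)) * -(z ^ 2 / 2) +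
        -(2 * h * (v.2 - u.2)) * z) + h ^ 2 * 2 * z ^ 4) ∂(truncLaw v τ) := by
    refine integral_mono_of_nonneg (ae_of_all _ fun z => sqDist_nonneg _ _) ?_
      (ae_of_all _ fun z => ?_)
    · exact (integrable_const _).add (((i2.const_mul _).add (i1.const_mul _)).add
        (i4.const_mul _))
    · refine (sgdStep_sqDist_le hu t y z v hh).trans (le_of_eq ?_)
      ring
  have lin : ∀ c A B D : ℝ, ∫ z, c + ((A * -(z ^ 2 / 2) + B * z) + D * z ^ 4) ∂(truncLaw v τ) =
      c + (A * ∫ z, -(z ^ 2 / 2) ∂(truncLaw v τ) + B * ∫ z, z ∂(truncLaw v τ) +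
        D * ∫ z, z ^ 4 ∂(truncLaw v τ)) := by
    intro c A B D
    have j1 : Integrable (fun z => A * -(z ^ 2 / 2) + B * z) (truncLaw v τ) :=
      (i2.const_mul A).add (i1.const_mul B)
    have j2 : Integrable (fun z => (A * -(z ^ 2 / 2) + B * z) + D * z ^ 4) (truncLaw v τ) :=
      j1.add (i4.const_mul D)
    rw [integral_add (integrable_const c) j2, integral_add j1 (i4.const_mul D),
      integral_add (i2.const_mul A) (i1.const_mul B), integral_const_mul, integral_const_mul,
      integral_const_mul, integral_const]
    simp
  rw [lin] at hle
  have hmono := truncLaw_strongMono hr hv hu hτ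
  have hmom := hK v hv τ hτ
  set E1 := ∫ z, -(z ^ 2 / 2) ∂(truncLaw v τ)
  set E2 := ∫ z, z ∂(truncLaw v τ)
  set F1 := ∫ z, -(z ^ 2 / 2) ∂(truncLaw u τ)
  set F2 := ∫ z, z ∂(truncLaw u τ)
  change lam * sqDist v u ≤ _ at hmono
  have hh0 : 0 < h := by positivity
  have e1 : 2 / ((t + 1 : ℕ) : ℝ) = 2 * h * lam := by
    rw [hh]; field_simp
  have e2 : 2 / (lam * ((t + 1 : ℕ) : ℝ)) = 2 * h := by
    rw [hh]; ring
  rw [e1, e2]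
  have h5 := mul_le_mul_of_nonneg_left hmono (by positivity : 0 ≤ 2 * h)
  have h6 := mul_le_mul_of_nonneg_left hmom (by positivity : 0 ≤ h ^ 2 * 2)
  nlinarith

/-! ## Iterates on clipped data -/

/-- Adaptedness: for a fixed truncation point, iterate `t` sees only the values and draws before
`t`. All later independence and exchange arguments rest on this. -/
lemma sgd_congr {r lam τ : ℝ} {y y' : ℕ → ℝ} {ξ ξ' : ℕ → ℕ → ℝ} {t : ℕ}
    (hy : ∀ i < t, y i = y' i) (hξ : ∀ i < t, ξ i = ξ' i) :
    sgd r lam τ y ξ t = sgd r lam τ y' ξ' t := by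
  induction t with
  | zero => rfl
  | succ t ih =>
    rw [sgd, sgd, ih (fun i hi => hy i (by omega)) (fun i hi => hξ i (by omega)), hy t (by omega),
      hξ t (by omega)]

lemma measurable_sgd {α : Type*} [MeasurableSpace α] {r lam : ℝ} {τ : α → ℝ} {y : α → ℕ → ℝ}
    {ξ : α → ℕ → ℕ → ℝ} (hτ : Measurable τ) (hy : Measurable y) (hξ : Measurable ξ) (t : ℕ) :
    Measurable fun a => sgd r lam (τ a) (y a) (ξ a) t := by
  induction t with
  | zero => exact measurable_const
  | succ t ih =>
    have hz : Measurable fun a => firstAccepted (sgd r lam (τ a) (y a) (ξ a) t) (τ a) (ξ a t) :=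
      measurable_firstAccepted.comp (ih.prodMk (hτ.prodMk ((measurable_pi_apply t).comp hξ)))
    have hyt : Measurable fun a => y a t := (measurable_pi_apply t).comp hy
    simp only [sgd, sgdStep]
    fun_prop

/-- The standard normal distribution, conditioned on `(-a, ∞)`. -/
def halfNormal (a : ℝ) : Measure ℝ := (gaussianReal 0 1)[|Set.Ioi (-a)]

instance (a : ℝ) : IsProbabilityMeasure (halfNormal a) :=
  cond_isProbabilityMeasure (gaussianReal_Ioi_ne_zero _)

/-- Data and random draws for one coordinate. -/
abbrev Outcome : Type := (ℕ → ℝ) × (ℕ × ℕ → ℕ → ℝ)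

/-- The law of data and random draws for one coordinate. -/
def outcomeLaw (a : ℝ) : Measure Outcome :=
  (Measure.infinitePi fun _ => halfNormal a).prod
    (Measure.infinitePi fun _ => Measure.infinitePi fun _ => gaussianReal 0 1)

instance (a : ℝ) : IsProbabilityMeasure (outcomeLaw a) := by
  unfold outcomeLaw; infer_instance

/-- The truncation point after standardization. -/
def threshold (a : ℝ) (N : ℕ) (y : ℕ → ℝ) : ℝ := 0 - (empMean N y + a) / empSd N y

/-- The true natural parameters after standardization. -/
def target (N : ℕ) (y : ℕ → ℝ) : ℝ × ℝ := (empSd N y ^ 2, -(empMean N y * empSd N y))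

/-- The iterates on batch `β` of the data, where raw values are clipped to `[-M, M]`. -/
def clippedIter (r a M : ℝ) (N T β : ℕ) (p : Outcome) (t : ℕ) : ℝ × ℝ :=
  sgd r (stepParam r) (threshold a N p.1)
    (fun t => (clip (-M) M (p.1 (β * T + t)) - empMean N p.1) / empSd N p.1) (fun t => p.2 (β, t)) t

/-- The data for which the true parameters lie in the box after standardization. -/
def Regular (r a : ℝ) (N : ℕ) (y : ℕ → ℝ) : Prop :=
  (∀ j < N, -a < y j) ∧ 0 < empSd N y ∧ target N y ∈ paramBox r

@[fun_prop]
lemma measurable_empMean (N : ℕ) : Measurable (empMean N) := by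
  unfold empMean
  fun_prop

@[fun_prop]
lemma measurable_empSd (N : ℕ) : Measurable (empSd N) := by
  unfold empSd
  have := measurable_empMean N
  refine Measurable.sqrt (Measurable.div_const (Finset.measurable_fun_sum _ fun j _ => ?_) _)
  fun_prop

@[fun_prop]
lemma measurable_threshold (a : ℝ) (N : ℕ) : Measurable (threshold a N) := by
  unfold threshold
  fun_prop

@[fun_prop]
lemma measurable_target (N : ℕ) : Measurable (target N) := by
  unfold target
  fun_prop

@[fun_prop]
lemma measurable_clippedIter (r a M : ℝ) (N T β t : ℕ) :
    Measurable fun p => clippedIter r a M N T β p t := by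
  unfold clippedIter
  refine measurable_sgd (by fun_prop) ?_ (by fun_prop) t
  exact measurable_pi_lambda _ fun t => by fun_prop

lemma clippedIter_mem {r : ℝ} (hr : 1 < r) (a M : ℝ) (N T β : ℕ) (p : Outcome) (t : ℕ) :
    clippedIter r a M N T β p t ∈ paramBox r := sgd_mem hr _ _ _ _ t

/-- A permutation of the data. -/
def permute (e : Equiv.Perm ℕ) (p : Outcome) : Outcome := (fun j => p.1 (e j), p.2)

lemma measurePreserving_permute (a : ℝ) (e : Equiv.Perm ℕ) :
    MeasurePreserving (permute e) (outcomeLaw a) (outcomeLaw a) :=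
  (measurePreserving_perm (halfNormal a) e).prod (MeasurePreserving.id _)

lemma empMean_perm {N : ℕ} {e : Equiv.Perm ℕ} (he : ∀ j, e j ≠ j → j < N) (y : ℕ → ℝ) :
    empMean N (fun j => y (e j)) = empMean N y := by
  unfold empMean
  rw [Equiv.Perm.sum_comp e (Finset.range N) y fun j hj => by simpa using he j hj]

lemma empSd_perm {N : ℕ} {e : Equiv.Perm ℕ} (he : ∀ j, e j ≠ j → j < N) (y : ℕ → ℝ) :
    empSd N (fun j => y (e j)) = empSd N y := by
  unfold empSd
  rw [empMean_perm he]
  rw [Equiv.Perm.sum_comp e (Finset.range N)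
    (fun j => (y j - empMean N y) * (y j - empMean N y)) fun j hj => by simpa using he j hj]

/-- The iterate depends on the data outside its own past only through the empirical mean and
deviation, which are symmetric. -/
lemma clippedIter_permute {r a M : ℝ} {N T β t : ℕ} {e : Equiv.Perm ℕ}
    (he : ∀ j, e j ≠ j → j < N) (hfix : ∀ i < t, e (β * T + i) = β * T + i) (p : Outcome) :
    clippedIter r a M N T β (permute e p) t = clippedIter r a M N T β p t := by
  unfold clippedIter threshold permute
  simp only [empMean_perm he, empSd_perm he]
  exact sgd_congr (fun i hi => by rw [hfix i hi]) fun _ _ => rfl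

lemma target_permute {N : ℕ} {e : Equiv.Perm ℕ} (he : ∀ j, e j ≠ j → j < N) (p : Outcome) :
    target N (permute e p).1 = target N p.1 := by
  unfold target permute
  simp only [empMean_perm he, empSd_perm he]

/-- New draws for the block `b`. -/
def redraw (b : ℕ × ℕ) (q : Outcome × (ℕ → ℝ)) : Outcome := (q.1.1, Function.update q.1.2 b q.2)

lemma measurePreserving_redraw (a : ℝ) (b : ℕ × ℕ) :
    MeasurePreserving (redraw b)
      ((outcomeLaw a).prod (Measure.infinitePi fun _ => gaussianReal 0 1)) (outcomeLaw a) := by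
  have h1 := (MeasurePreserving.id (Measure.infinitePi fun _ : ℕ => halfNormal a)).prod
    (measurePreserving_update (fun _ : ℕ × ℕ => Measure.infinitePi fun _ : ℕ => gaussianReal 0 1) b)
  exact h1.comp (measurePreserving_prodAssoc _ _ _)

/-- The draws of block `(β, t)` are first used in step `t`, so the iterate before it is unchanged.
Integrating over `ξ` then averages over a fresh truncated Gaussian at that iterate. -/
lemma clippedIter_redraw_succ {r a M : ℝ} {N T β t : ℕ} (p : Outcome) (ξ : ℕ → ℝ) :
    clippedIter r a M N T β (redraw (β, t) (p, ξ)) (t + 1) =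
      sgdStep r (stepParam r) t
        ((clip (-M) M (p.1 (β * T + t)) - empMean N p.1) / empSd N p.1)
        (firstAccepted (clippedIter r a M N T β p t) (threshold a N p.1) ξ)
        (clippedIter r a M N T β p t) := by
  have h : clippedIter r a M N T β (redraw (β, t) (p, ξ)) t = clippedIter r a M N T β p t := by
    unfold clippedIter redraw
    refine sgd_congr (fun _ _ => rfl) fun i hi => ?_
    exact Function.update_of_ne (by simp; omega) _ _
  rw [← h]
  unfold clippedIter
  rw [sgd]
  simp [redraw]

/-! ## Weighted convergence of projected SGD -/

lemma MeasurePreserving.integral_comp_eq {α β : Type*} [MeasurableSpace α] [MeasurableSpace β]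
    {μ : Measure α} {ν : Measure β} {g : α → β} (hg : MeasurePreserving g μ ν) {f : β → ℝ}
    (hf : Measurable f) : ∫ x, f (g x) ∂μ = ∫ y, f y ∂ν := by
  rw [← hg.map_eq, integral_map hg.measurable.aemeasurable hf.aestronglyMeasurable]

lemma integrable_of_measurable_of_bound {α : Type*} [MeasurableSpace α] {μ : Measure α}
    [IsFiniteMeasure μ] {f : α → ℝ} (hf : Measurable f) (C : ℝ) (h : ∀ x, |f x| ≤ C) :
    Integrable f μ :=
  Integrable.of_bound hf.aestronglyMeasurable C (ae_of_all _ h)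

/-! ### Moment bounds for half-normal laws, uniform in the truncation point. -/

/-- The first two moments of a half-infinite truncated normal variable. -/
def halfMean (a : ℝ) : ℝ := ∫ x, x ∂(halfNormal a)

/-- The second moment of a half-infinite truncated normal variable. -/
def halfSq (a : ℝ) : ℝ := ∫ x, x ^ 2 ∂(halfNormal a)

/-- For `a ≥ 0` the conditioning event contains `(0, ∞)`, so its mass is bounded below independently
of `a`. -/
lemma halfNormal_le {a : ℝ} (ha : 0 ≤ a) :
    halfNormal a ≤ (gaussianReal 0 1 (Set.Ioi 0))⁻¹ • gaussianReal 0 1 := by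
  unfold halfNormal ProbabilityTheory.cond
  refine Measure.le_iff.2 fun s hs => ?_
  simp only [Measure.smul_apply, smul_eq_mul]
  exact mul_le_mul' (ENNReal.inv_le_inv.2 (measure_mono (Set.Ioi_subset_Ioi (by linarith))))
    (Measure.restrict_apply_le _ _)

lemma integrable_halfNormal {a : ℝ} {f : ℝ → ℝ} (hf : Integrable f (gaussianReal 0 1)) :
    Integrable f (halfNormal a) :=
  hf.restrict.smul_measure (ENNReal.inv_ne_top.2 (gaussianReal_Ioi_ne_zero _))

/-- The inverse of the smallest acceptance probability of a half-normal variable. -/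
def halfConst : ℝ := ((gaussianReal 0 1).real (Set.Ioi 0))⁻¹

lemma halfConst_pos : 0 < halfConst :=
  inv_pos.2 (ENNReal.toReal_pos (gaussianReal_Ioi_ne_zero 0) (measure_ne_top _ _))

lemma integral_halfNormal_le {a : ℝ} (ha : 0 ≤ a) {f : ℝ → ℝ} (hf : Integrable f (gaussianReal 0 1))
    (h0 : ∀ x, 0 ≤ f x) : ∫ x, f x ∂(halfNormal a) ≤ halfConst * ∫ x, f x ∂(gaussianReal 0 1) := by
  have h1 : ∫ x, f x ∂(halfNormal a) ≤
      ∫ x, f x ∂((gaussianReal 0 1 (Set.Ioi 0))⁻¹ • gaussianReal 0 1) :=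
    integral_mono_measure (halfNormal_le ha) (ae_of_all _ h0)
      (hf.smul_measure (ENNReal.inv_ne_top.2 (gaussianReal_Ioi_ne_zero _)))
  rw [integral_smul_measure, smul_eq_mul, ENNReal.toReal_inv] at h1
  exact h1

lemma halfSq_nonneg (a : ℝ) : 0 ≤ halfSq a := integral_nonneg fun x => by positivity

/-- A bound for the moments of half-normal variables. -/
def momentConst : ℝ := 1 + halfConst * ∫ x, x ^ 2 ∂(gaussianReal 0 1)

lemma one_le_momentConst : 1 ≤ momentConst := by
  have : 0 ≤ ∫ x, x ^ 2 ∂(gaussianReal 0 1) := integral_nonneg fun x => by positivity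
  have := mul_nonneg halfConst_pos.le this
  unfold momentConst
  linarith

lemma halfSq_le {a : ℝ} (ha : 0 ≤ a) : halfSq a ≤ momentConst := by
  have := integral_halfNormal_le ha integrable_pow_gaussianReal (f := fun x => x ^ 2)
    fun x => by positivity
  unfold momentConst halfSq
  linarith

lemma abs_halfMean_le {a : ℝ} (ha : 0 ≤ a) : |halfMean a| ≤ momentConst := by
  have h1 : |halfMean a| ≤ ∫ x, |x| ∂(halfNormal a) := abs_integral_le_integral_abs
  have i1 : Integrable (fun x : ℝ => x) (gaussianReal 0 1) := by
    simpa using integrable_pow_gaussianReal (k := 1)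
  have h2 : ∫ x, |x| ∂(halfNormal a) ≤ ∫ x, (1 + x ^ 2) ∂(halfNormal a) := by
    refine integral_mono (integrable_halfNormal i1).abs
      ((integrable_const _).add (integrable_halfNormal integrable_pow_gaussianReal)) fun x => ?_
    simp only
    nlinarith [sq_abs x, sq_nonneg (|x| - 1)]
  rw [integral_add (integrable_const _) (integrable_halfNormal integrable_pow_gaussianReal)] at h2
  have h3 := integral_halfNormal_le ha integrable_pow_gaussianReal (f := fun x => x ^ 2)
    fun x => by positivity
  simp only [integral_const, probReal_univ, one_smul] at h2
  unfold momentConst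
  linarith

/-! ### Consequences of regularity: the gradient as a linear form in moment deviations. -/

section Regular

variable {r a : ℝ} {N : ℕ} {y : ℕ → ℝ}

lemma Regular.empMean_gt (h : Regular r a N y) (hN : 0 < N) : -a < empMean N y := by
  have hN' : (0 : ℝ) < N := by exact_mod_cast hN
  rw [empMean, lt_div_iff₀ hN']
  have : ∑ j ∈ Finset.range N, -a < ∑ j ∈ Finset.range N, y j :=
    Finset.sum_lt_sum_of_nonempty (by simpa using hN.ne') fun j hj => h.1 j (Finset.mem_range.1 hj)
  simp only [Finset.sum_const, Finset.card_range, nsmul_eq_mul] at this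
  linarith

lemma Regular.threshold_nonpos (h : Regular r a N y) (hN : 0 < N) : threshold a N y ≤ 0 := by
  have h1 := h.empMean_gt hN
  have h2 : 0 ≤ (empMean N y + a) / empSd N y := div_nonneg (by linarith) h.2.1.le
  unfold threshold
  linarith

/-- The standardizing map is affine, so it carries the half-normal law to a Gaussian with mean
`-mean / sd` and variance `1 / sd ^ 2`, truncated at the standardized point. Hence `target` is the
point at which the expected gradient vanishes, for any realized mean and deviation. -/
lemma Regular.truncLaw_target (h : Regular r a N y) :
    truncLaw (target N y) (threshold a N y) =
      (halfNormal a).map fun x => (x - empMean N y) / empSd N y := by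
  have hs := h.2.1
  have hc : candidate (target N y) = fun x => (x - empMean N y) / empSd N y := by
    funext x
    simp only [candidate, target, Real.sqrt_sq hs.le]
    field_simp
    ring
  have hset : {x | threshold a N y < candidate (target N y) x} = Set.Ioi (-a) := by
    ext x
    rw [hc, threshold]
    simp only [Set.mem_ofPred_eq, Set.mem_Ioi]
    rw [zero_sub, ← neg_div, div_lt_div_iff_of_pos_right hs]
    constructor <;> intro h <;> linarith
  rw [truncLaw, hset, hc, halfNormal]

lemma Regular.integral_id (h : Regular r a N y) :
    ∫ z, z ∂(truncLaw (target N y) (threshold a N y)) =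
      (halfMean a - empMean N y) / empSd N y := by
  have i1 : Integrable (fun x : ℝ => x) (halfNormal a) :=
    integrable_halfNormal (by simpa using integrable_pow_gaussianReal (k := 1))
  rw [h.truncLaw_target, integral_map (by fun_prop) (by fun_prop), integral_div,
    integral_sub i1 (integrable_const _), integral_const]
  simp [halfMean]

lemma Regular.integral_sq (h : Regular r a N y) :
    ∫ z, -(z ^ 2 / 2) ∂(truncLaw (target N y) (threshold a N y)) =
      -((halfSq a - 2 * empMean N y * halfMean a + empMean N y ^ 2) / (2 * empSd N y ^ 2)) := by
  have i1 : Integrable (fun x : ℝ => x) (halfNormal a) :=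
    integrable_halfNormal (by simpa using integrable_pow_gaussianReal (k := 1))
  have i2 : Integrable (fun x : ℝ => x ^ 2) (halfNormal a) :=
    integrable_halfNormal integrable_pow_gaussianReal
  have e : ∀ x : ℝ, -(((x - empMean N y) / empSd N y) ^ 2 / 2) =
      -((x ^ 2 - 2 * empMean N y * x + empMean N y ^ 2) / (2 * empSd N y ^ 2)) := by
    intro x
    rw [div_pow, div_div, mul_comm (empSd N y ^ 2)]
    congr 2
    ring
  have i3 : Integrable (fun x : ℝ => x ^ 2 - 2 * empMean N y * x) (halfNormal a) :=
    i2.sub (i1.const_mul _)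
  rw [h.truncLaw_target, integral_map (by fun_prop) (by fun_prop)]
  simp only [e]
  rw [integral_neg, integral_div, integral_add i3 (integrable_const _),
    integral_sub i2 (i1.const_mul _), integral_const_mul, integral_const]
  simp [halfMean, halfSq]

lemma Regular.bounds (h : Regular r a N y) (hr : 1 < r) :
    1 / empSd N y ^ 2 ≤ r ∧ (empMean N y / empSd N y) ^ 2 ≤ r ^ 4 ∧
      (empMean N y / empSd N y ^ 2) ^ 2 ≤ r ^ 5 := by
  obtain ⟨-, hs, ⟨h1, h2⟩, h3, h4⟩ := h
  simp only [target] at h1 h2 h3 h4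
  have hr0 : 0 < r := by linarith
  set σ := empSd N y
  set m := empMean N y
  have hi : 1 / σ ^ 2 ≤ r := by
    rw [div_le_iff₀ (by positivity)]
    rwa [div_le_iff₀ hr0, mul_comm] at h1
  have hm : (m * σ) ^ 2 ≤ r ^ 2 := by
    have : |m * σ| ≤ r := abs_le.2 ⟨by linarith, by linarith⟩
    rw [← sq_abs]
    gcongr
  have hi0 : 0 < 1 / σ ^ 2 := by positivity
  refine ⟨hi, ?_, ?_⟩
  · have : (m / σ) ^ 2 = (m * σ) ^ 2 * (1 / σ ^ 2) ^ 2 := by field_simp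
    rw [this, show r ^ 4 = r ^ 2 * r ^ 2 by ring]
    gcongr
  · have : (m / σ ^ 2) ^ 2 = (m * σ) ^ 2 * (1 / σ ^ 2) ^ 3 := by field_simp
    rw [this, show r ^ 5 = r ^ 2 * r ^ 3 by ring]
    gcongr

/-- The linear functional by which deviations `δ₁`, `δ₂` of the first two moments of the data enter
the gradient in direction `w`. -/
def gradForm (N : ℕ) (y : ℕ → ℝ) (w : ℝ × ℝ) (δ₁ δ₂ : ℝ) : ℝ :=
  w.1 * (-(δ₂ / (2 * empSd N y ^ 2)) + empMean N y / empSd N y ^ 2 * δ₁) +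
    w.2 * (1 / empSd N y * δ₁)

/-- Young's inequality with a free parameter `s`: the coefficients of the form are bounded by powers
of `r` on regular data. In the recursion, `s` is the inverse step parameter, so that the first
summand uses up half of the contraction. -/
lemma Regular.gradForm_le (h : Regular r a N y) (hr : 1 < r) (w : ℝ × ℝ) (δ₁ δ₂ s : ℝ) :
    2 * s * gradForm N y w δ₁ δ₂ ≤ (w.1 ^ 2 + w.2 ^ 2) +
      s ^ 2 * ((r + r ^ 2 + 2 * r ^ 5) * (δ₁ ^ 2 + δ₂ ^ 2)) := by
  obtain ⟨h1, h2, h3⟩ := h.bounds hr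
  have hs := h.2.1
  unfold gradForm
  set σ := empSd N y
  set m := empMean N y
  have hr0 : 0 < r := by linarith
  have hi0 : 0 < 1 / σ ^ 2 := by positivity
  set c₁ := -(δ₂ / (2 * σ ^ 2)) + m / σ ^ 2 * δ₁ with hc₁
  set c₂ := 1 / σ * δ₁ with hc₂
  have b1 : c₁ ^ 2 ≤ r ^ 2 * δ₂ ^ 2 + 2 * r ^ 5 * δ₁ ^ 2 := by
    have e1 : (δ₂ / (2 * σ ^ 2)) ^ 2 = (1 / σ ^ 2) ^ 2 * δ₂ ^ 2 / 4 := by field_simp; ring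
    have e2 : (1 / σ ^ 2) ^ 2 * δ₂ ^ 2 ≤ r ^ 2 * δ₂ ^ 2 := by gcongr
    have e3 : (m / σ ^ 2) ^ 2 * δ₁ ^ 2 ≤ r ^ 5 * δ₁ ^ 2 := by gcongr
    rw [hc₁]
    nlinarith [sq_nonneg (δ₂ / (2 * σ ^ 2) + m / σ ^ 2 * δ₁)]
  have b2 : c₂ ^ 2 ≤ r * δ₁ ^ 2 := by
    have : c₂ ^ 2 = 1 / σ ^ 2 * δ₁ ^ 2 := by rw [hc₂]; ring
    rw [this]
    gcongr
  have b3 : 2 * s * (w.1 * c₁ + w.2 * c₂) ≤ (w.1 ^ 2 + w.2 ^ 2) + s ^ 2 * (c₁ ^ 2 + c₂ ^ 2) := by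
    nlinarith [sq_nonneg (w.1 - s * c₁), sq_nonneg (w.2 - s * c₂)]
  have b4 : c₁ ^ 2 + c₂ ^ 2 ≤ (r + r ^ 2 + 2 * r ^ 5) * (δ₁ ^ 2 + δ₂ ^ 2) := by
    have p1 : 0 ≤ r * δ₂ ^ 2 := by positivity
    have p2 : 0 ≤ r ^ 2 * δ₁ ^ 2 := by positivity
    have p3 : 0 ≤ r ^ 5 * δ₂ ^ 2 := by positivity
    nlinarith
  have := mul_le_mul_of_nonneg_left b4 (sq_nonneg s)
  linarith

lemma Regular.abs_gradForm_le (h : Regular r a N y) (hr : 1 < r) (w : ℝ × ℝ) (δ₁ δ₂ : ℝ) :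
    |gradForm N y w δ₁ δ₂| ≤ (w.1 ^ 2 + w.2 ^ 2) +
      (r + r ^ 2 + 2 * r ^ 5) * (δ₁ ^ 2 + δ₂ ^ 2) := by
  have h1 := h.gradForm_le hr w δ₁ δ₂ 1
  have h2 := h.gradForm_le hr w δ₁ δ₂ (-1)
  have h3 : 0 ≤ (r + r ^ 2 + 2 * r ^ 5) * (δ₁ ^ 2 + δ₂ ^ 2) := by
    have : 0 < r := by linarith
    positivity
  rw [abs_le]
  constructor <;> nlinarith [sq_nonneg w.1, sq_nonneg w.2]

/-- After expansion of the square the standardization only enters the coefficients: what remains are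
deviations of raw moments, which do not involve the empirical mean and deviation and therefore
concentrate. -/
lemma Regular.gradForm_eq (h : Regular r a N y) (w : ℝ × ℝ) (c : ℝ) :
    w.1 * (-(((c - empMean N y) / empSd N y) ^ 2 / 2) -
        ∫ z, -(z ^ 2 / 2) ∂(truncLaw (target N y) (threshold a N y))) +
      w.2 * ((c - empMean N y) / empSd N y -
        ∫ z, z ∂(truncLaw (target N y) (threshold a N y))) =
      gradForm N y w (c - halfMean a) (c ^ 2 - halfSq a) := by
  rw [h.integral_id, h.integral_sq, gradForm]
  have := h.2.1.ne'
  field_simp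
  ring

lemma Regular.std_pow_le (h : Regular r a N y) (hr : 1 < r) {M c : ℝ} (hM : 1 ≤ M)
    (hc : |c| ≤ M) : ((c - empMean N y) / empSd N y) ^ 4 ≤ 4 * (r + r ^ 4) ^ 2 * M ^ 4 := by
  obtain ⟨h1, h2, h3⟩ := h.bounds hr
  have hs := h.2.1
  have hr0 : 0 < r := by linarith
  have hc2 : c ^ 2 ≤ M ^ 2 := by rw [← sq_abs]; gcongr
  have e1 : (c / empSd N y) ^ 2 ≤ r * M ^ 2 := by
    have : (c / empSd N y) ^ 2 = 1 / empSd N y ^ 2 * c ^ 2 := by field_simp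
    rw [this]
    gcongr
  have e2 : ((c - empMean N y) / empSd N y) ^ 2 ≤ 2 * (r + r ^ 4) * M ^ 2 := by
    rw [sub_div]
    have : 1 ≤ M ^ 2 := one_le_pow₀ hM
    have : r ^ 4 ≤ r ^ 4 * M ^ 2 := le_mul_of_one_le_right (by positivity) this
    nlinarith [sq_nonneg (c / empSd N y + empMean N y / empSd N y)]
  calc ((c - empMean N y) / empSd N y) ^ 4 = (((c - empMean N y) / empSd N y) ^ 2) ^ 2 := by ring
    _ ≤ (2 * (r + r ^ 4) * M ^ 2) ^ 2 := by gcongr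
    _ = _ := by ring

end Regular

lemma sqDist_le {r : ℝ} (hr : 1 < r) {v u : ℝ × ℝ} (hv : v ∈ paramBox r) (hu : u ∈ paramBox r) :
    sqDist v u ≤ 5 * r ^ 2 := by
  obtain ⟨⟨h1, h2⟩, h3, h4⟩ := hv
  obtain ⟨⟨g1, g2⟩, g3, g4⟩ := hu
  have hr0 : 0 < 1 / r := by positivity
  have e1 : (v.1 - u.1) ^ 2 ≤ r ^ 2 := by
    rw [← sq_abs]
    have : |v.1 - u.1| ≤ r := abs_le.2 ⟨by linarith, by linarith⟩
    gcongr
  have e2 : (v.2 - u.2) ^ 2 ≤ (2 * r) ^ 2 := by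
    rw [← sq_abs]
    have : |v.2 - u.2| ≤ 2 * r := abs_le.2 ⟨by linarith, by linarith⟩
    gcongr
  unfold sqDist
  linarith [mul_pow 2 r 2]

lemma abs_clip_le {M : ℝ} (hM : 0 ≤ M) (y : ℝ) : |clip (-M) M y| ≤ M :=
  abs_le.2 (clip_mem (by linarith) y)

@[fun_prop]
lemma measurable_sqDist {α : Type*} [MeasurableSpace α] {f g : α → ℝ × ℝ} (hf : Measurable f)
    (hg : Measurable g) : Measurable fun x => sqDist (f x) (g x) := by
  unfold sqDist
  fun_prop

/-! ### Weights, reservoirs and exchangeability. -/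

/-- The average of the values `f (y j)` for `j ∈ R`. -/
def avgOver (R : Finset ℕ) (f : ℝ → ℝ) (y : ℕ → ℝ) : ℝ := (∑ j ∈ R, f (y j)) / R.card

/-- The assumptions on a weight under which the run on batch `β` converges: `R` is a reservoir of
unused data that are exchangeable with the data of the batch. -/
structure IsWeight (r a : ℝ) (N T β : ℕ) (R : Finset ℕ) (Φ : Outcome → ℝ) : Prop where
  measurable : Measurable Φ
  nonneg : ∀ p, 0 ≤ Φ p
  le_one : ∀ p, Φ p ≤ 1
  regular : ∀ p, Φ p ≠ 0 → Regular r a N p.1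
  permute : ∀ t < T, ∀ s ∈ R, ∀ p, Φ (permute (Equiv.swap (β * T + t) s) p) = Φ p
  redraw : ∀ t < T, ∀ p ξ, Φ (redraw (β, t) (p, ξ)) = Φ p

/-- The assumptions on the reservoir of batch `β`. -/
structure IsReservoir (N T β : ℕ) (R : Finset ℕ) : Prop where
  nonempty : R.Nonempty
  lt : ∀ j ∈ R, j < N
  batch_lt : ∀ t < T, β * T + t < N
  notMem : ∀ t < T, β * T + t ∉ R

/-- The data for which the first two moments of the clipped values in `R` are accurate up to `η`. -/
def Accurate (a M η : ℝ) (R : Finset ℕ) : Set (ℕ → ℝ) :=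
  {y | |avgOver R (clip (-M) M) y - halfMean a| ≤ η ∧
    |avgOver R (fun x => clip (-M) M x ^ 2) y - halfSq a| ≤ η}

lemma measurable_avgOver (R : Finset ℕ) {f : ℝ → ℝ} (hf : Measurable f) :
    Measurable (avgOver R f) := by
  unfold avgOver
  exact Measurable.div_const (Finset.measurable_fun_sum _ fun j _ => by fun_prop) _

lemma measurableSet_accurate (a M η : ℝ) (R : Finset ℕ) : MeasurableSet (Accurate a M η R) := by
  have h1 := measurable_avgOver R (measurable_clip (-M) M)
  have h2 := measurable_avgOver R ((measurable_clip (-M) M).pow_const 2)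
  exact (measurableSet_le (h1.sub_const _).abs measurable_const).inter
    (measurableSet_le (h2.sub_const _).abs measurable_const)

/-- Swapping a batch value with a reservoir value preserves the law of the outcome, the weight `Φ`
and the functional `F`; only the evaluation point moves. -/
lemma IsWeight.integral_swap {r a : ℝ} {N T β : ℕ} {R : Finset ℕ} {Φ : Outcome → ℝ}
    (hΦ : IsWeight r a N T β R Φ) {t : ℕ} (ht : t < T) {s : ℕ}
    (hs : s ∈ R) {F : Outcome → ℝ → ℝ} (hF : Measurable (Function.uncurry F))
    (hFi : ∀ p x, F (ReluLearning.permute (Equiv.swap (β * T + t) s) p) x = F p x) :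
    ∫ p, Φ p * F p (p.1 (β * T + t)) ∂(outcomeLaw a) = ∫ p, Φ p * F p (p.1 s) ∂(outcomeLaw a) := by
  have hm := hΦ.measurable
  have hmF : Measurable fun p : Outcome => F p (p.1 (β * T + t)) :=
    hF.comp (measurable_id.prodMk ((measurable_pi_apply _).comp measurable_fst))
  have hf : Measurable fun p : Outcome => Φ p * F p (p.1 (β * T + t)) := hm.mul hmF
  rw [← MeasurePreserving.integral_comp_eq
    (measurePreserving_permute a (Equiv.swap (β * T + t) s)) hf]
  refine integral_congr_ae (ae_of_all _ fun p => ?_)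
  simp only
  rw [hΦ.permute t ht s hs, hFi]
  simp [ReluLearning.permute]

lemma swap_lt {N j s : ℕ} (hj : j < N) (hs : s < N) : ∀ i, Equiv.swap j s i ≠ i → i < N := by
  intro i hi
  by_contra h
  exact hi (Equiv.swap_apply_of_ne_of_ne (by omega) (by omega))

lemma avg_gradForm (N : ℕ) (y : ℕ → ℝ) (w : ℝ × ℝ) {R : Finset ℕ} (hR : R.Nonempty) (f g : ℕ → ℝ)
    (m q : ℝ) : (∑ s ∈ R, gradForm N y w (f s - m) (g s - q)) / R.card =
      gradForm N y w ((∑ s ∈ R, f s) / R.card - m) ((∑ s ∈ R, g s) / R.card - q) := by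
  have hc : (R.card : ℝ) ≠ 0 := by exact_mod_cast hR.card_pos.ne'
  have h : ∀ δ₁ δ₂ : ℝ, gradForm N y w δ₁ δ₂ =
      (w.1 * (empMean N y / empSd N y ^ 2) + w.2 * (1 / empSd N y)) * δ₁ +
        -(w.1 / (2 * empSd N y ^ 2)) * δ₂ := by
    intro δ₁ δ₂
    unfold gradForm
    ring
  simp only [h]
  rw [Finset.sum_add_distrib, ← Finset.mul_sum, ← Finset.mul_sum, Finset.sum_sub_distrib,
    Finset.sum_sub_distrib]
  simp only [Finset.sum_const, nsmul_eq_mul]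
  field_simp

/-- The deviation of the raw value `x` from its expectation, in the direction from the target to the
`t`-th iterate. -/
def deviation (r a M : ℝ) (N T β t : ℕ) (p : Outcome) (x : ℝ) : ℝ :=
  gradForm N p.1 (clippedIter r a M N T β p t - target N p.1) (clip (-M) M x - halfMean a)
    (clip (-M) M x ^ 2 - halfSq a)

/-- The average of `deviation` over the reservoir. -/
def avgDeviation (r a M : ℝ) (N T β t : ℕ) (R : Finset ℕ) (p : Outcome) : ℝ :=
  gradForm N p.1 (clippedIter r a M N T β p t - target N p.1)
    (avgOver R (clip (-M) M) p.1 - halfMean a) (avgOver R (fun x => clip (-M) M x ^ 2) p.1 - halfSq a)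

lemma measurable_deviation (r a M : ℝ) (N T β t : ℕ) :
    Measurable (Function.uncurry (deviation r a M N T β t)) := by
  have h1 := measurable_clippedIter r a M N T β t
  simp only [deviation, gradForm, Function.uncurry_def, Prod.fst_sub, Prod.snd_sub]
  fun_prop

lemma measurable_avgDeviation (r a M : ℝ) (N T β t : ℕ) (R : Finset ℕ) :
    Measurable (avgDeviation r a M N T β t R) := by
  have h1 := measurable_clippedIter r a M N T β t
  have m1 := measurable_avgOver R (measurable_clip (-M) M)
  have m2 := measurable_avgOver R ((measurable_clip (-M) M).pow_const 2)
  unfold avgDeviation gradForm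
  simp only [Prod.fst_sub, Prod.snd_sub]
  fun_prop

lemma sq_sub_halfMean_le {a M c : ℝ} (ha : 0 ≤ a) (hM : 1 ≤ M) (hc : |c| ≤ M) :
    (c - halfMean a) ^ 2 ≤ (1 + momentConst) ^ 2 * M ^ 4 := by
  have hmean := abs_halfMean_le ha
  have hmc1 := one_le_momentConst
  have hM1 : 1 ≤ M ^ 2 := one_le_pow₀ hM
  have h1 : |c - halfMean a| ≤ (1 + momentConst) * M ^ 2 := by
    refine (abs_sub _ _).trans ?_
    nlinarith
  rw [← sq_abs]
  calc |c - halfMean a| ^ 2 ≤ ((1 + momentConst) * M ^ 2) ^ 2 := by gcongr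
    _ = _ := by ring

lemma sq_sub_halfSq_le {a M c : ℝ} (ha : 0 ≤ a) (hM : 1 ≤ M) (hc0 : 0 ≤ c) (hc : c ≤ M ^ 2) :
    (c - halfSq a) ^ 2 ≤ (1 + momentConst) ^ 2 * M ^ 4 := by
  have hsq := halfSq_le ha
  have hsq0 := halfSq_nonneg a
  have hmc1 := one_le_momentConst
  have hM1 : 1 ≤ M ^ 2 := one_le_pow₀ hM
  have h1 : |c - halfSq a| ≤ (1 + momentConst) * M ^ 2 := by
    rw [abs_le]
    constructor <;> nlinarith
  rw [← sq_abs]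
  calc |c - halfSq a| ^ 2 ≤ ((1 + momentConst) * M ^ 2) ^ 2 := by gcongr
    _ = _ := by ring

lemma sq_clip_le {M : ℝ} (hM : 0 ≤ M) (x : ℝ) : clip (-M) M x ^ 2 ≤ M ^ 2 := by
  rw [← sq_abs]
  have := abs_clip_le hM x
  gcongr

lemma abs_avgOver_clip_le {M : ℝ} (hM : 0 ≤ M) {R : Finset ℕ} (hR : R.Nonempty) (y : ℕ → ℝ) :
    |avgOver R (clip (-M) M) y| ≤ M := by
  have hc : (0 : ℝ) < R.card := by exact_mod_cast hR.card_pos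
  rw [avgOver, abs_div, abs_of_pos hc, div_le_iff₀ hc]
  refine (Finset.abs_sum_le_sum_abs _ _).trans
    ((Finset.sum_le_sum fun s _ => abs_clip_le hM _).trans ?_)
  rw [Finset.sum_const, nsmul_eq_mul, mul_comm]

lemma avgOver_sq_clip_mem {M : ℝ} (hM : 0 ≤ M) {R : Finset ℕ} (hR : R.Nonempty) (y : ℕ → ℝ) :
    0 ≤ avgOver R (fun x => clip (-M) M x ^ 2) y ∧
      avgOver R (fun x => clip (-M) M x ^ 2) y ≤ M ^ 2 := by
  have hc : (0 : ℝ) < R.card := by exact_mod_cast hR.card_pos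
  refine ⟨div_nonneg (Finset.sum_nonneg fun s _ => sq_nonneg _) hc.le, ?_⟩
  rw [avgOver, div_le_iff₀ hc]
  refine (Finset.sum_le_sum fun s _ => sq_clip_le hM _).trans ?_
  rw [Finset.sum_const, nsmul_eq_mul, mul_comm]

/-- A bound for deviations, relative to the fourth power of the clipping level. -/
def deviationConst (r M : ℝ) : ℝ :=
  5 * r ^ 2 + (r + r ^ 2 + 2 * r ^ 5) * (2 * (1 + momentConst) ^ 2 * M ^ 4)

section Weighted

variable {r a M η : ℝ} {N T β t : ℕ} {R : Finset ℕ} {Φ : Outcome → ℝ}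

lemma deviationConst_nonneg (hr : 1 < r) : 0 ≤ deviationConst r M := by
  have : 0 < r := by linarith
  have := one_le_momentConst
  unfold deviationConst
  positivity

lemma Regular.abs_deviation_le (hr : 1 < r) (ha : 0 ≤ a) (hM : 1 ≤ M) {p : Outcome}
    (hp : Regular r a N p.1) (x : ℝ) :
    |deviation r a M N T β t p x| ≤ deviationConst r M := by
  have hr0 : 0 < r := by linarith
  refine (hp.abs_gradForm_le hr _ _ _).trans (add_le_add
    (sqDist_le hr (clippedIter_mem hr a M N T β p t) hp.2.2) ?_)
  have := sq_sub_halfMean_le ha hM (abs_clip_le (by linarith) x)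
  have := sq_sub_halfSq_le ha hM (sq_nonneg _) (sq_clip_le (by linarith) x)
  gcongr
  linarith

lemma Regular.abs_avgDeviation_le (hr : 1 < r) (ha : 0 ≤ a) (hM : 1 ≤ M) (hR : R.Nonempty)
    {p : Outcome} (hp : Regular r a N p.1) :
    |avgDeviation r a M N T β t R p| ≤ deviationConst r M := by
  have hr0 : 0 < r := by linarith
  refine (hp.abs_gradForm_le hr _ _ _).trans (add_le_add
    (sqDist_le hr (clippedIter_mem hr a M N T β p t) hp.2.2) ?_)
  have h0 : 0 ≤ M := by linarith
  have := sq_sub_halfMean_le ha hM (abs_avgOver_clip_le h0 hR p.1)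
  have h2 := avgOver_sq_clip_mem h0 hR p.1
  have := sq_sub_halfSq_le ha hM h2.1 h2.2
  gcongr
  linarith

lemma IsWeight.abs_mul_le (hΦ : IsWeight r a N T β R Φ) {f : Outcome → ℝ} {C : ℝ} (hC : 0 ≤ C)
    (hf : ∀ p, Regular r a N p.1 → |f p| ≤ C) (p : Outcome) : |Φ p * f p| ≤ C := by
  by_cases h0 : Φ p = 0
  · simpa [h0] using hC
  · rw [abs_mul, abs_of_nonneg (hΦ.nonneg p)]
    have := hf p (hΦ.regular p h0)
    nlinarith [hΦ.nonneg p, hΦ.le_one p, abs_nonneg (f p)]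

lemma IsWeight.integrable (hΦ : IsWeight r a N T β R Φ) : Integrable Φ (outcomeLaw a) :=
  integrable_of_measurable_of_bound hΦ.measurable 1 fun p => by
    rw [abs_of_nonneg (hΦ.nonneg p)]; exact hΦ.le_one p

lemma IsWeight.integrable_mul (hΦ : IsWeight r a N T β R Φ) {f : Outcome → ℝ} (hfm : Measurable f)
    {C : ℝ} (hC : 0 ≤ C) (hf : ∀ p, Regular r a N p.1 → |f p| ≤ C) :
    Integrable (fun p => Φ p * f p) (outcomeLaw a) :=
  integrable_of_measurable_of_bound (hΦ.measurable.mul hfm) C (hΦ.abs_mul_le hC hf)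

lemma Regular.abs_sqDist_le (hr : 1 < r) {p : Outcome} (hp : Regular r a N p.1) (t : ℕ) :
    |sqDist (clippedIter r a M N T β p t) (target N p.1)| ≤ 5 * r ^ 2 := by
  rw [abs_of_nonneg (sqDist_nonneg _ _)]
  exact sqDist_le hr (clippedIter_mem hr ..) hp.2.2

lemma measurable_iterError (r a M : ℝ) (N T β t : ℕ) :
    Measurable fun p : Outcome => sqDist (clippedIter r a M N T β p t) (target N p.1) :=
  measurable_sqDist (measurable_clippedIter ..) ((measurable_target N).comp measurable_fst)

lemma IsWeight.integrable_sqDist (hr : 1 < r) (hΦ : IsWeight r a N T β R Φ) (t : ℕ) :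
    Integrable (fun p => Φ p * sqDist (clippedIter r a M N T β p t) (target N p.1))
      (outcomeLaw a) :=
  hΦ.integrable_mul (measurable_iterError ..) (by positivity) fun _ hp => hp.abs_sqDist_le hr t

lemma measurable_deviation_apply (r a M : ℝ) (N T β t i : ℕ) :
    Measurable fun p : Outcome => deviation r a M N T β t p (p.1 i) := by
  have h1 := measurable_clippedIter r a M N T β t
  simp only [deviation, gradForm, Prod.fst_sub, Prod.snd_sub]
  fun_prop

lemma IsWeight.integrable_deviation (hr : 1 < r) (ha : 0 ≤ a) (hM : 1 ≤ M)
    (hΦ : IsWeight r a N T β R Φ) (i : ℕ) :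
    Integrable (fun p => Φ p * deviation r a M N T β t p (p.1 i)) (outcomeLaw a) :=
  hΦ.integrable_mul (measurable_deviation_apply ..) (deviationConst_nonneg (M := M) hr)
    fun _ hp => hp.abs_deviation_le hr ha hM _

lemma IsWeight.integrable_avgDeviation (hr : 1 < r) (ha : 0 ≤ a) (hM : 1 ≤ M)
    (hΦ : IsWeight r a N T β R Φ) (hR : R.Nonempty) :
    Integrable (fun p => Φ p * avgDeviation r a M N T β t R p) (outcomeLaw a) :=
  hΦ.integrable_mul (measurable_avgDeviation ..) (deviationConst_nonneg (M := M) hr)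
    fun _ hp => hp.abs_avgDeviation_le hr ha hM hR

lemma integral_clippedIter_succ (hr : 1 < r) (hN : 0 < N) {p : Outcome}
    (hp : Regular r a N p.1) (t : ℕ) :
    ∫ ξ, sqDist (clippedIter r a M N T β (redraw (β, t) (p, ξ)) (t + 1))
        (target N (redraw (β, t) (p, ξ)).1) ∂(Measure.infinitePi fun _ : ℕ => gaussianReal 0 1) =
      ∫ z, sqDist (sgdStep r (stepParam r) t
          ((clip (-M) M (p.1 (β * T + t)) - empMean N p.1) / empSd N p.1) z
          (clippedIter r a M N T β p t)) (target N p.1)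
        ∂(truncLaw (clippedIter r a M N T β p t) (threshold a N p.1)) := by
  have hτ := hp.threshold_nonpos hN
  have hV := clippedIter_mem hr a M N T β p t
  have hm1 : Measurable (firstAccepted (clippedIter r a M N T β p t) (threshold a N p.1)) :=
    measurable_firstAccepted.comp
      (measurable_const.prodMk (measurable_const.prodMk measurable_id))
  have hm2 : Measurable fun z => sqDist (sgdStep r (stepParam r) t
      ((clip (-M) M (p.1 (β * T + t)) - empMean N p.1) / empSd N p.1) z
      (clippedIter r a M N T β p t)) (target N p.1) := by
    unfold sgdStep
    fun_prop
  rw [truncLaw, ← map_firstAccepted _ _ _ (accept_ne_zero hr hV hτ),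
    integral_map hm1.aemeasurable hm2.aestronglyMeasurable]
  refine integral_congr_ae (ae_of_all _ fun ξ => ?_)
  simp only
  rw [clippedIter_redraw_succ]
  rfl

/-- The one-step inequality, integrated against the weight. Neither `Φ` nor the iterate before step
`t` changes when the draws of step `t` are renewed, so the inequality may be applied for a fixed
outcome with only these draws integrated. -/
lemma weighted_update (hr : 1 < r) : ∃ K : ℝ, 0 ≤ K ∧
    ∀ {a M : ℝ} {N T β : ℕ} {R : Finset ℕ} {Φ : Outcome → ℝ}, 0 ≤ a → 1 ≤ M →
      IsWeight r a N T β R Φ → IsReservoir N T β R → ∀ t < T,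
      ∫ p, Φ p * sqDist (clippedIter r a M N T β p (t + 1)) (target N p.1) ∂(outcomeLaw a) ≤
        (1 - 2 / ((t + 1 : ℕ) : ℝ)) *
          ∫ p, Φ p * sqDist (clippedIter r a M N T β p t) (target N p.1) ∂(outcomeLaw a) +
        2 / (stepParam r * ((t + 1 : ℕ) : ℝ)) *
          ∫ p, Φ p * deviation r a M N T β t p (p.1 (β * T + t)) ∂(outcomeLaw a) +
        (1 / (stepParam r * ((t + 1 : ℕ) : ℝ))) ^ 2 * (8 * (r + r ^ 4) ^ 2 * M ^ 4 + K) *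
          ∫ p, Φ p ∂(outcomeLaw a) := by
  obtain ⟨K₁, hK₁, hstep⟩ := integral_sgdStep_le hr
  refine ⟨K₁, hK₁, fun {a M N T β R Φ} ha hM hΦ hR t ht => ?_⟩
  have hN : 0 < N := lt_of_le_of_lt (Nat.zero_le _) (hR.batch_lt t ht)
  have hFm : Measurable fun p =>
      Φ p * sqDist (clippedIter r a M N T β p (t + 1)) (target N p.1) :=
    hΦ.measurable.mul (measurable_iterError ..)
  have hFb := hΦ.abs_mul_le (by positivity)
    fun p hp => Regular.abs_sqDist_le (M := M) (T := T) (β := β) hr hp (t + 1)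
  have hFi : Integrable (fun q : Outcome × (ℕ → ℝ) => Φ (ReluLearning.redraw (β, t) q) *
      sqDist (clippedIter r a M N T β (ReluLearning.redraw (β, t) q) (t + 1))
        (target N (ReluLearning.redraw (β, t) q).1))
      ((outcomeLaw a).prod (Measure.infinitePi fun _ : ℕ => gaussianReal 0 1)) :=
    integrable_of_measurable_of_bound (hFm.comp (measurePreserving_redraw a (β, t)).measurable) _
      fun q => hFb _
  have i0 := hΦ.integrable
  have i1 := hΦ.integrable_sqDist (M := M) hr t
  have i2 := hΦ.integrable_deviation (t := t) hr ha hM (β * T + t)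
  have i3 : Integrable (fun p => (1 - 2 / ((t + 1 : ℕ) : ℝ)) *
      (Φ p * sqDist (clippedIter r a M N T β p t) (target N p.1)) +
      2 / (stepParam r * ((t + 1 : ℕ) : ℝ)) *
        (Φ p * deviation r a M N T β t p (p.1 (β * T + t)))) (outcomeLaw a) :=
    (i1.const_mul _).add (i2.const_mul _)
  rw [← integral_const_mul, ← integral_const_mul, ← integral_const_mul,
    ← integral_add (i1.const_mul _) (i2.const_mul _), ← integral_add i3 (i0.const_mul _),
    ← MeasurePreserving.integral_comp_eq (measurePreserving_redraw a (β, t)) hFm,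
    integral_prod _ hFi]
  refine integral_mono hFi.integral_prod_left (i3.add (i0.const_mul _)) fun p => ?_
  simp only [hΦ.redraw t ht, integral_const_mul]
  by_cases h0 : Φ p = 0
  · simp [h0]
  have hp := hΦ.regular p h0
  rw [integral_clippedIter_succ hr hN hp]
  have hs := hstep _ (clippedIter_mem hr a M N T β p t) _ hp.2.2 _ (hp.threshold_nonpos hN)
    ((clip (-M) M (p.1 (β * T + t)) - empMean N p.1) / empSd N p.1) t
  have hge := hp.gradForm_eq (clippedIter r a M N T β p t - target N p.1)
    (clip (-M) M (p.1 (β * T + t)))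
  have h4 := hp.std_pow_le hr hM (abs_clip_le (by linarith) (p.1 (β * T + t)))
  rw [Prod.fst_sub, Prod.snd_sub] at hge
  rw [hge] at hs
  have h5 : 2 * ((clip (-M) M (p.1 (β * T + t)) - empMean N p.1) / empSd N p.1) ^ 4 + K₁ ≤
      8 * (r + r ^ 4) ^ 2 * M ^ 4 + K₁ := by linarith
  have h6 := mul_le_mul_of_nonneg_left
    (hs.trans (add_le_add_right (mul_le_mul_of_nonneg_left h5 (sq_nonneg _)) _)) (hΦ.nonneg p)
  refine h6.trans (le_of_eq ?_)
  unfold deviation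
  ring

/-- The decoupling step. The value used in step `t` is correlated with the weight and with the
empirical mean and deviation, but it is exchangeable with every reservoir value, and a deviation is
linear in the clipped moments. So it may be averaged over the reservoir under the integral. -/
lemma IsWeight.integral_deviation (hr : 1 < r) (ha : 0 ≤ a) (hM : 1 ≤ M)
    (hΦ : IsWeight r a N T β R Φ) (hR : IsReservoir N T β R) (ht : t < T) :
    ∫ p, Φ p * deviation r a M N T β t p (p.1 (β * T + t)) ∂(outcomeLaw a) =
      ∫ p, Φ p * avgDeviation r a M N T β t R p ∂(outcomeLaw a) := by
  have hc : (R.card : ℝ) ≠ 0 := by exact_mod_cast hR.nonempty.card_pos.ne'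
  have h1 : ∀ s ∈ R, ∫ p, Φ p * deviation r a M N T β t p (p.1 (β * T + t)) ∂(outcomeLaw a) =
      ∫ p, Φ p * deviation r a M N T β t p (p.1 s) ∂(outcomeLaw a) := by
    intro s hs
    refine hΦ.integral_swap ht hs (measurable_deviation r a M N T β t) fun p x => ?_
    have he := swap_lt (hR.batch_lt t ht) (hR.lt s hs)
    have hne : ∀ i < t, Equiv.swap (β * T + t) s (β * T + i) = β * T + i := fun i hi =>
      Equiv.swap_apply_of_ne_of_ne (by omega) fun h' => hR.notMem i (hi.trans ht) (h' ▸ hs)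
    simp only [deviation, gradForm, clippedIter_permute he hne, target_permute he]
    simp only [ReluLearning.permute, empMean_perm he, empSd_perm he]
  have h2 : ∫ p, Φ p * avgDeviation r a M N T β t R p ∂(outcomeLaw a) =
      ∫ p, (∑ s ∈ R, Φ p * deviation r a M N T β t p (p.1 s)) / R.card ∂(outcomeLaw a) := by
    refine integral_congr_ae (ae_of_all _ fun p => ?_)
    simp only [avgDeviation, avgOver, deviation]
    rw [← Finset.mul_sum, mul_div_assoc,
      avg_gradForm N p.1 _ hR.nonempty (fun s => clip (-M) M (p.1 s))
      (fun s => clip (-M) M (p.1 s) ^ 2)]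
  rw [h2, integral_div,
    integral_finsetSum _ fun s _ => hΦ.integrable_deviation (t := t) hr ha hM s,
    ← Finset.sum_congr rfl h1]
  rw [Finset.sum_const, nsmul_eq_mul, mul_div_cancel_left₀ _ hc]

/-- Where the reservoir averages are accurate, Young's inequality leaves `η ^ 2`, still multiplied
by the weight. On the rare remaining event the crude bound `M ^ 4` is used and the weight is
dropped. Keeping the weight in the first term is what makes the later product over batches possible.
-/
lemma IsWeight.integral_avgDeviation_le (hr : 1 < r) (ha : 0 ≤ a) (hM : 1 ≤ M)
    (hΦ : IsWeight r a N T β R Φ) (hR : R.Nonempty) {s : ℝ} :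
    2 * s * ∫ p, Φ p * avgDeviation r a M N T β t R p ∂(outcomeLaw a) ≤
      ∫ p, Φ p * sqDist (clippedIter r a M N T β p t) (target N p.1) ∂(outcomeLaw a) +
      s ^ 2 * ((r + r ^ 2 + 2 * r ^ 5) * (2 * (1 + momentConst) ^ 2)) *
        (η ^ 2 * ∫ p, Φ p ∂(outcomeLaw a) +
          M ^ 4 * (outcomeLaw a).real {p | p.1 ∉ Accurate a M η R}) := by
  have hM0 : 0 ≤ M := by linarith
  have hr0 : 0 < r := by linarith
  have hmc1 := one_le_momentConst
  set bad : Set Outcome := {p | p.1 ∉ Accurate a M η R} with hbad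
  have hbadm : MeasurableSet bad := (measurableSet_accurate a M η R).compl.preimage measurable_fst
  have i0 := hΦ.integrable
  have i1 := hΦ.integrable_sqDist (M := M) hr t
  have i2 := hΦ.integrable_avgDeviation (t := t) hr ha hM hR
  have i3 : Integrable (bad.indicator (1 : Outcome → ℝ)) (outcomeLaw a) :=
    (integrable_const (1 : ℝ)).indicator hbadm
  have i4 : Integrable (fun p => η ^ 2 * Φ p + M ^ 4 * bad.indicator (1 : Outcome → ℝ) p)
      (outcomeLaw a) := (i0.const_mul _).add (i3.const_mul _)
  rw [← integral_indicator_one hbadm, ← integral_const_mul, ← integral_const_mul,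
    ← integral_const_mul, ← integral_add (i0.const_mul _) (i3.const_mul _), ← integral_const_mul,
    ← integral_add i1 (i4.const_mul _)]
  refine integral_mono (i2.const_mul _) (i1.add (i4.const_mul _)) fun p => ?_
  simp only
  by_cases h0 : Φ p = 0
  · rw [h0]
    have : 0 ≤ bad.indicator (1 : Outcome → ℝ) p :=
      Set.indicator_nonneg (fun _ _ => zero_le_one) p
    simp only [zero_mul, mul_zero, zero_add]
    positivity
  have hp := hΦ.regular p h0
  have hg := hp.gradForm_le hr (clippedIter r a M N T β p t - target N p.1)
    (avgOver R (clip (-M) M) p.1 - halfMean a)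
    (avgOver R (fun x => clip (-M) M x ^ 2) p.1 - halfSq a) s
  have hδ : Φ p * ((avgOver R (clip (-M) M) p.1 - halfMean a) ^ 2 +
      (avgOver R (fun x => clip (-M) M x ^ 2) p.1 - halfSq a) ^ 2) ≤
      2 * (1 + momentConst) ^ 2 *
      (η ^ 2 * Φ p + M ^ 4 * bad.indicator (1 : Outcome → ℝ) p) := by
    by_cases hb : p ∈ bad
    · rw [Set.indicator_of_mem hb, Pi.one_apply, mul_one]
      have d1 := sq_sub_halfMean_le ha hM (abs_avgOver_clip_le hM0 hR p.1)
      have h2 := avgOver_sq_clip_mem hM0 hR p.1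
      have d2 := sq_sub_halfSq_le ha hM h2.1 h2.2
      have d4 := mul_le_of_le_one_left (add_nonneg (sq_nonneg
        (avgOver R (clip (-M) M) p.1 - halfMean a)) (sq_nonneg
        (avgOver R (fun x => clip (-M) M x ^ 2) p.1 - halfSq a))) (hΦ.le_one p)
      have d5 : 0 ≤ 2 * (1 + momentConst) ^ 2 * (η ^ 2 * Φ p) := by
        have := hΦ.nonneg p
        positivity
      linarith
    · rw [Set.indicator_of_notMem hb, mul_zero, add_zero]
      have hacc : p.1 ∈ Accurate a M η R := not_not.1 hb
      have d1 : (avgOver R (clip (-M) M) p.1 - halfMean a) ^ 2 ≤ η ^ 2 := by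
        rw [← sq_abs]
        have := hacc.1
        gcongr
      have d2 : (avgOver R (fun x => clip (-M) M x ^ 2) p.1 - halfSq a) ^ 2 ≤ η ^ 2 := by
        rw [← sq_abs]
        have := hacc.2
        gcongr
      have d3 : 1 ≤ (1 + momentConst) ^ 2 := one_le_pow₀ (by linarith)
      have d4 := mul_le_mul_of_nonneg_left (add_le_add d1 d2) (hΦ.nonneg p)
      have d5 := mul_le_mul_of_nonneg_right d3
        (mul_nonneg (hΦ.nonneg p) (sq_nonneg η))
      linarith
  have g1 := mul_le_mul_of_nonneg_left hg (hΦ.nonneg p)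
  have g2 := mul_le_mul_of_nonneg_left hδ
    (by positivity : 0 ≤ s ^ 2 * (r + r ^ 2 + 2 * r ^ 5))
  rw [mul_add] at g1
  have g4 : Φ p * ((clippedIter r a M N T β p t - target N p.1).1 ^ 2 +
      (clippedIter r a M N T β p t - target N p.1).2 ^ 2) =
      Φ p * sqDist (clippedIter r a M N T β p t) (target N p.1) := rfl
  rw [g4] at g1
  unfold avgDeviation
  linarith

/-- Choosing `s = 1 / stepParam r` in the drift bound gives up half of the contraction: the factor
`1 - 2 / (t + 1)` becomes `1 - 1 / (t + 1)`. -/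
lemma weighted_step (hr : 1 < r) : ∃ K : ℝ, 0 ≤ K ∧
    ∀ {a M η : ℝ} {N T β : ℕ} {R : Finset ℕ} {Φ : Outcome → ℝ}, 0 ≤ a → 1 ≤ M →
      IsWeight r a N T β R Φ → IsReservoir N T β R → ∀ t < T,
      ∫ p, Φ p * sqDist (clippedIter r a M N T β p (t + 1)) (target N p.1) ∂(outcomeLaw a) ≤
        (1 - 1 / ((t + 1 : ℕ) : ℝ)) *
          ∫ p, Φ p * sqDist (clippedIter r a M N T β p t) (target N p.1) ∂(outcomeLaw a) +
        K * (η ^ 2 * ∫ p, Φ p ∂(outcomeLaw a) +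
          M ^ 4 * (outcomeLaw a).real {p | p.1 ∉ Accurate a M η R}) / ((t + 1 : ℕ) : ℝ) +
        K * M ^ 4 / ((t + 1 : ℕ) : ℝ) ^ 2 * ∫ p, Φ p ∂(outcomeLaw a) := by
  obtain ⟨K₁, hK₁, hupdate⟩ := weighted_update hr
  have hr0 : 0 < r := by linarith
  have hlam0 := stepParam_pos hr
  have hmc1 := one_le_momentConst
  refine ⟨(1 / stepParam r) ^ 2 * ((r + r ^ 2 + 2 * r ^ 5) * (2 * (1 + momentConst) ^ 2)) +
    (1 / stepParam r) ^ 2 * (8 * (r + r ^ 4) ^ 2 + K₁), by positivity, ?_⟩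
  intro a M η N T β R Φ ha hM hΦ hR t ht
  have hreg := hupdate ha hM hΦ hR t ht
  have hdrift := hΦ.integral_avgDeviation_le (t := t) (η := η) (s := 1 / stepParam r)
    hr ha hM hR.nonempty
  rw [← hΦ.integral_deviation hr ha hM hR ht] at hdrift
  refine hreg.trans ?_
  have ht0 : (0 : ℝ) < ((t + 1 : ℕ) : ℝ) := by positivity
  have hEΦ0 : 0 ≤ ∫ p, Φ p ∂(outcomeLaw a) := integral_nonneg hΦ.nonneg
  have hPb0 : 0 ≤ (outcomeLaw a).real {p | p.1 ∉ Accurate a M η R} := measureReal_nonneg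
  generalize ∫ p, Φ p * deviation r a M N T β t p (p.1 (β * T + t)) ∂(outcomeLaw a) = EG at *
  generalize ∫ p, Φ p * sqDist (clippedIter r a M N T β p t) (target N p.1) ∂(outcomeLaw a) = EX
    at *
  generalize ∫ p, Φ p ∂(outcomeLaw a) = EΦ at *
  generalize (outcomeLaw a).real {p | p.1 ∉ Accurate a M η R} = Pb at *
  have hD0 : 0 ≤ η ^ 2 * EΦ + M ^ 4 * Pb := by positivity
  generalize η ^ 2 * EΦ + M ^ 4 * Pb = D at *
  generalize ((t + 1 : ℕ) : ℝ) = τ at *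
  have hM4 : 1 ≤ M ^ 4 := one_le_pow₀ hM
  generalize M ^ 4 = Q at *
  have e1 : 2 / (stepParam r * τ) = 2 * (1 / stepParam r) * (1 / τ) := by ring
  have e2 : 1 / (stepParam r * τ) = 1 / stepParam r * (1 / τ) := by
    ring
  rw [e1, e2]
  generalize 1 / stepParam r = l at *
  have hA : 0 ≤ l ^ 2 * ((r + r ^ 2 + 2 * r ^ 5) * (2 * (1 + momentConst) ^ 2)) := by positivity
  generalize l ^ 2 * ((r + r ^ 2 + 2 * r ^ 5) * (2 * (1 + momentConst) ^ 2)) = A at *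
  have hB : 0 ≤ 8 * (r + r ^ 4) ^ 2 := by positivity
  generalize 8 * (r + r ^ 4) ^ 2 = B at *
  have hi : 0 < 1 / τ := by positivity
  have f1 : (A + l ^ 2 * (B + K₁)) * D / τ = (A + l ^ 2 * (B + K₁)) * D * (1 / τ) := by ring
  have f2 : (A + l ^ 2 * (B + K₁)) * Q / τ ^ 2 * EΦ =
      (A + l ^ 2 * (B + K₁)) * Q * (1 / τ) ^ 2 * EΦ := by
    ring
  have f3 : 2 / τ = 2 * (1 / τ) := by ring
  rw [f1, f2, f3]
  generalize 1 / τ = i at *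
  have g1 := mul_le_mul_of_nonneg_left hdrift hi.le
  have g2 : l ^ 2 * i ^ 2 * EΦ * K₁ ≤ l ^ 2 * i ^ 2 * EΦ * (K₁ * Q) :=
    mul_le_mul_of_nonneg_left (le_mul_of_one_le_right hK₁ hM4) (by positivity)
  have g3 : 0 ≤ A * Q * i ^ 2 * EΦ := by positivity
  have g4 : 0 ≤ l ^ 2 * (B + K₁) * D * i := by positivity
  nlinarith

end Weighted

/-! ## Few batches are bad -/

/-- Multiplied by `t + 1`, the recursion telescopes, and the noise terms sum to a harmonic number.
Averaging the resulting bounds over `t` brings in a second one, whence `ℓ ^ 2`. -/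
lemma weighted_average {r : ℝ} (hr : 1 < r) : ∃ K : ℝ, 0 ≤ K ∧
    ∀ {a M η ℓ : ℝ} {N T β : ℕ} {R : Finset ℕ} {Φ : Outcome → ℝ}, 0 ≤ a → 1 ≤ M → 0 < T →
      (harmonic T : ℝ) ≤ ℓ → IsWeight r a N T β R Φ → IsReservoir N T β R →
      ∫ p, Φ p * ((∑ t ∈ Finset.range T,
          sqDist (clippedIter r a M N T β p (t + 1)) (target N p.1)) / T) ∂(outcomeLaw a) ≤
        K * (η ^ 2 * ∫ p, Φ p ∂(outcomeLaw a) +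
          M ^ 4 * (outcomeLaw a).real {p | p.1 ∉ Accurate a M η R}) +
        K * M ^ 4 * ℓ ^ 2 / T * ∫ p, Φ p ∂(outcomeLaw a) := by
  obtain ⟨K, hK, hstep⟩ := weighted_step hr
  refine ⟨K, hK, fun {a M η ℓ N T β R Φ} ha hM hT hℓ hΦ hR => ?_⟩
  have hs := hstep (η := η) ha hM hΦ hR
  have hEΦ : 0 ≤ ∫ p, Φ p ∂(outcomeLaw a) := integral_nonneg hΦ.nonneg
  have hi := fun t => hΦ.integrable_sqDist (M := M) hr t
  have e : ∀ p, Φ p * ((∑ t ∈ Finset.range T,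
      sqDist (clippedIter r a M N T β p (t + 1)) (target N p.1)) / T) =
      (∑ t ∈ Finset.range T,
        Φ p * sqDist (clippedIter r a M N T β p (t + 1)) (target N p.1)) / T := fun p => by
    rw [← Finset.mul_sum, mul_div_assoc]
  simp only [e]
  rw [integral_div, integral_finsetSum _ fun t _ => hi (t + 1)]
  set E : ℕ → ℝ := fun t =>
    ∫ p, Φ p * sqDist (clippedIter r a M N T β p t) (target N p.1) ∂(outcomeLaw a)
  set EΦ := ∫ p, Φ p ∂(outcomeLaw a)
  set D := η ^ 2 * EΦ + M ^ 4 * (outcomeLaw a).real {p | p.1 ∉ Accurate a M η R}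
  -- The contraction factor of the first step is `0`, so the initial distance does not enter.
  have hrec : ∀ t ≤ T, (t : ℝ) * E t ≤ t * (K * D) + K * M ^ 4 * EΦ * (harmonic t : ℝ) := by
    intro t
    induction t with
    | zero => intro _; simp
    | succ t ih =>
      intro ht
      have h1 := ih (by omega)
      have h2 := hs t (by omega)
      change E (t + 1) ≤ (1 - 1 / ((t + 1 : ℕ) : ℝ)) * E t + K * D / ((t + 1 : ℕ) : ℝ) +
        K * M ^ 4 / ((t + 1 : ℕ) : ℝ) ^ 2 * EΦ at h2
      have hp : (0 : ℝ) < ((t + 1 : ℕ) : ℝ) := by positivity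
      have h3 := mul_le_mul_of_nonneg_left h2 hp.le
      have e1 : ((t + 1 : ℕ) : ℝ) * ((1 - 1 / ((t + 1 : ℕ) : ℝ)) * E t +
          K * D / ((t + 1 : ℕ) : ℝ) + K * M ^ 4 / ((t + 1 : ℕ) : ℝ) ^ 2 * EΦ) =
          t * E t + K * D + K * M ^ 4 * EΦ * ((t + 1 : ℕ) : ℝ)⁻¹ := by
        have : (t : ℝ) = ((t + 1 : ℕ) : ℝ) - 1 := by push_cast; ring
        rw [this]
        field_simp
      rw [e1] at h3
      have e2 : ((harmonic (t + 1) : ℚ) : ℝ) = (harmonic t : ℝ) + ((t + 1 : ℕ) : ℝ)⁻¹ := by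
        rw [harmonic_succ]; push_cast; ring
      rw [e2]
      have e3 : ((t + 1 : ℕ) : ℝ) * (K * D) = t * (K * D) + K * D := by push_cast; ring
      rw [e3]
      linarith
  have hT' : (0 : ℝ) < T := by exact_mod_cast hT
  have hmono : ∀ t ≤ T, (harmonic t : ℝ) ≤ ℓ := fun t ht => by
    refine le_trans ?_ hℓ
    have : harmonic t ≤ harmonic T :=
      Finset.sum_le_sum_of_subset_of_nonneg (Finset.range_mono ht) fun i _ _ => by positivity
    exact_mod_cast this
  have hℓ0 : 0 ≤ ℓ := by have := hmono 0 (by omega); simpa using this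
  have hE : ∀ t < T, E (t + 1) ≤ K * D + K * M ^ 4 * EΦ * ℓ * ((t + 1 : ℕ) : ℝ)⁻¹ := by
    intro t ht
    have h1 := hrec (t + 1) ht
    have hp : (0 : ℝ) < ((t + 1 : ℕ) : ℝ) := by positivity
    have h2 : K * M ^ 4 * EΦ * (harmonic (t + 1) : ℝ) ≤ K * M ^ 4 * EΦ * ℓ :=
      mul_le_mul_of_nonneg_left (hmono _ ht) (by positivity)
    have h3 : E (t + 1) ≤ (((t + 1 : ℕ) : ℝ) * (K * D) + K * M ^ 4 * EΦ * ℓ) /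
        ((t + 1 : ℕ) : ℝ) := by
      rw [le_div_iff₀ hp, mul_comm]
      linarith
    refine h3.trans (le_of_eq ?_)
    field_simp
  have hsum : ∑ t ∈ Finset.range T, E (t + 1) ≤ T * (K * D) + K * M ^ 4 * EΦ * ℓ * ℓ := by
    refine (Finset.sum_le_sum fun t ht => hE t (Finset.mem_range.1 ht)).trans ?_
    rw [Finset.sum_add_distrib, Finset.sum_const, Finset.card_range, nsmul_eq_mul,
      ← Finset.mul_sum]
    have : ∑ t ∈ Finset.range T, (((t + 1 : ℕ) : ℝ))⁻¹ = (harmonic T : ℝ) := by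
      simp [harmonic]
    rw [this]
    gcongr
  have : (T * (K * D) + K * M ^ 4 * EΦ * ℓ * ℓ) / T = K * D + K * M ^ 4 * ℓ ^ 2 / T * EΦ := by
    field_simp
  rw [← this]
  gcongr

/-- The outcomes for which batch `β` contains a value above the clipping level, or the mean squared
error of the iterates exceeds `ρ ^ 2`. -/
def BadBatch (r a M ρ : ℝ) (N T β : ℕ) : Set Outcome :=
  {p | ∃ t < T, M < |p.1 (β * T + t)|} ∪ {p | ρ ^ 2 < (∑ t ∈ Finset.range T,
      sqDist (clippedIter r a M N T β p (t + 1)) (target N p.1)) / T}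

/-- The data for which at most a fraction `κ` of the values in `R` exceeds the clipping level. -/
def Scarce (M κ : ℝ) (R : Finset ℕ) : Set (ℕ → ℝ) :=
  {y | avgOver R ({x | M < |x|}.indicator 1) y ≤ κ}

lemma measurable_exceed (M : ℝ) : Measurable (({x : ℝ | M < |x|}.indicator 1 : ℝ → ℝ)) :=
  measurable_one.indicator (measurableSet_lt measurable_const (by fun_prop))

lemma measurableSet_scarce (M κ : ℝ) (R : Finset ℕ) : MeasurableSet (Scarce M κ R) :=
  measurableSet_le (measurable_avgOver R (measurable_exceed M)) measurable_const

lemma measurable_meanError (r a M : ℝ) (N T β : ℕ) : Measurable fun p : Outcome =>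
    (∑ t ∈ Finset.range T, sqDist (clippedIter r a M N T β p (t + 1)) (target N p.1)) / T :=
  (Finset.measurable_fun_sum _ fun _ _ => measurable_iterError ..).div_const _

lemma measurableSet_badBatch (r a M ρ : ℝ) (N T β : ℕ) :
    MeasurableSet (BadBatch r a M ρ N T β) := by
  refine MeasurableSet.union ?_ (measurableSet_lt measurable_const (measurable_meanError ..))
  simp only [Set.ofPred_exists]
  refine MeasurableSet.iUnion fun t => ?_
  by_cases ht : t < T
  · simp only [ht, true_and]
    exact measurableSet_lt measurable_const (by fun_prop)
  · simp [ht]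

lemma measurableSet_regular (r a : ℝ) (N : ℕ) : MeasurableSet {y | Regular r a N y} := by
  have h1 : MeasurableSet {y : ℕ → ℝ | ∀ j < N, -a < y j} := by
    have : {y : ℕ → ℝ | ∀ j < N, -a < y j} = ⋂ j, ⋂ (_ : j < N), {y | -a < y j} := by
      ext; simp
    rw [this]
    exact MeasurableSet.iInter fun j => MeasurableSet.iInter fun _ =>
      measurableSet_lt measurable_const (measurable_pi_apply j)
  have h2 : MeasurableSet {y : ℕ → ℝ | 0 < empSd N y} :=
    measurableSet_lt measurable_const (measurable_empSd N)
  have hbox : MeasurableSet (paramBox r) :=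
    ((measurableSet_le measurable_const measurable_fst).inter
      (measurableSet_le measurable_fst measurable_const)).inter
    ((measurableSet_le measurable_const measurable_snd).inter
      (measurableSet_le measurable_snd measurable_const))
  exact h1.inter (h2.inter (measurable_target N hbox))

section Bad

variable {a M ρ η κ ℓ : ℝ} {N T β : ℕ} {R : Finset ℕ} {Φ : Outcome → ℝ}

/-- The exchange argument again, for the event that a batch value exceeds the clipping level: its
weighted frequency equals that in the reservoir. -/
lemma IsWeight.integral_exceed_le {r : ℝ} (hΦ : IsWeight r a N T β R Φ) (hR : R.Nonempty) (hκ : 0 ≤ κ)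
    {t : ℕ} (ht : t < T) : ∫ p, Φ p * {x : ℝ | M < |x|}.indicator 1 (p.1 (β * T + t)) ∂(outcomeLaw a) ≤
      κ * ∫ p, Φ p ∂(outcomeLaw a) + (outcomeLaw a).real {p | p.1 ∉ Scarce M κ R} := by
  have hc : (0 : ℝ) < R.card := by exact_mod_cast hR.card_pos
  have hm := measurable_exceed M
  have h01 : ∀ x : ℝ, 0 ≤ ({x : ℝ | M < |x|}.indicator 1 x : ℝ) ∧
      ({x : ℝ | M < |x|}.indicator 1 x : ℝ) ≤ 1 := fun x =>
    ⟨Set.indicator_nonneg (fun _ _ => zero_le_one) x,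
      Set.indicator_le_self' (fun _ _ => zero_le_one) x⟩
  have hmi : ∀ i, Measurable fun p : Outcome => ({x : ℝ | M < |x|}.indicator 1 (p.1 i) : ℝ) :=
    fun i => hm.comp ((measurable_pi_apply i).comp measurable_fst)
  have hint : ∀ i, Integrable (fun p => Φ p * {x : ℝ | M < |x|}.indicator 1 (p.1 i))
      (outcomeLaw a) := fun i => hΦ.integrable_mul (hmi i) zero_le_one fun p _ => by
    rw [abs_of_nonneg (h01 _).1]; exact (h01 _).2
  have h1 : ∀ s ∈ R, ∫ p, Φ p * {x : ℝ | M < |x|}.indicator 1 (p.1 (β * T + t)) ∂(outcomeLaw a) =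
      ∫ p, Φ p * {x : ℝ | M < |x|}.indicator 1 (p.1 s) ∂(outcomeLaw a) := fun s hs =>
    hΦ.integral_swap ht hs (F := fun _ x => {x : ℝ | M < |x|}.indicator 1 x)
      (hm.comp measurable_snd) fun _ _ => rfl
  have h2 : ∫ p, Φ p * avgOver R ({x : ℝ | M < |x|}.indicator 1) p.1 ∂(outcomeLaw a) =
      ∫ p, Φ p * {x : ℝ | M < |x|}.indicator 1 (p.1 (β * T + t)) ∂(outcomeLaw a) := by
    have e : ∀ p : Outcome, Φ p * avgOver R ({x : ℝ | M < |x|}.indicator 1) p.1 =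
        (∑ s ∈ R, Φ p * {x : ℝ | M < |x|}.indicator 1 (p.1 s)) / R.card := fun p => by
      rw [avgOver, ← Finset.mul_sum, mul_div_assoc]
    simp only [e]
    rw [integral_div, integral_finsetSum _ fun s _ => hint s, ← Finset.sum_congr rfl h1,
      Finset.sum_const, nsmul_eq_mul, mul_div_cancel_left₀ _ hc.ne']
  have hbm : MeasurableSet {p : Outcome | p.1 ∉ Scarce M κ R} :=
    (measurableSet_scarce M κ R).compl.preimage measurable_fst
  have hbi : Integrable ({p : Outcome | p.1 ∉ Scarce M κ R}.indicator (1 : Outcome → ℝ))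
      (outcomeLaw a) := (integrable_const (1 : ℝ)).indicator hbm
  rw [← h2, ← integral_indicator_one hbm, ← integral_const_mul,
    ← integral_add (hΦ.integrable.const_mul _) hbi]
  have havg : ∀ y, 0 ≤ avgOver R ({x : ℝ | M < |x|}.indicator 1) y ∧
      avgOver R ({x : ℝ | M < |x|}.indicator 1) y ≤ 1 := by
    intro y
    refine ⟨div_nonneg (Finset.sum_nonneg fun s _ => (h01 _).1) hc.le, ?_⟩
    rw [avgOver, div_le_iff₀ hc]
    refine (Finset.sum_le_sum fun s _ => (h01 _).2).trans ?_
    simp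
  refine integral_mono (hΦ.integrable_mul ((measurable_avgOver R hm).comp measurable_fst)
    zero_le_one fun p _ => ?_) ((hΦ.integrable.const_mul _).add hbi) fun p => ?_
  · rw [abs_of_nonneg (havg p.1).1]
    exact (havg p.1).2
  · simp only
    by_cases hp : p.1 ∈ Scarce M κ R
    · have h3 : p ∉ {p : Outcome | p.1 ∉ Scarce M κ R} := not_not.2 hp
      rw [Set.indicator_of_notMem h3, add_zero, mul_comm κ]
      exact mul_le_mul_of_nonneg_left hp (hΦ.nonneg p)
    · have h3 : p ∈ {p : Outcome | p.1 ∉ Scarce M κ R} := hp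
      rw [Set.indicator_of_mem h3, Pi.one_apply]
      have := mul_nonneg hκ (hΦ.nonneg p)
      have := mul_le_one₀ (hΦ.le_one p) (havg p.1).1 (havg p.1).2
      linarith


/-- Union bound over the values of the batch for large entries and Markov's inequality for the mean
squared error, both under the weight. -/
lemma weighted_bad {r : ℝ} (hr : 1 < r) : ∃ K : ℝ, 0 ≤ K ∧
    ∀ {a M ρ η κ ℓ : ℝ} {N T β : ℕ} {R : Finset ℕ} {Φ : Outcome → ℝ}, 0 ≤ a → 1 ≤ M → 0 < T →
      0 < ρ → 0 ≤ κ → (harmonic T : ℝ) ≤ ℓ → IsWeight r a N T β R Φ → IsReservoir N T β R →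
      ∫ p, Φ p * (BadBatch r a M ρ N T β).indicator 1 p ∂(outcomeLaw a) ≤
        (T * κ + K * (η ^ 2 + M ^ 4 * ℓ ^ 2 / T) / ρ ^ 2) * ∫ p, Φ p ∂(outcomeLaw a) +
        (T * (outcomeLaw a).real {p | p.1 ∉ Scarce M κ R} +
          K * M ^ 4 / ρ ^ 2 * (outcomeLaw a).real {p | p.1 ∉ Accurate a M η R}) := by
  obtain ⟨K, hK, havg⟩ := weighted_average hr
  refine ⟨K, hK, fun {a M ρ η κ ℓ N T β R Φ} ha hM hT hρ hκ hℓ hΦ hR => ?_⟩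
  have h1 := havg (η := η) ha hM hT hℓ hΦ hR
  have h2 := fun t (ht : t < T) =>
    hΦ.integral_exceed_le (a := a) (M := M) (κ := κ) hR.nonempty hκ ht
  have hT' : (0 : ℝ) < T := by exact_mod_cast hT
  have hr0 : 0 < r := by linarith
  have hmi : ∀ i, Measurable fun p : Outcome => ({x : ℝ | M < |x|}.indicator 1 (p.1 i) : ℝ) :=
    fun i => (measurable_exceed M).comp ((measurable_pi_apply i).comp measurable_fst)
  have h01 : ∀ x : ℝ, 0 ≤ ({x : ℝ | M < |x|}.indicator 1 x : ℝ) ∧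
      ({x : ℝ | M < |x|}.indicator 1 x : ℝ) ≤ 1 := fun x =>
    ⟨Set.indicator_nonneg (fun _ _ => zero_le_one) x,
      Set.indicator_le_self' (fun _ _ => zero_le_one) x⟩
  have hint : ∀ t ∈ Finset.range T, Integrable
      (fun p => Φ p * {x : ℝ | M < |x|}.indicator 1 (p.1 (β * T + t)))
      (outcomeLaw a) := fun t _ => hΦ.integrable_mul (hmi _) zero_le_one fun p _ => by
    rw [abs_of_nonneg (h01 _).1]; exact (h01 _).2
  have hE : ∀ p, 0 ≤ (∑ t ∈ Finset.range T,
      sqDist (clippedIter r a M N T β p (t + 1)) (target N p.1)) / T := fun p =>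
    div_nonneg (Finset.sum_nonneg fun t _ => sqDist_nonneg _ _) hT'.le
  have hEi : Integrable (fun p => Φ p * ((∑ t ∈ Finset.range T,
      sqDist (clippedIter r a M N T β p (t + 1)) (target N p.1)) / T)) (outcomeLaw a) := by
    refine hΦ.integrable_mul (measurable_meanError ..) (C := 5 * r ^ 2) (by positivity)
      fun p hp => ?_
    rw [abs_of_nonneg (hE p), div_le_iff₀ hT']
    refine (Finset.sum_le_sum fun t _ => (le_abs_self _).trans (hp.abs_sqDist_le hr _)).trans ?_
    rw [Finset.sum_const, Finset.card_range, nsmul_eq_mul, mul_comm]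
  have hsum : Integrable (fun p => ∑ t ∈ Finset.range T,
      Φ p * {x : ℝ | M < |x|}.indicator 1 (p.1 (β * T + t))) (outcomeLaw a) :=
    integrable_finsetSum _ hint
  have hle : ∫ p, Φ p * (BadBatch r a M ρ N T β).indicator 1 p ∂(outcomeLaw a) ≤
      ∫ p, ((∑ t ∈ Finset.range T, Φ p * {x : ℝ | M < |x|}.indicator 1 (p.1 (β * T + t))) +
        1 / ρ ^ 2 * (Φ p * ((∑ t ∈ Finset.range T,
      sqDist (clippedIter r a M N T β p (t + 1)) (target N p.1)) / T))) ∂(outcomeLaw a) := by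
    refine integral_mono (hΦ.integrable_mul (measurable_one.indicator
      (measurableSet_badBatch ..)) zero_le_one fun p _ => ?_)
      (hsum.add (hEi.const_mul _)) fun p => ?_
    · by_cases hp : p ∈ BadBatch r a M ρ N T β <;> simp [hp]
    simp only
    rw [← Finset.mul_sum, mul_left_comm, ← mul_add]
    refine mul_le_mul_of_nonneg_left ?_ (hΦ.nonneg p)
    have s1 : 0 ≤ ∑ t ∈ Finset.range T, ({x : ℝ | M < |x|}.indicator 1 (p.1 (β * T + t)) : ℝ) :=
      Finset.sum_nonneg fun t _ => (h01 _).1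
    have s2 : 0 ≤ 1 / ρ ^ 2 * ((∑ t ∈ Finset.range T,
      sqDist (clippedIter r a M N T β p (t + 1)) (target N p.1)) / T) :=
      mul_nonneg (by positivity) (hE p)
    by_cases hp : p ∈ BadBatch r a M ρ N T β
    · rw [Set.indicator_of_mem hp, Pi.one_apply]
      rcases hp with ⟨t, ht, hMt⟩ | hp
      · have h3 := Finset.single_le_sum (f := fun t =>
          ({x : ℝ | M < |x|}.indicator 1 (p.1 (β * T + t)) : ℝ)) (fun t _ => (h01 _).1)
          (Finset.mem_range.2 ht)
        have h4 : p.1 (β * T + t) ∈ {x : ℝ | M < |x|} := hMt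
        simp only [Set.indicator_of_mem h4, Pi.one_apply] at h3
        linarith
      · have h3 : 1 ≤ 1 / ρ ^ 2 * ((∑ t ∈ Finset.range T,
            sqDist (clippedIter r a M N T β p (t + 1)) (target N p.1)) / T) := by
          rw [one_div, ← div_eq_inv_mul, one_le_div (by positivity)]
          exact hp.le
        linarith
    · rw [Set.indicator_of_notMem hp]
      linarith
  rw [integral_add hsum (hEi.const_mul _), integral_const_mul,
    integral_finsetSum _ hint] at hle
  have h3 := Finset.sum_le_sum fun t ht => h2 t (Finset.mem_range.1 ht)
  rw [Finset.sum_const, Finset.card_range, nsmul_eq_mul] at h3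
  have h4 := mul_le_mul_of_nonneg_left h1 (by positivity : 0 ≤ 1 / ρ ^ 2)
  refine hle.trans ((add_le_add h3 h4).trans (le_of_eq ?_))
  ring

/-! ### Many batches bad at once. -/

/-- The indicator of the event that the data are regular and the batches in `S` are bad. -/
def badWeight (r a M ρ : ℝ) (N T : ℕ) (S : Finset ℕ) : Outcome → ℝ :=
  ({p | Regular r a N p.1} ∩ ⋂ β ∈ S, BadBatch r a M ρ N T β).indicator 1

lemma regular_permute {r : ℝ} {e : Equiv.Perm ℕ} (he : ∀ j, e j ≠ j → j < N) (p : Outcome) :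
    Regular r a N (permute e p).1 ↔ Regular r a N p.1 := by
  unfold Regular
  rw [target_permute he]
  have h1 : empSd N (permute e p).1 = empSd N p.1 := empSd_perm he p.1
  have h2 : (∀ j < N, -a < (permute e p).1 j) ↔ ∀ j < N, -a < p.1 j := by
    have hlt : ∀ j, j < N ↔ e j < N := by
      intro j
      by_cases h : e j = j
      · rw [h]
      · refine iff_of_true (he j h) (he (e j) fun h' => h (e.injective h'))
    constructor
    · intro h j hj
      have := h (e.symm j) ((hlt _).2 (by simpa using hj))
      simpa [permute] using this
    · exact fun h j hj => h (e j) ((hlt j).1 hj)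
  rw [h1, h2]

lemma badBatch_permute {r : ℝ} {e : Equiv.Perm ℕ} (he : ∀ j, e j ≠ j → j < N)
    (hfix : ∀ i < T, e (β * T + i) = β * T + i) (p : Outcome) :
    permute e p ∈ BadBatch r a M ρ N T β ↔ p ∈ BadBatch r a M ρ N T β := by
  have h1 : ∀ t < T, (permute e p).1 (β * T + t) = p.1 (β * T + t) := fun t ht => by
    simp [permute, hfix t ht]
  have h2 : ∀ t ∈ Finset.range T, sqDist (clippedIter r a M N T β (permute e p) (t + 1))
      (target N (permute e p).1) = sqDist (clippedIter r a M N T β p (t + 1)) (target N p.1) := by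
    intro t ht
    have := Finset.mem_range.1 ht
    rw [target_permute he, clippedIter_permute he fun i hi => hfix i (by omega)]
  simp only [BadBatch, Set.mem_union, Set.mem_ofPred_eq]
  rw [Finset.sum_congr rfl h2]
  refine or_congr (exists_congr fun t => and_congr_right fun ht => ?_) Iff.rfl
  rw [h1 t ht]

lemma badBatch_redraw {r : ℝ} {β' t : ℕ} (hβ : β' ≠ β) (p : Outcome) (ξ : ℕ → ℝ) :
    redraw (β', t) (p, ξ) ∈ BadBatch r a M ρ N T β ↔ p ∈ BadBatch r a M ρ N T β := by
  have h2 : ∀ t', clippedIter r a M N T β (redraw (β', t) (p, ξ)) t' =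
      clippedIter r a M N T β p t' := by
    intro t'
    unfold clippedIter redraw
    refine sgd_congr (fun _ _ => rfl) fun i _ => ?_
    exact Function.update_of_ne (by simp; omega) _ _
  simp only [BadBatch, Set.mem_union, Set.mem_ofPred_eq, h2]
  rfl

lemma batch_index_ne {T β β' t t' : ℕ} (hβ : β ≠ β') (ht : t < T) (ht' : t' < T) :
    β * T + t ≠ β' * T + t' := by
  intro h
  have h1 : (β * T + t) / T = β := by
    rw [mul_comm, Nat.mul_add_div (by omega), Nat.div_eq_of_lt (by assumption), add_zero]
  have h2 : (β' * T + t') / T = β' := by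
    rw [mul_comm, Nat.mul_add_div (by omega), Nat.div_eq_of_lt (by assumption), add_zero]
  exact hβ (h1 ▸ h2 ▸ congrArg (· / T) h)

/-- Whether a batch in `S` is bad depends on its own values, its own draws and symmetric functions
of the data. Exchanging values of another batch `β` with the reservoir, or renewing draws of `β`,
affects none of these. -/
lemma isWeight_badWeight {r : ℝ} {S : Finset ℕ} (hβS : β ∉ S) (hR : IsReservoir N T β R)
    (hRS : ∀ β' ∈ S, ∀ t < T, β' * T + t ∉ R) :
    IsWeight r a N T β R (badWeight r a M ρ N T S) where
  measurable := measurable_one.indicator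
    (((measurableSet_regular r a N).preimage measurable_fst).inter
      (Finset.measurableSet_biInter _ fun _ _ => measurableSet_badBatch ..))
  nonneg p := Set.indicator_nonneg (fun _ _ => zero_le_one) p
  le_one p := Set.indicator_le_self' (fun _ _ => zero_le_one) p
  regular p hp := (Set.mem_of_indicator_ne_zero hp).1
  permute t ht s hs p := by
    have he := swap_lt (hR.batch_lt t ht) (hR.lt s hs)
    refine Set.indicator_eq_indicator ?_ rfl
    simp only [Set.mem_inter_iff, Set.mem_ofPred_eq, Set.mem_iInter, regular_permute he]
    refine and_congr_right fun _ => forall₂_congr fun β' hβ' => badBatch_permute he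
      (fun i hi => Equiv.swap_apply_of_ne_of_ne
        (batch_index_ne (by rintro rfl; exact hβS hβ') hi ht) fun h => hRS β' hβ' i hi (h ▸ hs)) p
  redraw t ht p ξ := by
    refine Set.indicator_eq_indicator ?_ rfl
    simp only [Set.mem_inter_iff, Set.mem_iInter]
    exact and_congr Iff.rfl (forall₂_congr fun β' hβ' =>
      badBatch_redraw (by rintro rfl; exact hβS hβ') p ξ)

/-- The data that do not belong to the batches in `J`. -/
def reservoir (N T : ℕ) (J : Finset ℕ) : Finset ℕ :=
  Finset.range N \ J.biUnion fun β => (Finset.range T).image (β * T + ·)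

lemma card_reservoir (N T : ℕ) (J : Finset ℕ) : N ≤ (reservoir N T J).card + J.card * T := by
  have h1 : (J.biUnion fun β => (Finset.range T).image (β * T + ·)).card ≤ J.card * T :=
    Finset.card_biUnion_le_card_mul _ _ _ fun β _ => Finset.card_image_le.trans (by simp)
  have h2 := Finset.le_card_sdiff (J.biUnion fun β => (Finset.range T).image (β * T + ·))
    (Finset.range N)
  rw [Finset.card_range] at h2
  unfold reservoir
  omega

lemma notMem_reservoir {J : Finset ℕ} (hβ : β ∈ J) {t : ℕ} (ht : t < T) :
    β * T + t ∉ reservoir N T J := by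
  simp only [reservoir, Finset.mem_sdiff, Finset.mem_biUnion, not_and, not_not]
  exact fun _ => ⟨β, hβ, Finset.mem_image_of_mem _ (Finset.mem_range.2 ht)⟩

lemma isReservoir_reservoir {B : ℕ} {J : Finset ℕ} (hJ : J ⊆ Finset.range B) (hN : B * T ≤ N)
    (hne : (reservoir N T J).Nonempty) (hβ : β ∈ J) : IsReservoir N T β (reservoir N T J) where
  nonempty := hne
  lt j hj := Finset.mem_range.1 (Finset.mem_sdiff.1 hj).1
  batch_lt t ht := by
    have := Finset.mem_range.1 (hJ hβ)
    nlinarith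
  notMem t ht := notMem_reservoir hβ ht

lemma badWeight_insert {r : ℝ} {S : Finset ℕ} (p : Outcome) :
    badWeight r a M ρ N T (insert β S) p =
      badWeight r a M ρ N T S p * (BadBatch r a M ρ N T β).indicator 1 p := by
  unfold badWeight
  rw [Finset.set_biInter_insert, Set.inter_left_comm, Set.inter_comm, Set.inter_indicator_one]
  rfl

/-- The probability that many batches are bad, in terms of the concentration of averages over
reservoirs. -/
lemma exists_many_bad_le {r : ℝ} (hr : 1 < r) : ∃ K : ℝ, 0 ≤ K ∧
    ∀ {a M ρ η κ ℓ π q : ℝ} {N T B m : ℕ}, 0 ≤ a → 1 ≤ M → 0 < T →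
      0 < ρ → 0 ≤ κ → (harmonic T : ℝ) ≤ ℓ → B * T ≤ N → 0 < N → 2 * m ≤ B →
      T * κ + K * (η ^ 2 + M ^ 4 * ℓ ^ 2 / T) / ρ ^ 2 ≤ π → π ≤ 1 / 2 →
      (∀ R : Finset ℕ, N ≤ 2 * R.card →
        T * (outcomeLaw a).real {p | p.1 ∉ Scarce M κ R} +
          K * M ^ 4 / ρ ^ 2 * (outcomeLaw a).real {p | p.1 ∉ Accurate a M η R} ≤ q) →
      (outcomeLaw a).real {p | Regular r a N p.1 ∧ ∃ J ⊆ Finset.range B, J.card = m ∧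
        ∀ β ∈ J, p ∈ BadBatch r a M ρ N T β} ≤ 2 ^ B * (π ^ m + 2 * q) := by
  obtain ⟨K, hK, hbad⟩ := weighted_bad hr
  refine ⟨K, hK, fun {a M ρ η κ ℓ π q N T B m} ha hM hT hρ hκ hℓ hBT hN hm hπ hπ2 hq => ?_⟩
  have hπ0 : 0 ≤ π := le_trans (by positivity) hπ
  have hJ : ∀ J ⊆ Finset.range B, J.card = m →
      ∫ p, badWeight r a M ρ N T J p ∂(outcomeLaw a) ≤ π ^ m + 2 * q := by
    intro J hJB hJm
    -- The `m` batches use at most half of the data because `2 * m ≤ B`.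
    have hcard : N ≤ 2 * (reservoir N T J).card := by
      have := card_reservoir N T J
      have : 2 * (J.card * T) ≤ B * T := by rw [hJm]; nlinarith
      omega
    have hne : (reservoir N T J).Nonempty := Finset.card_pos.1 (by omega)
    have hqR := hq _ hcard
    have hq0 : 0 ≤ q := le_trans (by positivity) hqR
    have hind : ∀ S ⊆ J, ∫ p, badWeight r a M ρ N T S p ∂(outcomeLaw a) ≤
        π ^ S.card + 2 * q := by
      intro S
      induction S using Finset.induction_on with
      | empty =>
        intro _
        have h1 : ∫ p, badWeight r a M ρ N T ∅ p ∂(outcomeLaw a) ≤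
            ∫ _, (1 : ℝ) ∂(outcomeLaw a) :=
          integral_mono_of_nonneg
            (ae_of_all _ fun p => Set.indicator_nonneg (fun _ _ => zero_le_one) p)
            (integrable_const _)
            (ae_of_all _ fun p => Set.indicator_le_self' (fun _ _ => zero_le_one) p)
        simp only [integral_const, probReal_univ, smul_eq_mul, mul_one] at h1
        simp only [Finset.card_empty, pow_zero]
        linarith
      | insert β S hβ ih =>
        intro hS
        rw [Finset.insert_subset_iff] at hS
        have hres := isReservoir_reservoir hJB hBT hne hS.1
        have hw := isWeight_badWeight (r := r) (a := a) (M := M) (ρ := ρ) hβ hres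
          fun β' hβ' t ht => notMem_reservoir (hS.2 hβ') ht
        have h1 := hbad (η := η) ha hM hT hρ hκ hℓ hw hres
        simp only [badWeight_insert]
        have h0 : 0 ≤ ∫ p, badWeight r a M ρ N T S p ∂(outcomeLaw a) := integral_nonneg hw.nonneg
        -- One more bad batch costs a factor `π` and an additive `q`. The additive errors stay below
        -- `2 * q` because `π ≤ 1 / 2`.
        have h2 := mul_le_mul_of_nonneg_right hπ h0
        have h3 := mul_le_mul_of_nonneg_left (ih hS.2) hπ0
        rw [Finset.card_insert_of_notMem hβ, pow_succ]
        nlinarith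
    exact hJm ▸ hind J subset_rfl
  set 𝒥 := (Finset.range B).powerset.filter fun J => J.card = m
  have hsub : {p : Outcome | Regular r a N p.1 ∧ ∃ J ⊆ Finset.range B, J.card = m ∧
        ∀ β ∈ J, p ∈ BadBatch r a M ρ N T β} ⊆
      ⋃ J ∈ 𝒥, ({p | Regular r a N p.1} ∩ ⋂ β ∈ J, BadBatch r a M ρ N T β) := by
    rintro p ⟨hp, J, hJB, hJm, hb⟩
    simp only [Set.mem_iUnion, exists_prop]
    exact ⟨J, Finset.mem_filter.2 ⟨Finset.mem_powerset.2 hJB, hJm⟩, hp, Set.mem_iInter₂.2 hb⟩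
  refine (measureReal_mono hsub (measure_ne_top _ _)).trans ((measureReal_biUnion_finset_le _ _).trans ?_)
  have h1 : ∀ J ∈ 𝒥, (outcomeLaw a).real
      ({p | Regular r a N p.1} ∩ ⋂ β ∈ J, BadBatch r a M ρ N T β) ≤ π ^ m + 2 * q := by
    intro J h
    obtain ⟨h1, h2⟩ := Finset.mem_filter.1 h
    refine le_trans (le_of_eq ?_) (hJ J (Finset.mem_powerset.1 h1) h2)
    rw [badWeight, integral_indicator_one]
    exact ((measurableSet_regular r a N).preimage measurable_fst).inter
      (Finset.measurableSet_biInter _ fun _ _ => measurableSet_badBatch ..)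
  refine (Finset.sum_le_card_nsmul _ _ _ h1).trans ?_
  rw [nsmul_eq_mul]
  have hq0 : 0 ≤ q := le_trans (by positivity) (hq (Finset.range N) (by simp; omega))
  refine mul_le_mul_of_nonneg_right ?_ (by positivity)
  have : 𝒥.card ≤ 2 ^ B := (Finset.card_filter_le _ _).trans (by simp)
  exact_mod_cast this

end Bad

/-! ## Concentration -/

section Iid

variable {ι Ω₀ : Type*} [MeasurableSpace Ω₀] (μ : Measure Ω₀) [IsProbabilityMeasure μ]

lemma iid_hoeffding {f : Ω₀ → ℝ} (hf : Measurable f) {D : ℝ} (hD : 0 < D) (hfD : ∀ x, |f x| ≤ D)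
    (R : Finset ι) {ε : ℝ} (hε : 0 ≤ ε) :
    (Measure.infinitePi fun _ : ι => μ).real
        {ω | R.card * ε ≤ |∑ j ∈ R, f (ω j) - R.card * ∫ x, f x ∂μ|} ≤
      2 * Real.exp (-(R.card * ε ^ 2 / (2 * D ^ 2))) := by
  set P := Measure.infinitePi fun _ : ι => μ
  set m := ∫ x, f x ∂μ
  have hmean : ∀ i : ι, ∫ ω, f (ω i) ∂P = m := fun i =>
    MeasurePreserving.integral_comp_eq (measurePreserving_eval_infinitePi (fun _ : ι => μ) i) hf
  have hind : iIndepFun (fun (i : ι) (ω : ι → Ω₀) => f (ω i) - m) P :=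
    iIndepFun_infinitePi (X := fun _ x => f x - m) fun _ => by fun_prop
  have hsub : ∀ i : ι, HasSubgaussianMGF (fun ω : ι → Ω₀ => f (ω i) - m)
      ((‖D - -D‖₊ / 2) ^ 2) P := fun i => by
    have := hasSubgaussianMGF_of_mem_Icc (μ := P) (X := fun ω : ι → Ω₀ => f (ω i)) (a := -D)
      (b := D) (hf.comp (measurable_pi_apply i)).aemeasurable
      (ae_of_all _ fun ω => abs_le.1 (hfD _))
    rwa [hmean] at this
  have hind' : iIndepFun (fun (i : ι) (ω : ι → Ω₀) => -(f (ω i) - m)) P :=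
    iIndepFun_infinitePi (X := fun _ x => -(f x - m)) fun _ => by fun_prop
  have hsum : ∀ ω : ι → Ω₀, ∑ j ∈ R, (f (ω j) - m) = ∑ j ∈ R, f (ω j) - R.card * m := fun ω => by
    rw [Finset.sum_sub_distrib, Finset.sum_const, nsmul_eq_mul]
  have hexp : -(R.card * ε) ^ 2 / (2 * ((∑ _i ∈ R, (‖D - -D‖₊ / 2) ^ 2 : NNReal) : ℝ)) =
      -(R.card * ε ^ 2 / (2 * D ^ 2)) := by
    have e : (((‖D - -D‖₊ / 2) ^ 2 : NNReal) : ℝ) = D ^ 2 := by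
      push_cast
      rw [Real.norm_eq_abs, div_pow, sq_abs]
      ring
    rw [NNReal.coe_sum, Finset.sum_const, e, nsmul_eq_mul]
    rcases eq_or_ne (R.card : ℝ) 0 with h0 | h0
    · simp [h0]
    · field_simp
  have hnn : 0 ≤ R.card * ε := by positivity
  have h1 := HasSubgaussianMGF.measure_sum_ge_le_of_iIndepFun hind (s := R)
    (fun i _ => hsub i) hnn
  have h2 := HasSubgaussianMGF.measure_sum_ge_le_of_iIndepFun hind' (s := R)
    (fun i _ => (hsub i).neg) hnn
  rw [hexp] at h1 h2
  have hsubset : {ω : ι → Ω₀ | R.card * ε ≤ |∑ j ∈ R, f (ω j) - R.card * m|} ⊆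
      {ω | R.card * ε ≤ ∑ j ∈ R, (f (ω j) - m)} ∪ {ω | R.card * ε ≤ ∑ j ∈ R, -(f (ω j) - m)} := by
    intro ω hω
    simp only [Set.mem_union, Set.mem_ofPred_eq, Finset.sum_neg_distrib, hsum] at hω ⊢
    exact le_abs.1 hω
  have := (measureReal_mono (μ := P) hsubset (measure_ne_top _ _)).trans (measureReal_union_le _ _)
  linarith

lemma iid_chernoff {f : Ω₀ → ℝ} (hf : Measurable f) {θ C : ℝ} (hθ : 0 ≤ θ)
    (hi : Integrable (fun x => Real.exp (θ * f x)) μ) (hC : ∫ x, Real.exp (θ * f x) ∂μ ≤ C)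
    (R : Finset ι) (c : ℝ) :
    (Measure.infinitePi fun _ : ι => μ).real {ω | c ≤ ∑ j ∈ R, f (ω j)} ≤
      Real.exp (-(θ * c)) * C ^ R.card := by
  set P := Measure.infinitePi fun _ : ι => μ
  have hev := fun i : ι => measurePreserving_eval_infinitePi (fun _ : ι => μ) i
  have hm : ∀ i : ι, Measurable fun ω : ι → Ω₀ => f (ω i) := fun i => by fun_prop
  have hind : iIndepFun (fun (i : ι) (ω : ι → Ω₀) => f (ω i)) P :=
    iIndepFun_infinitePi (X := fun _ x => f x) fun _ => by fun_prop
  have hint : ∀ i : ι, Integrable (fun ω : ι → Ω₀ => Real.exp (θ * f (ω i))) P := fun i =>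
    (hev i).integrable_comp_of_integrable hi
  have h1 := hind.integrable_exp_mul_sum hm (t := θ) (s := R) fun i _ => hint i
  have h2 := measure_ge_le_exp_mul_mgf c hθ h1
  rw [hind.mgf_sum hm] at h2
  have h3 : ∀ i : ι, mgf (fun ω : ι → Ω₀ => f (ω i)) P θ ≤ C := fun i => by
    rw [mgf, MeasurePreserving.integral_comp_eq (hev i) (f := fun x => Real.exp (θ * f x))
      (by fun_prop)]
    exact hC
  have h4 : ∏ i ∈ R, mgf (fun ω : ι → Ω₀ => f (ω i)) P θ ≤ C ^ R.card :=
    (Finset.prod_le_prod (fun i _ => mgf_nonneg) fun i _ => h3 i).trans (by simp)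
  simp only [Finset.sum_apply, neg_mul] at h2
  exact h2.trans (mul_le_mul_of_nonneg_left h4 (Real.exp_pos _).le)

end Iid

lemma exists_exp_sq_moment : ∃ s C : ℝ, 0 < s ∧ 1 ≤ C ∧ ∀ a : ℝ, 0 ≤ a →
    Integrable (fun x : ℝ => Real.exp (s * x ^ 2)) (halfNormal a) ∧
      ∫ x, Real.exp (s * x ^ 2) ∂(halfNormal a) ≤ C := by
  obtain ⟨s, hs, hi⟩ := IsGaussian.exists_integrable_exp_sq (gaussianReal 0 1)
  simp only [Real.norm_eq_abs, sq_abs] at hi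
  refine ⟨s, max 1 (halfConst * ∫ x, Real.exp (s * x ^ 2) ∂(gaussianReal 0 1)), hs,
    le_max_left _ _, fun a ha => ⟨integrable_halfNormal hi, ?_⟩⟩
  exact (integral_halfNormal_le ha hi fun x => (Real.exp_pos _).le).trans (le_max_right _ _)

/-- A rate of decay of half-normal tails. -/
def tailRate : ℝ := exists_exp_sq_moment.choose

/-- A bound for the exponential moments of half-normal variables. -/
def tailConst : ℝ := exists_exp_sq_moment.choose_spec.choose

lemma tailRate_pos : 0 < tailRate := exists_exp_sq_moment.choose_spec.choose_spec.1

lemma one_le_tailConst : 1 ≤ tailConst := exists_exp_sq_moment.choose_spec.choose_spec.2.1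

lemma integrable_exp_sq {a : ℝ} (ha : 0 ≤ a) :
    Integrable (fun x : ℝ => Real.exp (tailRate * x ^ 2)) (halfNormal a) :=
  (exists_exp_sq_moment.choose_spec.choose_spec.2.2 a ha).1

lemma integral_exp_sq_le {a : ℝ} (ha : 0 ≤ a) :
    ∫ x, Real.exp (tailRate * x ^ 2) ∂(halfNormal a) ≤ tailConst :=
  (exists_exp_sq_moment.choose_spec.choose_spec.2.2 a ha).2

lemma integral_exceed_halfNormal_le {a M : ℝ} (ha : 0 ≤ a) (hM : 0 ≤ M) :
    ∫ x, ({x : ℝ | M < |x|}.indicator 1 x : ℝ) ∂(halfNormal a) ≤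
      tailConst * Real.exp (-(tailRate * M ^ 2)) := by
  have hs := tailRate_pos
  have h1 : ∫ x, ({x : ℝ | M < |x|}.indicator 1 x : ℝ) ∂(halfNormal a) ≤
      ∫ x, Real.exp (-(tailRate * M ^ 2)) * Real.exp (tailRate * x ^ 2) ∂(halfNormal a) := by
    refine integral_mono_of_nonneg (ae_of_all _ fun x =>
      Set.indicator_nonneg (fun _ _ => zero_le_one) x) ((integrable_exp_sq ha).const_mul _)
      (ae_of_all _ fun x => ?_)
    simp only
    rw [← Real.exp_add]
    by_cases hx : x ∈ {x : ℝ | M < |x|}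
    · rw [Set.indicator_of_mem hx, Pi.one_apply, Real.one_le_exp_iff]
      have : M ^ 2 ≤ x ^ 2 := by
        rw [← sq_abs x]
        have : M < |x| := hx
        gcongr
      nlinarith
    · rw [Set.indicator_of_notMem hx]
      positivity
  rw [integral_const_mul, mul_comm] at h1
  exact h1.trans (mul_le_mul_of_nonneg_right (integral_exp_sq_le ha) (Real.exp_pos _).le)

lemma clip_eq_self {M x : ℝ} (h : |x| ≤ M) : clip (-M) M x = x := by
  rw [abs_le] at h
  unfold clip
  rw [if_neg (by linarith), if_neg (by linarith)]

lemma abs_clip_le_abs {M : ℝ} (hM : 0 ≤ M) (x : ℝ) : |clip (-M) M x| ≤ |x| := by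
  unfold clip
  split_ifs with h1 h2
  · rw [abs_neg, abs_of_nonneg hM, abs_of_neg (by linarith)]; linarith
  · rw [abs_of_nonneg hM, abs_of_pos (by linarith)]; exact h2.le
  · exact le_rfl

/-- The effect of clipping on the expectation of a function that is bounded by the square. -/
lemma abs_integral_clip_sub_le {a M : ℝ} (ha : 0 ≤ a) (hM : 1 ≤ M) {f : ℝ → ℝ}
    (hf : Measurable f) (hfb : ∀ x, 1 ≤ |x| → |f x| ≤ x ^ 2) (hfi : Integrable f (halfNormal a))
    (hb : ∀ x, M < |x| → |f (clip (-M) M x)| ≤ x ^ 2) (hB : ∃ C, ∀ x, |f (clip (-M) M x)| ≤ C) :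
    |∫ x, f (clip (-M) M x) ∂(halfNormal a) - ∫ x, f x ∂(halfNormal a)| ≤
      4 / tailRate * tailConst * Real.exp (-(tailRate * M ^ 2 / 2)) := by
  have hs := tailRate_pos
  obtain ⟨C, hC⟩ := hB
  have hfci : Integrable (fun x => f (clip (-M) M x)) (halfNormal a) :=
    integrable_of_measurable_of_bound (hf.comp (measurable_clip _ _)) C hC
  rw [← integral_sub hfci hfi]
  have h1 : ∫ x, |f (clip (-M) M x) - f x| ∂(halfNormal a) ≤
      ∫ x, 4 / tailRate * Real.exp (-(tailRate * M ^ 2 / 2)) * Real.exp (tailRate * x ^ 2)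
        ∂(halfNormal a) := by
    refine integral_mono_of_nonneg (ae_of_all _ fun x => abs_nonneg _)
      ((integrable_exp_sq ha).const_mul _) (ae_of_all _ fun x => ?_)
    simp only
    by_cases hx : |x| ≤ M
    · rw [clip_eq_self hx, sub_self, abs_zero]
      positivity
    · have hx' : M < |x| := not_le.1 hx
      have hMx : M ^ 2 ≤ x ^ 2 := by rw [← sq_abs x]; gcongr
      have h2 : |f (clip (-M) M x) - f x| ≤ 2 * x ^ 2 := by
        have := abs_sub (f (clip (-M) M x)) (f x)
        have := hb x hx'
        have := hfb x (by linarith)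
        linarith
      have h3 : tailRate * x ^ 2 / 2 ≤ Real.exp (tailRate * x ^ 2 / 2) := by
        have := Real.add_one_le_exp (tailRate * x ^ 2 / 2)
        linarith
      -- Half of the available exponential moment absorbs the square; the other half gives the decay
      -- in `M`, since `|x| > M`.
      have h4 : 2 * x ^ 2 ≤ 4 / tailRate * Real.exp (tailRate * x ^ 2 / 2) := by
        rw [div_mul_eq_mul_div, le_div_iff₀ hs]
        linarith
      refine h2.trans (h4.trans ?_)
      rw [mul_assoc, ← Real.exp_add]
      gcongr
      nlinarith
  rw [integral_const_mul] at h1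
  refine abs_integral_le_integral_abs.trans (h1.trans ?_)
  have := mul_le_mul_of_nonneg_left (integral_exp_sq_le ha)
    (by positivity : 0 ≤ 4 / tailRate * Real.exp (-(tailRate * M ^ 2 / 2)))
  refine this.trans (le_of_eq (by ring))

lemma outcomeLaw_real_fst {a : ℝ} {s : Set (ℕ → ℝ)} (hs : MeasurableSet s) :
    (outcomeLaw a).real {p | p.1 ∈ s} = (Measure.infinitePi fun _ => halfNormal a).real s := by
  have h : MeasurePreserving Prod.fst (outcomeLaw a) (Measure.infinitePi fun _ => halfNormal a) :=
    measurePreserving_fst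
  exact h.measureReal_preimage hs.nullMeasurableSet

lemma outcomeLaw_avgOver_le {a : ℝ} {f : ℝ → ℝ} (hf : Measurable f) {D : ℝ}
    (hD : 0 < D) (hfD : ∀ x, |f x| ≤ D) {R : Finset ℕ} (hR : R.Nonempty) {ε : ℝ} (hε : 0 ≤ ε) :
    (outcomeLaw a).real {p | ε ≤ |avgOver R f p.1 - ∫ x, f x ∂(halfNormal a)|} ≤
      2 * Real.exp (-(R.card * ε ^ 2 / (2 * D ^ 2))) := by
  have hc : (0 : ℝ) < R.card := by exact_mod_cast hR.card_pos
  have hm := measurable_avgOver R hf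
  have hset : MeasurableSet {y : ℕ → ℝ | ε ≤ |avgOver R f y - ∫ x, f x ∂(halfNormal a)|} :=
    measurableSet_le measurable_const (hm.sub_const _).abs
  refine (le_of_eq (outcomeLaw_real_fst hset)).trans (le_trans (le_of_eq ?_)
    (iid_hoeffding (halfNormal a) hf hD hfD R hε))
  congr 1
  ext y
  simp only [Set.mem_ofPred_eq, avgOver]
  have : (∑ j ∈ R, f (y j)) / R.card - ∫ x, f x ∂(halfNormal a) =
      (∑ j ∈ R, f (y j) - R.card * ∫ x, f x ∂(halfNormal a)) / R.card := by
    field_simp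
  rw [this, abs_div, abs_of_pos hc, le_div_iff₀ hc, mul_comm]

/-- Clipping shifts each expectation by at most `η / 4`, and the clipped averages deviate by less
than `η / 2` by Hoeffding's inequality, the clipped moments being bounded by `M ^ 2`. -/
lemma accurate_compl_le {a M η : ℝ} (ha : 0 ≤ a) (hM : 1 ≤ M) (hη : 0 < η)
    (hbias : 4 / tailRate * tailConst * Real.exp (-(tailRate * M ^ 2 / 2)) ≤ η / 4)
    {R : Finset ℕ} (hR : R.Nonempty) :
    (outcomeLaw a).real {p | p.1 ∉ Accurate a M η R} ≤
      4 * Real.exp (-(R.card * η ^ 2 / (8 * M ^ 4))) := by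
  have hM0 : 0 ≤ M := by linarith
  have b1 : |∫ x, clip (-M) M x ∂(halfNormal a) - halfMean a| ≤ η / 4 := by
    refine (abs_integral_clip_sub_le ha hM (f := fun x => x) measurable_id (fun x hx => ?_)
      (integrable_halfNormal (by simpa using integrable_pow_gaussianReal (k := 1)))
      (fun x hx => ?_) ⟨M, abs_clip_le hM0⟩).trans hbias
    · rw [← sq_abs]; nlinarith
    · have := abs_clip_le hM0 x
      rw [← sq_abs]; nlinarith
  have b2 : |∫ x, clip (-M) M x ^ 2 ∂(halfNormal a) - halfSq a| ≤ η / 4 := by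
    refine (abs_integral_clip_sub_le ha hM (f := fun x => x ^ 2) (by fun_prop) (fun x hx => ?_)
      (integrable_halfNormal integrable_pow_gaussianReal) (fun x hx => ?_)
      ⟨M ^ 2, fun x => ?_⟩).trans hbias
    · rw [abs_of_nonneg (sq_nonneg x)]
    · rw [abs_of_nonneg (sq_nonneg _), ← sq_abs x, ← sq_abs (clip _ _ _)]
      have := abs_clip_le_abs hM0 x
      gcongr
    · rw [abs_of_nonneg (sq_nonneg _)]
      exact sq_clip_le hM0 x
  have hD : ∀ x, |clip (-M) M x| ≤ M ^ 2 := fun x =>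
    (abs_clip_le hM0 x).trans (by nlinarith)
  have hD2 : ∀ x, |clip (-M) M x ^ 2| ≤ M ^ 2 := fun x => by
    rw [abs_of_nonneg (sq_nonneg _)]
    exact sq_clip_le hM0 x
  have h1 := outcomeLaw_avgOver_le (a := a) (measurable_clip (-M) M) (by positivity : 0 < M ^ 2)
    hD hR (by positivity : 0 ≤ η / 2)
  have h2 := outcomeLaw_avgOver_le (a := a) ((measurable_clip (-M) M).pow_const 2)
    (by positivity : 0 < M ^ 2) hD2 hR (by positivity : 0 ≤ η / 2)
  have e : R.card * (η / 2) ^ 2 / (2 * (M ^ 2) ^ 2) = R.card * η ^ 2 / (8 * M ^ 4) := by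
    field_simp
    norm_num
  rw [e] at h1 h2
  have hsub : {p : Outcome | p.1 ∉ Accurate a M η R} ⊆
      {p | η / 2 ≤ |avgOver R (clip (-M) M) p.1 - ∫ x, clip (-M) M x ∂(halfNormal a)|} ∪
      {p | η / 2 ≤ |avgOver R (fun x => clip (-M) M x ^ 2) p.1 -
        ∫ x, clip (-M) M x ^ 2 ∂(halfNormal a)|} := by
    intro p hp
    by_contra hcon
    simp only [Set.mem_union, Set.mem_ofPred_eq, not_or, not_le] at hcon
    refine hp ⟨?_, ?_⟩
    · have := abs_sub_le (avgOver R (clip (-M) M) p.1) (∫ x, clip (-M) M x ∂(halfNormal a))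
        (halfMean a)
      linarith [hcon.1]
    · have := abs_sub_le (avgOver R (fun x => clip (-M) M x ^ 2) p.1)
        (∫ x, clip (-M) M x ^ 2 ∂(halfNormal a)) (halfSq a)
      linarith [hcon.2]
  have := (measureReal_mono (μ := outcomeLaw a) hsub (measure_ne_top _ _)).trans (measureReal_union_le _ _)
  linarith

/-- A Chernoff bound rather than Hoeffding, since the target frequency `κ` is of order `1 / T`. The
hypothesis `hκ` bounds the exponential moment of the indicator by `exp (θ * κ / 2)`, half of the
exponent to be gained. -/
lemma scarce_compl_le {a M κ θ : ℝ} (ha : 0 ≤ a) (hM : 0 ≤ M) (hθ : 0 ≤ θ)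
    (hκ : tailConst * Real.exp (θ - tailRate * M ^ 2) ≤ θ * κ / 2) {R : Finset ℕ}
    (hR : R.Nonempty) :
    (outcomeLaw a).real {p | p.1 ∉ Scarce M κ R} ≤ Real.exp (-(R.card * (θ * κ / 2))) := by
  have hc : (0 : ℝ) < R.card := by exact_mod_cast hR.card_pos
  have hm := measurable_exceed M
  have hexp : ∀ x : ℝ, Real.exp (θ * {x : ℝ | M < |x|}.indicator 1 x) ≤
      1 + Real.exp θ * {x : ℝ | M < |x|}.indicator 1 x := by
    intro x
    by_cases hx : x ∈ {x : ℝ | M < |x|}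
    · rw [Set.indicator_of_mem hx]; simp
    · rw [Set.indicator_of_notMem hx]; simp
  have hind : Integrable (fun x => ({x : ℝ | M < |x|}.indicator 1 x : ℝ)) (halfNormal a) :=
    integrable_of_measurable_of_bound hm 1 fun x => by
      by_cases hx : x ∈ {x : ℝ | M < |x|} <;> simp [hx]
  have hint : Integrable (fun x => Real.exp (θ * {x : ℝ | M < |x|}.indicator 1 x))
      (halfNormal a) := by
    refine integrable_of_measurable_of_bound (by fun_prop) (1 + Real.exp θ) fun x => ?_
    rw [abs_of_pos (Real.exp_pos _)]
    refine (hexp x).trans ?_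
    have : ({x : ℝ | M < |x|}.indicator 1 x : ℝ) ≤ 1 :=
      Set.indicator_le_self' (fun _ _ => zero_le_one) x
    have := mul_le_mul_of_nonneg_left this (Real.exp_pos θ).le
    linarith
  have hC : ∫ x, Real.exp (θ * {x : ℝ | M < |x|}.indicator 1 x) ∂(halfNormal a) ≤
      Real.exp (θ * κ / 2) := by
    have h1 : ∫ x, Real.exp (θ * {x : ℝ | M < |x|}.indicator 1 x) ∂(halfNormal a) ≤
        ∫ x, (1 + Real.exp θ * {x : ℝ | M < |x|}.indicator 1 x) ∂(halfNormal a) :=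
      integral_mono hint ((integrable_const _).add (hind.const_mul _)) hexp
    rw [integral_add (integrable_const _) (hind.const_mul _), integral_const_mul] at h1
    simp only [integral_const, probReal_univ, smul_eq_mul, mul_one] at h1
    have h2 := mul_le_mul_of_nonneg_left (integral_exceed_halfNormal_le (M := M) ha hM)
      (Real.exp_pos θ).le
    have h3 : Real.exp θ * (tailConst * Real.exp (-(tailRate * M ^ 2))) =
        tailConst * Real.exp (θ - tailRate * M ^ 2) := by
      rw [sub_eq_add_neg, Real.exp_add]; ring
    rw [h3] at h2
    have := Real.add_one_le_exp (θ * κ / 2)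
    linarith
  have h := iid_chernoff (halfNormal a) hm hθ hint hC R (R.card * κ)
  have hset : MeasurableSet {y : ℕ → ℝ | y ∉ Scarce M κ R} := (measurableSet_scarce M κ R).compl
  refine (le_of_eq (outcomeLaw_real_fst hset)).trans (le_trans (measureReal_mono (fun y hy => ?_)
    (measure_ne_top _ _)) (h.trans (le_of_eq ?_)))
  · simp only [Scarce, Set.mem_ofPred_eq, not_le, avgOver] at hy ⊢
    rw [lt_div_iff₀ hc, mul_comm] at hy
    exact hy.le
  · rw [← Real.exp_nat_mul, ← Real.exp_add]
    congr 1
    ring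

/-! ## Success of most runs -/

-- With `ℓ = 1 + log T`, all parameters are tuned so that a batch is bad with weighted probability
-- at most `2 * p₁`, while the reservoir fails with probability at most a multiple of `exp (-4 ℓ
-- B)`: squared clipping level `m₀ ℓ`, exceedance frequency `p₁ / T`, moment accuracy `η ^ 2 = k₁ M
-- ^ 4 ℓ / T`, squared error `k ℓ ^ 4 / T`.
set_option maxHeartbeats 1000000 in
lemma exists_many_bad_le_exp {r : ℝ} (hr : 1 < r) : ∃ m₀ k C : ℝ, 0 < m₀ ∧ 0 < k ∧ 0 < C ∧
    ∀ {a : ℝ} {N T B : ℕ}, 0 ≤ a → 4 ≤ B → 0 < T → B * T ≤ N →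
      (outcomeLaw a).real {p | Regular r a N p.1 ∧ ∃ J ⊆ Finset.range B, J.card = B / 4 ∧
        ∀ β ∈ J, p ∈ BadBatch r a √(m₀ * (1 + Real.log T)) √(k * (1 + Real.log T) ^ 4 / T) N T β} ≤
      C * Real.exp (-(2 * B)) := by
  obtain ⟨K, hK, hbad⟩ := exists_many_bad_le hr
  have hs := tailRate_pos
  have hCt := one_le_tailConst
  set s := tailRate
  set Ct := tailConst
  -- So small that `(2 * p₁) ^ (B / 4)` beats the number `2 ^ B` of subsets of batches.
  obtain ⟨p₁, hp₁⟩ : ∃ x : ℝ, x = Real.exp (-24) / 2 := ⟨_, rfl⟩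
  have hp₁0 : 0 < p₁ := by rw [hp₁]; positivity
  have hp₁1 : p₁ ≤ 1 / 4 := by
    have h1 := Real.add_one_le_exp (24 : ℝ)
    have h2 : Real.exp (-24) ≤ 1 / 2 := by
      rw [Real.exp_neg, one_div]
      exact inv_anti₀ (by norm_num) (by linarith)
    linarith
  -- The `64` gives the exponent `4 ℓ B` in Hoeffding's inequality for a reservoir of at least `B *
  -- T / 2` values; the square makes `η` dominate the clipping bias.
  obtain ⟨k₁, hk₁⟩ : ∃ x : ℝ, x = 64 + (16 / s * Ct) ^ 2 := ⟨_, rfl⟩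
  have hk₁0 : 64 ≤ k₁ := by rw [hk₁]; linarith [sq_nonneg (16 / s * Ct)]
  -- The Chernoff parameter is `θ = k₂ ℓ`, which again gives the exponent `4 ℓ B`.
  obtain ⟨k₂, hk₂⟩ : ∃ x : ℝ, x = 16 / p₁ := ⟨_, rfl⟩
  have hk₂0 : 0 < k₂ := by rw [hk₂]; positivity
  -- Large enough for the tail beyond `M` to beat `1 / T` in the bias, and also the factor `exp (k₂
  -- ℓ)` in the Chernoff condition.
  obtain ⟨m₀, hm₀⟩ : ∃ x : ℝ, x = (k₂ + 2 + Ct) / s + 1 := ⟨_, rfl⟩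
  have hm₀1 : 1 ≤ m₀ := by rw [hm₀]; linarith [(by positivity : 0 ≤ (k₂ + 2 + Ct) / s)]
  have hsm : s * m₀ = k₂ + 2 + Ct + s := by rw [hm₀]; field_simp
  -- Chosen so that Markov's inequality bounds the probability of a large error by `p₁`.
  obtain ⟨k, hk⟩ : ∃ x : ℝ, x = (K + 1) * m₀ ^ 2 * (k₁ + 1) / p₁ := ⟨_, rfl⟩
  have hk0 : 0 < k := by rw [hk]; positivity
  obtain ⟨Cq, hCq⟩ : ∃ x : ℝ, x = 1 + 4 * (K * m₀ ^ 2 / k) := ⟨_, rfl⟩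
  have hCq0 : 0 < Cq := by rw [hCq]; positivity
  refine ⟨m₀, k, 1 + 2 * Cq, by linarith, hk0, by positivity, fun {a N T B} ha hB hT hBT => ?_⟩
  have hT' : (0 : ℝ) < T := by exact_mod_cast hT
  have hT1 : (1 : ℝ) ≤ T := by exact_mod_cast hT
  obtain ⟨ℓ, hℓ⟩ : ∃ x : ℝ, x = 1 + Real.log T := ⟨_, rfl⟩
  have hℓ1 : 1 ≤ ℓ := by
    have := Real.log_nonneg hT1
    linarith
  have hTexp : (T : ℝ) * Real.exp 1 = Real.exp ℓ := by
    rw [hℓ, Real.exp_add, Real.exp_log hT', mul_comm]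
  have hTle : (T : ℝ) ≤ Real.exp ℓ := by
    rw [← hTexp]
    exact le_mul_of_one_le_right hT'.le (Real.one_le_exp (by norm_num))
  have hTinv : Real.exp (-ℓ) ≤ 1 / T := by
    rw [Real.exp_neg, one_div]
    exact inv_anti₀ hT' hTle
  obtain ⟨M, hM⟩ : ∃ x : ℝ, x = √(m₀ * ℓ) := ⟨_, rfl⟩
  have hM2 : M ^ 2 = m₀ * ℓ := by rw [hM, Real.sq_sqrt (by positivity)]
  have hM4 : M ^ 4 = m₀ ^ 2 * ℓ ^ 2 := by
    rw [show M ^ 4 = (M ^ 2) ^ 2 by ring, hM2]; ring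
  have hM1 : 1 ≤ M := by
    rw [hM, Real.one_le_sqrt]
    exact one_le_mul_of_one_le_of_one_le hm₀1 hℓ1
  obtain ⟨ρ, hρ⟩ : ∃ x : ℝ, x = √(k * ℓ ^ 4 / T) := ⟨_, rfl⟩
  have hρ2 : ρ ^ 2 = k * ℓ ^ 4 / T := by rw [hρ, Real.sq_sqrt (by positivity)]
  have hρ0 : 0 < ρ := by rw [hρ]; exact Real.sqrt_pos.2 (by positivity)
  obtain ⟨η, hη⟩ : ∃ x : ℝ, x = √(k₁ * M ^ 4 * ℓ / T) := ⟨_, rfl⟩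
  have hη2 : η ^ 2 = k₁ * M ^ 4 * ℓ / T := by rw [hη, Real.sq_sqrt (by positivity)]
  have hη0 : 0 < η := by rw [hη]; exact Real.sqrt_pos.2 (by positivity)
  rw [← hℓ, ← hM, ← hρ]
  have hB0 : (4 : ℝ) ≤ B := by exact_mod_cast hB
  have hN : 0 < N := lt_of_lt_of_le (by positivity) hBT
  have hNr : (B : ℝ) * T ≤ N := by exact_mod_cast hBT
  -- the concentration of reservoir averages
  have hbias : 4 / s * Ct * Real.exp (-(s * M ^ 2 / 2)) ≤ η / 4 := by
    have h1 : Real.exp (-(s * M ^ 2 / 2)) ≤ 1 / T := by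
      refine le_trans (Real.exp_le_exp.2 ?_) hTinv
      rw [hM2, ← mul_assoc, hsm]
      have : 2 * ℓ ≤ (k₂ + 2 + Ct + s) * ℓ := by gcongr; linarith
      linarith
    have h2 : 16 / s * Ct * (1 / T) ≤ η := by
      rw [hη]
      refine Real.le_sqrt_of_sq_le ?_
      rw [mul_pow, hM4]
      have e : k₁ * (m₀ ^ 2 * ℓ ^ 2) * ℓ / T = k₁ * (m₀ ^ 2 * ℓ ^ 2 * ℓ) * (1 / T) := by ring
      rw [e]
      have h3 : (1 / (T : ℝ)) ^ 2 ≤ 1 / T := by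
        have : 1 / (T : ℝ) ≤ 1 := by rw [div_le_one hT']; exact hT1
        exact pow_le_of_le_one (by positivity) this (by norm_num)
      have h4 : 1 ≤ m₀ ^ 2 * ℓ ^ 2 * ℓ := by
        have := one_le_pow₀ (n := 2) hm₀1
        have := one_le_pow₀ (n := 2) hℓ1
        exact one_le_mul_of_one_le_of_one_le (one_le_mul_of_one_le_of_one_le ‹_› ‹_›) hℓ1
      have h5 : (16 / s * Ct) ^ 2 ≤ k₁ * (m₀ ^ 2 * ℓ ^ 2 * ℓ) :=
        le_trans (by rw [hk₁]; linarith) (le_mul_of_one_le_right (by linarith) h4)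
      gcongr
    have h3 := mul_le_mul_of_nonneg_left h1 (by positivity : 0 ≤ 4 / s * Ct)
    have e : 4 / s * Ct * (1 / T) = (16 / s * Ct * (1 / T)) / 4 := by ring
    linarith
  have hscarce : Ct * Real.exp (k₂ * ℓ - s * M ^ 2) ≤ k₂ * ℓ * (p₁ / T) / 2 := by
    have e1 : k₂ * ℓ * (p₁ / T) / 2 = 8 * ℓ * (1 / T) := by
      rw [hk₂]; field_simp; norm_num
    have e2 : Real.exp (k₂ * ℓ - s * M ^ 2) ≤ Real.exp (-Ct) * Real.exp (-ℓ) := by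
      rw [← Real.exp_add]
      refine Real.exp_le_exp.2 ?_
      rw [hM2, ← mul_assoc, hsm]
      have := le_mul_of_one_le_right (by linarith : 0 ≤ Ct) hℓ1
      have : 0 ≤ s * ℓ := by positivity
      linarith
    have e3 : Ct * Real.exp (-Ct) ≤ 1 := by
      have : Ct ≤ Real.exp Ct := by have := Real.add_one_le_exp Ct; linarith
      calc Ct * Real.exp (-Ct) ≤ Real.exp Ct * Real.exp (-Ct) := by gcongr
        _ = 1 := by rw [← Real.exp_add]; simp
    rw [e1]
    calc Ct * Real.exp (k₂ * ℓ - s * M ^ 2) ≤ Ct * (Real.exp (-Ct) * Real.exp (-ℓ)) := by gcongr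
      _ = Ct * Real.exp (-Ct) * Real.exp (-ℓ) := by ring
      _ ≤ 1 * (1 / T) := by gcongr
      _ ≤ 8 * ℓ * (1 / T) := by gcongr; linarith
  have hfin := hbad (a := a) (M := M) (ρ := ρ) (η := η) (κ := p₁ / T) (ℓ := ℓ) (π := 2 * p₁)
    (q := Cq * Real.exp (-(3 * B))) (N := N) (T := T) (B := B) (m := B / 4) ha hM1 hT hρ0
    (by positivity) (hℓ ▸ harmonic_le_one_add_log T) hBT hN (by omega) ?_ (by linarith) ?_
  · refine hfin.trans ?_
    have h1 : (2 : ℝ) ^ B ≤ Real.exp B := by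
      rw [← mul_one (B : ℝ), Real.exp_nat_mul]
      refine pow_le_pow_left₀ (by norm_num) ?_ _
      have := Real.add_one_le_exp (1 : ℝ)
      linarith
    -- The rounded quotient satisfies `B ≤ 8 * (B / 4)` for `B ≥ 4`, and `24 / 8 = 3`.
    have h2 : (2 * p₁) ^ (B / 4) ≤ Real.exp (-(3 * B)) := by
      rw [hp₁, mul_div_cancel₀ _ (by norm_num : (2 : ℝ) ≠ 0), ← Real.exp_nat_mul]
      refine Real.exp_le_exp.2 ?_
      have : B ≤ 8 * (B / 4) := by omega
      have : (B : ℝ) ≤ 8 * ((B / 4 : ℕ) : ℝ) := by exact_mod_cast this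
      linarith
    have e : Real.exp (-(2 * B)) = Real.exp B * Real.exp (-(3 * B)) := by
      rw [← Real.exp_add]; congr 1; ring
    rw [e]
    calc (2 : ℝ) ^ B * ((2 * p₁) ^ (B / 4) + 2 * (Cq * Real.exp (-(3 * B))))
        ≤ Real.exp B * (Real.exp (-(3 * B)) + 2 * (Cq * Real.exp (-(3 * B)))) := by gcongr
      _ = _ := by ring
  · have e1 : T * (p₁ / T) = p₁ := by field_simp
    rw [e1, hη2, hρ2, hM4]
    have h1 : K * (k₁ * (m₀ ^ 2 * ℓ ^ 2) * ℓ / T + m₀ ^ 2 * ℓ ^ 2 * ℓ ^ 2 / T) ≤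
        p₁ * (k * ℓ ^ 4 / T) := by
      have e2 : p₁ * (k * ℓ ^ 4 / T) = (K + 1) * (m₀ ^ 2 * (k₁ + 1) * ℓ ^ 4 / T) := by
        rw [hk]; field_simp
      have e3 : k₁ * (m₀ ^ 2 * ℓ ^ 2) * ℓ / T + m₀ ^ 2 * ℓ ^ 2 * ℓ ^ 2 / T ≤
          m₀ ^ 2 * (k₁ + 1) * ℓ ^ 4 / T := by
        rw [← add_div]
        gcongr
        have : ℓ ^ 3 ≤ ℓ ^ 4 := pow_le_pow_right₀ hℓ1 (by norm_num)
        have := mul_le_mul_of_nonneg_left this (by positivity : 0 ≤ k₁ * m₀ ^ 2)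
        linarith
      rw [e2]
      have := mul_le_mul_of_nonneg_left e3 hK
      have : 0 ≤ m₀ ^ 2 * (k₁ + 1) * ℓ ^ 4 / T := by positivity
      linarith
    have h2 := (div_le_iff₀ (by positivity : 0 < k * ℓ ^ 4 / T)).2 h1
    linarith
  · intro R hR
    have hRr : (B : ℝ) * T / 2 ≤ R.card := by
      have : (N : ℝ) ≤ 2 * R.card := by exact_mod_cast hR
      linarith
    have hRne : R.Nonempty := Finset.card_pos.1 (by
      omega)
    -- The prefactors of the reservoir failures are of order `T ≤ exp ℓ`; one of the four units of
    -- the exponent pays for them.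
    have hq : Real.exp ℓ * Real.exp (-(4 * ℓ * B)) ≤ Real.exp (-(3 * B)) := by
      rw [← Real.exp_add]
      refine Real.exp_le_exp.2 ?_
      have h1 := le_mul_of_one_le_right (by linarith : 0 ≤ ℓ) (by linarith : (1 : ℝ) ≤ B)
      have h2 := le_mul_of_one_le_left (by linarith : 0 ≤ (B : ℝ)) hℓ1
      linarith
    have a1 := accurate_compl_le ha hM1 hη0 hbias hRne
    have a2 := scarce_compl_le ha (by linarith : 0 ≤ M) (by positivity : 0 ≤ k₂ * ℓ) hscarce hRne
    have a3 : Real.exp (-(R.card * η ^ 2 / (8 * M ^ 4))) ≤ Real.exp (-(4 * ℓ * B)) := by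
      refine Real.exp_le_exp.2 (neg_le_neg ?_)
      have e : R.card * η ^ 2 / (8 * M ^ 4) = R.card * (k₁ * ℓ / (8 * T)) := by
        rw [hη2]; field_simp
      rw [e]
      refine le_trans ?_ (mul_le_mul_of_nonneg_right hRr (by positivity))
      have e' : (B : ℝ) * T / 2 * (k₁ * ℓ / (8 * T)) = k₁ / 16 * (ℓ * B) := by field_simp; norm_num
      rw [e']
      have : 4 * (ℓ * B) ≤ k₁ / 16 * (ℓ * B) := by gcongr; linarith
      linarith
    have a4 : Real.exp (-(R.card * (k₂ * ℓ * (p₁ / T) / 2))) ≤ Real.exp (-(4 * ℓ * B)) := by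
      refine Real.exp_le_exp.2 (neg_le_neg ?_)
      refine le_trans (le_of_eq ?_) (mul_le_mul_of_nonneg_right hRr (by positivity))
      rw [hk₂]
      field_simp
      norm_num
    have a5 : K * M ^ 4 / ρ ^ 2 ≤ K * m₀ ^ 2 / k * Real.exp ℓ := by
      have e : K * M ^ 4 / ρ ^ 2 = K * m₀ ^ 2 / k * (T * (1 / ℓ ^ 2)) := by
        rw [hM4, hρ2]; field_simp
      rw [e]
      refine mul_le_mul_of_nonneg_left ?_ (by positivity)
      refine le_trans (mul_le_of_le_one_right hT'.le ?_) hTle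
      rw [div_le_one (by positivity)]
      exact one_le_pow₀ hℓ1
    calc T * (outcomeLaw a).real {p | p.1 ∉ Scarce M (p₁ / T) R} +
          K * M ^ 4 / ρ ^ 2 * (outcomeLaw a).real {p | p.1 ∉ Accurate a M η R}
        ≤ Real.exp ℓ * Real.exp (-(4 * ℓ * B)) +
          K * m₀ ^ 2 / k * Real.exp ℓ * (4 * Real.exp (-(4 * ℓ * B))) :=
          add_le_add (mul_le_mul hTle (a2.trans a4) measureReal_nonneg (by positivity))
            (mul_le_mul a5 (a1.trans (by gcongr)) measureReal_nonneg (by positivity))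
      _ = Cq * (Real.exp ℓ * Real.exp (-(4 * ℓ * B))) := by rw [hCq]; ring
      _ ≤ _ := by gcongr

/-! ## Regularity of the data -/

lemma gaussianReal_le_halfNormal {a : ℝ} {S : Set ℝ} (hS : S ⊆ Set.Ioi (-a)) :
    (gaussianReal 0 1).real S ≤ (halfNormal a).real S := by
  unfold halfNormal
  refine ENNReal.toReal_mono (measure_ne_top _ _) ?_
  rw [ProbabilityTheory.cond_apply measurableSet_Ioi, Set.inter_eq_right.2 hS]
  refine le_mul_of_one_le_left (zero_le) ?_
  exact ENNReal.one_le_inv.2 prob_le_one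

/-- The second moment bounds mean and variance from above. For the lower bound on the variance, at
least one of the intervals `(0, 1]` and `(2, 3]` is at distance `1 / 2` from the empirical mean, and
each holds a positive fraction of the values. -/
lemma regular_of_moments {a p C : ℝ} {N : ℕ} {y : ℕ → ℝ} (hN : 0 < N) (hp : 0 < p) (hC : 0 < C)
    (ha : ∀ j < N, -a < y j) (hsq : ∑ j ∈ Finset.range N, y j ^ 2 ≤ N * C)
    (h1 : p / 2 * N ≤ ∑ j ∈ Finset.range N, (Set.Ioc (0 : ℝ) 1).indicator 1 (y j))
    (h2 : p / 2 * N ≤ ∑ j ∈ Finset.range N, (Set.Ioc (2 : ℝ) 3).indicator 1 (y j)) :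
    Regular (2 + C + 8 / p) a N y := by
  have hN' : (0 : ℝ) < N := by exact_mod_cast hN
  set m := empMean N y with hm
  set V := (∑ j ∈ Finset.range N, (y j - m) * (y j - m)) / N with hV
  have hsum : ∑ j ∈ Finset.range N, y j = N * m := by rw [hm, empMean]; field_simp
  have hVlow : p / 8 ≤ V := by
    rw [hV, le_div_iff₀ hN']
    have key : ∀ I : Set ℝ, (∀ x ∈ I, 1 / 4 ≤ (x - m) * (x - m)) →
        p / 2 * N ≤ ∑ j ∈ Finset.range N, I.indicator 1 (y j) →
        p / 8 * N ≤ ∑ j ∈ Finset.range N, (y j - m) * (y j - m) := by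
      intro I hI hle
      have : ∑ j ∈ Finset.range N, 1 / 4 * (I.indicator 1 (y j) : ℝ) ≤
          ∑ j ∈ Finset.range N, (y j - m) * (y j - m) := by
        refine Finset.sum_le_sum fun j _ => ?_
        by_cases h : y j ∈ I
        · rw [Set.indicator_of_mem h, Pi.one_apply, mul_one]
          exact hI _ h
        · rw [Set.indicator_of_notMem h, mul_zero]
          exact mul_self_nonneg _
      rw [← Finset.mul_sum] at this
      linarith
    rcases le_total m (3 / 2) with h | h
    · refine key _ (fun x hx => ?_) h2
      nlinarith [hx.1]
    · refine key _ (fun x hx => ?_) h1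
      nlinarith [hx.2]
  have hexpand : ∑ j ∈ Finset.range N, (y j - m) * (y j - m) =
      ∑ j ∈ Finset.range N, y j ^ 2 - N * m ^ 2 := by
    have e : ∀ j, (y j - m) * (y j - m) = y j ^ 2 - 2 * m * y j + m ^ 2 := fun j => by ring
    simp only [e]
    rw [Finset.sum_add_distrib, Finset.sum_sub_distrib, ← Finset.mul_sum, hsum, Finset.sum_const,
      Finset.card_range, nsmul_eq_mul]
    ring
  have hVm : V + m ^ 2 ≤ C := by
    rw [hV, hexpand, div_add' _ _ _ hN'.ne', div_le_iff₀ hN']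
    linarith
  have hV0 : 0 < V := by linarith [(by positivity : 0 < p / 8)]
  have hsd : empSd N y = √V := rfl
  have hsd2 : empSd N y ^ 2 = V := by rw [hsd, Real.sq_sqrt hV0.le]
  have hr : 8 / p ≤ 2 + C + 8 / p := by linarith
  have habs : |m * empSd N y| ≤ C := by
    refine abs_le_of_sq_le_sq ?_ hC.le
    rw [mul_pow, hsd2]
    nlinarith [sq_nonneg m, sq_nonneg (V - m ^ 2), sq_nonneg (V + m ^ 2)]
  rw [abs_le] at habs
  have h8 : 0 < 8 / p := by positivity
  refine ⟨ha, by rw [hsd]; exact Real.sqrt_pos.2 hV0, ⟨?_, ?_⟩, ?_, ?_⟩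
  · change 1 / (2 + C + 8 / p) ≤ empSd N y ^ 2
    rw [hsd2]
    refine le_trans ?_ hVlow
    rw [one_div, show p / 8 = (8 / p)⁻¹ by rw [inv_div]]
    exact inv_anti₀ h8 hr
  · change empSd N y ^ 2 ≤ _
    rw [hsd2]
    nlinarith [sq_nonneg m]
  · change 0 - (2 + C + 8 / p) ≤ -(m * empSd N y)
    linarith
  · change -(m * empSd N y) ≤ 2 + C + 8 / p
    linarith

lemma exists_regular : ∃ r k : ℝ, 1 < r ∧ 0 < k ∧ ∀ {a : ℝ} {N : ℕ}, 0 ≤ a → 0 < N →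
    (outcomeLaw a).real {p | ¬Regular r a N p.1} ≤ 5 * Real.exp (-(k * N)) := by
  have hs := tailRate_pos
  have hCt := one_le_tailConst
  set p := min ((gaussianReal 0 1).real (Set.Ioc 0 1)) ((gaussianReal 0 1).real (Set.Ioc 2 3))
    with hp
  have hp0 : 0 < p := lt_min
    (ENNReal.toReal_pos (gaussianReal_pos (by simp)) (measure_ne_top _ _))
    (ENNReal.toReal_pos (gaussianReal_pos (by simp; norm_num)) (measure_ne_top _ _))
  -- With this threshold for the second moment, Chernoff's bound equals `exp (-N)`.
  set C := (1 + Real.log tailConst) / tailRate with hC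
  have hC0 : 0 < C := by
    have := Real.log_nonneg hCt
    positivity
  refine ⟨2 + C + 8 / p, min 1 (p ^ 2 / 8), ?_, by positivity, fun {a N} ha hN => ?_⟩
  · have : 0 < 8 / p := by positivity
    linarith
  have hN' : (0 : ℝ) < N := by exact_mod_cast hN
  set k := min 1 (p ^ 2 / 8)
  have hmR := measurableSet_regular (2 + C + 8 / p) a N
  refine (le_of_eq (outcomeLaw_real_fst hmR.compl)).trans ?_
  set P := Measure.infinitePi fun _ : ℕ => halfNormal a with hP
  have A0 : P.real {y | ∃ j < N, y j ≤ -a} = 0 := by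
    have hsub : {y : ℕ → ℝ | ∃ j < N, y j ≤ -a} ⊆ ⋃ j, (fun y : ℕ → ℝ => y j) ⁻¹' Set.Iic (-a) := by
      rintro y ⟨j, _, h⟩
      exact Set.mem_iUnion.2 ⟨j, h⟩
    have : P (⋃ j, (fun y : ℕ → ℝ => y j) ⁻¹' Set.Iic (-a)) = 0 := by
      refine measure_iUnion_null fun j => ?_
      rw [(measurePreserving_eval_infinitePi (fun _ : ℕ => halfNormal a) j).measure_preimage
        measurableSet_Iic.nullMeasurableSet, halfNormal,
        ProbabilityTheory.cond_apply measurableSet_Ioi]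
      have : Set.Ioi (-a) ∩ Set.Iic (-a) = ∅ := by
        ext x; simp
      rw [this]; simp
    rw [measureReal_def, measure_mono_null hsub this]
    simp
  have A1 : P.real {y | N * C ≤ ∑ j ∈ Finset.range N, y j ^ 2} ≤ Real.exp (-(k * N)) := by
    refine (iid_chernoff (halfNormal a) (f := fun x => x ^ 2) (by fun_prop) hs.le
      (integrable_exp_sq ha) (integral_exp_sq_le ha) (Finset.range N) _).trans ?_
    have e : tailConst ^ N = Real.exp (N * Real.log tailConst) := by
      rw [Real.exp_nat_mul, Real.exp_log (by linarith)]
    rw [Finset.card_range, e, ← Real.exp_add]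
    refine Real.exp_le_exp.2 ?_
    have e' : tailRate * (N * C) = N * (1 + Real.log tailConst) := by rw [hC]; field_simp
    rw [e']
    have : k ≤ 1 := min_le_left _ _
    nlinarith
  have A2 : ∀ I : Set ℝ, MeasurableSet I → I ⊆ Set.Ioi (-a) → p ≤ (gaussianReal 0 1).real I →
      P.real {y | ∑ j ∈ Finset.range N, (I.indicator 1 (y j) : ℝ) < p / 2 * N} ≤
        2 * Real.exp (-(k * N)) := by
    intro I hI hIa hpI
    have hE : p ≤ ∫ x, (I.indicator 1 x : ℝ) ∂(halfNormal a) := by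
      rw [integral_indicator_one hI]
      exact hpI.trans (gaussianReal_le_halfNormal hIa)
    have h := iid_hoeffding (halfNormal a) (f := I.indicator 1) (measurable_one.indicator hI)
      one_pos (fun x => by by_cases h : x ∈ I <;> simp [h]) (Finset.range N)
      (by positivity : 0 ≤ p / 2)
    rw [Finset.card_range] at h
    refine le_trans (measureReal_mono (fun y hy => ?_) (measure_ne_top _ _)) (h.trans ?_)
    · simp only [Set.mem_ofPred_eq] at hy ⊢
      rw [abs_sub_comm]
      refine le_trans ?_ (le_abs_self _)
      nlinarith
    · have : k ≤ p ^ 2 / 8 := min_le_right _ _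
      have e : (N : ℝ) * (p / 2) ^ 2 / (2 * 1 ^ 2) = p ^ 2 / 8 * N := by ring
      rw [e]
      gcongr
  have hsub : {y | Regular (2 + C + 8 / p) a N y}ᶜ ⊆ {y | ∃ j < N, y j ≤ -a} ∪
      ({y | N * C ≤ ∑ j ∈ Finset.range N, y j ^ 2} ∪
      ({y | ∑ j ∈ Finset.range N, ((Set.Ioc (0 : ℝ) 1).indicator 1 (y j) : ℝ) < p / 2 * N} ∪
      {y | ∑ j ∈ Finset.range N, ((Set.Ioc (2 : ℝ) 3).indicator 1 (y j) : ℝ) < p / 2 * N})) := by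
    intro y hy
    by_contra hcon
    simp only [Set.mem_union, Set.mem_ofPred_eq, not_or, not_lt, not_le, not_exists, not_and]
      at hcon
    exact hy (regular_of_moments hN hp0 hC0 hcon.1 hcon.2.1.le hcon.2.2.1 hcon.2.2.2)
  have A3 := A2 (Set.Ioc 0 1) measurableSet_Ioc (fun x hx => by
    have := hx.1; simp only [Set.mem_Ioi]; linarith) (min_le_left _ _)
  have A4 := A2 (Set.Ioc 2 3) measurableSet_Ioc (fun x hx => by
    have := hx.1; simp only [Set.mem_Ioi]; linarith) (min_le_right _ _)
  have B1 := measureReal_mono (μ := P) hsub (measure_ne_top _ _)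
  have B2 := measureReal_union_le (μ := P) {y | ∃ j < N, y j ≤ -a}
    ({y | N * C ≤ ∑ j ∈ Finset.range N, y j ^ 2} ∪
      ({y | ∑ j ∈ Finset.range N, ((Set.Ioc (0 : ℝ) 1).indicator 1 (y j) : ℝ) < p / 2 * N} ∪
      {y | ∑ j ∈ Finset.range N, ((Set.Ioc (2 : ℝ) 3).indicator 1 (y j) : ℝ) < p / 2 * N}))
  have B3 := measureReal_union_le (μ := P) {y | N * C ≤ ∑ j ∈ Finset.range N, y j ^ 2}
      ({y | ∑ j ∈ Finset.range N, ((Set.Ioc (0 : ℝ) 1).indicator 1 (y j) : ℝ) < p / 2 * N} ∪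
      {y | ∑ j ∈ Finset.range N, ((Set.Ioc (2 : ℝ) 3).indicator 1 (y j) : ℝ) < p / 2 * N})
  have B4 := measureReal_union_le (μ := P)
      {y | ∑ j ∈ Finset.range N, ((Set.Ioc (0 : ℝ) 1).indicator 1 (y j) : ℝ) < p / 2 * N}
      {y | ∑ j ∈ Finset.range N, ((Set.Ioc (2 : ℝ) 3).indicator 1 (y j) : ℝ) < p / 2 * N}
  linarith

/-! ## Accuracy of the selected run -/

/-- A geometric median over the sample points is robust. If the minimizer were far from `u`, its
distances to the three quarters of good points would be large, and moving to a good point could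
increase the other distances only by the triangle inequality. -/
lemma dist_le_of_minimizes {E : Type*} [PseudoMetricSpace E] {B : ℕ} {f : ℕ → E} {u : E} {ρ : ℝ}
    {G : Finset ℕ} (hGB : G ⊆ Finset.range B) (hG : 3 * B ≤ 4 * G.card) (hB : 0 < B)
    (hgood : ∀ j ∈ G, dist (f j) u ≤ ρ) {β : ℕ}
    (hmin : ∀ j < B, ∑ i ∈ Finset.range B, dist (f β) (f i) ≤
      ∑ i ∈ Finset.range B, dist (f j) (f i)) : dist (f β) u ≤ 6 * ρ := by
  obtain ⟨j₀, hj₀⟩ : G.Nonempty := Finset.card_pos.1 (by omega)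
  have hρ : 0 ≤ ρ := dist_nonneg.trans (hgood j₀ hj₀)
  have h := hmin j₀ (Finset.mem_range.1 (hGB hj₀))
  rw [← Finset.sum_sdiff hGB, ← Finset.sum_sdiff hGB] at h
  set D := dist (f β) u with hD
  have hcard : ((Finset.range B \ G).card : ℝ) = B - G.card := by
    rw [Finset.card_sdiff_of_subset hGB, Finset.card_range, Nat.cast_sub]
    simpa using Finset.card_le_card hGB
  have h1 : (Finset.card G : ℝ) * (D - ρ) ≤ ∑ i ∈ G, dist (f β) (f i) := by
    rw [← nsmul_eq_mul]
    refine Finset.card_nsmul_le_sum _ _ _ fun i hi => ?_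
    have := dist_triangle (f β) (f i) u
    have := hgood i hi
    linarith
  have h2 : ∑ i ∈ G, dist (f j₀) (f i) ≤ (Finset.card G : ℝ) * (2 * ρ) := by
    rw [← nsmul_eq_mul]
    refine Finset.sum_le_card_nsmul _ _ _ fun i hi => ?_
    have := dist_triangle_right (f j₀) (f i) u
    have := hgood i hi
    have := hgood j₀ hj₀
    linarith
  have h3 : ∑ i ∈ Finset.range B \ G, dist (f j₀) (f i) ≤
      ∑ i ∈ Finset.range B \ G, dist (f β) (f i) + (B - G.card : ℝ) * (D + ρ) := by
    rw [← hcard, ← nsmul_eq_mul, ← Finset.sum_const, ← Finset.sum_add_distrib]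
    refine Finset.sum_le_sum fun i _ => ?_
    have := dist_triangle (f j₀) (f β) (f i)
    have := dist_triangle_right (f j₀) (f β) u
    have := hgood j₀ hj₀
    linarith
  have hg : (3 : ℝ) * B ≤ 4 * G.card := by exact_mod_cast hG
  have hgB : (G.card : ℝ) ≤ B := by
    have := Finset.card_le_card hGB
    rw [Finset.card_range] at this
    exact_mod_cast this
  have hB' : (0 : ℝ) < B := by exact_mod_cast hB
  -- With at least `3 B / 4` good points, this reads `B / 2 * D ≤ 3 * B * ρ`, whence the factor `6`.
  have h4 : (2 * G.card - B : ℝ) * D ≤ (2 * G.card + B) * ρ := by linarith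
  have hD0 : 0 ≤ D := dist_nonneg
  have h5 : (B : ℝ) / 2 * D ≤ (2 * G.card - B : ℝ) * D :=
    mul_le_mul_of_nonneg_right (by linarith) hD0
  have h6 : (2 * G.card + B : ℝ) * ρ ≤ 3 * B * ρ := mul_le_mul_of_nonneg_right (by linarith) hρ
  have h7 : (B : ℝ) / 2 * D ≤ B / 2 * (6 * ρ) := by linarith
  exact le_of_mul_le_mul_left h7 (by positivity)

/-- A pair of real numbers as a complex number. -/
def toComplex (v : ℝ × ℝ) : ℂ := ⟨v.1, v.2⟩

/-- The product type carries the maximum distance, whereas the algorithm uses the Euclidean one,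
which `ℂ` provides. -/
lemma dist_toComplex (v u : ℝ × ℝ) : dist (toComplex v) (toComplex u) = √(sqDist v u) := by
  rw [Complex.dist_eq_re_im]
  rfl

lemma totalDist_eq (B : ℕ) (run : ℕ → ℝ × ℝ) (β : ℕ) : totalDist B run β =
    ∑ j ∈ Finset.range B, dist (toComplex (run β)) (toComplex (run j)) := by
  unfold totalDist
  simp only [dist_toComplex, sqDist, sq]

lemma sq_avg_sub_le {T : ℕ} (hT : 0 < T) (f : ℕ → ℝ) (u : ℝ) :
    ((∑ t ∈ Finset.range T, f t) / T - u) ^ 2 ≤ (∑ t ∈ Finset.range T, (f t - u) ^ 2) / T := by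
  have hT' : (0 : ℝ) < T := by exact_mod_cast hT
  have e : (∑ t ∈ Finset.range T, f t) / T - u = (∑ t ∈ Finset.range T, (f t - u)) / T := by
    rw [Finset.sum_sub_distrib, Finset.sum_const, Finset.card_range, nsmul_eq_mul]
    field_simp
  rw [e, div_pow, div_le_div_iff₀ (by positivity) hT']
  have := sq_sum_le_card_mul_sum_sq (s := Finset.range T) (f := fun t => f t - u)
  rw [Finset.card_range] at this
  nlinarith

section Selection

variable {r a M ρ s : ℝ} {N B : ℕ} {p : Outcome}

/-- The natural parameters returned by the runs on unscaled data. -/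
def truncRun (r a : ℝ) (B N : ℕ) (p : Outcome) (β : ℕ) : ℝ × ℝ :=
  sgdAvg r (stepParam r) (threshold a N p.1) (N / B)
    (fun t => (p.1 (β * (N / B) + t) - empMean N p.1) / empSd N p.1) (fun t => p.2 (β, t))

lemma empMean_affine (hN : 0 < N) (s b : ℝ) (y : ℕ → ℝ) :
    empMean N (fun j => s * y j + b) = s * empMean N y + b := by
  have : (N : ℝ) ≠ 0 := by exact_mod_cast hN.ne'
  unfold empMean
  rw [Finset.sum_add_distrib, ← Finset.mul_sum, Finset.sum_const, Finset.card_range, nsmul_eq_mul]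
  field_simp

lemma empSd_affine (hN : 0 < N) (hs : 0 ≤ s) (b : ℝ) (y : ℕ → ℝ) :
    empSd N (fun j => s * y j + b) = s * empSd N y := by
  have e : ∀ j, (s * y j + b - (s * empMean N y + b)) * (s * y j + b - (s * empMean N y + b)) =
      s ^ 2 * ((y j - empMean N y) * (y j - empMean N y)) := fun j => by ring
  unfold empSd
  rw [empMean_affine hN]
  simp only [e]
  rw [← Finset.mul_sum, mul_div_assoc, Real.sqrt_mul (sq_nonneg s), Real.sqrt_sq hs]

/-- Standardization cancels the scale and the shift, so all analysis can be done on the half-normal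
data themselves. -/
lemma batchRun_affine (hN : 0 < N) (hs : 0 < s) (β : ℕ) :
    batchRun r (stepParam r) B N (fun j => s * p.1 j + s * a) (fun β t l => p.2 (β, t) l) β =
      truncRun r a B N p β := by
  unfold batchRun truncRun threshold
  rw [empMean_affine hN, empSd_affine hN hs.le, ← mul_add, mul_div_mul_left _ _ hs.ne']
  congr 1
  funext t
  rw [← mul_div_mul_left (p.1 _ - _) _ hs.ne']
  congr 1
  ring

lemma truncRun_mem (hr : 1 < r) (hT : 0 < N / B) (β : ℕ) : truncRun r a B N p β ∈ paramBox r := by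
  have hT' : (0 : ℝ) < ((N / B : ℕ) : ℝ) := by exact_mod_cast hT
  have h := fun t => sgd_mem hr (stepParam r) (threshold a N p.1)
    (fun t => (p.1 (β * (N / B) + t) - empMean N p.1) / empSd N p.1) (fun t => p.2 (β, t)) (t + 1)
  refine ⟨⟨?_, ?_⟩, ?_, ?_⟩
  · rw [truncRun, sgdAvg, le_div_iff₀ hT', mul_comm]
    simpa using Finset.card_nsmul_le_sum (Finset.range (N / B)) _ _ fun t _ => (h t).1.1
  · rw [truncRun, sgdAvg, div_le_iff₀ hT', mul_comm r]
    simpa using Finset.sum_le_card_nsmul (Finset.range (N / B)) _ _ fun t _ => (h t).1.2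
  · rw [truncRun, sgdAvg, le_div_iff₀ hT', mul_comm]
    simpa using Finset.card_nsmul_le_sum (Finset.range (N / B)) _ _ fun t _ => (h t).2.1
  · rw [truncRun, sgdAvg, div_le_iff₀ hT', mul_comm r]
    simpa using Finset.sum_le_card_nsmul (Finset.range (N / B)) _ _ fun t _ => (h t).2.2

/-- A batch that is not bad has no value beyond the clipping level, so the clipped iterates are the
true ones. Averaging the iterates does not increase the mean squared error. -/
lemma dist_truncRun_le (hρ : 0 ≤ ρ) (hT : 0 < N / B) {β : ℕ}
    (hb : p ∉ BadBatch r a M ρ N (N / B) β) :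
    dist (toComplex (truncRun r a B N p β)) (toComplex (target N p.1)) ≤ ρ := by
  simp only [BadBatch, Set.mem_union, Set.mem_ofPred_eq, not_or, not_exists, not_and, not_lt] at hb
  obtain ⟨h1, h2⟩ := hb
  have hc : ∀ t ≤ N / B, clippedIter r a M N (N / B) β p t = sgd r (stepParam r)
      (threshold a N p.1) (fun t => (p.1 (β * (N / B) + t) - empMean N p.1) / empSd N p.1)
      (fun t => p.2 (β, t)) t := fun t ht =>
    sgd_congr (fun i hi => by rw [clip_eq_self (h1 i (by omega))]) fun _ _ => rfl
  have hs : ∑ t ∈ Finset.range (N / B), sqDist (clippedIter r a M N (N / B) β p (t + 1))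
      (target N p.1) = ∑ t ∈ Finset.range (N / B), sqDist (sgd r (stepParam r)
      (threshold a N p.1) (fun t => (p.1 (β * (N / B) + t) - empMean N p.1) / empSd N p.1)
      (fun t => p.2 (β, t)) (t + 1)) (target N p.1) := by
    refine Finset.sum_congr rfl fun t ht => ?_
    have := Finset.mem_range.1 ht
    rw [hc (t + 1) (by omega)]
  rw [hs] at h2
  rw [dist_toComplex, Real.sqrt_le_left hρ]
  refine le_trans ?_ h2
  unfold sqDist truncRun sgdAvg
  rw [Finset.sum_add_distrib, add_div]
  exact add_le_add (sq_avg_sub_le hT _ _) (sq_avg_sub_le hT _ _)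

lemma unstandardize_eq {σ₀ : ℝ} (hσ : σ₀ ≠ 0) (μ₀ : ℝ) {v : ℝ × ℝ} (hv : v.1 ≠ 0) :
    unstandardize μ₀ σ₀ v = (μ₀ + σ₀ * (v.2 / v.1), σ₀ ^ 2 * (1 / v.1)) := by
  unfold unstandardize
  refine Prod.ext ?_ ?_
  · simp only
    field_simp
    ring
  · simp only
    field_simp

lemma unstandardize_close (hr : 1 < r) (hN : 0 < N) (hs : 0 < s)
    (hreg : Regular r a N p.1) {v : ℝ × ℝ} (hv : v ∈ paramBox r) {D : ℝ}
    (hD : dist (toComplex v) (toComplex (target N p.1)) ≤ D) :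
    |(unstandardize (empMean N fun j => s * p.1 j + s * a) (empSd N fun j => s * p.1 j + s * a)
        v).1 - s * a| ≤ 2 * r ^ 4 * s * D ∧
      |(unstandardize (empMean N fun j => s * p.1 j + s * a) (empSd N fun j => s * p.1 j + s * a)
        v).2 - s ^ 2| ≤ 2 * r ^ 4 * s ^ 2 * D := by
  have hr0 : 0 < r := by linarith
  have hσ := hreg.2.1
  have hu := hreg.2.2
  rw [empMean_affine hN, empSd_affine hN hs.le]
  set σ := empSd N p.1
  set m := empMean N p.1
  set u := target N p.1 with hu'
  have hu1 : u.1 = σ ^ 2 := rfl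
  have hu2 : u.2 = -(m * σ) := rfl
  obtain ⟨⟨v1, v2⟩, v3, v4⟩ := hv
  obtain ⟨⟨u1, u2⟩, u3, u4⟩ := hu
  have hri : 0 < 1 / r := by positivity
  have hv0 : 0 < v.1 := hri.trans_le v1
  have hu0 : 0 < u.1 := hri.trans_le u1
  rw [unstandardize_eq (by positivity) _ hv0.ne']
  have hD1 : |v.1 - u.1| ≤ D := by
    refine le_trans ?_ hD
    rw [dist_toComplex]
    exact Real.abs_le_sqrt (by unfold sqDist; nlinarith [sq_nonneg (v.2 - u.2)])
  have hD2 : |v.2 - u.2| ≤ D := by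
    refine le_trans ?_ hD
    rw [dist_toComplex]
    exact Real.abs_le_sqrt (by unfold sqDist; nlinarith [sq_nonneg (v.1 - u.1)])
  have hD0 : 0 ≤ D := (abs_nonneg _).trans hD1
  have hvi : 1 / v.1 ≤ r := by rw [div_le_iff₀ hv0]; rwa [div_le_iff₀ hr0, mul_comm] at v1
  have hui : 1 / u.1 ≤ r := by rw [div_le_iff₀ hu0]; rwa [div_le_iff₀ hr0, mul_comm] at u1
  have hinv : |1 / v.1 - 1 / u.1| ≤ r ^ 2 * D := by
    have e : 1 / v.1 - 1 / u.1 = 1 / v.1 * (1 / u.1) * (u.1 - v.1) := by field_simp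
    rw [e, abs_mul, abs_of_pos (by positivity), abs_sub_comm, sq]
    gcongr
  have hσ2 : σ ^ 2 ≤ r := hu1 ▸ u2
  have hσr : σ ≤ r := le_of_not_gt fun h => by nlinarith [mul_lt_mul'' h h hr0.le hr0.le]
  constructor
  · have e : s * m + s * a + s * σ * (v.2 / v.1) - s * a =
        s * σ * ((v.2 - u.2) * (1 / v.1) + u.2 * (1 / v.1 - 1 / u.1)) := by
      have : u.2 * (1 / u.1) = -(m / σ) := by rw [hu1, hu2]; field_simp
      rw [mul_sub u.2, this]
      field_simp
      ring
    simp only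
    rw [e, abs_mul, abs_of_pos (by positivity)]
    have h1 : |(v.2 - u.2) * (1 / v.1) + u.2 * (1 / v.1 - 1 / u.1)| ≤ D * r + r * (r ^ 2 * D) := by
      refine (abs_add_le _ _).trans (add_le_add ?_ ?_)
      · rw [abs_mul, abs_of_pos (by positivity : 0 < 1 / v.1)]
        gcongr
      · rw [abs_mul]
        have : |u.2| ≤ r := abs_le.2 ⟨by linarith, u4⟩
        gcongr
    have h2 : D * r + r * (r ^ 2 * D) ≤ 2 * r ^ 3 * D := by
      have : r ≤ r ^ 3 := le_self_pow₀ hr.le (by norm_num)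
      nlinarith
    calc s * σ * |(v.2 - u.2) * (1 / v.1) + u.2 * (1 / v.1 - 1 / u.1)|
        ≤ s * r * (2 * r ^ 3 * D) := by gcongr; exact h1.trans h2
      _ = _ := by ring
  · have e : (s * σ) ^ 2 * (1 / v.1) - s ^ 2 = s ^ 2 * (σ ^ 2 * (1 / v.1 - 1 / u.1)) := by
      rw [mul_sub (σ ^ 2), hu1]
      field_simp
    simp only
    rw [e, abs_mul, abs_mul, abs_of_pos (by positivity : 0 < s ^ 2),
      abs_of_pos (by positivity : 0 < σ ^ 2)]
    have : r ^ 3 ≤ r ^ 4 := pow_le_pow_right₀ hr.le (by norm_num)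
    calc s ^ 2 * (σ ^ 2 * |1 / v.1 - 1 / u.1|) ≤ s ^ 2 * (r * (r ^ 2 * D)) := by gcongr
      _ = r ^ 3 * s ^ 2 * D := by ring
      _ ≤ 2 * r ^ 4 * s ^ 2 * D := by
        have h1 := mul_le_mul_of_nonneg_right this (by positivity : 0 ≤ s ^ 2 * D)
        have h2 : 0 ≤ r ^ 4 * (s ^ 2 * D) := by positivity
        linarith

lemma estimate_close (hr : 1 < r) (hB : 4 ≤ B) (hBN : B ≤ N) (hs : 0 < s) (hρ : 0 ≤ ρ)
    (hreg : Regular r a N p.1)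
    (hfew : ¬∃ J ⊆ Finset.range B, J.card = B / 4 ∧ ∀ β ∈ J, p ∈ BadBatch r a M ρ N (N / B) β)
    {e : ℝ × ℝ} (he : IsEstimate r (stepParam r) B N (fun j => s * p.1 j + s * a)
      (fun β t l => p.2 (β, t) l) e) :
    |e.1 - s * a| ≤ 12 * r ^ 4 * s * ρ ∧ |e.2 - s ^ 2| ≤ 12 * r ^ 4 * s ^ 2 * ρ := by
  have hN : 0 < N := by omega
  have hT : 0 < N / B := Nat.div_pos hBN (by omega)
  have hsd : 0 < empSd N fun j => s * p.1 j + s * a := by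
    rw [empSd_affine hN hs.le]
    exact mul_pos hs hreg.2.1
  obtain ⟨β, hβ, hmin, rfl⟩ := he.2.2 hN.ne' hsd
  have hrun : batchRun r (stepParam r) B N (fun j => s * p.1 j + s * a)
      (fun β t l => p.2 (β, t) l) = truncRun r a B N p := funext fun β => batchRun_affine hN hs β
  rw [hrun] at hmin ⊢
  classical
  -- Otherwise at least `B / 4` batches would be bad, and a subset of exactly this size would
  -- contradict `hfew`.
  have hG : 3 * B ≤ 4 * ((Finset.range B).filter fun β => p ∉ BadBatch r a M ρ N (N / B) β).card := by
    have h1 := Finset.card_filter_add_card_filter_not (s := Finset.range B)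
      fun β => p ∉ BadBatch r a M ρ N (N / B) β
    rw [Finset.card_range] at h1
    by_contra hcon
    obtain ⟨J, hJ, hJc⟩ := Finset.exists_subset_card_eq
      (s := (Finset.range B).filter fun β => ¬p ∉ BadBatch r a M ρ N (N / B) β) (n := B / 4)
      (by omega)
    refine hfew ⟨J, hJ.trans (Finset.filter_subset _ _), hJc, fun β hβ => ?_⟩
    exact not_not.1 (Finset.mem_filter.1 (hJ hβ)).2
  have hD := dist_le_of_minimizes (f := fun β => toComplex (truncRun r a B N p β))
    (u := toComplex (target N p.1)) (Finset.filter_subset _ _) hG (by omega)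
    (fun j hj => dist_truncRun_le hρ hT (Finset.mem_filter.1 hj).2) (β := β)
    fun j hj => by simpa only [totalDist_eq] using hmin j hj
  obtain ⟨h1, h2⟩ := unstandardize_close hr hN hs hreg (truncRun_mem hr hT β) hD
  exact ⟨h1.trans (le_of_eq (by ring)), h2.trans (le_of_eq (by ring))⟩

end Selection

/-- The rate of convergence of the estimates, for batches of size `T`. -/
def rate (T : ℕ) : ℝ := √((1 + Real.log T) ^ 4 / T)

/-- The outcomes for which an estimate from `N` values deviates by more than the rate, up to the
constant `K`. -/
def BadEstimate (r K a s : ℝ) (B N : ℕ) : Set Outcome :=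
  {p | ∃ e, IsEstimate r (stepParam r) B N (fun j => s * p.1 j + s * a)
      (fun β t l => p.2 (β, t) l) e ∧
    ¬(|e.1 - s * a| ≤ K * s * rate (N / B) ∧ |e.2 - s ^ 2| ≤ K * s ^ 2 * rate (N / B))}

lemma exists_badEstimate_le : ∃ r K C k : ℝ, 1 < r ∧ 0 < K ∧ 0 < C ∧ 0 < k ∧
    ∀ {a s : ℝ} {B N : ℕ}, 0 ≤ a → 0 < s → 4 ≤ B → B ≤ N →
      (outcomeLaw a).real (BadEstimate r K a s B N) ≤ C * Real.exp (-(k * B)) := by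
  obtain ⟨r, k₀, hr, hk₀, hreg⟩ := exists_regular
  obtain ⟨m₀, k, C, hm₀, hk, hC, hbad⟩ := exists_many_bad_le_exp hr
  have hr0 : 0 < r := by linarith
  refine ⟨r, 12 * r ^ 4 * √k, C + 5, min 2 k₀, hr, by positivity, by linarith, by positivity,
    fun {a s B N} ha hs hB hBN => ?_⟩
  have hT : 0 < N / B := Nat.div_pos hBN (by omega)
  have h1 := hbad (a := a) (N := N) (T := N / B) ha hB hT (Nat.mul_div_le N B)
  have h2 := hreg (a := a) (N := N) ha (by omega)
  set ρ := √(k * (1 + Real.log ((N / B : ℕ) : ℝ)) ^ 4 / ((N / B : ℕ) : ℝ)) with hρ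
  have hρe : ρ = √k * rate (N / B) := by
    rw [hρ, rate, mul_div_assoc, Real.sqrt_mul hk.le]
  have hsub : BadEstimate r (12 * r ^ 4 * √k) a s B N ⊆ {p | ¬Regular r a N p.1} ∪
      {p | Regular r a N p.1 ∧ ∃ J ⊆ Finset.range B, J.card = B / 4 ∧
        ∀ β ∈ J, p ∈ BadBatch r a √(m₀ * (1 + Real.log ((N / B : ℕ) : ℝ))) ρ N (N / B) β} := by
    rintro p ⟨e, he, hne⟩
    by_cases hp : Regular r a N p.1
    · refine Or.inr ⟨hp, ?_⟩
      by_contra hfew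
      obtain ⟨e1, e2⟩ := estimate_close hr hB hBN hs (Real.sqrt_nonneg _) hp hfew he
      rw [← hρ, hρe] at e1 e2
      exact hne ⟨e1.trans (le_of_eq (by ring)), e2.trans (le_of_eq (by ring))⟩
    · exact Or.inl hp
  refine (measureReal_mono hsub (measure_ne_top _ _)).trans ((measureReal_union_le _ _).trans ?_)
  have hBN' : (B : ℝ) ≤ N := by exact_mod_cast hBN
  have e1 : Real.exp (-(k₀ * N)) ≤ Real.exp (-(min 2 k₀ * B)) := by
    refine Real.exp_le_exp.2 (neg_le_neg ?_)
    have : min 2 k₀ ≤ k₀ := min_le_right _ _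
    gcongr
  have e2 : Real.exp (-(2 * B)) ≤ Real.exp (-(min 2 k₀ * B)) := by
    refine Real.exp_le_exp.2 (neg_le_neg ?_)
    have : min 2 k₀ ≤ 2 := min_le_left _ _
    gcongr
  have e3 := mul_le_mul_of_nonneg_left e2 hC.le
  linarith

/-! ## The estimate for one coordinate -/

/-- The estimate `e` of the mean `b` and the variance `s ^ 2` has relative error at most `ρ`. -/
def Close (ρ b s : ℝ) (e : ℝ × ℝ) : Prop := |e.1 - b| ≤ ρ * s ∧ |e.2 - s ^ 2| ≤ ρ * s ^ 2

/-- The values and draws that admit an estimate that is not close. -/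
def BadValues (r ρ b s : ℝ) (B N : ℕ) : Set Outcome :=
  {p | ∃ e, IsEstimate r (stepParam r) B N p.1 (fun β t l => p.2 (β, t) l) e ∧ ¬Close ρ b s e}

lemma measurableSet_close (ρ b s : ℝ) : MeasurableSet {e | Close ρ b s e} :=
  (measurableSet_le (measurable_fst.sub_const b).abs measurable_const).inter
    (measurableSet_le (measurable_snd.sub_const (s ^ 2)).abs measurable_const)

lemma measurable_batchRun (r lam : ℝ) (B N β : ℕ) :
    Measurable fun p : Outcome => batchRun r lam B N p.1 (fun β t l => p.2 (β, t) l) β := by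
  have h := fun t => measurable_sgd (α := Outcome) (r := r) (lam := lam)
    (τ := fun p => 0 - empMean N p.1 / empSd N p.1)
    (y := fun p t => (p.1 (β * (N / B) + t) - empMean N p.1) / empSd N p.1)
    (ξ := fun p t l => p.2 (β, t) l) (by fun_prop)
    (measurable_pi_lambda _ fun t => by fun_prop) (by fun_prop) t
  unfold batchRun sgdAvg
  exact ((Finset.measurable_fun_sum _ fun t _ => (h (t + 1)).fst).div_const _).prodMk
    ((Finset.measurable_fun_sum _ fun t _ => (h (t + 1)).snd).div_const _)

lemma measurable_totalDist (r lam : ℝ) (B N β : ℕ) : Measurable fun p : Outcome =>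
    totalDist B (batchRun r lam B N p.1 fun β t l => p.2 (β, t) l) β := by
  have h := measurable_batchRun r lam B N
  unfold totalDist
  refine Finset.measurable_fun_sum _ fun j _ => Measurable.sqrt ?_
  have h1 := (h β).fst.sub (h j).fst
  have h2 := (h β).snd.sub (h j).snd
  exact (h1.mul h1).add (h2.mul h2)

lemma measurable_unstandardize :
    Measurable fun q : ℝ × ℝ × ℝ × ℝ => unstandardize q.1 q.2.1 q.2.2 := by
  unfold unstandardize
  fun_prop

/-- An estimate is not unique when scores tie, hence the existential quantifier. It ranges over at
most `B` candidates, each a measurable function of the outcome. -/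
lemma measurableSet_badValues (r ρ b s : ℝ) (B N : ℕ) : MeasurableSet (BadValues r ρ b s B N) := by
  have hC := (measurableSet_close ρ b s).compl
  rcases Nat.eq_zero_or_pos N with rfl | hN
  · have : BadValues r ρ b s B 0 = {_p | ¬Close ρ b s (0, 0)} := by
      ext p
      simp [BadValues, IsEstimate]
    rw [this]
    exact MeasurableSet.const _
  have hm : Measurable fun p : Outcome => (empMean N p.1, (0 : ℝ)) := by fun_prop
  have hu : ∀ β, Measurable fun p : Outcome => unstandardize (empMean N p.1) (empSd N p.1)
      (batchRun r (stepParam r) B N p.1 (fun β t l => p.2 (β, t) l) β) := by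
    intro β
    have := measurable_batchRun r (stepParam r) B N β
    have h1 : Measurable fun p : Outcome => empMean N p.1 := by fun_prop
    have h2 : Measurable fun p : Outcome => empSd N p.1 := by fun_prop
    have := measurable_unstandardize.comp (h1.prodMk (h2.prodMk this))
    exact this
  have hsd : MeasurableSet {p : Outcome | 0 < empSd N p.1} :=
    measurableSet_lt measurable_const (by fun_prop)
  have : BadValues r ρ b s B N = ({p | 0 < empSd N p.1}ᶜ ∩
      (fun p : Outcome => (empMean N p.1, (0 : ℝ))) ⁻¹' {e | Close ρ b s e}ᶜ) ∪
      ({p | 0 < empSd N p.1} ∩ ⋃ β ∈ Finset.range B, ((⋂ β' ∈ Finset.range B,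
        {p : Outcome | totalDist B (batchRun r (stepParam r) B N p.1 fun β t l => p.2 (β, t) l) β ≤
          totalDist B (batchRun r (stepParam r) B N p.1 fun β t l => p.2 (β, t) l) β'}) ∩
        (fun p : Outcome => unstandardize (empMean N p.1) (empSd N p.1)
          (batchRun r (stepParam r) B N p.1 (fun β t l => p.2 (β, t) l) β)) ⁻¹'
          {e | Close ρ b s e}ᶜ)) := by
    ext p
    by_cases h : 0 < empSd N p.1
    · simp only [BadValues, IsEstimate, hN.ne', h, Set.mem_union, Set.mem_inter_iff, Set.mem_compl_iff,
        Set.mem_ofPred_eq, Set.mem_preimage, Set.mem_iUnion, Set.mem_iInter, Finset.mem_range,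
        not_true, false_imp_iff, true_and, false_and, false_or, ne_eq, not_false_eq_true,
        true_imp_iff, exists_prop]
      constructor
      · rintro ⟨e, ⟨β, hβ, h1, rfl⟩, h2⟩
        exact ⟨β, hβ, h1, h2⟩
      · rintro ⟨β, hβ, h1, h2⟩
        exact ⟨_, ⟨β, hβ, h1, rfl⟩, h2⟩
    · simp only [BadValues, IsEstimate, hN.ne', h, Set.mem_union, Set.mem_inter_iff,
        Set.mem_compl_iff, Set.mem_ofPred_eq, Set.mem_preimage, not_false_eq_true, false_and,
        or_false, ne_eq, true_imp_iff, false_imp_iff, true_and, and_true]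
      constructor
      · rintro ⟨e, rfl, h2⟩
        exact h2
      · exact fun h2 => ⟨_, rfl, h2⟩
  rw [this]
  refine (hsd.compl.inter (hm hC)).union (hsd.inter
    (Finset.measurableSet_biUnion _ fun β _ => MeasurableSet.inter
      (Finset.measurableSet_biInter _ fun β' _ => ?_) (hu β hC)))
  exact measurableSet_le (measurable_totalDist ..) (measurable_totalDist ..)

lemma empMean_congr {N : ℕ} {y y' : ℕ → ℝ} (h : ∀ j < N, y j = y' j) :
    empMean N y = empMean N y' := by
  unfold empMean
  rw [Finset.sum_congr rfl fun j hj => h j (Finset.mem_range.1 hj)]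

lemma empSd_congr {N : ℕ} {y y' : ℕ → ℝ} (h : ∀ j < N, y j = y' j) :
    empSd N y = empSd N y' := by
  unfold empSd
  rw [empMean_congr h, Finset.sum_congr rfl fun j hj => by rw [h j (Finset.mem_range.1 hj)]]

/-- For `β < B` the batch ends before index `N`, so only the first `N` values matter; the rest of
the infinite sequence is arbitrary. -/
lemma batchRun_congr {r lam : ℝ} {B N β : ℕ} (hβ : β < B) {y y' : ℕ → ℝ} (h : ∀ j < N, y j = y' j)
    (ξ : ℕ → ℕ → ℕ → ℝ) : batchRun r lam B N y ξ β = batchRun r lam B N y' ξ β := by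
  have hs : ∀ t ≤ N / B, sgd r lam (0 - empMean N y / empSd N y)
      (fun t => (y (β * (N / B) + t) - empMean N y) / empSd N y) (ξ β) t =
      sgd r lam (0 - empMean N y' / empSd N y')
      (fun t => (y' (β * (N / B) + t) - empMean N y') / empSd N y') (ξ β) t := by
    intro t ht
    rw [empMean_congr h, empSd_congr h]
    refine sgd_congr (fun i hi => ?_) fun _ _ => rfl
    have h1 : (β + 1) * (N / B) ≤ N :=
      (Nat.mul_le_mul_right _ hβ).trans (Nat.mul_div_le N B)
    rw [h _ (by nlinarith)]
  unfold batchRun sgdAvg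
  have h1 : ∀ t ∈ Finset.range (N / B), t + 1 ≤ N / B := fun t ht => Finset.mem_range.1 ht
  rw [Finset.sum_congr rfl fun t ht => congrArg Prod.fst (hs (t + 1) (h1 t ht)),
    Finset.sum_congr rfl fun t ht => congrArg Prod.snd (hs (t + 1) (h1 t ht))]

lemma isEstimate_congr {r lam : ℝ} {B N : ℕ} {y y' : ℕ → ℝ} (h : ∀ j < N, y j = y' j)
    (ξ : ℕ → ℕ → ℕ → ℝ) (p : ℝ × ℝ) (hp : IsEstimate r lam B N y ξ p) :
    IsEstimate r lam B N y' ξ p := by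
  have ht : ∀ β < B, totalDist B (batchRun r lam B N y' ξ) β =
      totalDist B (batchRun r lam B N y ξ) β := by
    intro β hβ
    unfold totalDist
    refine Finset.sum_congr rfl fun j hj => ?_
    rw [batchRun_congr hβ h, batchRun_congr (Finset.mem_range.1 hj) h]
  refine ⟨hp.1, fun h0 h1 => ?_, fun h0 h1 => ?_⟩
  · rw [← empSd_congr h] at h1
    rw [← empMean_congr h]
    exact hp.2.1 h0 h1
  · rw [← empSd_congr h] at h1
    obtain ⟨β, hβ, h2, h3⟩ := hp.2.2 h0 h1
    refine ⟨β, hβ, fun β' hβ' => ?_, ?_⟩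
    · rw [ht β hβ, ht β' hβ']
      exact h2 β' hβ'
    · rw [← empSd_congr h, ← empMean_congr h, ← batchRun_congr hβ h]
      exact h3

/-! ## The positive entries of a column -/

/-- A column of length `n`, continued by zero. -/
def extend {n : ℕ} (x : Fin n → ℝ) (m : ℕ) : ℝ := if h : m < n then x ⟨m, h⟩ else 0

/-- The law of the draws for one coordinate. -/
def drawLaw : Measure (ℕ × ℕ → ℕ → ℝ) :=
  Measure.infinitePi fun _ => Measure.infinitePi fun _ => gaussianReal 0 1

instance : IsProbabilityMeasure drawLaw := by unfold drawLaw; infer_instance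

/-- The columns and draws for which the estimate need not be close. -/
def BadColumn (r ρ b s : ℝ) (B n : ℕ) : Set ((Fin n → ℝ) × (ℕ × ℕ → ℕ → ℝ)) :=
  {q | (posValue (extend q.1), q.2) ∈ BadValues r ρ b s B (posCount n (extend q.1))}

lemma measurable_extend {n : ℕ} (m : ℕ) : Measurable fun x : Fin n → ℝ => extend x m := by
  unfold extend
  split_ifs <;> fun_prop

/-- Split according to the finite set `P` of positive positions: on each piece the number and the
enumeration of the positive entries are constant. -/
lemma measurableSet_badColumn (r ρ b s : ℝ) (B n : ℕ) :
    MeasurableSet (BadColumn r ρ b s B n) := by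
  classical
  have key : BadColumn r ρ b s B n = ⋃ P : Finset (Fin n),
      {q | ∀ m, 0 < q.1 m ↔ m ∈ P} ∩
      (fun q : (Fin n → ℝ) × (ℕ × ℕ → ℕ → ℝ) =>
        ((fun j => extend q.1 (Nat.nth (fun m => ∃ h : m < n, (⟨m, h⟩ : Fin n) ∈ P) j), q.2) :
          Outcome)) ⁻¹' BadValues r ρ b s B (Nat.count (fun m => ∃ h : m < n, (⟨m, h⟩ : Fin n) ∈ P) n)
      := by
    have hpred : ∀ (q : (Fin n → ℝ) × (ℕ × ℕ → ℕ → ℝ)) (P : Finset (Fin n)),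
        (∀ m, 0 < q.1 m ↔ m ∈ P) →
        (fun m => 0 < extend q.1 m) = fun m => ∃ h : m < n, (⟨m, h⟩ : Fin n) ∈ P := by
      intro q P h
      funext m
      unfold extend
      split_ifs with hm
      · simp [h, hm]
      · simp [hm]
    ext q
    simp only [Set.mem_iUnion, Set.mem_inter_iff, Set.mem_ofPred_eq, Set.mem_preimage]
    constructor
    · intro h
      refine ⟨Finset.univ.filter fun m => 0 < q.1 m, by simp, ?_⟩
      have hp := hpred q (Finset.univ.filter fun m => 0 < q.1 m) (by simp)
      unfold BadColumn posValue posCount at h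
      simp only [Set.mem_ofPred_eq] at h
      convert h using 3
      all_goals rw [hp]
    · rintro ⟨P, hP, h⟩
      have hp := hpred q P hP
      unfold BadColumn posValue posCount
      simp only [Set.mem_ofPred_eq]
      convert h using 3
      all_goals rw [hp]
  rw [key]
  refine MeasurableSet.iUnion fun P => MeasurableSet.inter ?_ ?_
  · have : {q : (Fin n → ℝ) × (ℕ × ℕ → ℕ → ℝ) | ∀ m, 0 < q.1 m ↔ m ∈ P} =
        ⋂ m, {q | 0 < q.1 m ↔ m ∈ P} := by ext; simp
    rw [this]
    refine MeasurableSet.iInter fun m => ?_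
    have h0 : MeasurableSet {q : (Fin n → ℝ) × (ℕ × ℕ → ℕ → ℝ) | 0 < q.1 m} :=
      measurableSet_lt measurable_const (by fun_prop)
    by_cases hm : m ∈ P
    · simpa [hm] using h0
    · convert h0.compl using 1
      ext q
      simp [hm]
  · refine measurableSet_preimage (Measurable.prodMk (measurable_pi_lambda _ fun j => ?_)
      measurable_snd) (measurableSet_badValues ..)
    exact (measurable_extend _).comp measurable_fst

/-- Drawing the values above `-a` anew from their conditional law does not change the law. -/
lemma measurePreserving_resample (a : ℝ) :
    MeasurePreserving (fun (q : (ℕ → ℝ) × (ℕ → ℝ)) m => if -a < q.1 m then q.2 m else q.1 m)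
      ((Measure.infinitePi fun _ => gaussianReal 0 1).prod
        (Measure.infinitePi fun _ => halfNormal a))
      (Measure.infinitePi fun _ => gaussianReal 0 1) := by
  classical
  have hm : Measurable fun (q : (ℕ → ℝ) × (ℕ → ℝ)) m => if -a < q.1 m then q.2 m else q.1 m :=
    measurable_pi_lambda _ fun m => Measurable.ite (measurableSet_lt measurable_const (by fun_prop))
      (by fun_prop) (by fun_prop)
  refine ⟨hm, Measure.eq_infinitePi _ fun S t ht => ?_⟩
  have hS : MeasurableSet (Set.pi (S : Set ℕ) t) := MeasurableSet.pi S.countable_toSet fun j _ => ht j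
  rw [Measure.map_apply hm hS, Measure.prod_apply (hm hS)]
  -- The probability that entry `m` lands in `t m` after resampling, given its old value `x`; these
  -- are multiplied over the independent entries.
  set φ : ℕ → ℝ → ENNReal := fun m x => if -a < x then halfNormal a (t m) else (t m).indicator 1 x
    with hφ
  have hφm : ∀ m, Measurable (φ m) := fun m =>
    Measurable.ite measurableSet_Ioi measurable_const (measurable_one.indicator (ht m))
  have h1 : ∀ g : ℕ → ℝ, (Measure.infinitePi fun _ : ℕ => halfNormal a)
      (Prod.mk g ⁻¹' ((fun (q : (ℕ → ℝ) × (ℕ → ℝ)) m => if -a < q.1 m then q.2 m else q.1 m) ⁻¹'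
        (S : Set ℕ).pi t)) = ∏ m ∈ S, φ m (g m) := by
    intro g
    have : Prod.mk g ⁻¹' ((fun (q : (ℕ → ℝ) × (ℕ → ℝ)) m => if -a < q.1 m then q.2 m else q.1 m) ⁻¹'
        (S : Set ℕ).pi t) = (S : Set ℕ).pi fun m =>
          if -a < g m then t m else if g m ∈ t m then Set.univ else ∅ := by
      ext y
      simp only [Set.mem_preimage, Set.mem_pi]
      refine forall₂_congr fun m _ => ?_
      split_ifs <;> simp_all
    rw [this, Measure.infinitePi_pi]
    · refine Finset.prod_congr rfl fun m _ => ?_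
      simp only [hφ]
      split_ifs with h1 h2 <;> simp_all
    · intro m _
      split_ifs
      exacts [ht m, MeasurableSet.univ, MeasurableSet.empty]
  simp only [h1]
  rw [lintegral_prod_infinitePi _ S hφm]
  refine Finset.prod_congr rfl fun m _ => ?_
  have h2 : ∀ x, φ m x = (Set.Ioi (-a)).indicator (fun _ => halfNormal a (t m)) x +
      (t m ∩ Set.Iic (-a)).indicator 1 x := by
    intro x
    simp only [hφ]
    by_cases h : -a < x
    · simp [h]
    · have h' : x ≤ -a := not_lt.1 h
      by_cases hx : x ∈ t m <;> simp [h, h', hx]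
  simp only [h2]
  rw [lintegral_add_left (measurable_const.indicator measurableSet_Ioi),
    lintegral_indicator_const measurableSet_Ioi,
    lintegral_indicator_one ((ht m).inter measurableSet_Iic), halfNormal,
    ProbabilityTheory.cond_mul_eq_inter measurableSet_Ioi]
  rw [← measure_inter_add_sdiff (t m) (measurableSet_Ioi : MeasurableSet (Set.Ioi (-a))),
    Set.inter_comm]
  congr 2
  ext x
  simp [not_lt]

/-! ## The law of a column -/

/-- The column of length `n` with entries `max (s g + b) 0`. -/
def columnOf (s b : ℝ) (n : ℕ) (g : ℕ → ℝ) : Fin n → ℝ := fun m => max (s * g m + b) 0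

lemma measurable_columnOf (s b : ℝ) (n : ℕ) : Measurable (columnOf s b n) := by
  unfold columnOf
  fun_prop

lemma measurable_posCount (n : ℕ) : Measurable fun x : Fin n → ℝ => posCount n (extend x) := by
  classical
  have h : ∀ x : Fin n → ℝ, posCount n (extend x) =
      ∑ m ∈ Finset.range n, if 0 < extend x m then 1 else 0 := by
    intro x
    unfold posCount
    rw [Nat.count_eq_card_filter_range, Finset.card_filter]
  simp only [h]
  exact Finset.measurable_fun_sum _ fun m _ => Measurable.ite
    (measurableSet_lt measurable_const (measurable_extend m)) measurable_const measurable_const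

/-- The number of `m < n` with property `P`. -/
def hits (P : ℕ → Prop) (n : ℕ) : ℕ := open Classical in Nat.count P n

lemma nth_mem_of_lt_hits {P : ℕ → Prop} {n j : ℕ} (hj : j < hits P n) : P (Nat.nth P j) := by
  classical
  refine Nat.nth_mem (p := P) j fun hfin => hj.trans_le ?_
  rw [hits, Nat.count_eq_card_filter_range]
  exact Finset.card_le_card fun m hm => by simpa using (Finset.mem_filter.1 hm).2

/-- `Nat.nth` need not be injective beyond the count. An injective continuation makes the reindexing
of an independent sequence preserve its law. -/
lemma exists_enumeration (P : ℕ → Prop) (n : ℕ) :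
    ∃ f : ℕ → ℕ, Function.Injective f ∧ ∀ j < hits P n, f j = Nat.nth P j := by
  classical
  unfold hits
  have hc : ∀ j, j < Nat.count P n → Nat.count P (Nat.nth P j) = j := by
    intro j hj
    refine Nat.count_nth fun hfin => hj.trans_le ?_
    rw [Nat.count_eq_card_filter_range]
    exact Finset.card_le_card fun m hm => by simpa using (Finset.mem_filter.1 hm).2
  refine ⟨fun j => if j < Nat.count P n then Nat.nth P j else n + j, fun i j hij => ?_, fun j hj =>
    if_pos hj⟩
  simp only at hij
  split_ifs at hij with h1 h2 h2
  · rw [← hc i h1, hij, hc j h2]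
  · have := Nat.nth_lt_of_lt_count h1
    omega
  · have := Nat.nth_lt_of_lt_count h2
    omega
  · omega

section Resample

variable {a s : ℝ} {n : ℕ} {g y : ℕ → ℝ}

lemma extend_columnOf_pos_iff (hs : 0 < s) (x : ℕ → ℝ) (m : ℕ) :
    0 < extend (columnOf s (s * a) n x) m ↔ m < n ∧ -a < x m := by
  unfold extend columnOf
  split_ifs with h
  · simp only [lt_max_iff, lt_irrefl, or_false, h, true_and]
    rw [← mul_add, mul_pos_iff_of_pos_left hs]
    constructor <;> intro <;> linarith
  · simp [h]

lemma posCount_columnOf (hs : 0 < s) (x : ℕ → ℝ) :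
    posCount n (extend (columnOf s (s * a) n x)) = hits (fun m => m < n ∧ -a < x m) n := by
  unfold posCount hits
  simp only [extend_columnOf_pos_iff hs]
  congr

lemma resample_iff (hy : ∀ m, -a < y m) (m : ℕ) :
    (m < n ∧ -a < if -a < g m then y m else g m) ↔ m < n ∧ -a < g m := by
  split_ifs with h <;> simp [h, hy m]

lemma mem_badValues_of_mem_badColumn {r ρ : ℝ} {B : ℕ} (hs : 0 < s) (hy : ∀ m, -a < y m) {f : ℕ → ℕ}
    (hf : ∀ j < hits (fun m => m < n ∧ -a < g m) n, f j = Nat.nth (fun m => m < n ∧ -a < g m) j)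
    {ξ : ℕ × ℕ → ℕ → ℝ}
    (h : (columnOf s (s * a) n fun m => if -a < g m then y m else g m, ξ) ∈
      BadColumn r ρ (s * a) s B n) :
    (fun j => s * y (f j) + s * a, ξ) ∈
      BadValues r ρ (s * a) s B (hits (fun m => m < n ∧ -a < g m) n) := by
  unfold BadColumn at h
  simp only [Set.mem_ofPred_eq] at h
  rw [posCount_columnOf hs] at h
  simp only [resample_iff hy] at h
  obtain ⟨e, he, hne⟩ := h
  refine ⟨e, isEstimate_congr (fun j hj => ?_) _ _ he, hne⟩
  simp only [posValue, extend_columnOf_pos_iff hs, resample_iff hy]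
  rw [hf j hj]
  obtain ⟨hmn, hmg⟩ := nth_mem_of_lt_hits hj
  generalize Nat.nth (fun m => m < n ∧ -a < g m) j = m at hmn hmg
  simp only [extend, hmn, columnOf, hmg, dite_true, if_true]
  rw [max_eq_left]
  have := mul_pos hs (neg_lt_iff_pos_add.1 (hy m))
  linarith

end Resample

lemma halfNormal_ae_lt (a : ℝ) : ∀ᵐ x ∂(halfNormal a), -a < x :=
  ProbabilityTheory.ae_cond_mem measurableSet_Ioi

/-- The law of a sequence of independent standard Gaussians. -/
abbrev noise : Measure (ℕ → ℝ) := Measure.infinitePi fun _ => gaussianReal 0 1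

/-- Resampling the noise above `-a` does not change its law and separates two sources of randomness:
`g` decides which entries are positive, fresh half-normal variables give their values. For fixed
`g`, the positive entries are an injectively reindexed half-normal sequence. -/
lemma measure_badColumn_le {a s r ρ : ℝ} {B n N₀ : ℕ} (hs : 0 < s) {D : ENNReal}
    (h : ∀ N, N₀ ≤ N → outcomeLaw a
      {p | ((fun j => s * p.1 j + s * a, p.2) : Outcome) ∈ BadValues r ρ (s * a) s B N} ≤ D) :
    (noise.prod drawLaw) {q | (columnOf s (s * a) n q.1, q.2) ∈ BadColumn r ρ (s * a) s B n ∧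
      N₀ ≤ posCount n (extend (columnOf s (s * a) n q.1))} ≤ D := by
  classical
  set E : Set ((ℕ → ℝ) × (ℕ × ℕ → ℕ → ℝ)) :=
    {q | (columnOf s (s * a) n q.1, q.2) ∈ BadColumn r ρ (s * a) s B n ∧
      N₀ ≤ posCount n (extend (columnOf s (s * a) n q.1))} with hE
  have hEm : MeasurableSet E := by
    have h1 := measurableSet_preimage
      (((measurable_columnOf s (s * a) n).comp measurable_fst).prodMk
        (measurable_snd : Measurable (Prod.snd : (ℕ → ℝ) × (ℕ × ℕ → ℕ → ℝ) → _)))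
      (measurableSet_badColumn r ρ (s * a) s B n)
    have h2 := ((measurable_posCount n).comp (measurable_columnOf s (s * a) n)).comp
      (measurable_fst : Measurable (Prod.fst : (ℕ → ℝ) × (ℕ × ℕ → ℕ → ℝ) → _))
    exact h1.inter (measurableSet_le measurable_const h2)
  have hR := (measurePreserving_resample a).prod (MeasurePreserving.id drawLaw)
  have hA := (measurePreserving_prodAssoc noise (Measure.infinitePi fun _ : ℕ => halfNormal a)
    drawLaw).symm
  rw [← (hR.comp hA).measure_preimage hEm.nullMeasurableSet]
  rw [Measure.prod_apply ((hR.comp hA).measurable hEm)]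
  have hfib : ∀ g : ℕ → ℝ, outcomeLaw a (Prod.mk g ⁻¹'
      ((Prod.map (fun (q : (ℕ → ℝ) × (ℕ → ℝ)) m => if -a < q.1 m then q.2 m else q.1 m) id ∘
        MeasurableEquiv.prodAssoc.symm) ⁻¹' E)) ≤ D := by
    intro g
    obtain ⟨f, hfi, hf⟩ := exists_enumeration (fun m => m < n ∧ -a < g m) n
    set N := hits (fun m => m < n ∧ -a < g m) n with hN
    have hperm : MeasurePreserving (fun p : Outcome => ((fun j => p.1 (f j), p.2) : Outcome))
        (outcomeLaw a) (outcomeLaw a) :=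
      (MeasurePreserving.mk (by fun_prop) (Measure.map_infinitePi_infinitePi_of_inj hfi)).prod
        (MeasurePreserving.id _)
    have hae : ∀ᵐ p ∂(outcomeLaw a), ∀ m, -a < p.1 m := by
      have h1 : ∀ᵐ y ∂(Measure.infinitePi fun _ : ℕ => halfNormal a), ∀ m, -a < y m :=
        ae_all_iff.2 fun m => (measurePreserving_eval_infinitePi
          (fun _ : ℕ => halfNormal a) m).quasiMeasurePreserving.ae (halfNormal_ae_lt a)
      exact Measure.quasiMeasurePreserving_fst.ae h1
    by_cases hNN : N₀ ≤ N
    · have hm : MeasurableSet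
          {p : Outcome | ((fun j => s * p.1 j + s * a, p.2) : Outcome) ∈
            BadValues r ρ (s * a) s B N} :=
        measurableSet_preimage (by fun_prop) (measurableSet_badValues ..)
      refine le_trans ?_ (h N hNN)
      rw [← hperm.measure_preimage hm.nullMeasurableSet]
      refine measure_mono_ae ?_
      filter_upwards [hae] with p hp hmem
      exact mem_badValues_of_mem_badColumn hs hp hf hmem.1
    -- With fewer than `N₀` positive positions the event is impossible, because resampling keeps the
    -- positions.
    · refine le_trans (le_of_eq (measure_eq_zero_iff_ae_notMem.2 ?_)) zero_le
      filter_upwards [hae] with p hp hmem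
      refine hNN ?_
      have h1 : N₀ ≤ posCount n (extend (columnOf s (s * a) n
        fun m => if -a < g m then p.1 m else g m)) := hmem.2
      rw [posCount_columnOf hs] at h1
      simpa only [resample_iff hp] using h1
  calc _ ≤ ∫⁻ _, D ∂noise := lintegral_mono hfib
    _ = D := by simp

/-- The law of `max (s g + b) 0` for a standard Gaussian `g`. -/
def colLaw (s b : ℝ) : Measure ℝ := (gaussianReal 0 1).map fun g => max (s * g + b) 0

instance (s b : ℝ) : IsProbabilityMeasure (colLaw s b) :=
  Measure.isProbabilityMeasure_map (by fun_prop)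

lemma measurePreserving_columnOf (s b : ℝ) (n : ℕ) :
    MeasurePreserving (columnOf s b n) noise (Measure.pi fun _ : Fin n => colLaw s b) := by
  refine ⟨measurable_columnOf s b n, ?_⟩
  have h : (Measure.infinitePi fun _ : Fin n => colLaw s b) = Measure.infinitePi fun _ : Fin n =>
      (gaussianReal 0 1).map fun g => max (s * g + b) 0 := rfl
  rw [← Measure.infinitePi_eq_pi, h, ← Measure.infinitePi_map_pi
    (μ := fun _ : Fin n => gaussianReal 0 1) (f := fun _ g => max (s * g + b) 0)
    fun _ => by fun_prop, ← Measure.map_infinitePi_infinitePi_of_inj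
      (P := fun _ : ℕ => gaussianReal 0 1) (Fin.val_injective (n := n)),
    Measure.map_map (by fun_prop) (by fun_prop)]
  rfl

/-- The probability that a standard Gaussian is positive. -/
def posProb : ℝ := (gaussianReal 0 1).real (Set.Ioi 0)

lemma posProb_pos : 0 < posProb :=
  ENNReal.toReal_pos (by simpa using gaussianReal_Ioi_ne_zero 0) (measure_ne_top _ _)

lemma posCount_columnOf_ge {s b : ℝ} (hs : 0 < s) (hb : 0 ≤ b) (n : ℕ) (g : ℕ → ℝ) :
    ∑ m ∈ Finset.range n, (Set.Ioi 0).indicator 1 (g m) ≤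
      (posCount n (extend (columnOf s b n g)) : ℝ) := by
  classical
  unfold posCount
  rw [Nat.count_eq_card_filter_range, Finset.card_filter]
  push_cast
  refine Finset.sum_le_sum fun m hm => ?_
  by_cases h : 0 < g m
  · have : 0 < s * g m + b := by positivity
    rw [if_pos]
    · simp [h]
    · simpa [extend, columnOf, Finset.mem_range.1 hm] using this
  · simp only [Set.mem_Ioi, h, not_false_eq_true, Set.indicator_of_notMem]
    positivity

lemma noise_posCount_lt_le {s b : ℝ} (hs : 0 < s) (hb : 0 ≤ b) {n N₀ : ℕ}
    (hN : (N₀ : ℝ) ≤ n * (posProb / 2)) :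
    noise.real {g | posCount n (extend (columnOf s b n g)) < N₀} ≤
      2 * Real.exp (-(n * posProb ^ 2 / 8)) := by
  have hint : ∫ x, (Set.Ioi (0 : ℝ)).indicator 1 x ∂(gaussianReal 0 1) = posProb := by
    rw [integral_indicator_one measurableSet_Ioi, posProb]
  have h := iid_hoeffding (gaussianReal 0 1) (f := (Set.Ioi (0 : ℝ)).indicator 1)
    (measurable_one.indicator measurableSet_Ioi) one_pos
    (fun x => by by_cases hx : 0 < x <;> simp [hx]) (Finset.range n) (ε := posProb / 2)
    (by have := posProb_pos; positivity)
  rw [hint, Finset.card_range] at h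
  refine (measureReal_mono (fun g hg => ?_) (measure_ne_top _ _)).trans (h.trans (le_of_eq ?_))
  · simp only [Set.mem_ofPred_eq] at hg ⊢
    have h1 := posCount_columnOf_ge hs hb n g
    have h2 : (posCount n (extend (columnOf s b n g)) : ℝ) < N₀ := by exact_mod_cast hg
    rw [abs_sub_comm]
    refine le_trans ?_ (le_abs_self _)
    linarith
  · congr 2
    ring

/-- A zero row. Relative closeness with `s = 0` means equality, and the special branches for no
positive value and for zero empirical deviation return the exact answer. -/
lemma badColumn_const_notMem {r ρ b : ℝ} {B n : ℕ} (hn : 0 < n) (hb : 0 ≤ b)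
    (ξ : ℕ × ℕ → ℕ → ℝ) : ((fun _ => b : Fin n → ℝ), ξ) ∉ BadColumn r ρ b 0 B n := by
  classical
  rintro ⟨e, he, hne⟩
  refine hne ?_
  suffices h : e = (b, 0) by simp [h, Close]
  simp only at he
  have hext : ∀ m, m < n → extend (fun _ : Fin n => b) m = b := fun m hm => by simp [extend, hm]
  rcases hb.eq_or_lt with rfl | hb
  · refine he.1 ?_
    unfold posCount
    rw [Nat.count_eq_card_filter_range, Finset.card_eq_zero, Finset.filter_eq_empty_iff]
    intro m hm
    rw [hext m (Finset.mem_range.1 hm)]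
    exact lt_irrefl 0
  · have hc : posCount n (extend (fun _ : Fin n => b)) = n := by
      unfold posCount
      rw [Nat.count_eq_card_filter_range, Finset.filter_true_of_mem, Finset.card_range]
      intro m hm
      rw [hext m (Finset.mem_range.1 hm)]
      exact hb
    have hv : ∀ j, j < n → posValue (extend fun _ : Fin n => b) j = b := by
      intro j hj
      refine hext _ ?_
      refine Nat.nth_lt_of_lt_count ?_
      rw [← hc] at hj
      exact hj
    rw [hc] at he
    have hn0 : (n : ℝ) ≠ 0 := by positivity
    have hmean : empMean n (posValue (extend fun _ : Fin n => b)) = b := by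
      rw [empMean_congr hv]
      simp [empMean, hn0]
    have hsd : empSd n (posValue (extend fun _ : Fin n => b)) = 0 := by
      have : empMean n (fun _ => b) = b := by simp [empMean, hn0]
      rw [empSd_congr hv]
      simp [empSd, this]
    rw [he.2.1 hn.ne' (by rw [hsd]; exact lt_irrefl 0), hmean]

/-- A column fails if it has too few positive entries or if the estimate from at least `B * T₀` of
them is poor. Quantifying over all `T ≥ T₀` is needed as the actual batch length is random. -/
lemma exists_badColumn_le : ∃ (r K C k : ℝ) (M : ℕ), 1 < r ∧ 0 < K ∧ 0 < C ∧ 0 < k ∧ 0 < M ∧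
    ∀ {s b ρ : ℝ} {B n T₀ : ℕ}, 0 ≤ s → 0 ≤ b → 4 ≤ B → 0 < T₀ → M * (B * T₀) ≤ n →
      (∀ T, T₀ ≤ T → K * rate T ≤ ρ) →
      ((Measure.pi fun _ : Fin n => colLaw s b).prod drawLaw).real (BadColumn r ρ b s B n) ≤
        C * Real.exp (-(k * B)) := by
  obtain ⟨r, K, C, k, hr, hK, hC, hk, hest⟩ := exists_badEstimate_le
  have hp := posProb_pos
  -- So that `B * T₀` is at most half of the expected number of positive noise variables.
  obtain ⟨M, hM⟩ := exists_nat_gt (2 / posProb)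
  have hM0 : (0 : ℝ) < M := lt_trans (by positivity) hM
  refine ⟨r, K, C + 2, min k (posProb ^ 2 / 8), M, hr, hK, by linarith, by positivity,
    by exact_mod_cast hM0, fun {s b ρ B n T₀} hs hb hB hT hn hρ => ?_⟩
  have hBn : B ≤ n := by
    have h1 : 0 < M := by exact_mod_cast hM0
    calc B ≤ B * T₀ := Nat.le_mul_of_pos_right B hT
      _ ≤ M * (B * T₀) := Nat.le_mul_of_pos_left _ h1
      _ ≤ n := hn
  rcases hs.eq_or_lt with rfl | hs
  · have h0 : ((Measure.pi fun _ : Fin n => colLaw 0 b).prod drawLaw) (BadColumn r ρ b 0 B n) = 0 := by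
      rw [← ((measurePreserving_columnOf 0 b n).prod
        (MeasurePreserving.id drawLaw)).measure_preimage (measurableSet_badColumn ..).nullMeasurableSet]
      convert measure_empty (μ := noise.prod drawLaw)
      refine Set.eq_empty_of_forall_notMem fun q hq => ?_
      refine badColumn_const_notMem (n := n) (by omega) hb q.2 ?_ (r := r) (ρ := ρ) (B := B)
      have : columnOf 0 b n q.1 = fun _ => b := by
        funext m
        simp [columnOf, hb]
      rw [← this]
      exact hq
    rw [Measure.real, h0]
    simp only [ENNReal.toReal_zero]
    positivity
  obtain ⟨a, ha, rfl⟩ : ∃ a, 0 ≤ a ∧ b = s * a := ⟨b / s, by positivity, by field_simp⟩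
  have hE : ∀ N, B * T₀ ≤ N → outcomeLaw a
      {p | ((fun j => s * p.1 j + s * a, p.2) : Outcome) ∈ BadValues r ρ (s * a) s B N} ≤
      ENNReal.ofReal (C * Real.exp (-(k * B))) := by
    intro N hN
    have hBN : B ≤ N := (Nat.le_mul_of_pos_right B hT).trans hN
    have h1 := hest (a := a) (s := s) ha hs hB hBN
    rw [← ENNReal.ofReal_toReal (measure_ne_top (outcomeLaw a) _)]
    refine ENNReal.ofReal_le_ofReal (le_trans ?_ h1)
    refine measureReal_mono ?_ (measure_ne_top _ _)
    rintro p ⟨e, he, hne⟩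
    refine ⟨e, he, fun hh => hne ?_⟩
    have h2 := hρ (N / B) ((Nat.le_div_iff_mul_le (by omega)).2 (by rwa [mul_comm]))
    refine ⟨hh.1.trans ?_, hh.2.trans ?_⟩
    · calc K * s * rate (N / B) = (K * rate (N / B)) * s := by ring
        _ ≤ ρ * s := by gcongr
    · calc K * s ^ 2 * rate (N / B) = (K * rate (N / B)) * s ^ 2 := by ring
        _ ≤ ρ * s ^ 2 := by gcongr
  have h1 := measure_badColumn_le (n := n) hs hE
  have hN₀ : ((B * T₀ : ℕ) : ℝ) ≤ n * (posProb / 2) := by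
    have h2 : (M : ℝ) * ((B * T₀ : ℕ) : ℝ) ≤ n := by exact_mod_cast hn
    have h3 : 1 ≤ M * (posProb / 2) := by
      rw [div_lt_iff₀ hp] at hM
      linarith
    have h4 : (0 : ℝ) ≤ ((B * T₀ : ℕ) : ℝ) := Nat.cast_nonneg _
    calc ((B * T₀ : ℕ) : ℝ) = ((B * T₀ : ℕ) : ℝ) * 1 := by ring
      _ ≤ ((B * T₀ : ℕ) : ℝ) * (M * (posProb / 2)) := by gcongr
      _ = M * ((B * T₀ : ℕ) : ℝ) * (posProb / 2) := by ring
      _ ≤ n * (posProb / 2) := by gcongr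
  have h2 := noise_posCount_lt_le hs (mul_nonneg hs.le ha) (n := n) hN₀
  have h3 : ((Measure.pi fun _ : Fin n => colLaw s (s * a)).prod drawLaw).real
      (BadColumn r ρ (s * a) s B n) ≤ C * Real.exp (-(k * B)) +
      2 * Real.exp (-(n * posProb ^ 2 / 8)) := by
    rw [Measure.real, ← ((measurePreserving_columnOf s (s * a) n).prod
      (MeasurePreserving.id drawLaw)).measure_preimage (measurableSet_badColumn ..).nullMeasurableSet]
    change (noise.prod drawLaw).real _ ≤ _
    refine (measureReal_mono (μ := noise.prod drawLaw) (s₂ := {q |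
      (columnOf s (s * a) n q.1, q.2) ∈ BadColumn r ρ (s * a) s B n ∧
      B * T₀ ≤ posCount n (extend (columnOf s (s * a) n q.1))} ∪
      Prod.fst ⁻¹' {g | posCount n (extend (columnOf s (s * a) n g)) < B * T₀})
      (fun q hq => ?_) (measure_ne_top _ _)).trans ((measureReal_union_le _ _).trans ?_)
    · rcases lt_or_ge (posCount n (extend (columnOf s (s * a) n q.1))) (B * T₀) with h | h
      · exact Or.inr h
      · exact Or.inl ⟨hq, h⟩
    · refine add_le_add ?_ ?_
      · exact ENNReal.toReal_le_of_le_ofReal (by positivity) h1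
      · refine le_trans (le_of_eq ?_) h2
        have hm : MeasurableSet {g | posCount n (extend (columnOf s (s * a) n g)) < B * T₀} :=
          measurableSet_lt ((measurable_posCount n).comp (measurable_columnOf s (s * a) n))
            measurable_const
        rw [Measure.real, (measurePreserving_fst (μ := noise) (ν := drawLaw)).measure_preimage
          hm.nullMeasurableSet]
        rfl
  refine h3.trans ?_
  have e1 : Real.exp (-(k * B)) ≤ Real.exp (-(min k (posProb ^ 2 / 8) * B)) := by
    refine Real.exp_le_exp.2 (neg_le_neg ?_)
    have : min k (posProb ^ 2 / 8) ≤ k := min_le_left _ _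
    gcongr
  have e2 : Real.exp (-(n * posProb ^ 2 / 8)) ≤ Real.exp (-(min k (posProb ^ 2 / 8) * B)) := by
    refine Real.exp_le_exp.2 (neg_le_neg ?_)
    have h4 : min k (posProb ^ 2 / 8) ≤ posProb ^ 2 / 8 := min_le_right _ _
    have h5 : (B : ℝ) ≤ n := by exact_mod_cast hBn
    calc min k (posProb ^ 2 / 8) * B ≤ posProb ^ 2 / 8 * n := by gcongr
      _ = n * posProb ^ 2 / 8 := by ring
  have e3 := mul_le_mul_of_nonneg_left e1 hC.le
  linarith

/-! ## The orthant probability of two Gaussians -/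

section Cone

lemma gaussianPDF_mul (r φ : ℝ) : gaussianPDF 0 1 (r * Real.cos φ) * gaussianPDF 0 1 (r * Real.sin φ) =
    gaussianPDF 0 1 r * gaussianPDF 0 1 0 := by
  simp only [gaussianPDF_def, gaussianPDFReal_def]
  rw [← ENNReal.ofReal_mul (by positivity), ← ENNReal.ofReal_mul (by positivity)]
  congr 1
  rw [mul_mul_mul_comm, mul_mul_mul_comm _ (Real.exp _) _ (Real.exp (-(0 - 0) ^ 2 / _)),
    ← Real.exp_add, ← Real.exp_add]
  congr 2
  have := Real.sin_sq_add_cos_sq φ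
  simp only [sub_zero, mul_pow, NNReal.coe_one, mul_one]
  linear_combination (-r ^ 2 / 2) * this

/-- The radial part of the standard Gaussian law of the plane. -/
def radialMass : ENNReal :=
  ∫⁻ r in Set.Ioi 0, ENNReal.ofReal r * (gaussianPDF 0 1 r * gaussianPDF 0 1 0)

/-- In polar coordinates the Gaussian density depends on the radius only, so a cone has mass
proportional to its angle. The radial factor need not be computed: the whole plane determines it. -/
lemma measure_cone {S : Set (ℝ × ℝ)} {A : Set ℝ} (hS : MeasurableSet S) (hA : MeasurableSet A)
    (h : ∀ r > 0, ∀ φ, (r * Real.cos φ, r * Real.sin φ) ∈ S ↔ φ ∈ A) :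
    ((gaussianReal 0 1).prod (gaussianReal 0 1)) S =
      radialMass * volume (A ∩ Set.Ioo (-Real.pi) Real.pi) := by
  have hg := measurable_gaussianPDF 0 1
  rw [gaussianReal_of_var_ne_zero 0 one_ne_zero, prod_withDensity_left hg,
    prod_withDensity_right hg, ← withDensity_mul _ (by fun_prop) (by fun_prop),
    withDensity_apply _ hS, ← lintegral_indicator hS, ← Measure.volume_eq_prod,
    ← lintegral_comp_polarCoord_symm]
  have h1 : ∀ p ∈ polarCoord.target, ENNReal.ofReal p.1 • S.indicator
      ((fun z : ℝ × ℝ => gaussianPDF 0 1 z.2) * fun z : ℝ × ℝ => gaussianPDF 0 1 z.1)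
      (polarCoord.symm p) =
      (ENNReal.ofReal p.1 * (gaussianPDF 0 1 p.1 * gaussianPDF 0 1 0)) * A.indicator 1 p.2 := by
    rintro ⟨r, φ⟩ ⟨hr, -⟩
    simp only [polarCoord_symm_apply, smul_eq_mul]
    have := h r hr φ
    by_cases hφ : φ ∈ A
    · rw [Set.indicator_of_mem (this.2 hφ), Set.indicator_of_mem hφ, Pi.mul_apply, mul_comm
        (gaussianPDF 0 1 (r * Real.sin φ)), gaussianPDF_mul, Pi.one_apply, mul_one]
    · rw [Set.indicator_of_notMem (fun hm => hφ (this.1 hm)), Set.indicator_of_notMem hφ]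
      simp
  rw [setLIntegral_congr_fun polarCoord.open_target.measurableSet h1, polarCoord_target,
    Measure.volume_eq_prod, ← Measure.prod_restrict, lintegral_prod_mul
      (f := fun r => ENNReal.ofReal r * (gaussianPDF 0 1 r * gaussianPDF 0 1 0)) (by fun_prop)
      (measurable_one.indicator hA).aemeasurable, radialMass, lintegral_indicator_one hA,
    Measure.restrict_apply hA]

lemma radialMass_mul : radialMass * ENNReal.ofReal (2 * Real.pi) = 1 := by
  have := measure_cone (S := Set.univ) (A := Set.univ) MeasurableSet.univ MeasurableSet.univ (by simp)
  rw [measure_univ, Set.univ_inter, Real.volume_Ioo] at this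
  rw [this]
  congr 2
  ring

lemma measure_wedge {θ : ℝ} (h0 : 0 ≤ θ) (h1 : θ ≤ Real.pi) :
    ((gaussianReal 0 1).prod (gaussianReal 0 1)).real
      {p | 0 < p.1 ∧ 0 < Real.cos θ * p.1 + Real.sin θ * p.2} = (Real.pi - θ) / (2 * Real.pi) := by
  have hpi := Real.pi_pos
  have hS : MeasurableSet {p : ℝ × ℝ | 0 < p.1 ∧ 0 < Real.cos θ * p.1 + Real.sin θ * p.2} :=
    (measurableSet_lt measurable_const measurable_fst).inter
      (measurableSet_lt measurable_const
        ((measurable_fst.const_mul _).add (measurable_snd.const_mul _)))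
  have hA : MeasurableSet {φ : ℝ | 0 < Real.cos φ ∧ 0 < Real.cos (φ - θ)} :=
    (measurableSet_lt measurable_const Real.measurable_cos).inter
      (measurableSet_lt measurable_const (Real.measurable_cos.comp (measurable_id.sub_const θ)))
  have h := measure_cone hS hA fun r hr φ => by
    have : Real.cos θ * (r * Real.cos φ) + Real.sin θ * (r * Real.sin φ) =
        r * Real.cos (φ - θ) := by
      rw [Real.cos_sub]
      ring
    simp only [Set.mem_ofPred_eq, this, mul_pos_iff_of_pos_left hr]
  -- Two half-planes whose normals enclose the angle `θ` meet in a wedge of angle `π - θ`.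
  have hI : {φ : ℝ | 0 < Real.cos φ ∧ 0 < Real.cos (φ - θ)} ∩ Set.Ioo (-Real.pi) Real.pi =
      Set.Ioo (θ - Real.pi / 2) (Real.pi / 2) := by
    ext φ
    simp only [Set.mem_inter_iff, Set.mem_ofPred_eq, Set.mem_Ioo]
    constructor
    · rintro ⟨⟨h2, h3⟩, h4, h5⟩
      have h6 : -(Real.pi / 2) < φ := by
        by_contra hc
        have := Real.cos_nonpos_of_pi_div_two_le_of_le (x := -φ) (by linarith) (by linarith)
        rw [Real.cos_neg] at this
        linarith
      have h7 : φ < Real.pi / 2 := by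
        by_contra hc
        have := Real.cos_nonpos_of_pi_div_two_le_of_le (x := φ) (by linarith) (by linarith)
        linarith
      refine ⟨?_, h7⟩
      by_contra hc
      have := Real.cos_nonpos_of_pi_div_two_le_of_le (x := -(φ - θ)) (by linarith) (by linarith)
      rw [Real.cos_neg] at this
      linarith
    · rintro ⟨h2, h3⟩
      exact ⟨⟨Real.cos_pos_of_mem_Ioo ⟨by linarith, by linarith⟩,
        Real.cos_pos_of_mem_Ioo ⟨by linarith, by linarith⟩⟩, by linarith, by linarith⟩
  rw [Measure.real, h, hI, Real.volume_Ioo]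
  have hr : radialMass = ENNReal.ofReal ((2 * Real.pi)⁻¹) := by
    rw [ENNReal.ofReal_inv_of_pos (by positivity)]
    exact ENNReal.eq_inv_of_mul_eq_one_left radialMass_mul
  rw [hr, ENNReal.toReal_mul, ENNReal.toReal_ofReal (by positivity),
    ENNReal.toReal_ofReal (by linarith)]
  field_simp
  ring

end Cone

section Projections

variable {E F : Type} [NormedAddCommGroup E] [InnerProductSpace ℝ E] [FiniteDimensional ℝ E]
  [MeasurableSpace E] [BorelSpace E] [NormedAddCommGroup F] [InnerProductSpace ℝ F]
  [FiniteDimensional ℝ F] [MeasurableSpace F] [BorelSpace F]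

lemma map_inner_stdGaussian (u : E) :
    (stdGaussian E).map (fun x => inner ℝ u x) = (gaussianReal 0 1).map fun g => ‖u‖ * g := by
  have h := IsGaussian.map_eq_gaussianReal (μ := stdGaussian E) (innerSL ℝ u)
  rw [integral_strongDual_stdGaussian, variance_dual_stdGaussian, innerSL_apply_norm] at h
  rw [gaussianReal_map_const_mul, mul_zero]
  convert h using 2
  · ext
    simp
  · rw [mul_one]
    exact (Real.toNNReal_of_nonneg (sq_nonneg _)).symm

/-- The joint law of two projections of a standard Gaussian depends only on their Gram matrix. -/
lemma map_inner_pair_stdGaussian (u v : E) (u' v' : F) (hu : ‖u‖ = ‖u'‖) (hv : ‖v‖ = ‖v'‖)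
    (huv : inner ℝ u v = inner ℝ u' v') :
    (stdGaussian E).map (fun x => (inner ℝ u x, inner ℝ v x)) =
      (stdGaussian F).map (fun x => (inner ℝ u' x, inner ℝ v' x)) := by
  -- The characteristic function at `L` involves only the norm of `L (1, 0) • u + L (0, 1) • v`,
  -- which the Gram matrix determines.
  have key : ∀ (G : Type) [NormedAddCommGroup G] [InnerProductSpace ℝ G] [FiniteDimensional ℝ G]
      [MeasurableSpace G] [BorelSpace G] (u v : G) (L : StrongDual ℝ (ℝ × ℝ)),
      charFunDual ((stdGaussian G).map (fun x => (inner ℝ u x, inner ℝ v x))) L =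
        Complex.exp (-((L (1, 0) ^ 2 * ‖u‖ ^ 2 + 2 * (L (1, 0) * L (0, 1) * inner ℝ u v) +
          L (0, 1) ^ 2 * ‖v‖ ^ 2 : ℝ)) / 2) := by
    intro G _ _ _ _ _ u v L
    have h1 : (fun x => (inner ℝ u x, inner ℝ v x)) = ((innerSL ℝ u).prod (innerSL ℝ v) : G → ℝ × ℝ) := by
      ext x <;> simp
    have h2 : L.comp ((innerSL ℝ u).prod (innerSL ℝ v)) =
        innerSL ℝ (L (1, 0) • u + L (0, 1) • v) := by
      ext x
      have : ((inner ℝ u x, inner ℝ v x) : ℝ × ℝ) =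
          inner ℝ u x • ((1, 0) : ℝ × ℝ) + inner ℝ v x • ((0, 1) : ℝ × ℝ) := by simp
      simp only [ContinuousLinearMap.comp_apply, ContinuousLinearMap.prod_apply, innerSL_apply_apply,
        this, map_add, map_smul, smul_eq_mul, _root_.add_apply, _root_.smul_apply]
      ring
    rw [h1, charFunDual_map, charFunDual_stdGaussian, h2, innerSL_apply_norm, ← Complex.ofReal_pow,
      norm_add_sq_real, norm_smul, norm_smul, real_inner_smul_left, real_inner_smul_right, mul_pow,
      mul_pow, Real.norm_eq_abs, Real.norm_eq_abs, sq_abs, sq_abs, mul_assoc (L (1, 0))]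
  have hE : IsProbabilityMeasure ((stdGaussian E).map (fun x => (inner ℝ u x, inner ℝ v x))) :=
    Measure.isProbabilityMeasure_map (by fun_prop)
  have hF : IsProbabilityMeasure ((stdGaussian F).map (fun x => (inner ℝ u' x, inner ℝ v' x))) :=
    Measure.isProbabilityMeasure_map (by fun_prop)
  refine Measure.ext_of_charFunDual (funext fun L => ?_)
  rw [key E, key F, hu, hv, huv]

/-- The pair of projections has the same law as that of two plane vectors with the same norms and
angle, one of them on the first axis. This reduces the claim to `measure_wedge`. -/
lemma stdGaussian_orthant {u v : E} (hu : u ≠ 0) (hv : v ≠ 0) :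
    (stdGaussian E).real {x | 0 < inner ℝ u x ∧ 0 < inner ℝ v x} =
      (Real.pi - InnerProductGeometry.angle u v) / (2 * Real.pi) := by
  obtain ⟨θ, hθ⟩ : ∃ θ, θ = InnerProductGeometry.angle u v := ⟨_, rfl⟩
  have hS : MeasurableSet {p : ℝ × ℝ | 0 < p.1 ∧ 0 < p.2} :=
    (measurableSet_lt measurable_const measurable_fst).inter
      (measurableSet_lt measurable_const measurable_snd)
  have hn : ∀ r c s : ℝ, 0 ≤ r → s ^ 2 + c ^ 2 = 1 → ‖(!₂[r * c, r * s] : EuclideanSpace ℝ (Fin 2))‖ = r := by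
    intro r c s hr h
    rw [EuclideanSpace.norm_eq]
    simp only [Fin.sum_univ_two, Matrix.cons_val_zero, Matrix.cons_val_one,
      Real.norm_eq_abs, sq_abs]
    rw [show (r * c) ^ 2 + (r * s) ^ 2 = r ^ 2 by linear_combination r ^ 2 * h, Real.sqrt_sq hr]
  have h1 := map_inner_pair_stdGaussian u v (!₂[‖u‖ * 1, ‖u‖ * 0] : EuclideanSpace ℝ (Fin 2))
    (!₂[‖v‖ * Real.cos θ, ‖v‖ * Real.sin θ] : EuclideanSpace ℝ (Fin 2))
    (hn _ _ _ (norm_nonneg _) (by norm_num)).symm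
    (hn _ _ _ (norm_nonneg _) (Real.sin_sq_add_cos_sq θ)).symm (by
      rw [← InnerProductGeometry.cos_angle_mul_norm_mul_norm u v, ← hθ]
      simp [PiLp.inner_apply, Fin.sum_univ_two]
      ring)
  have h2 : (stdGaussian E) {x | 0 < inner ℝ u x ∧ 0 < inner ℝ v x} =
      ((stdGaussian E).map (fun x => (inner ℝ u x, inner ℝ v x))) {p | 0 < p.1 ∧ 0 < p.2} := by
    rw [Measure.map_apply (by fun_prop) hS]
    rfl
  have hu' : 0 < ‖u‖ := norm_pos_iff.2 hu
  have hv' : 0 < ‖v‖ := norm_pos_iff.2 hv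
  rw [hθ.symm, ← measure_wedge (hθ ▸ InnerProductGeometry.angle_nonneg u v)
    (hθ ▸ InnerProductGeometry.angle_le_pi u v), Measure.real, Measure.real, h2, h1,
    Measure.map_apply (by fun_prop) hS, ← map_pi_eq_stdGaussian,
    Measure.map_apply (by fun_prop) (measurableSet_preimage (by fun_prop) hS),
    ← (measurePreserving_finTwoArrow (gaussianReal 0 1)).measure_preimage_equiv]
  congr 2
  ext x
  simp only [Set.mem_preimage, Set.mem_ofPred_eq, PiLp.inner_apply, Fin.sum_univ_two,
    Matrix.cons_val_zero, Matrix.cons_val_one, mul_one, mul_zero,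
    MeasurableEquiv.finTwoArrow_apply, RCLike.inner_apply, conj_trivial, add_zero]
  rw [mul_pos_iff_of_pos_right hu', show x 0 * (‖v‖ * Real.cos θ) + x 1 * (‖v‖ * Real.sin θ) =
    ‖v‖ * (Real.cos θ * x 0 + Real.sin θ * x 1) by ring, mul_pos_iff_of_pos_left hv']

end Projections

/-! ## Frequencies of events among the samples -/

variable {d k n : ℕ}

/-- The `i`-th row of `W`. -/
def rowVec (W : Matrix (Fin d) (Fin k) ℝ) (i : Fin d) : EuclideanSpace ℝ (Fin k) :=
  WithLp.toLp 2 (W i)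

lemma measurable_relu_inner (W : Matrix (Fin d) (Fin k) ℝ) (b : Fin d → ℝ) :
    Measurable fun (z : EuclideanSpace ℝ (Fin k)) i => max (inner ℝ (rowVec W i) z + b i) 0 := by
  fun_prop

lemma rectifiedGaussian_eq (W : Matrix (Fin d) (Fin k) ℝ) (b : Fin d → ℝ) :
    rectifiedGaussian W b = (stdGaussian (EuclideanSpace ℝ (Fin k))).map
      fun z i => max (inner ℝ (rowVec W i) z + b i) 0 := by
  rw [← map_pi_eq_stdGaussian, Measure.map_map (measurable_relu_inner W b) (by fun_prop)]
  unfold rectifiedGaussian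
  congr 1
  funext z i
  simp [rowVec, PiLp.inner_apply, Matrix.mulVec, dotProduct, mul_comm]

instance (W : Matrix (Fin d) (Fin k) ℝ) (b : Fin d → ℝ) :
    IsProbabilityMeasure (rectifiedGaussian W b) := by
  rw [rectifiedGaussian_eq]
  exact Measure.isProbabilityMeasure_map (measurable_relu_inner W b).aemeasurable

lemma map_eval_rectifiedGaussian (W : Matrix (Fin d) (Fin k) ℝ) (b : Fin d → ℝ) (i : Fin d) :
    (rectifiedGaussian W b).map (fun y => y i) = colLaw ‖rowVec W i‖ (b i) := by
  rw [rectifiedGaussian_eq, Measure.map_map (by fun_prop) (measurable_relu_inner W b)]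
  have h := congrArg (Measure.map fun t => max (t + b i) 0) (map_inner_stdGaussian (rowVec W i))
  rw [Measure.map_map (by fun_prop) (by fun_prop), Measure.map_map (by fun_prop) (by fun_prop)] at h
  exact h

/-- The event that the samples `i` and `j` both exceed their bias. -/
def jointEvent (b : Fin d → ℝ) (i j : Fin d) : Set (Fin d → ℝ) := {y | b i < y i ∧ b j < y j}

/-- The event that a sample of coordinate `i` is positive and close to the bias. -/
def nearEvent (W : Matrix (Fin d) (Fin k) ℝ) (b : Fin d → ℝ) (ρ : ℝ) (i : Fin d) :
    Set (Fin d → ℝ) := {y | 0 < y i ∧ |y i - b i| ≤ ρ * ‖rowVec W i‖}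

lemma measurableSet_jointEvent (b : Fin d → ℝ) (i j : Fin d) : MeasurableSet (jointEvent b i j) :=
  (measurableSet_lt measurable_const (measurable_pi_apply i)).inter
    (measurableSet_lt measurable_const (measurable_pi_apply j))

lemma measurableSet_nearEvent (W : Matrix (Fin d) (Fin k) ℝ) (b : Fin d → ℝ) (ρ : ℝ) (i : Fin d) :
    MeasurableSet (nearEvent W b ρ i) := by
  have h0 : Measurable fun y : Fin d → ℝ => y i := measurable_pi_apply i
  have h : Measurable fun y : Fin d → ℝ => |y i - b i| := (h0.sub_const (b i)).abs
  exact (measurableSet_lt measurable_const (measurable_pi_apply i)).inter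
    (measurableSet_le h measurable_const)

lemma measure_jointEvent (W : Matrix (Fin d) (Fin k) ℝ) {b : Fin d → ℝ} (hb : ∀ i, 0 ≤ b i)
    {i j : Fin d} (hi : rowVec W i ≠ 0) (hj : rowVec W j ≠ 0) :
    (rectifiedGaussian W b).real (jointEvent b i j) =
      (Real.pi - InnerProductGeometry.angle (rowVec W i) (rowVec W j)) / (2 * Real.pi) := by
  rw [← stdGaussian_orthant hi hj, rectifiedGaussian_eq, Measure.real, Measure.real,
    Measure.map_apply (measurable_relu_inner W b) (measurableSet_jointEvent b i j)]
  congr 2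
  ext z
  have h : ∀ i t, b i < max (t + b i) 0 ↔ 0 < t := fun i t => by
    rw [lt_max_iff, lt_add_iff_pos_left]
    exact or_iff_left (hb i).not_gt
  simp [jointEvent, h]

lemma gaussianReal_Icc_le {ρ : ℝ} (hρ : 0 ≤ ρ) :
    (gaussianReal 0 1).real (Set.Icc (-ρ) ρ) ≤ ρ := by
  have h1 : (gaussianReal 0 1) (Set.Icc (-ρ) ρ) ≤ ENNReal.ofReal ρ := by
    rw [gaussianReal_apply 0 one_ne_zero]
    have h2 : ∀ x, gaussianPDF 0 1 x ≤ ENNReal.ofReal (1 / 2) := by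
      intro x
      rw [gaussianPDF_def]
      refine ENNReal.ofReal_le_ofReal ?_
      rw [gaussianPDFReal_def]
      have h3 : Real.exp (-(x - 0) ^ 2 / (2 * ((1 : NNReal) : ℝ))) ≤ 1 :=
        Real.exp_le_one_iff.2 (div_nonpos_of_nonpos_of_nonneg (by nlinarith [sq_nonneg (x - 0)])
          (by positivity))
      have h4 : (2 : ℝ) ≤ √(2 * Real.pi * ((1 : NNReal) : ℝ)) := by
        refine Real.le_sqrt_of_sq_le ?_
        have := Real.pi_gt_three
        simp only [NNReal.coe_one]
        linarith
      calc _ ≤ (√(2 * Real.pi * ((1 : NNReal) : ℝ)))⁻¹ * 1 :=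
            mul_le_mul_of_nonneg_left h3 (by positivity)
        _ ≤ 1 / 2 := by
          rw [mul_one, one_div]
          exact inv_anti₀ two_pos h4
    calc _ ≤ ∫⁻ _ in Set.Icc (-ρ) ρ, ENNReal.ofReal (1 / 2) := lintegral_mono fun x => h2 x
      _ = ENNReal.ofReal ρ := by
        rw [setLIntegral_const, Real.volume_Icc, ← ENNReal.ofReal_mul (by positivity)]
        congr 1
        ring
  exact ENNReal.toReal_le_of_le_ofReal hρ h1

/-- Positivity in `nearEvent` excludes the atom that rectification creates at `0`. What remains is a
small interval for the underlying standard Gaussian. -/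
lemma measure_nearEvent_le (W : Matrix (Fin d) (Fin k) ℝ) (b : Fin d → ℝ) {ρ : ℝ} (hρ : 0 ≤ ρ)
    {i : Fin d} (hi : rowVec W i ≠ 0) : (rectifiedGaussian W b).real (nearEvent W b ρ i) ≤ ρ := by
  have hs : 0 < ‖rowVec W i‖ := norm_pos_iff.2 hi
  refine le_trans ?_ (gaussianReal_Icc_le hρ)
  have hm : MeasurableSet {t : ℝ | 0 < t ∧ |t - b i| ≤ ρ * ‖rowVec W i‖} :=
    (measurableSet_lt measurable_const measurable_id).inter
      (measurableSet_le (measurable_id.sub_const (b i)).abs measurable_const)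
  have h1 : (rectifiedGaussian W b) (nearEvent W b ρ i) =
      colLaw ‖rowVec W i‖ (b i) {t : ℝ | 0 < t ∧ |t - b i| ≤ ρ * ‖rowVec W i‖} := by
    rw [← map_eval_rectifiedGaussian, Measure.map_apply (by fun_prop) hm]
    rfl
  rw [Measure.real, Measure.real, h1, colLaw, Measure.map_apply (by fun_prop) hm]
  refine ENNReal.toReal_mono (measure_ne_top _ _) (measure_mono fun g hg => ?_)
  simp only [Set.mem_preimage, Set.mem_ofPred_eq, lt_max_iff, lt_irrefl, or_false] at hg
  obtain ⟨h2, h3⟩ := hg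
  rw [max_eq_left h2.le, add_sub_cancel_right, abs_mul, abs_of_pos hs, mul_comm] at h3
  exact abs_le.1 (le_of_mul_le_mul_right h3 hs)

/-- The frequency of the event `S` in the samples `X` is not `ρ`-close to its probability. -/
def BadFreq (μ : Measure (Fin d → ℝ)) (n : ℕ) (ρ : ℝ) (S : Set (Fin d → ℝ)) :
    Set (Fin n → Fin d → ℝ) := {X | n * ρ ≤ |∑ m, S.indicator 1 (X m) - n * μ.real S|}

lemma measure_badFreq_le (μ : Measure (Fin d → ℝ)) [IsProbabilityMeasure μ] (n : ℕ) {ρ : ℝ}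
    (hρ : 0 ≤ ρ) {S : Set (Fin d → ℝ)} (hS : MeasurableSet S) :
    (Measure.pi fun _ : Fin n => μ).real (BadFreq μ n ρ S) ≤ 2 * Real.exp (-(n * ρ ^ 2 / 2)) := by
  have h := iid_hoeffding μ (f := S.indicator 1) (measurable_one.indicator hS) one_pos
    (fun x => by by_cases hx : x ∈ S <;> simp [hx]) (Finset.univ : Finset (Fin n)) hρ
  rw [Measure.infinitePi_eq_pi, integral_indicator_one hS, Finset.card_univ, Fintype.card_fin] at h
  simpa [BadFreq] using h

/-! ## Accuracy of the entries -/

lemma abs_indicator_sub_le {α : Type*} {A B C D : Set α} {x : α}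
    (h : ¬(x ∈ A ↔ x ∈ B) → x ∈ C ∨ x ∈ D) :
    |A.indicator 1 x - B.indicator 1 x| ≤ (C.indicator 1 x + D.indicator 1 x : ℝ) := by
  by_cases hA : x ∈ A <;> by_cases hB : x ∈ B <;> by_cases hC : x ∈ C <;> by_cases hD : x ∈ D <;>
    simp_all

/-- If the two thresholds disagree about `t`, then `t` lies between them and exceeds one of them.
Both are nonnegative, so `t` is positive; this is why the estimated bias is cut off at `0`. -/
lemma near_of_lt_iff_not {b e t h : ℝ} (hb : 0 ≤ b) (hh : 0 ≤ h) (hbh : |h - b| ≤ e)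
    (hne : ¬(h < t ↔ b < t)) : 0 < t ∧ |t - b| ≤ e := by
  rw [abs_le] at hbh ⊢
  by_cases h1 : h < t
  · have h2 : ¬b < t := fun h2 => hne ⟨fun _ => h2, fun _ => h1⟩
    exact ⟨by linarith, by linarith, by linarith⟩
  · have h2 : b < t := by
      by_contra h2
      exact hne ⟨fun h3 => absurd h3 h1, fun h3 => absurd h3 h2⟩
    exact ⟨by linarith, by linarith, by linarith⟩

/-- The estimates `h` may depend on the samples, so only events defined by the true biases are
controlled. The error `5 * ρ` is `ρ` for the joint frequency and, for each coordinate, `ρ` for the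
probability and `ρ` for the frequency of being near the bias. -/
lemma abs_jointFreq_sub_le {W : Matrix (Fin d) (Fin k) ℝ} {b : Fin d → ℝ} (hb : ∀ i, 0 ≤ b i)
    {i j : Fin d} (hi : rowVec W i ≠ 0) (hj : rowVec W j ≠ 0) {ρ : ℝ} (hρ : 0 ≤ ρ)
    {X : Fin n → Fin d → ℝ} (hij : X ∉ BadFreq (rectifiedGaussian W b) n ρ (jointEvent b i j))
    (hni : X ∉ BadFreq (rectifiedGaussian W b) n ρ (nearEvent W b ρ i))
    (hnj : X ∉ BadFreq (rectifiedGaussian W b) n ρ (nearEvent W b ρ j)) {h : Fin d → ℝ}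
    (hh : ∀ i, 0 ≤ h i) (hhb : ∀ i, |h i - b i| ≤ ρ * ‖rowVec W i‖) :
    |∑ m, (jointEvent h i j).indicator 1 (X m) - n * ((Real.pi -
      InnerProductGeometry.angle (rowVec W i) (rowVec W j)) / (2 * Real.pi))| ≤ n * (5 * ρ) := by
  simp only [BadFreq, Set.mem_ofPred_eq, not_le] at hij hni hnj
  rw [measure_jointEvent W hb hi hj] at hij
  have h1 := mul_le_mul_of_nonneg_left (measure_nearEvent_le W b hρ hi) (Nat.cast_nonneg (α := ℝ) n)
  have h2 := mul_le_mul_of_nonneg_left (measure_nearEvent_le W b hρ hj) (Nat.cast_nonneg (α := ℝ) n)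
  have h3 : |∑ m, (jointEvent h i j).indicator 1 (X m) - ∑ m, (jointEvent b i j).indicator 1 (X m)| ≤
      ∑ m, (nearEvent W b ρ i).indicator 1 (X m) +
        ∑ m, (nearEvent W b ρ j).indicator (1 : (Fin d → ℝ) → ℝ) (X m) := by
    rw [← Finset.sum_sub_distrib, ← Finset.sum_add_distrib]
    refine (Finset.abs_sum_le_sum_abs _ _).trans (Finset.sum_le_sum fun m _ => ?_)
    refine abs_indicator_sub_le fun hne => ?_
    by_contra hc
    rw [not_or] at hc
    refine hne ?_
    have e1 : h i < X m i ↔ b i < X m i := by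
      by_contra hne'
      exact hc.1 (near_of_lt_iff_not (hb i) (hh i) (hhb i) hne')
    have e2 : h j < X m j ↔ b j < X m j := by
      by_contra hne'
      exact hc.2 (near_of_lt_iff_not (hb j) (hh j) (hhb j) hne')
    simp [jointEvent, e1, e2]
  rw [abs_le] at h3 ⊢
  rw [abs_lt] at hij hni hnj
  constructor <;> linarith

lemma abs_sqrt_mul_sub_le {s s' q q' ρ : ℝ} (hs : 0 ≤ s) (hs' : 0 ≤ s') (hρ : 0 ≤ ρ) (hρ1 : ρ ≤ 1)
    (hq : |q - s ^ 2| ≤ ρ * s ^ 2) (hq' : |q' - s' ^ 2| ≤ ρ * s' ^ 2) :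
    |√(q * q') - s * s'| ≤ ρ * (s * s') := by
  rw [abs_le] at hq hq'
  have h0 : 0 ≤ (1 - ρ) * s ^ 2 := mul_nonneg (by linarith) (sq_nonneg s)
  have h0' : 0 ≤ (1 - ρ) * s' ^ 2 := mul_nonneg (by linarith) (sq_nonneg s')
  have e1 : (1 - ρ) * s ^ 2 ≤ q := by linarith
  have e2 : q ≤ (1 + ρ) * s ^ 2 := by linarith
  have e1' : (1 - ρ) * s' ^ 2 ≤ q' := by linarith
  have e2' : q' ≤ (1 + ρ) * s' ^ 2 := by linarith
  have l1 : ((1 - ρ) * (s * s')) ^ 2 ≤ q * q' := by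
    calc ((1 - ρ) * (s * s')) ^ 2 = ((1 - ρ) * s ^ 2) * ((1 - ρ) * s' ^ 2) := by ring
      _ ≤ q * q' := mul_le_mul e1 e1' h0' (h0.trans e1)
  have l2 : q * q' ≤ ((1 + ρ) * (s * s')) ^ 2 := by
    calc q * q' ≤ ((1 + ρ) * s ^ 2) * ((1 + ρ) * s' ^ 2) :=
          mul_le_mul e2 e2' (h0'.trans e1') (by positivity)
      _ = _ := by ring
  have u1 := Real.le_sqrt_of_sq_le l1
  have u2 := (Real.sqrt_le_sqrt l2).trans_eq (Real.sqrt_sq (by positivity))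
  rw [abs_le]
  constructor <;> linarith

/-- A frequency error of `5 * ρ` is an angle error of `10 * π * ρ ≤ 32 * ρ`, and cosine is
1-Lipschitz; the geometric mean of the variances adds one more `ρ`. -/
lemma abs_pairEstimate_sub_le {s s' q q' ρ c θ : ℝ} (hn : 0 < n) (hs : 0 ≤ s) (hs' : 0 ≤ s')
    (hρ : 0 ≤ ρ) (hρ1 : ρ ≤ 1) (hq : |q - s ^ 2| ≤ ρ * s ^ 2) (hq' : |q' - s' ^ 2| ≤ ρ * s' ^ 2)
    (hc : |c - n * ((Real.pi - θ) / (2 * Real.pi))| ≤ n * (5 * ρ)) :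
    |pairEstimate n q q' c - s * s' * Real.cos θ| ≤ 33 * ρ * (s * s') := by
  have hpi := Real.pi_pos
  have hn' : (0 : ℝ) < n := by exact_mod_cast hn
  have h1 := abs_sqrt_mul_sub_le hs hs' hρ hρ1 hq hq'
  obtain ⟨θ', hθ'⟩ : ∃ θ', θ' = Real.pi - 2 * Real.pi / n * c := ⟨_, rfl⟩
  have h2 : |Real.cos θ' - Real.cos θ| ≤ 32 * ρ := by
    refine (Real.abs_cos_sub_cos_le θ' θ).trans ?_
    have e : θ' - θ = -(2 * Real.pi / n) * (c - n * ((Real.pi - θ) / (2 * Real.pi))) := by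
      rw [hθ']
      field_simp
      ring
    rw [e, abs_mul, abs_neg, abs_of_pos (by positivity)]
    calc _ ≤ 2 * Real.pi / n * (n * (5 * ρ)) := by gcongr
      _ = 10 * Real.pi * ρ := by field_simp; ring
      _ ≤ 32 * ρ := by
        have := Real.pi_lt_d2
        gcongr
        linarith
  have h3 : pairEstimate n q q' c - s * s' * Real.cos θ =
      (√(q * q') - s * s') * Real.cos θ' + s * s' * (Real.cos θ' - Real.cos θ) := by
    rw [pairEstimate, hθ']
    ring
  have h4 := Real.abs_cos_le_one θ'
  have hss : 0 ≤ s * s' := mul_nonneg hs hs'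
  rw [h3]
  refine (abs_add_le _ _).trans ?_
  rw [abs_mul, abs_mul, abs_of_nonneg hss]
  calc _ ≤ ρ * (s * s') * 1 + s * s' * (32 * ρ) := by gcongr
    _ = 33 * ρ * (s * s') := by ring

/-! ## Accuracy of the output -/

section Accuracy

variable {d k n B : ℕ} {W : Matrix (Fin d) (Fin k) ℝ} {b : Fin d → ℝ} {r ρ : ℝ}

lemma frobenius_norm_sq {m l : ℕ} (A : Matrix (Fin m) (Fin l) ℝ) : ‖A‖ ^ 2 = ∑ i, ∑ j, A i j ^ 2 := by
  have h : 0 ≤ ∑ i, ∑ j, A i j ^ 2 := by positivity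
  have e : ‖A‖ = √(∑ i, ∑ j, A i j ^ 2) := by
    rw [Matrix.frobenius_norm_def, Real.sqrt_eq_rpow]
    simp
  rw [e, Real.sq_sqrt h]

lemma frobenius_norm_sq_eq_rowVec (W : Matrix (Fin d) (Fin k) ℝ) :
    ‖W‖ ^ 2 = ∑ i, ‖rowVec W i‖ ^ 2 := by
  rw [frobenius_norm_sq]
  refine Finset.sum_congr rfl fun i _ => ?_
  rw [EuclideanSpace.real_norm_sq_eq]
  rfl

lemma mul_transpose_apply (W : Matrix (Fin d) (Fin k) ℝ) (i j : Fin d) :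
    (W * W.transpose) i j = inner ℝ (rowVec W i) (rowVec W j) := by
  simp [Matrix.mul_apply, rowVec, PiLp.inner_apply, mul_comm]

lemma initial_column (X : Fin n → Fin d → ℝ) (i : Fin d) :
    (fun m => (initial X).mem (Cell.x m i)) = extend fun m => X m i := by
  funext m
  simp [initial, extend]

lemma jointCount_eq {mem : Cell → ℝ} {X : Fin n → Fin d → ℝ}
    (h : ∀ m i, mem (Cell.x m i) = (initial X).mem (Cell.x m i)) (i j : Fin d) :
    (jointCount n i j mem : ℝ) =
      ∑ m, (jointEvent (fun i : Fin d => mem (Cell.bhat i)) i j).indicator 1 (X m) := by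
  classical
  unfold jointCount
  rw [Finset.card_filter, Finset.sum_range]
  push_cast
  refine Finset.sum_congr rfl fun m _ => ?_
  have e : ∀ i : Fin d, (initial X).mem (Cell.x m i) = X m i := fun i => by simp [initial]
  rw [h, h, e, e]
  by_cases hm : X m ∈ jointEvent (fun i : Fin d => mem (Cell.bhat i)) i j
  · rw [Set.indicator_of_mem hm, Pi.one_apply]
    exact if_pos hm
  · rw [Set.indicator_of_notMem hm]
    exact if_neg hm

/-- The samples and draws of coordinate `i`. -/
def columnData (i : Fin d) (p : (Fin n → Fin d → ℝ) × (Draw → ℝ)) :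
    (Fin n → ℝ) × (ℕ × ℕ → ℕ → ℝ) :=
  (fun m => p.1 m i, fun q l => p.2 ((i : ℕ), q.1, q.2, l))

lemma close_of_rowEstimate {X : Fin n → Fin d → ℝ} {ω : Draw → ℝ} {i : Fin d} {s β h q : ℝ}
    (hβ : 0 ≤ β) (hrow : RowEstimate r (stepParam r) B n i (initial X).mem ω h q)
    (hcol : columnData i (X, ω) ∉ BadColumn r ρ β s B n) :
    0 ≤ h ∧ |h - β| ≤ ρ * s ∧ |q - s ^ 2| ≤ ρ * s ^ 2 := by
  obtain ⟨p, hp, rfl, rfl⟩ := hrow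
  rw [initial_column] at hp
  have hc : Close ρ β s p := by
    by_contra hc
    exact hcol ⟨p, hp, hc⟩
  refine ⟨le_max_right _ _, ?_, hc.2⟩
  -- Cutting off at `0` is 1-Lipschitz and fixes the true bias.
  calc |max p.1 0 - β| = |max p.1 0 - max β 0| := by rw [max_eq_left hβ]
    _ ≤ |p.1 - β| := abs_max_sub_max_le_abs _ _ _
    _ ≤ ρ * s := hc.1

variable {X : Fin n → Fin d → ℝ} {ω : Draw → ℝ} {mem : Cell → ℝ}

lemma abs_entry_sub_le (hn : 0 < n) (hb : ∀ i, 0 ≤ b i) (hρ : 0 ≤ ρ) (hρ1 : ρ ≤ 1)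
    (hres : LearnResult r (stepParam r) B d n ω (initial X).mem mem)
    (hcol : ∀ i, columnData i (X, ω) ∉ BadColumn r ρ (b i) ‖rowVec W i‖ B n)
    (hjoint : ∀ i j, X ∉ BadFreq (rectifiedGaussian W b) n ρ (jointEvent b i j))
    (hnear : ∀ i, X ∉ BadFreq (rectifiedGaussian W b) n ρ (nearEvent W b ρ i)) (i j : Fin d) :
    |mem (Cell.sig i j) - (W * W.transpose) i j| ≤
      33 * ρ * (‖rowVec W i‖ * ‖rowVec W j‖) := by
  have hrow := fun i : Fin d => close_of_rowEstimate (hb i) (hres.row i i.2) (hcol i)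
  have key : ∀ i j : Fin d, |pairEstimate n (mem (Cell.sig i i)) (mem (Cell.sig j j))
      (jointCount n i j mem) - (W * W.transpose) i j| ≤
      33 * ρ * (‖rowVec W i‖ * ‖rowVec W j‖) := by
    intro i j
    rw [mul_transpose_apply]
    -- The angle carries no information about a zero row, but its estimated variance is exactly `0`,
    -- which annihilates the product.
    by_cases hi : rowVec W i = 0
    · have h := (hrow i).2.2
      rw [hi] at h ⊢
      have h0 : mem (Cell.sig i i) = 0 := by simpa using h
      simp [h0, pairEstimate]
    by_cases hj : rowVec W j = 0
    · have h := (hrow j).2.2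
      rw [hj] at h ⊢
      have h0 : mem (Cell.sig j j) = 0 := by simpa using h
      simp [h0, pairEstimate]
    rw [← InnerProductGeometry.cos_angle_mul_norm_mul_norm, mul_comm (Real.cos _)]
    refine abs_pairEstimate_sub_le hn (norm_nonneg _) (norm_nonneg _) hρ hρ1 (hrow i).2.2
      (hrow j).2.2 ?_
    rw [jointCount_eq hres.samples]
    exact abs_jointFreq_sub_le hb hi hj hρ (hjoint i j) (hnear i) (hnear j) (fun i => (hrow i).1)
      fun i => (hrow i).2.1
  rcases lt_trichotomy i j with h | h | h
  · rw [(hres.pair i j h j.2).1]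
    exact key i j
  · subst h
    rw [mul_transpose_apply, real_inner_self_eq_norm_sq, ← sq]
    refine (hrow i).2.2.trans ?_
    have : 0 ≤ ρ * ‖rowVec W i‖ ^ 2 := by positivity
    linarith
  · rw [(hres.pair j i h i.2).2, mul_transpose_apply, real_inner_comm, mul_comm ‖rowVec W i‖]
    have := key j i
    rwa [mul_transpose_apply] at this

lemma norm_sigma_sub_le (hρ : 0 ≤ ρ) {A : Matrix (Fin d) (Fin d) ℝ}
    (h : ∀ i j, |A i j - (W * W.transpose) i j| ≤ ρ * (‖rowVec W i‖ * ‖rowVec W j‖)) :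
    ‖A - W * W.transpose‖ ≤ ρ * ‖W‖ ^ 2 := by
  refine (sq_le_sq₀ (norm_nonneg _) (by positivity)).1 ?_
  rw [frobenius_norm_sq, mul_pow, frobenius_norm_sq_eq_rowVec, sq (∑ i, _), Finset.sum_mul_sum,
    Finset.mul_sum]
  refine Finset.sum_le_sum fun i _ => ?_
  rw [Finset.mul_sum]
  refine Finset.sum_le_sum fun j _ => ?_
  calc (A - W * W.transpose) i j ^ 2 = |A i j - (W * W.transpose) i j| ^ 2 := by
        rw [sq_abs, Matrix.sub_apply]
    _ ≤ (ρ * (‖rowVec W i‖ * ‖rowVec W j‖)) ^ 2 := by gcongr; exact h i j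
    _ = _ := by ring

lemma norm_bias_sub_le (hρ : 0 ≤ ρ) {h : Fin d → ℝ} (hh : ∀ i, |h i - b i| ≤ ρ * ‖rowVec W i‖) :
    ‖(WithLp.toLp 2 h : EuclideanSpace ℝ (Fin d)) - WithLp.toLp 2 b‖ ≤ ρ * ‖W‖ := by
  refine (sq_le_sq₀ (norm_nonneg _) (by positivity)).1 ?_
  rw [EuclideanSpace.real_norm_sq_eq, mul_pow, frobenius_norm_sq_eq_rowVec, Finset.mul_sum]
  refine Finset.sum_le_sum fun i _ => ?_
  calc _ = |h i - b i| ^ 2 := by rw [sq_abs]; rfl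
    _ ≤ (ρ * ‖rowVec W i‖) ^ 2 := by gcongr; exact hh i
    _ = _ := by ring

end Accuracy

/-! ## The number of rejected draws -/

lemma firstExceed_eq_succ_iff {κ : ℝ} {ξ : ℕ → ℝ} {N : ℕ} :
    firstExceed κ ξ = N + 1 ↔ (∀ j < N, ξ j ∈ Set.Iic κ) ∧ ξ N ∈ Set.Ioi κ := by
  classical
  unfold firstExceed
  split_ifs with h
  · rw [Nat.add_right_cancel_iff, Nat.find_eq_iff]
    simp [and_comm]
  · push Not at h
    constructor
    · intro h0
      exact h0.elim
    · rintro ⟨-, h1⟩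
      exact absurd h1 (not_lt.2 (h N))

lemma firstExceed_eq_zero_iff {κ : ℝ} {ξ : ℕ → ℝ} : firstExceed κ ξ = 0 ↔ ∀ l, ξ l ≤ κ := by
  by_cases h : ∃ l, κ < ξ l
  · have h1 : firstExceed κ ξ ≠ 0 := by simp [firstExceed, h]
    obtain ⟨l, hl⟩ := h
    exact iff_of_false h1 fun h0 => absurd (h0 l) (not_le.2 hl)
  · have h1 : firstExceed κ ξ = 0 := by simp only [firstExceed, h, dite_false]
    push Not at h
    exact iff_of_true h1 h

lemma measurable_firstExceed (κ : ℝ) : Measurable (firstExceed κ) := by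
  refine measurable_to_countable' fun N => ?_
  cases N with
  | zero =>
    have : firstExceed κ ⁻¹' {0} = ⋂ l, {ξ | ξ l ≤ κ} := by
      ext ξ
      simp [firstExceed_eq_zero_iff]
    rw [this]
    exact MeasurableSet.iInter fun l => measurableSet_le (by fun_prop) measurable_const
  | succ N =>
    have : firstExceed κ ⁻¹' {N + 1} = {ξ | (∀ j < N, ξ j ∈ Set.Iic κ) ∧ ξ N ∈ Set.Ioi κ} := by
      ext ξ
      simp only [Set.mem_preimage, Set.mem_singleton_iff, firstExceed_eq_succ_iff, Set.mem_ofPred_eq]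
    rw [this]
    exact measurableSet_forall_lt measurableSet_Iic measurableSet_Ioi N

lemma noise_forall_le_eq_zero (κ : ℝ) : noise {ξ | ∀ l, ξ l ≤ κ} = 0 := by
  have hlt : gaussianReal 0 1 (Set.Iic κ) < 1 := by
    have h := prob_compl_eq_one_sub (μ := gaussianReal 0 1) (measurableSet_Ioi (a := κ))
    rw [Set.compl_Ioi] at h
    rw [h]
    exact ENNReal.sub_lt_self ENNReal.one_ne_top one_ne_zero (gaussianReal_Ioi_ne_zero κ)
  refine le_antisymm (le_of_tendsto_of_tendsto' tendsto_const_nhds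
    (ENNReal.tendsto_pow_atTop_nhds_zero_of_lt_one hlt) fun l => ?_) zero_le
  have h := infinitePi_apply_forall (gaussianReal 0 1) (measurableSet_Iic (a := κ))
    MeasurableSet.univ l
  rw [measure_univ, mul_one] at h
  rw [← h]
  exact measure_mono fun ξ hξ => ⟨fun j _ => hξ j, trivial⟩

/-- The law of all draws. -/
abbrev allDraws : Measure (Draw → ℝ) := Measure.infinitePi fun _ => gaussianReal 0 1

lemma measurePreserving_drawBlocks : MeasurePreserving
    (fun (ω : Draw → ℝ) (q : ℕ × ℕ × ℕ) (l : ℕ) => ω (q.1, q.2.1, q.2.2, l)) allDraws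
    (Measure.infinitePi fun _ => noise) :=
  measurePreserving_blocks (gaussianReal 0 1) (f := fun p : (ℕ × ℕ × ℕ) × ℕ =>
    ((p.1.1, p.1.2.1, p.1.2.2, p.2) : Draw)) fun p q h => by
      simp only [Prod.mk.injEq] at h
      exact Prod.ext (Prod.ext h.1 (Prod.ext h.2.1 h.2.2.1)) h.2.2.2

lemma ae_not_stuck (κ : ℝ) : ∀ᵐ ω ∂allDraws, ¬Stuck κ ω := by
  have h : ∀ q : ℕ × ℕ × ℕ, ∀ᵐ ω ∂allDraws, ¬∀ l, ω (q.1, q.2.1, q.2.2, l) ≤ κ := by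
    intro q
    have h1 : ∀ᵐ ξ ∂noise, ¬∀ l, ξ l ≤ κ := by
      rw [ae_iff]
      simpa using noise_forall_le_eq_zero κ
    exact ((measurePreserving_eval_infinitePi (fun _ : ℕ × ℕ × ℕ => noise) q).comp
      measurePreserving_drawBlocks).quasiMeasurePreserving.ae h1
  filter_upwards [ae_all_iff.2 h] with ω hω
  rintro ⟨i, β, t, hs⟩
  exact hω (i, β, t) hs

/-- The number of attempts for `d` coordinates. -/
def totalAttempts (κ : ℝ) (d n B : ℕ) (ω : Draw → ℝ) : ℕ :=
  ∑ i ∈ Finset.range d, rowAttempts κ ω n B i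

lemma totalAttempts_eq (κ : ℝ) (d n B : ℕ) (ω : Draw → ℝ) : totalAttempts κ d n B ω =
    ∑ q ∈ Finset.range d ×ˢ Finset.range B ×ˢ Finset.range (n / B),
      firstExceed κ fun l => ω (q.1, q.2.1, q.2.2, l) := by
  unfold totalAttempts rowAttempts
  simp only [attemptsNeeded_eq, Finset.sum_product]

lemma card_attempts_le (d n B : ℕ) :
    (Finset.range d ×ˢ Finset.range B ×ˢ Finset.range (n / B)).card ≤ d * n := by
  simp only [Finset.card_product, Finset.card_range]
  exact Nat.mul_le_mul_left _ (Nat.mul_div_le n B)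

lemma measurable_totalAttempts (κ : ℝ) (d n B : ℕ) : Measurable (totalAttempts κ d n B) := by
  have h := measurable_firstExceed κ
  simp only [funext (totalAttempts_eq κ d n B)]
  exact Finset.measurable_fun_sum _ fun q _ => h.comp (by fun_prop)

/-- The waiting times of different labels use disjoint blocks of draws. They are thus independent
with a common exponential moment, and there are at most `d * n` of them. -/
lemma exists_totalAttempts_le (κ : ℝ) : ∃ A : ℝ, 0 < A ∧ ∀ d n B : ℕ,
    ∫⁻ ω, (totalAttempts κ d n B ω : ENNReal) ∂allDraws ≤ ENNReal.ofReal (A * (d * n)) ∧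
    allDraws.real {ω | A * (d * n) ≤ totalAttempts κ d n B ω} ≤ Real.exp (-(d * n)) := by
  obtain ⟨s, K, hs, hK, hexp⟩ := exists_exp_moment_firstExceed (gaussianReal 0 1) κ
    (gaussianReal_Ioi_ne_zero κ)
  have hf := measurable_firstExceed κ
  have hfr : Measurable fun ξ : ℕ → ℝ => (firstExceed κ ξ : ℝ) := measurable_from_nat.comp hf
  have hlogK : 0 ≤ Real.log K := Real.log_nonneg hK
  have hint : Integrable (fun ξ : ℕ → ℝ => Real.exp (s * firstExceed κ ξ)) noise := by
    refine ⟨(by fun_prop : Measurable _).aestronglyMeasurable, ?_⟩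
    rw [hasFiniteIntegral_iff_ofReal (ae_of_all _ fun ξ => (Real.exp_pos _).le)]
    exact hexp.trans_lt ENNReal.ofReal_lt_top
  have hle : ∫ ξ, Real.exp (s * firstExceed κ ξ) ∂noise ≤ K := by
    rw [integral_eq_lintegral_of_nonneg_ae (ae_of_all _ fun ξ => (Real.exp_pos _).le)
      hint.aestronglyMeasurable]
    exact ENNReal.toReal_le_of_le_ofReal (by linarith) hexp
  have hAB : K / s ≤ K / s + (Real.log K + 1) / s := le_add_of_nonneg_right (by positivity)
  -- The first summand bounds a single expectation, from `s * x ≤ exp (s * x)`; the second makes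
  -- Chernoff's bound at most `exp (-(d * n))`.
  refine ⟨K / s + (Real.log K + 1) / s, by positivity, fun d n B => ⟨?_, ?_⟩⟩
  · have h1 : ∫⁻ ξ, (firstExceed κ ξ : ENNReal) ∂noise ≤ ENNReal.ofReal (K / s) := by
      have h2 : ∀ ξ : ℕ → ℝ, (firstExceed κ ξ : ENNReal) ≤
          ENNReal.ofReal s⁻¹ * ENNReal.ofReal (Real.exp (s * firstExceed κ ξ)) := by
        intro ξ
        rw [← ENNReal.ofReal_mul (by positivity), ← ENNReal.ofReal_natCast]
        refine ENNReal.ofReal_le_ofReal ?_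
        rw [inv_mul_eq_div, le_div_iff₀ hs, mul_comm]
        have := Real.add_one_le_exp (s * firstExceed κ ξ)
        linarith
      refine (lintegral_mono h2).trans ?_
      rw [lintegral_const_mul _ (by fun_prop)]
      refine (mul_le_mul_right hexp _).trans (le_of_eq ?_)
      rw [← ENNReal.ofReal_mul (by positivity), inv_mul_eq_div]
    have h3 : ∀ q : ℕ × ℕ × ℕ, ∫⁻ ω, (firstExceed κ (fun l => ω (q.1, q.2.1, q.2.2, l)) : ENNReal)
        ∂allDraws ≤ ENNReal.ofReal (K / s) := by
      intro q
      have hp := (measurePreserving_eval_infinitePi (fun _ : ℕ × ℕ × ℕ => noise) q).comp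
        measurePreserving_drawBlocks
      exact (hp.lintegral_comp (f := fun ξ => (firstExceed κ ξ : ENNReal))
        (measurable_from_nat.comp hf)).le.trans h1
    simp only [totalAttempts_eq, Nat.cast_sum]
    rw [lintegral_finsetSum]
    · refine (Finset.sum_le_sum fun q _ => h3 q).trans ?_
      rw [Finset.sum_const, nsmul_eq_mul, ← ENNReal.ofReal_natCast, ← ENNReal.ofReal_mul (by positivity),
        mul_comm]
      refine ENNReal.ofReal_le_ofReal ?_
      have h4 : ((Finset.range d ×ˢ Finset.range B ×ˢ Finset.range (n / B)).card : ℝ) ≤ d * n := by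
        exact_mod_cast card_attempts_le d n B
      gcongr
    · intro q _
      exact measurable_from_nat.comp (hf.comp (by fun_prop))
  · set R := Finset.range d ×ˢ Finset.range B ×ˢ Finset.range (n / B) with hR
    set c := (K / s + (Real.log K + 1) / s) * (d * n) with hc
    have h1 := iid_chernoff noise (f := fun ξ => (firstExceed κ ξ : ℝ)) hfr hs.le hint hle R c
    have hm : MeasurableSet {g : ℕ × ℕ × ℕ → ℕ → ℝ | c ≤ ∑ j ∈ R, (firstExceed κ (g j) : ℝ)} :=
      measurableSet_le measurable_const (Finset.measurable_fun_sum _ fun j _ => hfr.comp (by fun_prop))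
    have h2 : allDraws.real {ω | c ≤ totalAttempts κ d n B ω} =
        (Measure.infinitePi fun _ : ℕ × ℕ × ℕ => noise).real
          {g | c ≤ ∑ j ∈ R, (firstExceed κ (g j) : ℝ)} := by
      rw [Measure.real, Measure.real, ← measurePreserving_drawBlocks.measure_preimage
        hm.nullMeasurableSet]
      congr 2
      ext ω
      simp [totalAttempts_eq, hR]
    rw [h2]
    refine h1.trans ?_
    have hK0 : 0 < K := by linarith
    rw [← Real.exp_log hK0, ← Real.exp_nat_mul, ← Real.exp_add]
    refine Real.exp_le_exp.2 ?_
    have h4 : (R.card : ℝ) ≤ d * n := by exact_mod_cast card_attempts_le d n B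
    have h5 := mul_le_mul_of_nonneg_right h4 hlogK
    have h6 : s * c = (K + Real.log K + 1) * (d * n) := by
      rw [hc]
      field_simp
      ring
    have h7 : 0 ≤ K * ((d : ℝ) * n) := by positivity
    rw [h6]
    linarith

/-! ## The failure probability and the running time -/

section Experiment

variable {d k n B : ℕ}

instance (W : Matrix (Fin d) (Fin k) ℝ) (b : Fin d → ℝ) (n : ℕ) :
    IsProbabilityMeasure (experiment W b n) := by
  unfold experiment
  infer_instance

lemma measurePreserving_columnData (W : Matrix (Fin d) (Fin k) ℝ) (b : Fin d → ℝ) (n : ℕ)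
    (i : Fin d) : MeasurePreserving (columnData i) (experiment W b n)
      ((Measure.pi fun _ : Fin n => colLaw ‖rowVec W i‖ (b i)).prod drawLaw) := by
  have h1 : MeasurePreserving (fun (X : Fin n → Fin d → ℝ) m => X m i)
      (Measure.pi fun _ => rectifiedGaussian W b)
      (Measure.pi fun _ => colLaw ‖rowVec W i‖ (b i)) :=
    measurePreserving_pi _ _ fun _ => ⟨by fun_prop, map_eval_rectifiedGaussian W b i⟩
  have h2 : MeasurePreserving (fun (ω : Draw → ℝ) (q : ℕ × ℕ) l => ω ((i : ℕ), q.1, q.2, l))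
      allDraws drawLaw :=
    measurePreserving_blocks (gaussianReal 0 1)
      (f := fun p : (ℕ × ℕ) × ℕ => (((i : ℕ), p.1.1, p.1.2, p.2) : Draw)) fun p q h => by
        simp only [Prod.mk.injEq, true_and] at h
        exact Prod.ext (Prod.ext h.1 h.2.1) h.2.2
  exact h1.prod h2

lemma experiment_real_fst (W : Matrix (Fin d) (Fin k) ℝ) (b : Fin d → ℝ)
    (S : Set (Fin n → Fin d → ℝ)) : (experiment W b n).real (Prod.fst ⁻¹' S) =
      (Measure.pi fun _ : Fin n => rectifiedGaussian W b).real S := by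
  rw [experiment, ← Set.prod_univ, Measure.real, Measure.prod_prod, measure_univ, mul_one]
  rfl

lemma experiment_real_snd (W : Matrix (Fin d) (Fin k) ℝ) (b : Fin d → ℝ) (S : Set (Draw → ℝ)) :
    (experiment W b n).real (Prod.snd ⁻¹' S) = allDraws.real S := by
  rw [experiment, ← Set.univ_prod, Measure.real, Measure.prod_prod, measure_univ, one_mul]
  rfl

/-- A bound for the number of steps, given the number of attempts. -/
def stepCost (d n B : ℕ) (a : ℝ) : ℝ :=
  d * (105 * n + 200 * B ^ 2 + 104) + d * (1 + d * (10 * n + 23)) + 11 * a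

lemma stepBound_eq (κ : ℝ) (d n B : ℕ) (ω : Draw → ℝ) :
    (stepBound κ d n B ω : ℝ) = stepCost d n B (totalAttempts κ d n B ω) := by
  unfold stepBound stepCost totalAttempts
  push_cast
  ring

/-- Outside finitely many controlled events and the null event `Stuck`, the conclusion is
deterministic. Only containment of the failure event is used, so its own measurability is not
needed. -/
lemma experiment_failure_le {W : Matrix (Fin d) (Fin k) ℝ} {b : Fin d → ℝ} (hb : ∀ i, 0 ≤ b i)
    {r ρ A p q a : ℝ} (hr : 1 < r) (hn : 0 < n) (hB : 0 < B) (hρ : 0 ≤ ρ) (hρ1 : ρ ≤ 1)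
    (hcol : ∀ i : Fin d, ((Measure.pi fun _ : Fin n => colLaw ‖rowVec W i‖ (b i)).prod drawLaw).real
      (BadColumn r ρ (b i) ‖rowVec W i‖ B n) ≤ p)
    (hfreq : 2 * Real.exp (-(n * ρ ^ 2 / 2)) ≤ q)
    (hatt : allDraws.real {ω | A ≤ totalAttempts (r * √r) d n B ω} ≤ a) :
    (experiment W b n).real {p | ¬∃ σ : State Cell, final r (stepParam r) B p.1 p.2 = some σ ∧
      ‖σ.sigmaHat d - W * W.transpose‖ ≤ 33 * ρ * ‖W‖ ^ 2 ∧
      ‖σ.biasHat d - WithLp.toLp 2 b‖ ≤ ρ * ‖W‖ ∧ (σ.steps : ℝ) ≤ stepCost d n B A} ≤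
      d * p + d * (d * q) + d * q + a := by
  set μ := experiment W b n
  set Bcol := ⋃ i ∈ (Finset.univ : Finset (Fin d)),
    (columnData i ⁻¹' BadColumn r ρ (b i) ‖rowVec W i‖ B n : Set ((Fin n → Fin d → ℝ) × (Draw → ℝ)))
    with hBcol
  set Bjoint := ⋃ i ∈ (Finset.univ : Finset (Fin d)), ⋃ j ∈ (Finset.univ : Finset (Fin d)),
    (Prod.fst ⁻¹' BadFreq (rectifiedGaussian W b) n ρ (jointEvent b i j) :
      Set ((Fin n → Fin d → ℝ) × (Draw → ℝ))) with hBjoint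
  set Bnear := ⋃ i ∈ (Finset.univ : Finset (Fin d)),
    (Prod.fst ⁻¹' BadFreq (rectifiedGaussian W b) n ρ (nearEvent W b ρ i) :
      Set ((Fin n → Fin d → ℝ) × (Draw → ℝ))) with hBnear
  set Batt : Set ((Fin n → Fin d → ℝ) × (Draw → ℝ)) :=
    Prod.snd ⁻¹' {ω | A ≤ totalAttempts (r * √r) d n B ω}
  set Bstuck : Set ((Fin n → Fin d → ℝ) × (Draw → ℝ)) := Prod.snd ⁻¹' {ω | Stuck (r * √r) ω}
  have hsub : {p : (Fin n → Fin d → ℝ) × (Draw → ℝ) | ¬∃ σ : State Cell,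
      final r (stepParam r) B p.1 p.2 = some σ ∧
      ‖σ.sigmaHat d - W * W.transpose‖ ≤ 33 * ρ * ‖W‖ ^ 2 ∧
      ‖σ.biasHat d - WithLp.toLp 2 b‖ ≤ ρ * ‖W‖ ∧ (σ.steps : ℝ) ≤ stepCost d n B A} ⊆
      (((Bcol ∪ Bjoint) ∪ Bnear) ∪ Batt) ∪ Bstuck := by
    rintro ⟨X, ω⟩ hX
    by_contra hgood
    simp only [Set.mem_union, not_or] at hgood
    obtain ⟨⟨⟨⟨g1, g2⟩, g3⟩, g4⟩, g5⟩ := hgood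
    simp only [hBcol, Set.mem_iUnion, Finset.mem_univ, exists_const, not_exists,
      Set.mem_preimage] at g1
    simp only [hBjoint, Set.mem_iUnion, Finset.mem_univ, exists_const, not_exists,
      Set.mem_preimage] at g2
    simp only [hBnear, Set.mem_iUnion, Finset.mem_univ, exists_const, not_exists,
      Set.mem_preimage] at g3
    have g4' : (totalAttempts (r * √r) d n B ω : ℝ) ≤ A := (not_le.1 g4).le
    have hspec := final_spec hr (stepParam r) hB X ω
    refine hX ?_
    cases hf : final r (stepParam r) B X ω with
    | none => exact absurd (hspec.1 hf) g5
    | some σ =>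
      obtain ⟨hres, hsteps, -⟩ := hspec.2 σ hf
      refine ⟨σ, rfl, norm_sigma_sub_le (by positivity) fun i j =>
        abs_entry_sub_le hn hb hρ hρ1 hres g1 g2 g3 i j, norm_bias_sub_le hρ fun i =>
        (close_of_rowEstimate (hb i) (hres.row i i.2) (g1 i)).2.1, ?_⟩
      have h1 : (σ.steps : ℝ) ≤ stepBound (r * √r) d n B ω := by exact_mod_cast hsteps g5
      refine h1.trans ?_
      rw [stepBound_eq]
      unfold stepCost
      linarith
  have hf : ∀ S : Set (Fin d → ℝ), MeasurableSet S →
      μ.real (Prod.fst ⁻¹' BadFreq (rectifiedGaussian W b) n ρ S) ≤ q := fun S hS => by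
    rw [experiment_real_fst]
    exact (measure_badFreq_le _ n hρ hS).trans hfreq
  have h1 : μ.real Bcol ≤ d * p := by
    refine (measureReal_biUnion_finset_le _ _).trans ?_
    refine (Finset.sum_le_card_nsmul _ _ p fun i _ => ?_).trans (by simp)
    rw [Measure.real, (measurePreserving_columnData W b n i).measure_preimage
      (measurableSet_badColumn ..).nullMeasurableSet]
    exact hcol i
  have h2 : μ.real Bjoint ≤ d * (d * q) := by
    refine (measureReal_biUnion_finset_le _ _).trans ?_
    refine (Finset.sum_le_card_nsmul _ _ (d * q) fun i _ => ?_).trans (by simp)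
    refine (measureReal_biUnion_finset_le _ _).trans ?_
    refine (Finset.sum_le_card_nsmul _ _ q fun j _ => ?_).trans (by simp)
    exact hf _ (measurableSet_jointEvent b i j)
  have h3 : μ.real Bnear ≤ d * q := by
    refine (measureReal_biUnion_finset_le _ _).trans ?_
    refine (Finset.sum_le_card_nsmul _ _ q fun i _ => ?_).trans (by simp)
    exact hf _ (measurableSet_nearEvent W b ρ i)
  have h4 : μ.real Batt ≤ a := by
    rw [experiment_real_snd]
    exact hatt
  have h5 : μ.real Bstuck = 0 := by
    rw [experiment_real_snd, Measure.real]
    have : allDraws {ω | Stuck (r * √r) ω} = 0 := by simpa [ae_iff] using ae_not_stuck (r * √r)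
    rw [this, ENNReal.toReal_zero]
  refine (measureReal_mono hsub (measure_ne_top _ _)).trans ?_
  have u1 := measureReal_union_le (μ := μ) (((Bcol ∪ Bjoint) ∪ Bnear) ∪ Batt) Bstuck
  have u2 := measureReal_union_le (μ := μ) ((Bcol ∪ Bjoint) ∪ Bnear) Batt
  have u3 := measureReal_union_le (μ := μ) (Bcol ∪ Bjoint) Bnear
  have u4 := measureReal_union_le (μ := μ) Bcol Bjoint
  linarith

lemma lintegral_runTime_le (W : Matrix (Fin d) (Fin k) ℝ) (b : Fin d → ℝ) {r A : ℝ} (hr : 1 < r)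
    (hB : 0 < B) (hA : 0 ≤ A) (hatt : ∫⁻ ω, (totalAttempts (r * √r) d n B ω : ENNReal) ∂allDraws ≤
      ENNReal.ofReal A) :
    ∫⁻ p, runTime r (stepParam r) B p.1 p.2 ∂(experiment W b n) ≤
      ENNReal.ofReal (stepCost d n B A) := by
  have hae : ∀ᵐ p ∂(experiment W b n), ¬Stuck (r * √r) p.2 :=
    Measure.quasiMeasurePreserving_snd.ae (ae_not_stuck (r * √r))
  have hle : ∫⁻ p, runTime r (stepParam r) B p.1 p.2 ∂(experiment W b n) ≤
      ∫⁻ p, (ENNReal.ofReal (stepCost d n B 0) + 11 * (totalAttempts (r * √r) d n B p.2 : ENNReal))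
        ∂(experiment W b n) := by
    refine lintegral_mono_ae ?_
    filter_upwards [hae] with p hp
    have hspec := final_spec hr (stepParam r) hB p.1 p.2
    unfold runTime
    cases hf : final r (stepParam r) B p.1 p.2 with
    | none => exact absurd (hspec.1 hf) hp
    | some σ =>
      have h1 : (σ.steps : ℝ) ≤ stepBound (r * √r) d n B p.2 := by
        exact_mod_cast (hspec.2 σ hf).2.1 hp
      rw [stepBound_eq] at h1
      have h2 : stepCost d n B (totalAttempts (r * √r) d n B p.2) =
          stepCost d n B 0 + 11 * (totalAttempts (r * √r) d n B p.2 : ℝ) := by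
        unfold stepCost
        ring
      have h3 : 0 ≤ stepCost d n B 0 := by
        unfold stepCost
        positivity
      rw [h2] at h1
      have h4 := ENNReal.ofReal_le_ofReal h1
      rw [ENNReal.ofReal_add h3 (by positivity), ENNReal.ofReal_mul (by norm_num),
        ENNReal.ofReal_natCast, ENNReal.ofReal_natCast, ENNReal.ofReal_ofNat] at h4
      exact h4
  refine hle.trans ?_
  have hm : Measurable fun ω => (totalAttempts (r * √r) d n B ω : ENNReal) :=
    measurable_from_nat.comp (measurable_totalAttempts (r * √r) d n B)
  have hsnd : ∫⁻ p, (totalAttempts (r * √r) d n B p.2 : ENNReal) ∂(experiment W b n) =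
      ∫⁻ ω, (totalAttempts (r * √r) d n B ω : ENNReal) ∂allDraws :=
    (measurePreserving_snd (μ := Measure.pi fun _ : Fin n => rectifiedGaussian W b)
      (ν := allDraws)).lintegral_comp hm
  rw [lintegral_add_left measurable_const, lintegral_const, measure_univ, mul_one,
    lintegral_const_mul' _ _ (by norm_num), hsnd]
  have h3 : 0 ≤ stepCost d n B 0 := by
    unfold stepCost
    positivity
  have h2 : stepCost d n B A = stepCost d n B 0 + 11 * A := by
    unfold stepCost
    ring
  rw [h2, ENNReal.ofReal_add h3 (by positivity), ENNReal.ofReal_mul (by norm_num),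
    ENNReal.ofReal_ofNat]
  gcongr

end Experiment

/-! ## The choice of the parameters -/

lemma log_two_gt_half : (1 / 2 : ℝ) < Real.log 2 := by
  have := Real.log_two_gt_d9
  linarith

/-- The batch length contains the factor `D`, whose logarithm reappears in the rate; `D` must
dominate a power of its own logarithm. -/
lemma exists_log_pow_le (c : ℝ) : ∃ D : ℝ, c ≤ D ∧ 1 ≤ D ∧ c * (16 + 2 * Real.log D) ^ 4 ≤ D := by
  obtain ⟨c', hc', hcc⟩ : ∃ c' : ℝ, 0 < c' ∧ c ≤ c' := ⟨max c 1, by positivity, le_max_left _ _⟩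
  have h1 : ∀ᶠ x : ℝ in Filter.atTop, ‖Real.log x ^ 4‖ ≤ (c' * 81)⁻¹ * ‖id x‖ :=
    (Real.isLittleO_pow_log_id_atTop (n := 4)).def (by positivity)
  have h2 : ∀ᶠ x : ℝ in Filter.atTop, 16 ≤ Real.log x :=
    Real.tendsto_log_atTop.eventually_ge_atTop 16
  obtain ⟨D, e1, e2, e3, e4⟩ := (h1.and (h2.and ((Filter.eventually_ge_atTop 1).and
    (Filter.eventually_ge_atTop c)))).exists
  refine ⟨D, e4, e3, ?_⟩
  have hD : 0 < D := by linarith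
  have hl : 0 ≤ Real.log D := by linarith
  rw [Real.norm_of_nonneg (by positivity), id, Real.norm_of_nonneg hD.le] at e1
  have h3 : (16 + 2 * Real.log D) ^ 4 ≤ (3 * Real.log D) ^ 4 := by
    gcongr
    linarith
  calc c * (16 + 2 * Real.log D) ^ 4 ≤ c' * (3 * Real.log D) ^ 4 := by gcongr
    _ = c' * 81 * Real.log D ^ 4 := by ring
    _ ≤ c' * 81 * ((c' * 81)⁻¹ * D) := by gcongr
    _ = D := by field_simp

lemma rate_le_of_le {D η ℓ ε : ℝ} {T : ℕ} (hD : 1 ≤ D) (hη : 0 < η) (hε : 0 < ε) (hε1 : ε < 1)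
    (hℓ : ℓ = Real.log (2 / ε)) (hDη : (16 + 2 * Real.log D) ^ 4 / η ^ 2 ≤ D)
    (hT : D * (1 / ε ^ 2) * ℓ ^ 4 ≤ T) : rate T ≤ η * ε := by
  have hl2 := log_two_gt_half
  have hℓ2 : Real.log 2 + Real.log (1 / ε) = ℓ := by
    rw [← Real.log_mul (by norm_num) (by positivity), hℓ]
    congr 1
    ring
  have hε' : 0 ≤ Real.log (1 / ε) := Real.log_nonneg (by rw [le_div_iff₀ hε]; linarith)
  have hℓ0 : 1 / 2 < ℓ := by linarith
  have hℓp : 0 < ℓ := by linarith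
  obtain ⟨Q, hQ⟩ : ∃ Q, Q = D * (1 / ε ^ 2) * ℓ ^ 4 := ⟨_, rfl⟩
  have hQp : 0 < Q := by rw [hQ]; positivity
  rw [← hQ] at hT
  obtain ⟨w, hw⟩ : ∃ w, w = (T : ℝ) / Q := ⟨_, rfl⟩
  have hw1 : 1 ≤ w := by rw [hw, le_div_iff₀ hQp]; linarith
  have hTw : (T : ℝ) = Q * w := by rw [hw]; field_simp
  -- The bound is needed for all `T ≥ Q`, not only at `Q`. With `w = T / Q` and `log w ≤ 4 * u` for
  -- the fourth root `u`, the fourth power of the logarithm grows at most like `w` and cancels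
  -- against `T = Q * w`.
  obtain ⟨u, hu⟩ : ∃ u, u = √(√w) := ⟨_, rfl⟩
  have hu4 : u ^ 4 = w := by
    rw [hu, show (4 : ℕ) = 2 * 2 from rfl, pow_mul, Real.sq_sqrt (Real.sqrt_nonneg _),
      Real.sq_sqrt (by linarith)]
  have hu1 : 1 ≤ u := by
    rw [hu, Real.one_le_sqrt, Real.one_le_sqrt]
    exact hw1
  have hlogw : Real.log w ≤ 4 * u := by
    have h1 : Real.log w = 4 * Real.log u := by rw [← hu4, Real.log_pow]; norm_num
    have h2 := Real.log_le_self (by linarith : 0 ≤ u)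
    linarith
  have hlogℓ : Real.log ℓ ≤ ℓ := Real.log_le_self hℓp.le
  have hlogD : 0 ≤ Real.log D := Real.log_nonneg hD
  have hlogT : 1 + Real.log T ≤ (16 + 2 * Real.log D) * ℓ * u := by
    have h1 : Real.log T = Real.log D + 2 * Real.log (1 / ε) + 4 * Real.log ℓ + Real.log w := by
      rw [hTw, hQ, show (1 / ε ^ 2 : ℝ) = (1 / ε) ^ 2 by rw [div_pow, one_pow],
        Real.log_mul (by positivity) (by positivity), Real.log_mul (by positivity) (by positivity),
        Real.log_mul (by positivity) (by positivity), Real.log_pow, Real.log_pow]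
      norm_num
    have h2 : 1 ≤ 2 * (ℓ * u) := by nlinarith
    have h3 : Real.log D ≤ Real.log D * (2 * (ℓ * u)) := le_mul_of_one_le_right hlogD h2
    have h4 : ℓ ≤ ℓ * u := le_mul_of_one_le_right hℓp.le hu1
    have h5 : u ≤ 2 * (ℓ * u) := by nlinarith
    have h6 : (16 + 2 * Real.log D) * ℓ * u = 16 * (ℓ * u) + Real.log D * (2 * (ℓ * u)) := by ring
    linarith
  have hlogT0 : 0 ≤ 1 + Real.log T := by
    have := Real.log_natCast_nonneg T
    linarith
  have hTp : (0 : ℝ) < T := by linarith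
  unfold rate
  rw [Real.sqrt_le_left (by positivity), div_le_iff₀ hTp]
  calc (1 + Real.log T) ^ 4 ≤ ((16 + 2 * Real.log D) * ℓ * u) ^ 4 := by gcongr
    _ = (16 + 2 * Real.log D) ^ 4 / η ^ 2 * (η ^ 2 * ℓ ^ 4 * w) := by
      rw [mul_pow, mul_pow, hu4]
      field_simp
    _ ≤ D * (η ^ 2 * ℓ ^ 4 * w) := by gcongr
    _ = (η * ε) ^ 2 * T := by
      rw [hTw, hQ]
      field_simp

lemma one_le_mul_log_pow {ε : ℝ} (hε : 0 < ε) (hε1 : ε < 1) :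
    1 ≤ 16 * ((1 / ε ^ 2) * Real.log (2 / ε) ^ 4) := by
  have h1 : (1 / 2 : ℝ) ≤ Real.log (2 / ε) :=
    log_two_gt_half.le.trans (Real.log_le_log two_pos (by rw [le_div_iff₀ hε]; linarith))
  have h2 : (1 : ℝ) ≤ 1 / ε ^ 2 := by
    rw [le_div_iff₀ (by positivity), one_mul]
    exact pow_le_one₀ hε.le hε1.le
  have h3 : (1 / 2 : ℝ) ^ 4 ≤ Real.log (2 / ε) ^ 4 := by gcongr
  have h4 : 1 * (1 / 2 : ℝ) ^ 4 ≤ (1 / ε ^ 2) * Real.log (2 / ε) ^ 4 := by gcongr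
  linarith

/-- The batch length that is needed for the accuracy `ε`. -/
lemma exists_batch_length {K : ℝ} (hK : 0 < K) : ∃ D : ℝ, 0 < D ∧ ∀ ε : ℝ, 0 < ε → ε < 1 →
    ∃ T₀ : ℕ, 0 < T₀ ∧ (T₀ : ℝ) ≤ D * ((1 / ε ^ 2) * Real.log (2 / ε) ^ 4) ∧
      (∀ T, T₀ ≤ T → K * rate T ≤ ε / 33) ∧ 1 ≤ T₀ * (ε / 33) ^ 2 / 2 := by
  have hη : 0 < (33 * K)⁻¹ := by positivity
  obtain ⟨D, hcD, hD1, hD⟩ := exists_log_pow_le (max ((33 * K) ^ 2) (32 * 33 ^ 2))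
  have hl : 0 ≤ 16 + 2 * Real.log D := by
    have := Real.log_nonneg hD1
    positivity
  have hDη : (16 + 2 * Real.log D) ^ 4 / (33 * K)⁻¹ ^ 2 ≤ D := by
    refine le_trans ?_ hD
    rw [inv_pow, div_inv_eq_mul, mul_comm]
    gcongr
    exact le_max_left _ _
  refine ⟨D + 16, by linarith, fun ε hε hε1 => ?_⟩
  have hQ := one_le_mul_log_pow hε hε1
  have hD0 : 0 < D := by linarith
  refine ⟨⌈D * (1 / ε ^ 2) * Real.log (2 / ε) ^ 4⌉₊, Nat.ceil_pos.2 ?_, ?_, fun T hT => ?_, ?_⟩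
  · rw [mul_assoc]
    exact mul_pos hD0 (by linarith)
  · refine (Nat.ceil_lt_add_one ?_).le.trans ?_
    · rw [mul_assoc]
      exact (mul_pos hD0 (by linarith)).le
    · rw [add_mul]
      linarith
  · have h1 := rate_le_of_le hD1 hη hε hε1 rfl hDη (Nat.ceil_le.1 hT)
    calc K * rate T ≤ K * ((33 * K)⁻¹ * ε) := by gcongr
      _ = ε / 33 := by field_simp
  · have h1 := Nat.le_ceil (D * (1 / ε ^ 2) * Real.log (2 / ε) ^ 4)
    have h2 : (32 * 33 ^ 2 : ℝ) ≤ D := (le_max_right _ _).trans hcD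
    have h4 : (1 / 2 : ℝ) ≤ Real.log (2 / ε) :=
      log_two_gt_half.le.trans (Real.log_le_log two_pos (by rw [le_div_iff₀ hε]; linarith))
    have h5 : (1 / 2 : ℝ) ^ 4 ≤ Real.log (2 / ε) ^ 4 := by gcongr
    have h6 : (32 * 33 ^ 2) * (1 / ε ^ 2) * (1 / 2 : ℝ) ^ 4 ≤
        (⌈D * (1 / ε ^ 2) * Real.log (2 / ε) ^ 4⌉₊ : ℝ) := le_trans (by gcongr) h1
    calc (1 : ℝ) = (32 * 33 ^ 2) * (1 / ε ^ 2) * (1 / 2 : ℝ) ^ 4 * (ε / 33) ^ 2 / 2 := by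
          field_simp
          norm_num
      _ ≤ _ := by gcongr

lemma half_lt_log_div {d : ℕ} (hd : 0 < d) {δ : ℝ} (hδ : 0 < δ) (hδ1 : δ < 1) :
    1 / 2 < Real.log (2 * d / δ) := by
  have hd' : (1 : ℝ) ≤ d := by exact_mod_cast hd
  refine log_two_gt_half.trans_le (Real.log_le_log two_pos ?_)
  rw [le_div_iff₀ hδ]
  nlinarith

/-- The number of runs that is needed for the confidence `δ`. -/
lemma exists_numRuns {k C : ℝ} (hk : 0 < k) (hC : 1 ≤ C) : ∃ c : ℝ, 0 < c ∧ ∀ (d : ℕ) (δ : ℝ),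
    0 < d → 0 < δ → δ < 1 → 4 ≤ numRuns c d δ ∧
      (numRuns c d δ : ℝ) ≤ (c + 2) * Real.log (2 * d / δ) ∧
      (d : ℝ) ^ 2 * (C * Real.exp (-(k * numRuns c d δ))) ≤ δ := by
  have hlC := Real.log_nonneg hC
  -- As the logarithm exceeds `1 / 2`, the `8` ensures at least four runs. The second entry makes
  -- the failure probability small enough for a union bound over `d ^ 2` pairs.
  have hc8 : 8 ≤ max 8 ((2 + 2 * Real.log C) / k) := le_max_left _ _
  have hck : 2 + 2 * Real.log C ≤ max 8 ((2 + 2 * Real.log C) / k) * k := by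
    rw [← div_le_iff₀ hk]
    exact le_max_right _ _
  obtain ⟨c, hc⟩ : ∃ c, c = max 8 ((2 + 2 * Real.log C) / k) := ⟨_, rfl⟩
  rw [← hc] at hc8 hck
  refine ⟨c, by linarith, fun d δ hd hδ hδ1 => ?_⟩
  have hL := half_lt_log_div hd hδ hδ1
  obtain ⟨L, hLe⟩ : ∃ L, L = Real.log (2 * d / δ) := ⟨_, rfl⟩
  rw [← hLe] at hL ⊢
  have hd' : (1 : ℝ) ≤ d := by exact_mod_cast hd
  have h1 : c * L ≤ (numRuns c d δ : ℝ) := by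
    rw [hLe]
    exact Nat.le_ceil _
  have hcL : 8 * (1 / 2) ≤ c * L := by gcongr
  have h2 : (numRuns c d δ : ℝ) ≤ c * L + 1 := by
    rw [hLe] at hcL ⊢
    exact (Nat.ceil_lt_add_one (by linarith)).le
  refine ⟨?_, by linarith, ?_⟩
  · have : ((4 : ℕ) : ℝ) ≤ (numRuns c d δ : ℝ) := by
      push_cast
      linarith
    exact_mod_cast this
  have h3 : 2 * L + Real.log C ≤ k * numRuns c d δ := by
    calc 2 * L + Real.log C ≤ 2 * L + 2 * Real.log C * L := by nlinarith
      _ = (2 + 2 * Real.log C) * L := by ring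
      _ ≤ c * k * L := by gcongr
      _ = k * (c * L) := by ring
      _ ≤ _ := by gcongr
  have h4 : Real.exp (-(k * numRuns c d δ)) ≤ (δ / (2 * d)) ^ 2 / C := by
    calc _ ≤ Real.exp (-(2 * L + Real.log C)) := Real.exp_le_exp.2 (neg_le_neg h3)
      _ = _ := by
        rw [neg_add, Real.exp_add, Real.exp_neg (Real.log C), Real.exp_log (by linarith),
          show -(2 * L) = ((2 : ℕ) : ℝ) * -L by push_cast; ring, Real.exp_nat_mul, Real.exp_neg, hLe,
          Real.exp_log (by positivity), inv_div, ← div_eq_mul_inv]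
  have hC0 : 0 < C := by linarith
  calc (d : ℝ) ^ 2 * (C * Real.exp (-(k * numRuns c d δ)))
      ≤ (d : ℝ) ^ 2 * (C * ((δ / (2 * d)) ^ 2 / C)) := by gcongr
    _ = δ * (δ / 4) := by field_simp; ring
    _ ≤ δ := by nlinarith

/-! ## The size of the bounds -/

section Bounds

variable {d n B : ℕ} {Q L N c A C : ℝ}

lemma space_le (hd : 0 < d) (hQ : 1 ≤ 16 * Q) (hL : 1 / 2 < L) (hN : 0 ≤ N) (hc : 0 ≤ c)
    (hn : (n : ℝ) ≤ N * L * Q) (hB : (B : ℝ) ≤ c * L) (hC : 2 * N + 32 * c + 2 ≤ C) :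
    ((n * d + n + 2 * B + d + d * d : ℕ) : ℝ) ≤ C * (d * L * Q + d ^ 2) := by
  have hd' : (1 : ℝ) ≤ d := by exact_mod_cast hd
  push_cast
  have h1 : (n : ℝ) * d ≤ N * L * Q * d := by gcongr
  have h2 : (n : ℝ) ≤ n * d := le_mul_of_one_le_right (Nat.cast_nonneg n) hd'
  have h3 : (d : ℝ) ≤ d * d := le_mul_of_one_le_right (by linarith) hd'
  have h4 : c * L ≤ c * L * (16 * Q) * d := by
    have : 0 ≤ c * L := by positivity
    calc c * L = c * L * 1 * 1 := by ring
      _ ≤ c * L * (16 * Q) * d := by gcongr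
  have hQ0 : 0 ≤ Q := by linarith
  have hX : 0 ≤ d * L * Q := by positivity
  calc _ ≤ (2 * N + 32 * c) * (d * L * Q) + 2 * (d : ℝ) ^ 2 := by nlinarith
    _ ≤ C * (d * L * Q) + C * (d : ℝ) ^ 2 := by
      gcongr <;> linarith
    _ = _ := by ring

/-- The terms without `n` are at most `128 * d ^ 2` apart from the one with `B ^ 2`, and `1 ≤ 32 *
(L * Q)`, whence `4096`. The term `200 * d * B ^ 2` is the cost of comparing the runs and gives the
separate summand `d * L ^ 2`. -/
lemma steps_le (hd : 0 < d) (hQ : 1 ≤ 16 * Q) (hL : 1 / 2 < L) (hA : 0 ≤ A)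
    (hn : (n : ℝ) ≤ N * L * Q) (hB : (B : ℝ) ≤ c * L)
    (hC : (115 + 11 * A) * N + 4096 ≤ C) (hC' : 200 * c ^ 2 ≤ C) :
    stepCost d n B (A * (d * n)) ≤ C * (d ^ 2 * L * Q + d * L ^ 2) := by
  have hd' : (1 : ℝ) ≤ d := by exact_mod_cast hd
  have h3 : (d : ℝ) ≤ d ^ 2 := by nlinarith
  have hn0 : (0 : ℝ) ≤ n := Nat.cast_nonneg n
  have h1 : (d : ℝ) * n ≤ d ^ 2 * (N * L * Q) := by gcongr
  have h2 : (d : ℝ) ^ 2 * n ≤ d ^ 2 * (N * L * Q) := by gcongr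
  have h4 : (B : ℝ) ^ 2 ≤ c ^ 2 * L ^ 2 := by rw [← mul_pow]; gcongr
  have h5 : (1 : ℝ) ≤ 32 * (L * Q) := by
    have hQ0 : 0 ≤ 16 * Q := by linarith
    calc (1 : ℝ) ≤ 2 * L * (16 * Q) := by
          have : (1 : ℝ) ≤ 2 * L := by linarith
          calc (1 : ℝ) = 1 * 1 := by ring
            _ ≤ _ := by gcongr
      _ = _ := by ring
  have h6 : (d : ℝ) ^ 2 ≤ d ^ 2 * (32 * (L * Q)) := le_mul_of_one_le_right (by positivity) h5
  have hQ0 : 0 ≤ Q := by linarith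
  have hX : 0 ≤ (d : ℝ) ^ 2 * L * Q := by positivity
  have h7 : (d : ℝ) * B ^ 2 ≤ d * (c ^ 2 * L ^ 2) := by gcongr
  have h8 : A * ((d : ℝ) * n) ≤ A * (d ^ 2 * (N * L * Q)) := by gcongr
  have h9 : ((115 + 11 * A) * N + 4096) * ((d : ℝ) ^ 2 * L * Q) ≤ C * (d ^ 2 * L * Q) := by gcongr
  have h10 : 200 * c ^ 2 * ((d : ℝ) * L ^ 2) ≤ C * (d * L ^ 2) := by gcongr
  unfold stepCost
  linarith

end Bounds

end ReluLearning

end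

/-! ### Choice of the sample size and union bound. -/

theorem theorem1 :
    ∃ (r lam c C : ℝ) (a : ℕ), 1 < r ∧ 0 < lam ∧ 0 < c ∧ 0 < C ∧
      ∀ (d : ℕ), 0 < d → ∀ (ε δ : ℝ), 0 < ε → ε < 1 → 0 < δ → δ < 1 →
        ∃ n : ℕ, 0 < n ∧ (n : ℝ) ≤ ReluLearning.sampleBound C a d ε δ ∧
          -- space, for every input and every outcome of the random draws
          (∀ (X : Fin n → Fin d → ℝ) (ω : ReluLearning.Draw → ℝ)
              (σ : ReluLearning.State ReluLearning.Cell),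
            ReluLearning.final r lam (ReluLearning.numRuns c d δ) X ω = some σ →
              σ.used.Finite ∧
              (σ.used.ncard : ℝ) ≤ ReluLearning.spaceBound C a d ε δ) ∧
          ∀ (k : ℕ) (W : Matrix (Fin d) (Fin k) ℝ) (b : Fin d → ℝ), (∀ i, 0 ≤ b i) →
            -- accuracy and running time, with probability at least `1 - δ`
            ReluLearning.experiment W b n {p | ¬ ∃ σ : ReluLearning.State ReluLearning.Cell,
                ReluLearning.final r lam (ReluLearning.numRuns c d δ) p.1 p.2 = some σ ∧
                ‖σ.sigmaHat d - W * W.transpose‖ ≤ ε * ‖W‖ ^ 2 ∧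
                ‖σ.biasHat d - WithLp.toLp 2 b‖ ≤ ε * ‖W‖ ∧
                (σ.steps : ℝ) ≤ ReluLearning.timeBound C a d ε δ}
              ≤ ENNReal.ofReal δ ∧
            -- expected running time
            ∫⁻ p, ReluLearning.runTime r lam (ReluLearning.numRuns c d δ) p.1 p.2
                ∂(ReluLearning.experiment W b n)
              ≤ ENNReal.ofReal (ReluLearning.timeBound C a d ε δ) := by
  obtain ⟨r, K, C₁, k₁, M, hr, hK, hC₁, hk₁, hM, hrow⟩ := ReluLearning.exists_badColumn_le
  obtain ⟨A, hA, hatt⟩ := ReluLearning.exists_totalAttempts_le (r * √r)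
  obtain ⟨D, hD, hbatch⟩ := ReluLearning.exists_batch_length hK
  obtain ⟨c, hc, hruns⟩ := ReluLearning.exists_numRuns (k := min k₁ 1) (C := C₁ + 5) (by positivity)
    (by linarith)
  have hM' : (0 : ℝ) < M := by exact_mod_cast hM
  -- The sample size will be `M * (B * T₀)` with `B ≤ (c + 2) * L` and `T₀ ≤ D * Q`, that is, at
  -- most `N * L * Q`.
  obtain ⟨N, hN⟩ : ∃ N : ℝ, N = M * (c + 2) * D := ⟨_, rfl⟩
  have hN0 : 0 < N := by rw [hN]; positivity
  obtain ⟨C, hC⟩ : ∃ C : ℝ, C = (2 * N + 32 * (c + 2) + 2) + ((115 + 11 * A) * N + 4096) +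
      200 * (c + 2) ^ 2 := ⟨_, rfl⟩
  have hC1 : 0 ≤ 2 * N + 32 * (c + 2) + 2 := by positivity
  have hC2 : 0 ≤ (115 + 11 * A) * N + 4096 := by positivity
  have hC3 : 0 ≤ 200 * (c + 2) ^ 2 := by positivity
  have hCa : 2 * N + 32 * (c + 2) + 2 ≤ C := by linarith
  have hCb : (115 + 11 * A) * N + 4096 ≤ C := by linarith
  have hCc : 200 * (c + 2) ^ 2 ≤ C := by linarith
  have hNC : N ≤ C := by linarith
  refine ⟨r, ReluLearning.stepParam r, c, C, 4, hr, ReluLearning.stepParam_pos hr, hc, by linarith,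
    fun d hd ε δ hε hε1 hδ hδ1 => ?_⟩
  obtain ⟨T₀, hT, hTD, hrate, hTε⟩ := hbatch ε hε hε1
  obtain ⟨hB4, hBL, hBδ⟩ := hruns d δ hd hδ hδ1
  have hL := ReluLearning.half_lt_log_div hd hδ hδ1
  have hQ := ReluLearning.one_le_mul_log_pow hε hε1
  unfold ReluLearning.timeBound ReluLearning.spaceBound ReluLearning.sampleBound
  obtain ⟨L, hLe⟩ : ∃ L, L = Real.log (2 * d / δ) := ⟨_, rfl⟩
  obtain ⟨Q, hQe⟩ : ∃ Q, Q = (1 / ε ^ 2) * Real.log (2 / ε) ^ 4 := ⟨_, rfl⟩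
  obtain ⟨B, hBe⟩ : ∃ B, B = ReluLearning.numRuns c d δ := ⟨_, rfl⟩
  rw [← hLe] at hL hBL ⊢
  rw [← hQe] at hQ hTD
  rw [← hBe] at hB4 hBL hBδ ⊢
  have hB0 : 0 < B := by omega
  have hdr : (1 : ℝ) ≤ d := by exact_mod_cast hd
  have hnL : ((M * (B * T₀) : ℕ) : ℝ) ≤ N * L * Q := by
    push_cast
    calc (M : ℝ) * (B * T₀) ≤ M * (((c + 2) * L) * (D * Q)) := by gcongr
      _ = N * L * Q := by rw [hN]; ring
  obtain ⟨n, hn⟩ : ∃ n, n = M * (B * T₀) := ⟨_, rfl⟩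
  rw [← hn] at hnL
  have hn0 : 0 < n := by rw [hn]; positivity
  have hBn : B * T₀ ≤ n := by
    rw [hn]
    exact Nat.le_mul_of_pos_left _ hM
  have hsteps := ReluLearning.steps_le (n := n) hd hQ hL hA.le hnL hBL hCb hCc
  have e1 : C * ((d : ℝ) ^ 2 * L * Q + d * L ^ 2) =
      C * ((d : ℝ) ^ 2 / ε ^ 2 * L * Real.log (2 / ε) ^ 4 + d * L ^ 2) := by rw [hQe]; ring
  have e2 : C * ((d : ℝ) * L * Q + d ^ 2) =
      C * (d / ε ^ 2 * L * Real.log (2 / ε) ^ 4 + (d : ℝ) ^ 2) := by rw [hQe]; ring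
  rw [e1] at hsteps
  refine ⟨n, hn0, ?_, fun X ω σ hσ => ?_, fun k W b hb => ⟨?_, ?_⟩⟩
  · calc (n : ℝ) ≤ N * L * Q := hnL
      _ ≤ C * L * Q := by
        have : 0 ≤ Q := by linarith
        gcongr
      _ = _ := by rw [hQe]; ring
  · obtain ⟨hfin, hcard⟩ := ReluLearning.finite_and_ncard_allowed_le d n B
    have hused := ((ReluLearning.final_spec hr _ hB0 X ω).2 σ hσ).2.2
    refine ⟨hfin.subset hused, ?_⟩
    rw [← e2]
    refine le_trans ?_ (ReluLearning.space_le (n := n) hd hQ hL hN0.le (by positivity) hnL hBL hCa)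
    exact_mod_cast (Set.ncard_le_ncard hused hfin).trans hcard
  · obtain ⟨E, hE⟩ : ∃ E, E = Real.exp (-(min k₁ 1 * B)) := ⟨_, rfl⟩
    rw [← hE] at hBδ
    have hE0 : 0 < E := by rw [hE]; exact Real.exp_pos _
    have hBE : Real.exp (-(B : ℝ)) ≤ E := by
      rw [hE]
      refine Real.exp_le_exp.2 (neg_le_neg ?_)
      exact mul_le_of_le_one_left (Nat.cast_nonneg B) (min_le_right _ _)
    -- All failure probabilities are multiples of `E`. Their sum `d C₁ E + 2 d² E + 2 d E + E` is at
    -- most `d² (C₁ + 5) E`, which explains the constant `C₁ + 5` given to `exists_numRuns`; `33` is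
    -- the loss in an entry.
    have hfail := ReluLearning.experiment_failure_le (W := W) hb (B := B) (n := n) (ρ := ε / 33)
      (p := C₁ * E) (q := 2 * E) (A := A * (d * n)) (a := E) hr hn0 hB0 (by positivity)
      (by linarith) (fun i => ?_) ?_ ?_
    · refine (measure_mono (t := {p | ¬∃ σ : ReluLearning.State ReluLearning.Cell,
        ReluLearning.final r (ReluLearning.stepParam r) B p.1 p.2 = some σ ∧
        ‖σ.sigmaHat d - W * W.transpose‖ ≤ 33 * (ε / 33) * ‖W‖ ^ 2 ∧
        ‖σ.biasHat d - WithLp.toLp 2 b‖ ≤ ε / 33 * ‖W‖ ∧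
        (σ.steps : ℝ) ≤ ReluLearning.stepCost d n B (A * (d * n))}) fun p hp => ?_).trans ?_
      · rintro ⟨σ, h1, h2, h3, h4⟩
        refine hp ⟨σ, h1, ?_, h3.trans ?_, h4.trans hsteps⟩
        · rwa [mul_div_cancel₀ ε (by norm_num : (33 : ℝ) ≠ 0)] at h2
        · gcongr
          linarith
      · rw [← ENNReal.ofReal_toReal (measure_ne_top _ _)]
        refine ENNReal.ofReal_le_ofReal (hfail.trans (le_trans ?_ hBδ))
        have hd2 : (d : ℝ) ≤ d ^ 2 := by nlinarith
        have h1 : (d : ℝ) * (C₁ * E) ≤ d ^ 2 * (C₁ * E) := by gcongr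
        have h2 : (d : ℝ) * (2 * E) ≤ d ^ 2 * (2 * E) := by gcongr
        have h3 : E ≤ d ^ 2 * E := le_mul_of_one_le_left hE0.le (hdr.trans hd2)
        linarith
    · refine (hrow (norm_nonneg _) (hb i) hB4 hT hn.ge hrate).trans ?_
      rw [hE]
      gcongr
      exact min_le_left _ _
    · have h1 : (B : ℝ) ≤ n * (ε / 33) ^ 2 / 2 := by
        calc (B : ℝ) = B * 1 := by ring
          _ ≤ B * (T₀ * (ε / 33) ^ 2 / 2) := by gcongr
          _ = ((B * T₀ : ℕ) : ℝ) * (ε / 33) ^ 2 / 2 := by push_cast; ring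
          _ ≤ n * (ε / 33) ^ 2 / 2 := by gcongr
      have h2 := Real.exp_le_exp.2 (neg_le_neg h1)
      linarith
    · refine (hatt d n B).2.trans (le_trans (Real.exp_le_exp.2 (neg_le_neg ?_)) hBE)
      have h1 : (B : ℝ) ≤ n := by exact_mod_cast (Nat.le_mul_of_pos_right B hT).trans hBn
      exact h1.trans (le_mul_of_one_le_left (Nat.cast_nonneg n) hdr)
  · exact (ReluLearning.lintegral_runTime_le W b hr hB0 (by positivity) (hatt d n B).1).trans
      (ENNReal.ofReal_le_ofReal hsteps)
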